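/- Let $F$ be a field of characteristic $p>3$, let $m,n\ge 3$ be integers and let $t=(t_1,\dots,t_m)$ be a tuple of positive integers. Let $\mathfrak A(m,n)=\mathfrak A(m)\otimes_F\Lambda(n)$, where $\mathfrak A(m)$ is the divided power algebra over $F$ with basis $x^{(\alpha)}$, $\alpha\in\mathbb N_0^m$, and product $x^{(\alpha)}x^{(\beta)}=\binom{\alpha+\beta}{\alpha}x^{(\alpha+\beta)}$, and $\Lambda(n)$ is the exterior algebra over $F$ in $x_{m+1},\dots,x_{m+n}$; the $\mathbb Z_2$-grading of $\mathfrak A(m,n)$ is induced by that of $\Lambda(n)$, and $\mathrm p(f)$ denotes the parity of a homogeneous $f$. Let $D_1,\dots,D_{m+n}$ be the partial superderivations of $\mathfrak A(m,n)$: $D_i(x^{(\alpha)}\omega)=x^{(\alpha-\varepsilon_i)}\omega$ for $i\le m$ (zero if $\alpha_i=0$), and $D_k(x^{(\alpha)}\omega)=x^{(\alpha)}\,\partial\omega/\partial x_k$ for $k>m$. Put $\tau(r)=0$ for $r\le m$ and $\tau(r)=1$ for $r>m$. Let $\mathfrak A(m,n;t)$ be the span of the $x^{(\alpha)}\omega$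 with $\omega\in\Lambda(n)$ and $\alpha_i<p^{t_i}$ for all $i$. Let $S(m,n;t)$ be the special Lie superalgebra, that is, the span of all $$D_{rs}(f)=(-1)^{\tau(r)\tau(s)}D_r(f)D_s-(-1)^{(\tau(r)+\tau(s))\mathrm p(f)}D_s(f)D_r,\qquad 1\le r,s\le m+n,\ f\in\mathfrak A(m,n;t),$$ (the formula is for homogeneous $f$ and is extended linearly), and let $\mathcal S=S(m,n;t)_{\bar 0}$ be its even part, a Lie algebra under the commutator. Let $\mathrm{Der}_{\mathrm{out}}(\mathcal S)=\mathrm{Der}(\mathcal S)/\mathrm{ad}\,\mathcal S$. (i) If $n$ is odd, then $\mathrm{Der}_{\mathrm{out}}(\mathcal S)$ is an abelian Lie algebra of dimension $1+\sum_{i=1}^m t_i-m$. (ii) If $n$ is even, then $\mathrm{Der}_{\mathrm{out}}(\mathcal S)$ is a metabelian Lie algebra of dimension $1+\sum_{i=1}^m t_i$. It is isomorphic to the semidirect product $F\cdot A\ltimes V$, where $V$ is any abelian Lie algebra over $F$ of dimension $\sum_{i=1}^m t_i$ and $A\in\mathrm{End}_F(V)$ is any semisimple operator whose eigenspaces for $0$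 and $1$ have dimensions $\sum_{i=1}^m t_i-m$ and $m$ respectively. -/

import Mathlib

open scoped TensorProduct

namespace SpecialSuper

attribute [local instance] LieRing.ofAssociativeRing

/-- The divided power algebra `𝔄(m)` over `F`, with `F`-basis `x^(α)`, `α ∈ ℕ^m`. -/
def DividedPow (F : Type*) [Field F] (m : ℕ) : Type _ := (Fin m → ℕ) →₀ F

namespace DividedPow

noncomputable instance (F : Type*) [Field F] (m : ℕ) : AddCommGroup (DividedPow F m) :=
  inferInstanceAs (AddCommGroup ((Fin m → ℕ) →₀ F))

noncomputable instance (F : Type*) [Field F] (m : ℕ) : Module F (DividedPow F m) :=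
  inferInstanceAs (Module F ((Fin m → ℕ) →₀ F))

/-- The basis `x^(α)`. -/
noncomputable def basis (F : Type*) [Field F] (m : ℕ) :
    Module.Basis (Fin m → ℕ) F (DividedPow F m) :=
  Module.Basis.ofRepr (LinearEquiv.refl F ((Fin m → ℕ) →₀ F))

/-- The basis element `x^(α)`. -/
noncomputable def monomial (F : Type*) [Field F] {m : ℕ} (α : Fin m → ℕ) : DividedPow F m :=
  basis F m α

/-- The bilinear product with `x^(α) x^(β) = (∏ i, binom (α i + β i) (α i)) x^(α + β)`. -/
noncomputable def mulLin (F : Type*) [Field F] (m : ℕ) :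
    DividedPow F m →ₗ[F] DividedPow F m →ₗ[F] DividedPow F m :=
  (basis F m).constr F fun α => (basis F m).constr F fun β =>
    ((∏ i, (α i + β i).choose (α i) : ℕ) : F) • monomial F (α + β)

theorem mulLin_monomial (F : Type*) [Field F] {m : ℕ} (α β : Fin m → ℕ) :
    mulLin F m (monomial F α) (monomial F β) =
      ((∏ i, (α i + β i).choose (α i) : ℕ) : F) • monomial F (α + β) := by
  rw [mulLin, monomial, monomial, Module.Basis.constr_basis, Module.Basis.constr_basis]

theorem induction (F : Type*) [Field F] {m : ℕ} {P : DividedPow F m → Prop}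
    (x : DividedPow F m) (hz : P 0) (ha : ∀ x y, P x → P y → P (x + y))
    (hs : ∀ (c : F) x, P x → P (c • x)) (hm : ∀ α, P (monomial F α)) : P x := by
  have hx : x ∈ Submodule.span F (Set.range (basis F m)) := by
    rw [Module.Basis.span_eq]; trivial
  induction hx using Submodule.span_induction with
  | mem x h => obtain ⟨α, rfl⟩ := h; exact hm α
  | zero => exact hz
  | add x y _ _ h1 h2 => exact ha x y h1 h2
  | smul c x _ h => exact hs c x h

theorem mulLin_comm (F : Type*) [Field F] {m : ℕ} (x y : DividedPow F m) :
    mulLin F m x y = mulLin F m y x := by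
  induction x using induction with
  | hz => simp
  | ha a b h1 h2 => simp [h1, h2]
  | hs c a h => simp [h]
  | hm α =>
    induction y using induction with
    | hz => simp
    | ha a b h1 h2 => simp [h1, h2]
    | hs c a h => simp [h]
    | hm β =>
      rw [mulLin_monomial, mulLin_monomial, add_comm α β]
      congr 2
      refine Finset.prod_congr rfl fun i _ => ?_
      rw [add_comm (α i) (β i)]
      exact (Nat.choose_symm_add).symm

theorem mulLin_assoc (F : Type*) [Field F] {m : ℕ} (x y z : DividedPow F m) :
    mulLin F m (mulLin F m x y) z = mulLin F m x (mulLin F m y z) := by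
  induction x using induction with
  | hz => simp
  | ha a b h1 h2 => simp [h1, h2]
  | hs c a h => simp [h]
  | hm α =>
    induction y using induction with
    | hz => simp
    | ha a b h1 h2 => simp [h1, h2]
    | hs c a h => simp [h]
    | hm β =>
      induction z using induction with
      | hz => simp
      | ha a b h1 h2 => simp [h1, h2]
      | hs c a h => simp [h]
      | hm γ =>
        simp only [mulLin_monomial, map_smul, LinearMap.smul_apply, smul_smul, add_assoc]
        congr 1
        rw [← Nat.cast_mul, ← Nat.cast_mul, ← Finset.prod_mul_distrib, ← Finset.prod_mul_distrib]
        congr 1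
        refine Finset.prod_congr rfl fun i _ => ?_
        simp only [Pi.add_apply]
        have h := Nat.choose_mul (n := α i + (β i + γ i)) (k := α i + β i) (s := α i)
          (by omega)
        rw [show α i + (β i + γ i) - α i = β i + γ i by omega,
          show α i + β i - α i = β i by omega] at h
        rw [add_assoc, mul_comm, h, mul_comm]

theorem mulLin_one (F : Type*) [Field F] {m : ℕ} (x : DividedPow F m) :
    mulLin F m (monomial F 0) x = x := by
  induction x using induction with
  | hz => simp
  | ha a b h1 h2 => simp [h1, h2]
  | hs c a h => simp [h]
  | hm α => simp [mulLin_monomial]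

noncomputable instance (F : Type*) [Field F] (m : ℕ) : CommRing (DividedPow F m) where
  __ := (inferInstance : AddCommGroup (DividedPow F m))
  mul x y := mulLin F m x y
  one := monomial F 0
  mul_assoc := mulLin_assoc F
  one_mul := mulLin_one F
  mul_one x := (mulLin_comm F x (monomial F 0)).trans (mulLin_one F x)
  left_distrib x y z := map_add (mulLin F m x) y z
  right_distrib x y z := by
    change mulLin F m (x + y) z = mulLin F m x z + mulLin F m y z
    simp
  zero_mul x := by
    change mulLin F m 0 x = 0
    simp
  mul_zero x := map_zero (mulLin F m x)
  mul_comm := mulLin_comm F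
noncomputable instance (F : Type*) [Field F] (m : ℕ) : Algebra F (DividedPow F m) :=
  Algebra.ofModule
    (fun c x y => by
      change mulLin F m (c • x) y = c • mulLin F m x y
      simp)
    (fun c x y => by
      change mulLin F m x (c • y) = c • mulLin F m x y
      simp)

theorem monomial_mul (F : Type*) [Field F] {m : ℕ} (α β : Fin m → ℕ) :
    monomial F α * monomial F β =
      ((∏ i, (α i + β i).choose (α i) : ℕ) : F) • monomial F (α + β) :=
  mulLin_monomial F α β

/-- The multi-index `ε_i`. -/
def e {m : ℕ} (i : Fin m) : Fin m → ℕ := Pi.single i 1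

theorem e_same {m : ℕ} (i : Fin m) : e i i = 1 := by simp [e]

theorem e_ne {m : ℕ} {i j : Fin m} (h : j ≠ i) : e i j = 0 := by simp [e, h]

theorem exists_add_e {m : ℕ} {i : Fin m} {α : Fin m → ℕ} (h : 0 < α i) :
    ∃ a, α = a + e i := by
  refine ⟨α - e i, ?_⟩
  ext j
  by_cases hj : j = i
  · subst hj
    simp only [Pi.add_apply, Pi.sub_apply, e_same]
    omega
  · simp [e_ne hj]

/-- The derivation `D_i` of `𝔄(m)`: `D_i x^(α) = x^(α - ε_i)`, read as `0` if `α i = 0`. -/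
noncomputable def partialDeriv (F : Type*) [Field F] {m : ℕ} (i : Fin m) :
    DividedPow F m →ₗ[F] DividedPow F m :=
  (basis F m).constr F fun α => if α i = 0 then 0 else monomial F (α - e i)

theorem partialDeriv_monomial (F : Type*) [Field F] {m : ℕ} (i : Fin m) (α : Fin m → ℕ) :
    partialDeriv F i (monomial F α) =
      if α i = 0 then 0 else monomial F (α - e i) := by
  rw [partialDeriv, monomial, Module.Basis.constr_basis]

theorem partialDeriv_monomial_add (F : Type*) [Field F] {m : ℕ} (i : Fin m) (α : Fin m → ℕ) :
    partialDeriv F i (monomial F (α + e i)) = monomial F α := by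
  rw [partialDeriv_monomial, if_neg (by simp [e_same]), add_tsub_cancel_right]

theorem partialDeriv_comm (F : Type*) [Field F] {m : ℕ} (i j : Fin m) (x : DividedPow F m) :
    partialDeriv F i (partialDeriv F j x) = partialDeriv F j (partialDeriv F i x) := by
  induction x using induction with
  | hz => simp
  | ha a b h1 h2 => simp [h1, h2]
  | hs c a h => simp [h]
  | hm α =>
    rcases eq_or_ne i j with rfl | hij
    · rfl
    · rw [partialDeriv_monomial, partialDeriv_monomial]
      have h1 : (α - e j) i = α i := by simp [e_ne hij]
      have h2 : (α - e i) j = α j := by simp [e_ne hij.symm]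
      by_cases hi : α i = 0 <;> by_cases hj : α j = 0 <;>
        simp [hi, hj, partialDeriv_monomial, h1, h2, tsub_right_comm]

theorem partialDeriv_mul (F : Type*) [Field F] {m : ℕ} (i : Fin m) (x y : DividedPow F m) :
    partialDeriv F i (x * y) = partialDeriv F i x * y + x * partialDeriv F i y := by
  induction x using induction with
  | hz => simp
  | ha a b h1 h2 => simp only [add_mul, map_add, h1, h2]; abel
  | hs c a h => simp [h]
  | hm α =>
    induction y using induction with
    | hz => simp
    | ha a b h1 h2 => simp only [mul_add, map_add, h1, h2]; abel
    | hs c a h => simp [h]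
    | hm β =>
      rcases Nat.eq_zero_or_pos (α i) with ha | ha <;>
        rcases Nat.eq_zero_or_pos (β i) with hb | hb
      · simp [monomial_mul, partialDeriv_monomial, ha, hb]
      · obtain ⟨b, rfl⟩ : ∃ b, β = b + e i := exists_add_e hb
        rw [monomial_mul, map_smul, ← add_assoc, partialDeriv_monomial_add,
          partialDeriv_monomial_add, partialDeriv_monomial, if_pos ha, zero_mul, zero_add,
          monomial_mul]
        congr 2
        refine Finset.prod_congr rfl fun j _ => ?_
        by_cases h : j = i
        · subst h; simp [ha]
        · simp [e_ne h]
      · obtain ⟨a, rfl⟩ : ∃ b, α = b + e i := exists_add_e ha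
        rw [monomial_mul, map_smul, add_right_comm, partialDeriv_monomial_add,
          partialDeriv_monomial_add, partialDeriv_monomial, if_pos hb, mul_zero, add_zero,
          monomial_mul]
        congr 2
        refine Finset.prod_congr rfl fun j _ => ?_
        by_cases h : j = i
        · subst h; simp [hb]
        · simp [e_ne h]
      · obtain ⟨a, rfl⟩ : ∃ b, α = b + e i := exists_add_e ha
        obtain ⟨b, rfl⟩ : ∃ b, β = b + e i := exists_add_e hb
        rw [monomial_mul, map_smul, ← add_assoc, partialDeriv_monomial_add,
          partialDeriv_monomial_add, partialDeriv_monomial_add, monomial_mul, monomial_mul,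
          ← add_assoc, add_right_comm a (e i) b, ← add_smul, ← Nat.cast_add]
        congr 2
        rw [← Finset.mul_prod_erase _ _ (Finset.mem_univ i),
          ← Finset.mul_prod_erase _ (fun j => (a j + (b + e i) j).choose (a j))
            (Finset.mem_univ i),
          ← Finset.mul_prod_erase _ (fun j => ((a + e i) j + b j).choose ((a + e i) j))
            (Finset.mem_univ i)]
        have e1 : ∀ j ∈ Finset.univ.erase i, (a j + (b + e i) j).choose (a j) =
            ((a + e i) j + (b + e i) j).choose ((a + e i) j) := by
          intro j hj
          have : j ≠ i := (Finset.mem_erase.mp hj).1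
          simp [e_ne this]
        have e2 : ∀ j ∈ Finset.univ.erase i, ((a + e i) j + b j).choose
              ((a + e i) j) =
            ((a + e i) j + (b + e i) j).choose ((a + e i) j) := by
          intro j hj
          have : j ≠ i := (Finset.mem_erase.mp hj).1
          simp [e_ne this]
        rw [Finset.prod_congr rfl e1, Finset.prod_congr rfl e2, ← add_mul]
        congr 1
        simp only [Pi.add_apply, e_same]
        rw [show a i + 1 + (b i + 1) = (a i + b i + 1) + 1 by ring, Nat.choose_succ_succ]
        congr 2; ring

/-- The span of the `x^(α)` with `α i < p ^ t i` for all `i`. -/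
noncomputable def truncated (F : Type*) [Field F] (p : ℕ) {m : ℕ} (t : Fin m → ℕ) :
    Submodule F (DividedPow F m) :=
  Submodule.span F {x | ∃ α : Fin m → ℕ, (∀ i, α i < p ^ t i) ∧ x = monomial F α}

theorem truncated_mul (F : Type*) [Field F] (p : ℕ) [Fact p.Prime] [CharP F p] {m : ℕ}
    (t : Fin m → ℕ) {x y : DividedPow F m} (hx : x ∈ truncated F p t)
    (hy : y ∈ truncated F p t) : x * y ∈ truncated F p t := by
  induction hx using Submodule.span_induction with
  | zero => simp
  | add a b _ _ h1 h2 => rw [add_mul]; exact add_mem h1 h2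
  | smul c a _ h => rw [smul_mul_assoc]; exact Submodule.smul_mem _ _ h
  | mem x h =>
    obtain ⟨α, hα, rfl⟩ := h
    induction hy using Submodule.span_induction with
    | zero => simp
    | add a b _ _ h1 h2 => rw [mul_add]; exact add_mem h1 h2
    | smul c a _ h => rw [mul_smul_comm]; exact Submodule.smul_mem _ _ h
    | mem y h =>
      obtain ⟨β, hβ, rfl⟩ := h
      rw [monomial_mul]
      by_cases h : ∀ i, α i + β i < p ^ t i
      · exact Submodule.smul_mem _ _ (Submodule.subset_span ⟨_, h, rfl⟩)
      · push Not at h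
        obtain ⟨i, hi⟩ := h
        have hp : p.Prime := Fact.out
        have hd : p ∣ (α i + β i).choose (α i) := by
          refine Nat.dvd_of_factorization_pos ?_
          rw [add_comm, Nat.factorization_choose' hp (Nat.lt_succ_self _)]
          refine Finset.card_ne_zero_of_mem (a := t i) (Finset.mem_filter.mpr ⟨?_, ?_⟩)
          · refine Finset.mem_Ico.mpr ⟨?_, ?_⟩
            · by_contra h0
              have h1 := hα i
              have h2 := hβ i
              have h3 : t i = 0 := by omega
              simp only [h3, pow_zero] at h1 h2 hi
              omega
            · refine Nat.lt_succ_of_le (Nat.le_log_of_pow_le hp.one_lt ?_)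
              omega
          · rw [Nat.mod_eq_of_lt (hα i), Nat.mod_eq_of_lt (hβ i)]
            exact hi
        have hz : ((∏ i, (α i + β i).choose (α i) : ℕ) : F) = 0 :=
          (CharP.cast_eq_zero_iff F p _).mpr
            (hd.trans (Finset.dvd_prod_of_mem _ (Finset.mem_univ i)))
        rw [hz, zero_smul]
        exact zero_mem _

theorem truncated_partialDeriv (F : Type*) [Field F] (p : ℕ) {m : ℕ}
    (t : Fin m → ℕ) (i : Fin m) {x : DividedPow F m} (hx : x ∈ truncated F p t) :
    partialDeriv F i x ∈ truncated F p t := by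
  induction hx using Submodule.span_induction with
  | zero => simp
  | add a b _ _ h1 h2 => rw [map_add]; exact add_mem h1 h2
  | smul c a _ h => rw [map_smul]; exact Submodule.smul_mem _ _ h
  | mem x h =>
    obtain ⟨α, hα, rfl⟩ := h
    rw [partialDeriv_monomial]
    split_ifs
    · exact zero_mem _
    · exact Submodule.subset_span ⟨_, fun j => lt_of_le_of_lt (Nat.sub_le _ _) (hα j), rfl⟩

end DividedPow

/-- The super-commutative algebra `𝔄(m,n) = 𝔄(m) ⊗ Λ(n)`. -/
abbrev SuperAlg (F : Type*) [Field F] (m n : ℕ) : Type _ :=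
  DividedPow F m ⊗[F] ExteriorAlgebra F (Fin n → F)

/-- The parity automorphism of `𝔄(m,n)`: it is `1` on the even part and `-1` on the odd part,
so that `f` is homogeneous of parity `θ` if and only if `parity f = (-1) ^ θ • f`. -/
noncomputable def parity (F : Type*) [Field F] (m n : ℕ) : SuperAlg F m n →ₐ[F] SuperAlg F m n :=
  Algebra.TensorProduct.map (AlgHom.id F (DividedPow F m)) CliffordAlgebra.involute

/-- The parity `τ(r)` of the index `r ∈ Y = Y₀ ∪ Y₁`: it is `0` on `Y₀`, `1` on `Y₁`. -/
def tau {m n : ℕ} : Fin m ⊕ Fin n → ℕ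
  | Sum.inl _ => 0
  | Sum.inr _ => 1

/-- The superderivations `D_r`, `r ∈ Y`: `D_i` for `i ∈ Y₀` acts on the divided powers, and `D_k`
for `k ∈ Y₁` is the (left) partial derivative `∂/∂x_k` of the exterior algebra. -/
noncomputable def D (F : Type*) [Field F] {m n : ℕ} :
    Fin m ⊕ Fin n → Module.End F (SuperAlg F m n)
  | Sum.inl i => LinearMap.rTensor _ (DividedPow.partialDeriv F i)
  | Sum.inr k => LinearMap.lTensor _
      (CliffordAlgebra.contractLeft (Q := (0 : QuadraticForm F (Fin n → F))) (LinearMap.proj k))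

section Exterior

theorem involute_contractLeft {F : Type*} [Field F] {n : ℕ} (d : Module.Dual F (Fin n → F))
    (x : ExteriorAlgebra F (Fin n → F)) :
    CliffordAlgebra.involute (CliffordAlgebra.contractLeft d x) =
      -CliffordAlgebra.contractLeft d (CliffordAlgebra.involute x) := by
  induction x using CliffordAlgebra.left_induction with
  | algebraMap r => simp [CliffordAlgebra.contractLeft_algebraMap]
  | add x y hx hy => simp only [map_add, hx, hy]; abel
  | ι_mul x v h =>
    simp only [CliffordAlgebra.contractLeft_ι_mul, map_sub, map_smul, map_mul,
      CliffordAlgebra.involute_ι, h, neg_mul, map_neg]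
    simp

theorem contractLeft_mul {F : Type*} [Field F] {n : ℕ} (d : Module.Dual F (Fin n → F))
    (x y : ExteriorAlgebra F (Fin n → F)) :
    CliffordAlgebra.contractLeft d (x * y) = CliffordAlgebra.contractLeft d x * y +
      CliffordAlgebra.involute x * CliffordAlgebra.contractLeft d y := by
  induction x using CliffordAlgebra.left_induction with
  | algebraMap r =>
    simp [CliffordAlgebra.contractLeft_algebraMap, CliffordAlgebra.contractLeft_algebraMap_mul]
  | add a b ha hb => simp only [map_add, add_mul, ha, hb]; abel
  | ι_mul a v h =>
    simp only [mul_assoc, CliffordAlgebra.contractLeft_ι_mul, map_mul,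
      CliffordAlgebra.involute_ι, h, sub_mul, smul_mul_assoc, mul_add, neg_mul]
    abel

theorem ι_mul_comm {F : Type*} [Field F] {n : ℕ} (v : Fin n → F)
    (y : ExteriorAlgebra F (Fin n → F)) :
    ExteriorAlgebra.ι F v * y = CliffordAlgebra.involute y * ExteriorAlgebra.ι F v := by
  induction y using CliffordAlgebra.left_induction with
  | algebraMap r => simp [Algebra.commutes]
  | add a b ha hb => simp only [map_add, add_mul, mul_add, ha, hb]
  | ι_mul a w h =>
    have h1 : ExteriorAlgebra.ι F v * ExteriorAlgebra.ι F w =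
        -(ExteriorAlgebra.ι F w * ExteriorAlgebra.ι F v) :=
      eq_neg_of_add_eq_zero_left (ExteriorAlgebra.ι_add_mul_swap v w)
    change ExteriorAlgebra.ι F v * (ExteriorAlgebra.ι F w * a) =
      CliffordAlgebra.involute (ExteriorAlgebra.ι F w * a) * ExteriorAlgebra.ι F v
    rw [map_mul, CliffordAlgebra.involute_ι, ← mul_assoc, h1, neg_mul, mul_assoc, h]
    simp only [neg_mul, mul_assoc]

theorem exterior_supercomm {F : Type*} [Field F] {n : ℕ} (x : ExteriorAlgebra F (Fin n → F)) :
    (∀ y, (x + CliffordAlgebra.involute x) * y = y * (x + CliffordAlgebra.involute x)) ∧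
    (∀ y, (x - CliffordAlgebra.involute x) * y =
      CliffordAlgebra.involute y * (x - CliffordAlgebra.involute x)) := by
  induction x using CliffordAlgebra.left_induction with
  | algebraMap r =>
    refine ⟨fun y => ?_, fun y => by simp⟩
    rw [AlgHom.commutes, ← map_add]
    exact Algebra.commutes _ _
  | add a b ha hb =>
    refine ⟨fun y => ?_, fun y => ?_⟩
    · have h1 := ha.1 y
      have h2 := hb.1 y
      rw [map_add, add_add_add_comm, add_mul, mul_add, h1, h2]
    · have h1 := ha.2 y
      have h2 := hb.2 y
      rw [map_add, add_sub_add_comm, add_mul, mul_add, h1, h2]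
  | ι_mul a v h =>
    have e1 : CliffordAlgebra.involute (ExteriorAlgebra.ι F v * a) =
        -(ExteriorAlgebra.ι F v * CliffordAlgebra.involute a) := by
      rw [map_mul, CliffordAlgebra.involute_ι, neg_mul]
    refine ⟨fun y => ?_, fun y => ?_⟩
    · change (ExteriorAlgebra.ι F v * a + CliffordAlgebra.involute (ExteriorAlgebra.ι F v * a)) * y
        = y * (ExteriorAlgebra.ι F v * a +
          CliffordAlgebra.involute (ExteriorAlgebra.ι F v * a))
      rw [e1, ← sub_eq_add_neg, ← mul_sub, mul_assoc, h.2, ← mul_assoc, ι_mul_comm,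
        CliffordAlgebra.involute_involute, mul_assoc]
    · change (ExteriorAlgebra.ι F v * a - CliffordAlgebra.involute (ExteriorAlgebra.ι F v * a)) * y
        = CliffordAlgebra.involute y * (ExteriorAlgebra.ι F v * a -
          CliffordAlgebra.involute (ExteriorAlgebra.ι F v * a))
      rw [e1, sub_neg_eq_add, ← mul_add, mul_assoc, h.1, ← mul_assoc, ι_mul_comm, mul_assoc]

end Exterior

section Super

variable {F : Type*} [Field F] {m n : ℕ}

theorem superAlg_induction {P : SuperAlg F m n → Prop} (z : SuperAlg F m n)
    (ha : ∀ x y, P x → P y → P (x + y)) (ht : ∀ a ω, P (a ⊗ₜ[F] ω)) : P z := by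
  induction z using TensorProduct.induction_on with
  | zero => simpa using ht 0 0
  | tmul a b => exact ht a b
  | add x y hx hy => exact ha x y hx hy

@[simp] theorem parity_tmul (a : DividedPow F m) (ω : ExteriorAlgebra F (Fin n → F)) :
    parity F m n (a ⊗ₜ[F] ω) = a ⊗ₜ[F] CliffordAlgebra.involute ω := by
  simp [parity]

theorem parity_parity (f : SuperAlg F m n) : parity F m n (parity F m n f) = f := by
  induction f using superAlg_induction with
  | ha x y hx hy => rw [map_add, map_add, hx, hy]
  | ht a ω => simp

theorem parity_D (r : Fin m ⊕ Fin n) (f : SuperAlg F m n) :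
    parity F m n (D F r f) = (-1 : F) ^ tau r • D F r (parity F m n f) := by
  induction f using superAlg_induction with
  | ha x y hx hy => simp only [map_add, hx, hy, smul_add]
  | ht a ω =>
    rcases r with i | k
    · simp [D, tau]
    · simp [D, tau, involute_contractLeft, TensorProduct.tmul_neg]

theorem D_mul (r : Fin m ⊕ Fin n) (f g : SuperAlg F m n) :
    D F r (f * g) = D F r f * g + ((parity F m n).toLinearMap ^ tau r) f * D F r g := by
  induction f using superAlg_induction with
  | ha x y hx hy => simp only [map_add, add_mul, hx, hy]; abel
  | ht a ω =>
    induction g using superAlg_induction with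
    | ha x y hx hy => simp only [map_add, mul_add, hx, hy]; abel
    | ht b η =>
      rcases r with i | k
      · simp [D, tau, DividedPow.partialDeriv_mul, TensorProduct.add_tmul]
      · simp [D, tau, contractLeft_mul, TensorProduct.tmul_add]

theorem D_comm (r s : Fin m ⊕ Fin n) (f : SuperAlg F m n) :
    D F r (D F s f) = (-1 : F) ^ (tau r * tau s) • D F s (D F r f) := by
  induction f using superAlg_induction with
  | ha x y hx hy => simp only [map_add, hx, hy, smul_add]
  | ht a ω =>
    rcases r with i | k <;> rcases s with j | l
    · simp [D, tau, DividedPow.partialDeriv_comm F i j]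
    · simp [D, tau]
    · simp [D, tau]
    · simp only [D, tau, LinearMap.lTensor_tmul, mul_one, pow_one, neg_smul, one_smul,
        ← TensorProduct.tmul_neg]
      rw [CliffordAlgebra.contractLeft_comm]

theorem even_comm (h2 : (2 : F) ≠ 0) {f : SuperAlg F m n} (hf : parity F m n f = f)
    (g : SuperAlg F m n) : f * g = g * f := by
  have key : ∀ f g : SuperAlg F m n,
      (f + parity F m n f) * g = g * (f + parity F m n f) := by
    intro f g
    induction f using superAlg_induction with
    | ha x y hx hy => rw [map_add, add_add_add_comm, add_mul, mul_add, hx, hy]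
    | ht a ω =>
      induction g using superAlg_induction with
      | ha x y hx hy => rw [mul_add, add_mul x y, hx, hy]
      | ht b η =>
        rw [parity_tmul, ← TensorProduct.tmul_add, Algebra.TensorProduct.tmul_mul_tmul,
          Algebra.TensorProduct.tmul_mul_tmul, mul_comm, (exterior_supercomm ω).1]
  have h := key f g
  rw [hf, ← two_smul F f, smul_mul_assoc, mul_smul_comm] at h
  exact smul_right_injective _ h2 h

theorem odd_comm (h2 : (2 : F) ≠ 0) {f : SuperAlg F m n} (hf : parity F m n f = -f)
    (g : SuperAlg F m n) : f * g = parity F m n g * f := by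
  have key : ∀ f g : SuperAlg F m n,
      (f - parity F m n f) * g = parity F m n g * (f - parity F m n f) := by
    intro f g
    induction f using superAlg_induction with
    | ha x y hx hy => rw [map_add, add_sub_add_comm, add_mul, mul_add, hx, hy]
    | ht a ω =>
      induction g using superAlg_induction with
      | ha x y hx hy => rw [mul_add, map_add, add_mul, hx, hy]
      | ht b η =>
        rw [parity_tmul, parity_tmul, ← TensorProduct.tmul_sub,
          Algebra.TensorProduct.tmul_mul_tmul,
          Algebra.TensorProduct.tmul_mul_tmul, mul_comm, (exterior_supercomm ω).2]
  have h := key f g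
  rw [hf, sub_neg_eq_add, ← two_smul F f, smul_mul_assoc, mul_smul_comm] at h
  exact smul_right_injective _ h2 h

end Super

/-- `𝔄(m,n;t)`, the span of the `x^(α) ω` with `α i < p ^ t i` for all `i` and `ω ∈ Λ(n)`. -/
noncomputable def truncAlg (F : Type*) [Field F] (p : ℕ) {m : ℕ} (n : ℕ) (t : Fin m → ℕ) :
    Submodule F (SuperAlg F m n) :=
  Submodule.span F {z | ∃ (α : Fin m → ℕ) (ω : ExteriorAlgebra F (Fin n → F)),
    (∀ i, α i < p ^ t i) ∧ z = DividedPow.monomial F α ⊗ₜ[F] ω}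

section Closure

variable {F : Type*} [Field F] {p m n : ℕ} {t : Fin m → ℕ}

theorem truncAlg_induction {P : ∀ z : SuperAlg F m n, z ∈ truncAlg F p n t → Prop}
    {z : SuperAlg F m n} (hz : z ∈ truncAlg F p n t) (h0 : P 0 (zero_mem _))
    (ha : ∀ x y hx hy, P x hx → P y hy → P (x + y) (add_mem hx hy))
    (hs : ∀ (c : F) x hx, P x hx → P (c • x) (Submodule.smul_mem _ c hx))
    (ht : ∀ a ω, a ∈ DividedPow.truncated F p t → ∀ h, P (a ⊗ₜ[F] ω) h) : P z hz := by
  induction hz using Submodule.span_induction with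
  | zero => exact h0
  | add x y hx hy h1 h2 => exact ha x y hx hy h1 h2
  | smul c x hx h => exact hs c x hx h
  | mem x h =>
    obtain ⟨α, ω, hα, rfl⟩ := h
    exact ht _ ω (Submodule.subset_span ⟨α, hα, rfl⟩) _

theorem tmul_mem_truncAlg {a : DividedPow F m} (ha : a ∈ DividedPow.truncated F p t)
    (ω : ExteriorAlgebra F (Fin n → F)) : a ⊗ₜ[F] ω ∈ truncAlg F p n t := by
  induction ha using Submodule.span_induction with
  | zero => simp
  | add x y _ _ h1 h2 => rw [TensorProduct.add_tmul]; exact add_mem h1 h2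
  | smul c x _ h => rw [← TensorProduct.smul_tmul']; exact Submodule.smul_mem _ _ h
  | mem x h =>
    obtain ⟨α, hα, rfl⟩ := h
    exact Submodule.subset_span ⟨α, ω, hα, rfl⟩

theorem truncAlg_mul [Fact p.Prime] [CharP F p] {x y : SuperAlg F m n}
    (hx : x ∈ truncAlg F p n t) (hy : y ∈ truncAlg F p n t) : x * y ∈ truncAlg F p n t := by
  induction hx using truncAlg_induction with
  | h0 => simp
  | ha a b _ _ h1 h2 => rw [add_mul]; exact add_mem h1 h2
  | hs c a _ h => rw [smul_mul_assoc]; exact Submodule.smul_mem _ _ h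
  | ht a ω hα _ =>
    induction hy using truncAlg_induction with
    | h0 => simp
    | ha a b _ _ h1 h2 => rw [mul_add]; exact add_mem h1 h2
    | hs c a _ h => rw [mul_smul_comm]; exact Submodule.smul_mem _ _ h
    | ht b η hb _ =>
      rw [Algebra.TensorProduct.tmul_mul_tmul]
      exact tmul_mem_truncAlg (DividedPow.truncated_mul F p t hα hb) _

theorem truncAlg_D (r : Fin m ⊕ Fin n) {x : SuperAlg F m n}
    (hx : x ∈ truncAlg F p n t) : D F r x ∈ truncAlg F p n t := by
  induction hx using truncAlg_induction with
  | h0 => simp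
  | ha a b _ _ h1 h2 => rw [map_add]; exact add_mem h1 h2
  | hs c a _ h => rw [map_smul]; exact Submodule.smul_mem _ _ h
  | ht a ω ha _ =>
    rcases r with i | k
    · exact tmul_mem_truncAlg (DividedPow.truncated_partialDeriv F p t i ha) _
    · exact tmul_mem_truncAlg ha _

theorem truncAlg_parity {x : SuperAlg F m n}
    (hx : x ∈ truncAlg F p n t) : parity F m n x ∈ truncAlg F p n t := by
  induction hx using truncAlg_induction with
  | h0 => simp
  | ha a b _ _ h1 h2 => rw [map_add]; exact add_mem h1 h2
  | hs c a _ h => rw [map_smul]; exact Submodule.smul_mem _ _ h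
  | ht a ω ha _ => rw [parity_tmul]; exact tmul_mem_truncAlg ha _

end Closure

/-- The vector field `f D_r`, as an operator on `𝔄(m,n)`. -/
noncomputable def vf {F : Type*} [Field F] {m n : ℕ} (f : SuperAlg F m n) (r : Fin m ⊕ Fin n) :
    Module.End F (SuperAlg F m n) :=
  LinearMap.mulLeft F f * D F r

/-- `D_{rs}(f) = (-1)^{τ(r)τ(s)} D_r(f) D_s - (-1)^{(τ(r)+τ(s)) p(f)} D_s(f) D_r`, extended
linearly to all `f`; the operator `parity ^ k` multiplies a homogeneous `f` by `(-1)^{k p(f)}`. -/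
noncomputable def Dtwo {F : Type*} [Field F] {m n : ℕ} (r s : Fin m ⊕ Fin n)
    (f : SuperAlg F m n) : Module.End F (SuperAlg F m n) :=
  (-1 : F) ^ (tau r * tau s) • vf (D F r f) s -
    vf (D F s (((parity F m n).toLinearMap ^ (tau r + tau s)) f)) r

/-- The special Lie superalgebra `S(m,n;t)`, as a space of operators on `𝔄(m,n)`:
the span of all `D_{rs}(f)` with `r, s ∈ Y` and `f ∈ 𝔄(m,n;t)`. -/
noncomputable def specialSuper (F : Type*) [Field F] (p : ℕ) {m : ℕ} (n : ℕ) (t : Fin m → ℕ) :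
    Submodule F (Module.End F (SuperAlg F m n)) :=
  Submodule.span F {X | ∃ (r s : Fin m ⊕ Fin n) (f : SuperAlg F m n),
    f ∈ truncAlg F p n t ∧ X = Dtwo r s f}

/-- The even operators on `𝔄(m,n)`, those which preserve parity. -/
noncomputable def evenEnd (F : Type*) [Field F] (m n : ℕ) :
    Submodule F (Module.End F (SuperAlg F m n)) where
  carrier := {X | ∀ f, parity F m n (X f) = X (parity F m n f)}
  add_mem' hX hY f := by
    rw [LinearMap.add_apply, map_add, hX, hY, LinearMap.add_apply]
  zero_mem' f := by simp
  smul_mem' c X hX f := by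
    rw [LinearMap.smul_apply, map_smul, hX, LinearMap.smul_apply]

section Closure

variable {F : Type*} [Field F] {p m n : ℕ} {t : Fin m → ℕ}

theorem vf_apply (f : SuperAlg F m n) (r : Fin m ⊕ Fin n) (φ : SuperAlg F m n) :
    vf f r φ = f * D F r φ := rfl

theorem vf_add (f g : SuperAlg F m n) (r : Fin m ⊕ Fin n) :
    vf (f + g) r = vf f r + vf g r := by
  refine LinearMap.ext fun φ => ?_
  simp [vf_apply, add_mul]

theorem vf_neg (f : SuperAlg F m n) (r : Fin m ⊕ Fin n) : vf (-f) r = -vf f r :=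
  LinearMap.ext fun φ => neg_mul f (D F r φ)

theorem vf_smul (c : F) (f : SuperAlg F m n) (r : Fin m ⊕ Fin n) :
    vf (c • f) r = c • vf f r :=
  LinearMap.ext fun φ => smul_mul_assoc c f (D F r φ)

theorem vf_zero (r : Fin m ⊕ Fin n) : vf (0 : SuperAlg F m n) r = 0 := by
  refine LinearMap.ext fun φ => ?_
  simp [vf_apply]

theorem vf_sum {ι : Type*} (u : Finset ι) (f : ι → SuperAlg F m n) (r : Fin m ⊕ Fin n) :
    vf (∑ a ∈ u, f a) r = ∑ a ∈ u, vf (f a) r := by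
  classical
  induction u using Finset.induction_on with
  | empty => simp [vf_zero]
  | insert a u ha h => rw [Finset.sum_insert ha, Finset.sum_insert ha, vf_add, h]

theorem Dtwo_add (r s : Fin m ⊕ Fin n) (f g : SuperAlg F m n) :
    Dtwo r s (f + g) = Dtwo r s f + Dtwo r s g := by
  simp only [Dtwo, map_add, vf_add]
  module

theorem Dtwo_smul (r s : Fin m ⊕ Fin n) (c : F) (f : SuperAlg F m n) :
    Dtwo r s (c • f) = c • Dtwo r s f := by
  simp only [Dtwo, map_smul, vf_smul]
  module

theorem tau_cases (r : Fin m ⊕ Fin n) : tau r = 0 ∨ tau r = 1 := by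
  rcases r with i | k
  · exact Or.inl rfl
  · exact Or.inr rfl

theorem parity_pow_of_eq {k l : ℕ} {f : SuperAlg F m n}
    (hf : parity F m n f = (-1 : F) ^ l • f) :
    ((parity F m n).toLinearMap ^ k) f = (-1 : F) ^ (k * l) • f := by
  induction k with
  | zero => simp
  | succ k ih =>
    rw [pow_succ', Module.End.mul_apply, ih, map_smul, AlgHom.toLinearMap_apply, hf, smul_smul,
      ← pow_add]
    congr 2
    ring

theorem Dtwo_of_parity (r s : Fin m ⊕ Fin n) {f : SuperAlg F m n}
    (hf : parity F m n f = (-1 : F) ^ (tau r + tau s) • f) :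
    Dtwo r s f = (-1 : F) ^ (tau r * tau s) • vf (D F r f) s -
      (-1 : F) ^ (tau r + tau s) • vf (D F s f) r := by
  rw [Dtwo, parity_pow_of_eq hf, map_smul, vf_smul]
  congr 2
  rcases tau_cases r with h | h <;> rcases tau_cases s with h' | h' <;> norm_num [h, h']

theorem supercomm (h2 : (2 : F) ≠ 0) {k l : ℕ} {f g : SuperAlg F m n}
    (hf : parity F m n f = (-1 : F) ^ k • f) (hg : parity F m n g = (-1 : F) ^ l • g) :
    f * g = (-1 : F) ^ (k * l) • (g * f) := by
  rcases Nat.even_or_odd k with hk | hk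
  · rw [hk.neg_one_pow, one_smul] at hf
    rw [(hk.mul_right l).neg_one_pow, one_smul, even_comm h2 hf]
  · rw [hk.neg_one_pow, neg_one_smul] at hf
    rw [odd_comm h2 hf, hg, smul_mul_assoc, mul_comm k l, pow_mul]
    congr 1
    rcases Nat.even_or_odd l with hl | hl
    · simp [hl.neg_one_pow]
    · simp [hl.neg_one_pow, hk.neg_one_pow]

theorem parity_D_of {l : ℕ} (r : Fin m ⊕ Fin n) {f : SuperAlg F m n}
    (hf : parity F m n f = (-1 : F) ^ l • f) :
    parity F m n (D F r f) = (-1 : F) ^ (tau r + l) • D F r f := by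
  rw [parity_D, hf, map_smul, smul_smul, pow_add]

theorem parity_mul_of {k l : ℕ} {f g : SuperAlg F m n}
    (hf : parity F m n f = (-1 : F) ^ k • f) (hg : parity F m n g = (-1 : F) ^ l • g) :
    parity F m n (f * g) = (-1 : F) ^ (k + l) • (f * g) := by
  rw [map_mul, hf, hg, smul_mul_smul_comm, pow_add]

/-- Even vector fields with coefficients in `𝔄(m,n;t)` and zero divergence. -/
structure IsDivFree (p : ℕ) (t : Fin m → ℕ) (h : Fin m ⊕ Fin n → SuperAlg F m n) : Prop where
  mem : ∀ a, h a ∈ truncAlg F p n t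
  par : ∀ a, parity F m n (h a) = (-1 : F) ^ tau a • h a
  div : ∑ a, (-1 : F) ^ tau a • D F a (h a) = 0

/-- The generators of the even part. -/
def evenGen (F : Type*) [Field F] (p : ℕ) {m : ℕ} (n : ℕ) (t : Fin m → ℕ) :
    Set (Module.End F (SuperAlg F m n)) :=
  {X | ∃ (r s : Fin m ⊕ Fin n) (f : SuperAlg F m n), f ∈ truncAlg F p n t ∧
    parity F m n f = (-1 : F) ^ (tau r + tau s) • f ∧ X = Dtwo r s f}

theorem parity_Dtwo (r s : Fin m ⊕ Fin n) (f φ : SuperAlg F m n) :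
    parity F m n (Dtwo r s f φ) =
      (-1 : F) ^ (tau r + tau s) • Dtwo r s (parity F m n f) (parity F m n φ) := by
  have hc : parity F m n (((parity F m n).toLinearMap ^ (tau r + tau s)) f) =
      ((parity F m n).toLinearMap ^ (tau r + tau s)) (parity F m n f) := by
    have : Commute (parity F m n).toLinearMap ((parity F m n).toLinearMap ^ (tau r + tau s)) :=
      (Commute.refl _).pow_right _
    exact LinearMap.congr_fun this f
  simp only [Dtwo, LinearMap.sub_apply, LinearMap.smul_apply, vf_apply, map_sub, map_smul,
    map_mul, parity_D, hc, smul_mul_smul_comm, pow_add (-1 : F), smul_sub]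
  module

theorem evenGen_even {X : Module.End F (SuperAlg F m n)} (hX : X ∈ evenGen F p n t) :
    X ∈ evenEnd F m n := by
  obtain ⟨r, s, f, -, hf, rfl⟩ := hX
  intro φ
  rw [parity_Dtwo, hf, Dtwo_smul, LinearMap.smul_apply, smul_smul, ← mul_pow]
  simp

theorem span_evenGen_le :
    Submodule.span F (evenGen F p n t) ≤ specialSuper F p n t ⊓ evenEnd F m n := by
  rw [Submodule.span_le]
  intro X hX
  refine ⟨?_, evenGen_even hX⟩
  obtain ⟨r, s, f, hf, -, rfl⟩ := hX
  exact Submodule.subset_span ⟨r, s, f, hf, rfl⟩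

theorem le_span_evenGen (h2 : (2 : F) ≠ 0) :
    specialSuper F p n t ⊓ evenEnd F m n ≤ Submodule.span F (evenGen F p n t) := by
  rintro X ⟨hX, hE⟩
  have key : ∀ Y ∈ specialSuper F p n t,
      Y + (parity F m n).toLinearMap * Y * (parity F m n).toLinearMap ∈
        Submodule.span F (evenGen F p n t) := by
    intro Y hY
    induction hY using Submodule.span_induction with
    | zero => simp
    | add x y _ _ hx hy =>
      have := add_mem hx hy
      rw [mul_add, add_mul]
      convert this using 1
      abel
    | smul c x _ hx =>
      have := Submodule.smul_mem _ c hx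
      rwa [smul_add, ← smul_mul_assoc, ← mul_smul_comm] at this
    | mem x h =>
      obtain ⟨r, s, f, hf, rfl⟩ := h
      refine Submodule.subset_span ⟨r, s, f + (-1 : F) ^ (tau r + tau s) • parity F m n f,
        add_mem hf (Submodule.smul_mem _ _ (truncAlg_parity hf)), ?_, ?_⟩
      · rw [map_add, map_smul, parity_parity, smul_add, smul_smul, ← mul_pow, add_comm]
        simp
      · rw [Dtwo_add, Dtwo_smul]
        congr 1
        refine LinearMap.ext fun φ => ?_
        rw [Module.End.mul_apply, Module.End.mul_apply, AlgHom.toLinearMap_apply,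
          AlgHom.toLinearMap_apply, parity_Dtwo, parity_parity, LinearMap.smul_apply]
  have h := key X hX
  have e : (parity F m n).toLinearMap * X * (parity F m n).toLinearMap = X := by
    refine LinearMap.ext fun φ => ?_
    rw [Module.End.mul_apply, Module.End.mul_apply, AlgHom.toLinearMap_apply,
      AlgHom.toLinearMap_apply, hE, parity_parity]
  rw [e, ← two_smul F X] at h
  exact (Submodule.smul_mem_iff _ h2).mp h

theorem commutator_smul {V : Type*} [AddCommGroup V] [Module F V] (c : F)
    (X Y : Module.End F V) : ⁅X, c • Y⁆ = c • ⁅X, Y⁆ := by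
  rw [Ring.lie_def, Ring.lie_def, mul_smul_comm, smul_mul_assoc, smul_sub]

theorem lie_vf (h2 : (2 : F) ≠ 0) {h : Fin m ⊕ Fin n → SuperAlg F m n}
    (hh : IsDivFree p t h) (g : SuperAlg F m n) (j : Fin m ⊕ Fin n) :
    ⁅∑ a, vf (h a) a, vf g j⁆ =
      ∑ a, (vf (h a * D F a g) j - vf (g * D F j (h a)) a) := by
  rw [Ring.lie_def, Finset.sum_mul, Finset.mul_sum, ← Finset.sum_sub_distrib]
  refine Finset.sum_congr rfl fun a _ => LinearMap.ext fun φ => ?_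
  have hc : h a * ((parity F m n).toLinearMap ^ tau a) g = g * h a := by
    have hp := hh.par a
    rcases tau_cases a with ha | ha
    · rw [ha, pow_zero, one_smul] at hp
      rw [ha, even_comm h2 hp]
      simp
    · rw [ha, pow_one, neg_one_smul] at hp
      rw [ha, pow_one, AlgHom.toLinearMap_apply, odd_comm h2 hp, parity_parity]
  have hd : ((parity F m n).toLinearMap ^ tau j) (h a) * D F j (D F a φ) =
      h a * D F a (D F j φ) := by
    rw [parity_pow_of_eq (hh.par a), D_comm j a, smul_mul_smul_comm, ← mul_pow]
    simp
  simp only [LinearMap.sub_apply, Module.End.mul_apply, vf_apply, D_mul]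
  rw [mul_add, mul_add, hd, ← mul_assoc (h a), ← mul_assoc (h a), hc, ← mul_assoc g (D F j (h a)),
    ← mul_assoc g (h a)]
  abel

theorem pair_identity (h2 : (2 : F) ≠ 0) (a i j : Fin m ⊕ Fin n) {h g : SuperAlg F m n}
    (hh : parity F m n h = (-1 : F) ^ tau a • h)
    (hg : parity F m n g = (-1 : F) ^ (tau i + tau j) • g) :
    -(-1 : F) ^ (tau i * tau j + tau a * tau j + tau a * tau i + tau a) •
        Dtwo a j (D F i h * g) +
      (-1 : F) ^ (tau i + tau j + tau a * tau j + tau a * tau i + tau a) •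
        Dtwo a i (D F j h * g) =
    -(-1 : F) ^ (tau i * tau j) • vf ((-1 : F) ^ tau a • D F i (D F a h) * g) j
      - (-1 : F) ^ (tau i * tau j) • vf (D F i h * D F a g) j
      + (-1 : F) ^ (tau i + tau j) • vf (D F j g * D F i h) a
      + (-1 : F) ^ (tau i + tau j) • vf ((-1 : F) ^ tau a • D F j (D F a h) * g) i
      + (-1 : F) ^ (tau i + tau j) • vf (D F j h * D F a g) i
      - (-1 : F) ^ (tau i * tau j) • vf (D F i g * D F j h) a := by
  have p1 := parity_D_of i hh
  have p2 := parity_D_of j hh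
  have q1 := parity_mul_of p1 hg
  have q2 := parity_mul_of p2 hg
  have e1 : parity F m n (D F i h * g) = (-1 : F) ^ (tau a + tau j) • (D F i h * g) := by
    rw [q1]
    congr 1
    rcases tau_cases a with ha | ha <;> rcases tau_cases i with hi | hi <;>
      rcases tau_cases j with hj | hj <;> norm_num [ha, hi, hj]
  have e2 : parity F m n (D F j h * g) = (-1 : F) ^ (tau a + tau i) • (D F j h * g) := by
    rw [q2]
    congr 1
    rcases tau_cases a with ha | ha <;> rcases tau_cases i with hi | hi <;>
      rcases tau_cases j with hj | hj <;> norm_num [ha, hi, hj]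
  have c1 := supercomm h2 (parity_D_of j hg) p1
  have c2 := supercomm h2 (parity_D_of i hg) p2
  rw [Dtwo_of_parity a j e1, Dtwo_of_parity a i e2, c1, c2]
  simp only [D_mul, parity_pow_of_eq p1, parity_pow_of_eq p2, D_comm a i h, D_comm a j h,
    D_comm i j h, vf_add, vf_smul, smul_mul_assoc]
  rcases tau_cases a with ha | ha <;> rcases tau_cases i with hi | hi <;>
    rcases tau_cases j with hj | hj <;> simp only [ha, hi, hj] <;> norm_num <;> module

theorem lie_Dtwo (h2 : (2 : F) ≠ 0) {h : Fin m ⊕ Fin n → SuperAlg F m n}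
    (hh : IsDivFree p t h) (i j : Fin m ⊕ Fin n) {g : SuperAlg F m n}
    (hg : parity F m n g = (-1 : F) ^ (tau i + tau j) • g) :
    ⁅∑ a, vf (h a) a, Dtwo i j g⁆ =
      Dtwo i j (∑ a, h a * D F a g) +
      ∑ a, (-(-1 : F) ^ (tau i * tau j + tau a * tau j + tau a * tau i + tau a) •
          Dtwo a j (D F i (h a) * g) +
        (-1 : F) ^ (tau i + tau j + tau a * tau j + tau a * tau i + tau a) •
          Dtwo a i (D F j (h a) * g)) := by
  have pX : parity F m n (∑ a, h a * D F a g) =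
      (-1 : F) ^ (tau i + tau j) • ∑ a, h a * D F a g := by
    rw [map_sum, Finset.smul_sum]
    refine Finset.sum_congr rfl fun a _ => ?_
    rw [parity_mul_of (hh.par a) (parity_D_of a hg), ← add_assoc, pow_add _ (tau a + tau a),
      ← two_mul, pow_mul]
    simp
  have dX : ∀ r : Fin m ⊕ Fin n, D F r (∑ a, h a * D F a g) =
      ∑ a, (D F r (h a) * D F a g + h a * D F a (D F r g)) := by
    intro r
    rw [map_sum]
    refine Finset.sum_congr rfl fun a _ => ?_
    rw [D_mul, parity_pow_of_eq (hh.par a), D_comm r a, smul_mul_smul_comm, ← mul_pow]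
    simp
  have z : ∀ r s : Fin m ⊕ Fin n,
      ∑ a, vf ((-1 : F) ^ tau a • D F r (D F a (h a)) * g) s = 0 := by
    intro r s
    rw [← vf_sum, ← Finset.sum_mul]
    have : ∑ a, (-1 : F) ^ tau a • D F r (D F a (h a)) = 0 := by
      simpa using congrArg (D F r) hh.div
    rw [this, zero_mul, vf_zero]
  rw [Finset.sum_congr rfl fun a _ => pair_identity h2 a i j (hh.par a) hg,
    Dtwo_of_parity i j hg, Dtwo_of_parity i j pX, lie_sub, commutator_smul, commutator_smul,
    lie_vf h2 hh, lie_vf h2 hh, dX, dX]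
  simp only [Finset.sum_add_distrib, Finset.sum_sub_distrib, ← Finset.smul_sum, z, vf_sum,
    vf_add, smul_zero]
  module

theorem isDivFree_add {h k : Fin m ⊕ Fin n → SuperAlg F m n} (hh : IsDivFree p t h)
    (hk : IsDivFree p t k) : IsDivFree p t (h + k) where
  mem a := add_mem (hh.mem a) (hk.mem a)
  par a := by rw [Pi.add_apply, map_add, hh.par, hk.par, smul_add]
  div := by
    simp only [Pi.add_apply, map_add, smul_add, Finset.sum_add_distrib, hh.div, hk.div, add_zero]

theorem isDivFree_smul (c : F) {h : Fin m ⊕ Fin n → SuperAlg F m n} (hh : IsDivFree p t h) :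
    IsDivFree p t (c • h) where
  mem a := Submodule.smul_mem _ _ (hh.mem a)
  par a := by rw [Pi.smul_apply, map_smul, hh.par, smul_comm]
  div := by
    simp only [Pi.smul_apply, map_smul]
    rw [Finset.sum_congr rfl fun a _ => smul_comm _ c _, ← Finset.smul_sum, hh.div, smul_zero]

theorem exists_isDivFree {X : Module.End F (SuperAlg F m n)}
    (hX : X ∈ Submodule.span F (evenGen F p n t)) :
    ∃ h, IsDivFree p t h ∧ X = ∑ a, vf (h a) a := by
  induction hX using Submodule.span_induction with
  | zero =>
    exact ⟨0, ⟨fun _ => zero_mem _, fun _ => by simp, by simp⟩, by simp [vf_zero]⟩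
  | add x y _ _ hx hy =>
    obtain ⟨h, hh, rfl⟩ := hx
    obtain ⟨k, hk, rfl⟩ := hy
    exact ⟨h + k, isDivFree_add hh hk, by simp [vf_add, Finset.sum_add_distrib]⟩
  | smul c x _ hx =>
    obtain ⟨h, hh, rfl⟩ := hx
    exact ⟨c • h, isDivFree_smul c hh, by simp [vf_smul, Finset.smul_sum]⟩
  | mem x hx =>
    obtain ⟨r, s, f, hf, hp, rfl⟩ := hx
    classical
    refine ⟨(-1 : F) ^ (tau r * tau s) • (Pi.single s (D F r f) : Fin m ⊕ Fin n → SuperAlg F m n) +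
      (-(-1 : F) ^ (tau r + tau s)) • (Pi.single r (D F s f) : Fin m ⊕ Fin n → SuperAlg F m n), ⟨fun a => ?_, fun a => ?_, ?_⟩, ?_⟩
    · refine add_mem (Submodule.smul_mem _ _ ?_) (Submodule.smul_mem _ _ ?_)
      · by_cases h : a = s
        · subst h; simpa using truncAlg_D r hf
        · simp [h]
      · by_cases h : a = r
        · subst h; simpa using truncAlg_D s hf
        · simp [h]
    · have h1 : parity F m n ((Pi.single s (D F r f) : Fin m ⊕ Fin n → SuperAlg F m n) a) =
          (-1 : F) ^ tau a • (Pi.single s (D F r f) : Fin m ⊕ Fin n → SuperAlg F m n) a := by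
        by_cases h : a = s
        · subst h
          rw [Pi.single_eq_same, parity_D_of r hp, ← add_assoc, ← two_mul, pow_add, pow_mul]
          simp
        · simp [h]
      have h2 : parity F m n ((Pi.single r (D F s f) : Fin m ⊕ Fin n → SuperAlg F m n) a) =
          (-1 : F) ^ tau a • (Pi.single r (D F s f) : Fin m ⊕ Fin n → SuperAlg F m n) a := by
        by_cases h : a = r
        · subst h
          rw [Pi.single_eq_same, parity_D_of s hp, add_left_comm, ← two_mul, pow_add, pow_mul _ 2]
          simp
        · simp [h]
      simp only [Pi.add_apply, Pi.smul_apply, map_add, map_smul, h1, h2, smul_add]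
      module
    · have e : ∀ (u : Fin m ⊕ Fin n) (x : SuperAlg F m n),
          ∑ a, (-1 : F) ^ tau a • D F a ((Pi.single u x : Fin m ⊕ Fin n → SuperAlg F m n) a) =
            (-1 : F) ^ tau u • D F u x := by
        intro u x
        rw [Finset.sum_eq_single u]
        · simp
        · intro b _ hb
          simp [hb]
        · simp
      simp only [Pi.add_apply, Pi.smul_apply, map_add, map_smul, smul_add,
        Finset.sum_add_distrib]
      rw [Finset.sum_congr rfl fun a _ => smul_comm _ ((-1 : F) ^ (tau r * tau s)) _,
        ← Finset.smul_sum, e,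
        Finset.sum_congr rfl fun a _ => smul_comm _ (-(-1 : F) ^ (tau r + tau s)) _,
        ← Finset.smul_sum, e, D_comm s r]
      rcases tau_cases r with hr | hr <;> rcases tau_cases s with hs | hs <;>
        norm_num [hr, hs]
    · have e : ∀ (u : Fin m ⊕ Fin n) (x : SuperAlg F m n),
          ∑ a, vf ((Pi.single u x : Fin m ⊕ Fin n → SuperAlg F m n) a) a = vf x u := by
        intro u x
        rw [Finset.sum_eq_single u]
        · simp
        · intro b _ hb
          simp [hb, vf_zero]
        · simp
      simp only [Pi.add_apply, Pi.smul_apply, vf_add, vf_smul, Finset.sum_add_distrib,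
        ← Finset.smul_sum, e]
      rw [Dtwo_of_parity r s hp]
      module

theorem lie_mem_span [Fact p.Prime] [CharP F p] (h2 : (2 : F) ≠ 0)
    {X Y : Module.End F (SuperAlg F m n)} (hX : X ∈ Submodule.span F (evenGen F p n t))
    (hY : Y ∈ Submodule.span F (evenGen F p n t)) :
    ⁅X, Y⁆ ∈ Submodule.span F (evenGen F p n t) := by
  obtain ⟨h, hh, rfl⟩ := exists_isDivFree hX
  induction hY using Submodule.span_induction with
  | zero => rw [lie_zero]; exact zero_mem _
  | add x y _ _ hx hy => rw [lie_add]; exact add_mem hx hy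
  | smul c x _ hx => rw [commutator_smul]; exact Submodule.smul_mem _ _ hx
  | mem x hx =>
    obtain ⟨i, j, g, hg, hp, rfl⟩ := hx
    rw [lie_Dtwo h2 hh i j hp]
    refine add_mem (Submodule.subset_span ⟨i, j, _, ?_, ?_, rfl⟩)
      (Submodule.sum_mem _ fun a _ => add_mem
        (Submodule.smul_mem _ _ (Submodule.subset_span ⟨a, j, _, ?_, ?_, rfl⟩))
        (Submodule.smul_mem _ _ (Submodule.subset_span ⟨a, i, _, ?_, ?_, rfl⟩)))
    · exact Submodule.sum_mem _ fun a _ => truncAlg_mul (hh.mem a) (truncAlg_D a hg)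
    · rw [map_sum, Finset.smul_sum]
      refine Finset.sum_congr rfl fun a _ => ?_
      rw [parity_mul_of (hh.par a) (parity_D_of a hp), ← add_assoc, pow_add _ (tau a + tau a),
        ← two_mul, pow_mul]
      simp
    · exact truncAlg_mul (truncAlg_D i (hh.mem a)) hg
    · rw [parity_mul_of (parity_D_of i (hh.par a)) hp]
      congr 1
      rcases tau_cases a with ha | ha <;> rcases tau_cases i with hi | hi <;>
        rcases tau_cases j with hj | hj <;> norm_num [ha, hi, hj]
    · exact truncAlg_mul (truncAlg_D j (hh.mem a)) hg
    · rw [parity_mul_of (parity_D_of j (hh.par a)) hp]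
      congr 1
      rcases tau_cases a with ha | ha <;> rcases tau_cases i with hi | hi <;>
        rcases tau_cases j with hj | hj <;> norm_num [ha, hi, hj]

end Closure

theorem two_ne_zero_of_char (F : Type*) [Field F] (p : ℕ) [CharP F p] (hp : 3 < p) :
    (2 : F) ≠ 0 := by
  intro h
  have h1 : ((2 : ℕ) : F) = 0 := by exact_mod_cast h
  have := Nat.le_of_dvd (by norm_num) ((CharP.cast_eq_zero_iff F p 2).mp h1)
  omega

/-- The Lie algebra `𝒮`, the even part of the special Lie superalgebra `S(m,n;t)`. Its bracket is
the commutator of operators on `𝔄(m,n)`. -/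
noncomputable def evenSpecial (F : Type*) [Field F] (p : ℕ) [Fact p.Prime] [CharP F p]
    (hp : 3 < p) {m : ℕ} (n : ℕ) (t : Fin m → ℕ) :
    LieSubalgebra F (Module.End F (SuperAlg F m n)) where
  __ := specialSuper F p n t ⊓ evenEnd F m n
  lie_mem' hX hY :=
    span_evenGen_le (lie_mem_span (two_ne_zero_of_char F p hp)
      (le_span_evenGen (two_ne_zero_of_char F p hp) hX)
      (le_span_evenGen (two_ne_zero_of_char F p hp) hY))

/-- The outer derivation algebra `Der_out(L) = Der(L) / ad L`. -/
abbrev DerOut (F : Type*) (L : Type*) [Field F] [LieRing L] [LieAlgebra F L] : Type _ :=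
  LieDerivation F L L ⧸ (LieDerivation.ad F L).idealRange

/-- The one-generated abelian Lie algebra `F·A` of operators on `V`. -/
def lineAlg {F : Type*} [Field F] {V : Type*} [AddCommGroup V] [Module F V]
    (A : Module.End F V) : LieSubalgebra F (Module.End F V) where
  __ := Submodule.span F {A}
  lie_mem' {X Y} hX hY := by
    obtain ⟨a, rfl⟩ := Submodule.mem_span_singleton.mp hX
    obtain ⟨b, rfl⟩ := Submodule.mem_span_singleton.mp hY
    have h : ⁅a • A, b • A⁆ = 0 := by
      rw [Ring.lie_def, smul_mul_smul_comm, smul_mul_smul_comm, mul_comm a b, sub_self]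
    rw [h]
    exact Submodule.zero_mem (Submodule.span F {A})

/-- The operators in `F·A`, acting as derivations of the abelian Lie algebra `V`. -/
def lineAction {F : Type*} [Field F] {V : Type*} [LieRing V] [LieAlgebra F V] [IsLieAbelian V]
    (A : Module.End F V) : lineAlg A →ₗ⁅F⁆ LieDerivation F V V where
  toFun X :=
    { toLinearMap := X.1
      leibniz' := fun v w => by simp [LieModule.IsTrivial.trivial] }
  map_add' X Y := rfl
  map_smul' c X := rfl
  map_lie' {X Y} := by
    ext v
    rfl

/-- The semidirect product `F·A ⋉ V`, with `[A, v] = A v` and `[V, V] = 0`. -/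
abbrev lineSemidirect {F : Type*} [Field F] {V : Type*} [LieRing V] [LieAlgebra F V]
    [IsLieAbelian V] (A : Module.End F V) : Type _ :=
  LieAlgebra.SemiDirectSum V (lineAlg A) (lineAction A)

end SpecialSuper

namespace EvenSpecial
open SpecialSuper (DividedPow tau tau_cases SuperAlg DerOut lineAlg lineAction lineSemidirect evenSpecial)
open SpecialSuper.DividedPow (monomial e)
attribute [local instance 100] LieRing.ofAssociativeRing

/-! Write `θ_k` for the odd generators and `W` for the even vector fields `∑ h_r D_r` with
coefficients in the untruncated algebra `𝔄(m,n)`. A derivation of `𝒮` is treated as a 1-cocycle `δ`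
of `𝒮` with values in the larger space `W`. There integration is unobstructed, so `δ` can be
corrected by brackets with elements of `W` until it vanishes on many elements of `𝒮`.

The corrections are as follows. The values on the commuting translations `D_j` are removed by the
Poincaré lemma (`IsCocycle.exists_kill_pd`), and those on the toral elements `x_i D_i + θ_s D_s` by
the identity `(ad H)^p = ad H` (`IsCocycle.exists_kill_toral`). Weights then force `δ (f θ_k D_l) =
φ_kl(f) θ_k D_l`, and `[f θ_k D_l, g θ_l D_s] = f g θ_k D_s` ties the `φ_kl` together: after a
correction by `∑ b_k θ_k D_k` they are all one derivation of the truncated divided power algebra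
that commutes with the `D_j`. Such a derivation is determined by the constant terms of its values at
`x_i^(p^s)`, so a combination of the `D_j^(p^s)`, `s ≥ 1`, removes it (`IsGraded.exists_isReduced`).
One scalar remains on the `θ_k θ_l D_i` (`IsReduced.exists_isSmall`). Brackets then propagate the
vanishing to all of `𝒮`; the only delicate elements are the `x^(α) D_i + ...` without odd factors,
treated by weights and induction on the degree (`IsSmall.cf_monomial_mem_killed`). Hence every
derivation is `ad (U + ∑ c_js D_j^(p^s))` with `U` in `W` (`IsCocycle.exists_eq_lie`).

The powers `D_j^(p^s)` normalize `𝒮`, so `U` does too. A normalizing field has truncated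
coefficients and constant divergence, so a multiple of `θ_k D_k`, whose divergence is `-1`, makes it
divergence free. Partial integration shows that a truncated divergence free even field lies in `𝒮`
up to the fields `x^(π_i) θ_1 ⋯ θ_n D_i`, with `π_i` maximal in all variables except `x_i`
(`mem_sup_span_topField`); these are even only if `n` is. They are independent modulo `𝒮`, because
the Berezin type functional `X ↦ ∫ X(x_i^(p^(t_i)))` vanishes on `𝒮` and separates them.

So the outer derivations have a basis made of `θ_k D_k`, the `∑ (t_j - 1)` powers `D_j^(p^s)` with
`0 < s < t_j`, and, for `n` even, `m` top fields (`exists_derOut_basis`). Modulo `𝒮` the first acts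
as `0` on the powers and as `1` on the top fields, and all the others commute. This multiplication
table determines the Lie algebra and is also that of `F·A ⋉ V`. -/

/-- The algebra `𝔄(m,n)`, with its ring and algebra structures sealed. -/
def SAlg (F : Type*) [Field F] (m n : ℕ) : Type _ := SuperAlg F m n

/-! ### Superderivations and even vector fields on the untruncated algebra. -/

section Fields

variable {F : Type*} [Field F] {m n : ℕ}

noncomputable instance : Ring (SAlg F m n) := inferInstanceAs (Ring (SuperAlg F m n))
noncomputable instance : Algebra F (SAlg F m n) := inferInstanceAs (Algebra F (SuperAlg F m n))

/-- The exterior algebra `Λ(n)`. -/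
abbrev Ext (F : Type*) [Field F] (n : ℕ) : Type _ := ExteriorAlgebra F (Fin n → F)

/-- The pure tensor `a ⊗ ω`, bilinear in both arguments. -/
noncomputable def tm : DividedPow F m →ₗ[F] Ext F n →ₗ[F] SAlg F m n :=
  TensorProduct.mk F (DividedPow F m) (Ext F n)

/-- The parity automorphism. -/
noncomputable def par : SAlg F m n →ₐ[F] SAlg F m n := SpecialSuper.parity F m n

/-- The partial superderivations. -/
noncomputable def pd (r : Fin m ⊕ Fin n) : Module.End F (SAlg F m n) := SpecialSuper.D F r

/-- The contraction `∂/∂x_k` of the exterior algebra. -/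
noncomputable def ctr (k : Fin n) : Ext F n →ₗ[F] Ext F n :=
  CliffordAlgebra.contractLeft (Q := (0 : QuadraticForm F (Fin n → F))) (LinearMap.proj k)

/-- The vector field `f D_r`. -/
noncomputable def vf (f : SAlg F m n) (r : Fin m ⊕ Fin n) : Module.End F (SAlg F m n) :=
  LinearMap.mulLeft F f * pd r

theorem tm_induction {P : SAlg F m n → Prop} (z : SAlg F m n)
    (ha : ∀ x y, P x → P y → P (x + y)) (ht : ∀ a ω, P (tm a ω)) : P z :=
  SpecialSuper.superAlg_induction z ha ht

theorem tm_mul (a b : DividedPow F m) (ω η : Ext F n) :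
    (tm a ω * tm b η : SAlg F m n) = tm (a * b) (ω * η) :=
  Algebra.TensorProduct.tmul_mul_tmul _ _ _ _

theorem one_eq_tm : (1 : SAlg F m n) = tm 1 1 := Algebra.TensorProduct.one_def

@[simp] theorem par_tm (a : DividedPow F m) (ω : Ext F n) :
    par (tm a ω : SAlg F m n) = tm a (CliffordAlgebra.involute ω) :=
  SpecialSuper.parity_tmul a ω

@[simp] theorem par_par (f : SAlg F m n) : par (par f) = f := SpecialSuper.parity_parity f

theorem par_pd (r : Fin m ⊕ Fin n) (f : SAlg F m n) :
    par (pd r f) = (-1 : F) ^ tau r • pd r (par f) := SpecialSuper.parity_D r f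

theorem pd_mul (r : Fin m ⊕ Fin n) (f g : SAlg F m n) :
    pd r (f * g) = pd r f * g + (par.toLinearMap ^ tau r) f * pd r g := SpecialSuper.D_mul r f g

theorem pd_comm (r s : Fin m ⊕ Fin n) (f : SAlg F m n) :
    pd r (pd s f) = (-1 : F) ^ (tau r * tau s) • pd s (pd r f) := SpecialSuper.D_comm r s f

theorem even_comm (h2 : (2 : F) ≠ 0) {f : SAlg F m n} (hf : par f = f) (g : SAlg F m n) :
    f * g = g * f := SpecialSuper.even_comm h2 hf g

theorem odd_comm (h2 : (2 : F) ≠ 0) {f : SAlg F m n} (hf : par f = -f) (g : SAlg F m n) :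
    f * g = par g * f := SpecialSuper.odd_comm h2 hf g

theorem vf_apply (f : SAlg F m n) (r : Fin m ⊕ Fin n) (φ : SAlg F m n) :
    vf f r φ = f * pd r φ := rfl

theorem vf_add (f g : SAlg F m n) (r : Fin m ⊕ Fin n) : vf (f + g) r = vf f r + vf g r :=
  LinearMap.ext fun φ => by simp [vf_apply, add_mul]

theorem vf_sub (f g : SAlg F m n) (r : Fin m ⊕ Fin n) : vf (f - g) r = vf f r - vf g r :=
  LinearMap.ext fun φ => by simp [vf_apply, sub_mul]

theorem vf_neg (f : SAlg F m n) (r : Fin m ⊕ Fin n) : vf (-f) r = -vf f r :=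
  LinearMap.ext fun φ => neg_mul f (pd r φ)

theorem vf_smul (c : F) (f : SAlg F m n) (r : Fin m ⊕ Fin n) : vf (c • f) r = c • vf f r :=
  LinearMap.ext fun φ => smul_mul_assoc c f (pd r φ)

@[simp] theorem vf_zero (r : Fin m ⊕ Fin n) : vf (0 : SAlg F m n) r = 0 :=
  LinearMap.ext fun φ => by simp [vf_apply]

theorem par_pow_of_eq {k l : ℕ} {f : SAlg F m n} (hf : par f = (-1 : F) ^ l • f) :
    (par.toLinearMap ^ k) f = (-1 : F) ^ (k * l) • f := SpecialSuper.parity_pow_of_eq hf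

theorem par_pd_of {l : ℕ} (r : Fin m ⊕ Fin n) {f : SAlg F m n}
    (hf : par f = (-1 : F) ^ l • f) : par (pd r f) = (-1 : F) ^ (tau r + l) • pd r f :=
  SpecialSuper.parity_D_of r hf

theorem par_mul_of {k l : ℕ} {f g : SAlg F m n}
    (hf : par f = (-1 : F) ^ k • f) (hg : par g = (-1 : F) ^ l • g) :
    par (f * g) = (-1 : F) ^ (k + l) • (f * g) := SpecialSuper.parity_mul_of hf hg

/-- The generators `x_r`, `r ∈ Y`. -/
noncomputable def gen (F : Type*) [Field F] {m n : ℕ} : Fin m ⊕ Fin n → SAlg F m n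
  | Sum.inl i => tm (DividedPow.monomial F (DividedPow.e i)) 1
  | Sum.inr k => tm 1 (ExteriorAlgebra.ι F (Pi.single k 1))

theorem one_eq_monomial : (1 : DividedPow F m) = DividedPow.monomial F 0 := rfl

theorem partialDeriv_one (i : Fin m) :
    DividedPow.partialDeriv F i (1 : DividedPow F m) = 0 :=
  (DividedPow.partialDeriv_monomial F i 0).trans (if_pos rfl)

@[simp] theorem pd_inl_tm (i : Fin m) (f : DividedPow F m) (ω : Ext F n) :
    (pd (Sum.inl i) (tm f ω) : SAlg F m n) = tm (DividedPow.partialDeriv F i f) ω := rfl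

@[simp] theorem pd_inr_tm (k : Fin n) (f : DividedPow F m) (ω : Ext F n) :
    (pd (Sum.inr k) (tm f ω) : SAlg F m n) = tm f (ctr k ω) := rfl

@[simp] theorem ctr_one (k : Fin n) : ctr k (1 : Ext F n) = 0 :=
  CliffordAlgebra.contractLeft_one (Q := (0 : QuadraticForm F (Fin n → F))) (LinearMap.proj k)

theorem ctr_ι (k : Fin n) (v : Fin n → F) :
    ctr k (ExteriorAlgebra.ι F v) = algebraMap F (Ext F n) (v k) :=
  CliffordAlgebra.contractLeft_ι (Q := (0 : QuadraticForm F (Fin n → F))) (LinearMap.proj k) v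

theorem ctr_sq (k : Fin n) (ω : Ext F n) : ctr k (ctr k ω) = 0 :=
  CliffordAlgebra.contractLeft_contractLeft (Q := (0 : QuadraticForm F (Fin n → F)))
    (LinearMap.proj k) ω

theorem involute_theta (v : Fin n → F) :
    CliffordAlgebra.involute (ExteriorAlgebra.ι F v : Ext F n) = -ExteriorAlgebra.ι F v :=
  CliffordAlgebra.involute_ι (Q := (0 : QuadraticForm F (Fin n → F))) v

@[simp] theorem pd_one (r : Fin m ⊕ Fin n) : pd r (1 : SAlg F m n) = 0 := by
  rw [one_eq_tm]
  rcases r with i | k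
  · rw [pd_inl_tm, partialDeriv_one, map_zero, LinearMap.zero_apply]
  · rw [pd_inr_tm, ctr_one, map_zero]

theorem pd_gen (r s : Fin m ⊕ Fin n) :
    pd r (gen F s : SAlg F m n) = if r = s then 1 else 0 := by
  rcases r with i | k <;> rcases s with j | l
  · rw [gen, pd_inl_tm]
    by_cases h : i = j
    · subst h
      have := DividedPow.partialDeriv_monomial_add F i 0
      rw [zero_add] at this
      rw [if_pos rfl, this, one_eq_tm, one_eq_monomial]
    · rw [if_neg (by simpa using h), DividedPow.partialDeriv_monomial,
        if_pos (DividedPow.e_ne h), map_zero, LinearMap.zero_apply]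
  · rw [gen, pd_inl_tm, partialDeriv_one, map_zero, LinearMap.zero_apply, if_neg (by simp)]
  · rw [gen, pd_inr_tm, ctr_one, map_zero, if_neg (by simp)]
  · rw [gen, pd_inr_tm, ctr_ι]
    by_cases h : k = l
    · subst h
      simp [one_eq_tm]
    · simp [h]

@[simp] theorem pd_gen_self (r : Fin m ⊕ Fin n) : pd r (gen F r) = 1 := by simp [pd_gen]

theorem pd_gen_ne {r s : Fin m ⊕ Fin n} (h : r ≠ s) : pd r (gen F s) = 0 := by simp [pd_gen, h]

theorem par_gen (r : Fin m ⊕ Fin n) :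
    par (gen F r : SAlg F m n) = (-1 : F) ^ tau r • gen F r := by
  rcases r with i | k
  · simp [gen, tau]
  · rw [gen, par_tm, involute_theta, map_neg]
    simp [tau]

@[simp] theorem par_gen_inl (i : Fin m) :
    par (gen F (Sum.inl i) : SAlg F m n) = gen F (Sum.inl i) := by
  simpa [tau] using par_gen (F := F) (n := n) (Sum.inl i)

@[simp] theorem par_gen_inr (k : Fin n) :
    par (gen F (Sum.inr k) : SAlg F m n) = -gen F (Sum.inr k) := by
  simpa [tau] using par_gen (F := F) (m := m) (Sum.inr k)

theorem pd_inl_mul (i : Fin m) (f g : SAlg F m n) :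
    pd (Sum.inl i) (f * g) = pd (Sum.inl i) f * g + f * pd (Sum.inl i) g := by
  rw [pd_mul]; simp [tau]

theorem pd_inr_mul (k : Fin n) (f g : SAlg F m n) :
    pd (Sum.inr k) (f * g) = pd (Sum.inr k) f * g + par f * pd (Sum.inr k) g := by
  rw [pd_mul]; simp [tau]

theorem pd_even_mul {f : SAlg F m n} (hf : par f = f) (r : Fin m ⊕ Fin n)
    (g : SAlg F m n) : pd r (f * g) = pd r f * g + f * pd r g := by
  rcases r with i | k
  · exact pd_inl_mul i f g
  · rw [pd_inr_mul, hf]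

theorem pd_inr_comm (k l : Fin n) (f : SAlg F m n) :
    pd (Sum.inr k) (pd (Sum.inr l) f) = -pd (Sum.inr l) (pd (Sum.inr k) f) := by
  simpa [tau] using pd_comm (Sum.inr k) (Sum.inr l) f

theorem pd_inl_comm (i : Fin m) (s : Fin m ⊕ Fin n) (f : SAlg F m n) :
    pd (Sum.inl i) (pd s f) = pd s (pd (Sum.inl i) f) := by
  simpa [tau] using pd_comm (Sum.inl i) s f

@[simp] theorem pd_inr_pd_inr (k : Fin n) (f : SAlg F m n) :
    pd (Sum.inr k) (pd (Sum.inr k) f) = 0 := by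
  induction f using tm_induction with
  | ha x y hx hy => simp only [map_add, hx, hy, add_zero]
  | ht a ω => rw [pd_inr_tm, pd_inr_tm, ctr_sq, map_zero]

theorem theta_mul_theta (k l : Fin n) :
    gen F (Sum.inr k) * gen F (Sum.inr l) =
      -(gen F (Sum.inr l) * gen F (Sum.inr k) : SAlg F m n) := by
  simp only [gen, tm_mul, ← map_neg]
  congr 1
  exact eq_neg_of_add_eq_zero_left (ExteriorAlgebra.ι_add_mul_swap _ _)

@[simp] theorem theta_sq (k : Fin n) :
    gen F (Sum.inr k) * gen F (Sum.inr k) = (0 : SAlg F m n) := by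
  simp only [gen, tm_mul, ExteriorAlgebra.ι_sq_zero, map_zero]

@[simp] theorem theta_theta_mul (k : Fin n) (f : SAlg F m n) :
    gen F (Sum.inr k) * (gen F (Sum.inr k) * f) = 0 := by
  rw [← mul_assoc, theta_sq, zero_mul]

/-- The even generators `x_i` are central. -/
theorem gen_inl_comm (i : Fin m) (f : SAlg F m n) :
    gen F (Sum.inl i) * f = f * gen F (Sum.inl i) := by
  induction f using tm_induction with
  | ha x y hx hy => rw [mul_add, hx, hy, add_mul]
  | ht a ω => simp [gen, tm_mul, mul_comm]

theorem theta_comm (k : Fin n) (f : SAlg F m n) :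
    gen F (Sum.inr k) * f = par f * gen F (Sum.inr k) := by
  induction f using tm_induction with
  | ha x y hx hy => rw [mul_add, hx, hy, map_add, add_mul]
  | ht a ω => simp [gen, tm_mul, SpecialSuper.ι_mul_comm]

theorem comm_theta (k : Fin n) (f : SAlg F m n) :
    f * gen F (Sum.inr k) = gen F (Sum.inr k) * par f := by
  rw [theta_comm, par_par]

theorem pd_inr_theta_mul (k l : Fin n) (f : SAlg F m n) :
    pd (Sum.inr k) (gen F (Sum.inr l) * f) =
      (if k = l then f else 0) - gen F (Sum.inr l) * pd (Sum.inr k) f := by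
  rw [pd_inr_mul, pd_gen, par_gen_inr, neg_mul, ← sub_eq_add_neg]
  by_cases h : k = l <;> simp [h]

theorem pd_inr_theta_mul_self (k : Fin n) (f : SAlg F m n) :
    pd (Sum.inr k) (gen F (Sum.inr k) * f) = f - gen F (Sum.inr k) * pd (Sum.inr k) f := by
  rw [pd_inr_theta_mul, if_pos rfl]

theorem pd_inr_theta_mul_ne {k l : Fin n} (h : k ≠ l) (f : SAlg F m n) :
    pd (Sum.inr k) (gen F (Sum.inr l) * f) = -(gen F (Sum.inr l) * pd (Sum.inr k) f) := by
  rw [pd_inr_theta_mul, if_neg h, zero_sub]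

theorem pd_inl_theta_mul (i : Fin m) (l : Fin n) (f : SAlg F m n) :
    pd (Sum.inl i) (gen F (Sum.inr l) * f) = gen F (Sum.inr l) * pd (Sum.inl i) f := by
  rw [pd_inl_mul, pd_gen_ne (by simp), zero_mul, zero_add]

theorem vf_gen (f : SAlg F m n) (r s : Fin m ⊕ Fin n) :
    vf f r (gen F s) = if r = s then f else 0 := by
  rw [vf_apply, pd_gen]
  by_cases h : r = s <;> simp [h]

@[simp] theorem vf_gen_self (f : SAlg F m n) (r : Fin m ⊕ Fin n) :
    vf f r (gen F r) = f := by simp [vf_gen]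

theorem vf_gen_ne (f : SAlg F m n) {r s : Fin m ⊕ Fin n} (h : r ≠ s) :
    vf f r (gen F s) = 0 := by simp [vf_gen, h]

/-- The even vector fields `∑ h_r D_r` with arbitrary coefficients in `𝔄(m,n)`. -/
noncomputable def evenField (F : Type*) [Field F] (m n : ℕ) :
    Submodule F (Module.End F (SAlg F m n)) where
  carrier := {X | (∀ r, par (X (gen F r)) = (-1 : F) ^ tau r • X (gen F r)) ∧
    X = ∑ r, vf (X (gen F r)) r}
  add_mem' {X Y} hX hY := by
    refine ⟨fun r => ?_, ?_⟩
    · rw [LinearMap.add_apply, map_add, hX.1, hY.1, smul_add]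
    · simp only [LinearMap.add_apply, vf_add, Finset.sum_add_distrib]
      rw [← hX.2, ← hY.2]
  zero_mem' := by simp [vf_zero]
  smul_mem' c X hX := by
    refine ⟨fun r => ?_, ?_⟩
    · rw [LinearMap.smul_apply, map_smul, hX.1, smul_comm]
    · simp only [LinearMap.smul_apply, vf_smul, ← Finset.smul_sum]
      rw [← hX.2]

theorem evenField.par_gen {X : Module.End F (SAlg F m n)} (hX : X ∈ evenField F m n)
    (r : Fin m ⊕ Fin n) : par (X (gen F r)) = (-1 : F) ^ tau r • X (gen F r) :=
  hX.1 r

theorem evenField.par_inl {X : Module.End F (SAlg F m n)} (hX : X ∈ evenField F m n)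
    (i : Fin m) : par (X (gen F (Sum.inl i))) = X (gen F (Sum.inl i)) := by
  simpa [tau] using hX.1 (Sum.inl i)

theorem evenField.eq_sum {X : Module.End F (SAlg F m n)} (hX : X ∈ evenField F m n) :
    X = ∑ r, vf (X (gen F r)) r := hX.2

theorem evenField.apply_eq_sum {X : Module.End F (SAlg F m n)} (hX : X ∈ evenField F m n)
    (f : SAlg F m n) : X f = ∑ r, X (gen F r) * pd r f := by
  conv_lhs => rw [evenField.eq_sum hX]
  simp [LinearMap.sum_apply, vf_apply]

theorem evenField.ext {X Y : Module.End F (SAlg F m n)} (hX : X ∈ evenField F m n)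
    (hY : Y ∈ evenField F m n) (h : ∀ r, X (gen F r) = Y (gen F r)) : X = Y := by
  rw [evenField.eq_sum hX, evenField.eq_sum hY]
  simp [h]

theorem vf_mem_evenField {f : SAlg F m n} {r : Fin m ⊕ Fin n}
    (hf : par f = (-1 : F) ^ tau r • f) : vf f r ∈ evenField F m n := by
  refine ⟨fun s => ?_, ?_⟩
  · by_cases h : r = s
    · subst h; rw [vf_gen_self, hf]
    · simp [vf_gen_ne f h]
  · rw [Finset.sum_eq_single r]
    · rw [vf_gen_self]
    · intro b _ hb
      rw [vf_gen_ne f hb.symm, vf_zero]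
    · simp

theorem vf_inl_mem_evenField {f : SAlg F m n} {i : Fin m}
    (hf : par f = f) : vf f (Sum.inl i) ∈ evenField F m n :=
  vf_mem_evenField (by simpa [tau] using hf)

theorem vf_inr_mem_evenField {f : SAlg F m n} {k : Fin n}
    (hf : par f = -f) : vf f (Sum.inr k) ∈ evenField F m n :=
  vf_mem_evenField (by simpa [tau] using hf)

theorem sum_vf_gen (h : Fin m ⊕ Fin n → SAlg F m n) (s : Fin m ⊕ Fin n) :
    (∑ r, vf (h r) r) (gen F s) = h s := by
  rw [LinearMap.sum_apply, Finset.sum_eq_single s]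
  · simp
  · intro b _ hb
    rw [vf_gen_ne _ hb]
  · simp

theorem mem_evenField_sum {h : Fin m ⊕ Fin n → SAlg F m n}
    (hh : ∀ r, par (h r) = (-1 : F) ^ tau r • h r) :
    ∑ r, vf (h r) r ∈ evenField F m n :=
  Submodule.sum_mem _ fun r _ => vf_mem_evenField (hh r)

/-- In an even field the coefficient of `D_r` has parity `τ(r)`. The sign from moving `g` past it is
therefore exactly the sign in the super Leibniz rule of `D_r`. -/
theorem par_tau_mul_comm (h2 : (2 : F) ≠ 0) {r : Fin m ⊕ Fin n} {f : SAlg F m n}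
    (hf : par f = (-1 : F) ^ tau r • f) (g : SAlg F m n) :
    f * (par.toLinearMap ^ tau r) g = g * f := by
  rcases tau_cases r with ha | ha
  · rw [ha, pow_zero, one_smul] at hf
    rw [ha, even_comm h2 hf]
    simp
  · rw [ha, pow_one, neg_one_smul] at hf
    rw [ha, pow_one, AlgHom.toLinearMap_apply, odd_comm h2 hf, par_par]

/-- The signs in the super Leibniz rules of the `D_r` cancel against those of the coefficients, so
an even field is an ordinary derivation. -/
theorem evenField.leibniz (h2 : (2 : F) ≠ 0) {X : Module.End F (SAlg F m n)}
    (hX : X ∈ evenField F m n) (f g : SAlg F m n) : X (f * g) = X f * g + f * X g := by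
  rw [evenField.apply_eq_sum hX, evenField.apply_eq_sum hX f, evenField.apply_eq_sum hX g,
    Finset.sum_mul, Finset.mul_sum, ← Finset.sum_add_distrib]
  refine Finset.sum_congr rfl fun r _ => ?_
  rw [pd_mul, mul_add, ← mul_assoc, ← mul_assoc, par_tau_mul_comm h2 (hX.1 r), mul_assoc f]

theorem evenField.parity_apply {X : Module.End F (SAlg F m n)}
    (hX : X ∈ evenField F m n) (f : SAlg F m n) :
    par (X f) = X (par f) := by
  rw [evenField.apply_eq_sum hX, evenField.apply_eq_sum hX, map_sum]
  refine Finset.sum_congr rfl fun r _ => ?_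
  rw [map_mul, hX.1 r, par_pd, smul_mul_smul_comm, ← mul_pow]
  simp

theorem evenField.apply_one {X : Module.End F (SAlg F m n)}
    (hX : X ∈ evenField F m n) : X 1 = 0 := by
  rw [evenField.apply_eq_sum hX]; simp

theorem lie_apply_op (X Y : Module.End F (SAlg F m n)) (f : SAlg F m n) :
    ⁅X, Y⁆ f = X (Y f) - Y (X f) := rfl

theorem smul_commutator {V : Type*} [AddCommGroup V] [Module F V] (c : F)
    (X Y : Module.End F V) : ⁅c • X, Y⁆ = c • ⁅X, Y⁆ := by
  rw [Ring.lie_def, Ring.lie_def, mul_smul_comm, smul_mul_assoc, smul_sub]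

/-- This is the commutator `[D_j, X]`: differentiating the coefficients gives the sum, and the sign
in `D_j D_a = ± D_a D_j` is absorbed by the parity of the coefficient. -/
theorem evenField.apply_pd {X : Module.End F (SAlg F m n)}
    (hX : X ∈ evenField F m n) (j : Fin m ⊕ Fin n) (f : SAlg F m n) :
    pd j (X f) = ∑ a, pd j (X (gen F a)) * pd a f + X (pd j f) := by
  rw [evenField.apply_eq_sum hX, evenField.apply_eq_sum hX (pd j f), map_sum,
    ← Finset.sum_add_distrib]
  refine Finset.sum_congr rfl fun a _ => ?_
  rw [pd_mul, par_pow_of_eq (hX.1 a), pd_comm j a, smul_mul_smul_comm, ← mul_pow]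
  simp

theorem evenField.lie_vf (h2 : (2 : F) ≠ 0) {X : Module.End F (SAlg F m n)}
    (hX : X ∈ evenField F m n) (g : SAlg F m n) (j : Fin m ⊕ Fin n) :
    ⁅X, vf g j⁆ = vf (X g) j - ∑ a, vf (g * pd j (X (gen F a))) a := by
  refine LinearMap.ext fun φ => ?_
  rw [lie_apply_op, vf_apply, vf_apply, evenField.leibniz h2 hX, LinearMap.sub_apply, vf_apply,
    evenField.apply_pd hX, LinearMap.sum_apply, mul_add, Finset.mul_sum]
  simp only [vf_apply, mul_assoc]
  abel

theorem evenField.lie_mem (h2 : (2 : F) ≠ 0) {X Y : Module.End F (SAlg F m n)}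
    (hX : X ∈ evenField F m n) (hY : Y ∈ evenField F m n) : ⁅X, Y⁆ ∈ evenField F m n := by
  rw [evenField.eq_sum hY, lie_sum]
  refine Submodule.sum_mem _ fun j _ => ?_
  rw [evenField.lie_vf h2 hX]
  refine sub_mem (vf_mem_evenField ?_) (Submodule.sum_mem _ fun a _ => vf_mem_evenField ?_)
  · rw [evenField.parity_apply hX, hY.1, map_smul]
  · rw [par_mul_of (hY.1 j) (par_pd_of j (hX.1 a)), ← add_assoc, pow_add, ← two_mul, pow_mul]
    simp

end Fields

/-! ### Coefficients, integration, number operators and augmentation. -/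

section Coefficients

variable {F : Type*} [Field F] {m n : ℕ}

theorem basis_eq_monomial (α : Fin m → ℕ) : DividedPow.basis F m α = monomial F α := rfl

theorem coord_monomial (β α : Fin m → ℕ) :
    (DividedPow.basis F m).coord β (monomial F α) = if α = β then 1 else 0 := by
  classical
  rw [← basis_eq_monomial, Module.Basis.coord_apply, Module.Basis.repr_self,
    Finsupp.single_apply]

/-- The coefficient in `Λ(n)` of `x^(β)`. -/
noncomputable def coeff (β : Fin m → ℕ) : SAlg F m n →ₗ[F] Ext F n :=
  (Finsupp.lapply β).comp
    (TensorProduct.equivFinsuppOfBasisLeft (N := Ext F n) (DividedPow.basis F m)).toLinearMap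

theorem coeff_tm (β : Fin m → ℕ) (a : DividedPow F m) (ω : Ext F n) :
    coeff β (tm a ω : SAlg F m n) = (DividedPow.basis F m).coord β a • ω :=
  TensorProduct.equivFinsuppOfBasisLeft_apply_tmul_apply (DividedPow.basis F m) a ω β

theorem coeff_tm_monomial (β α : Fin m → ℕ) (ω : Ext F n) :
    coeff β (tm (monomial F α) ω : SAlg F m n) = if α = β then ω else 0 := by
  rw [coeff_tm, coord_monomial]
  split_ifs <;> simp

theorem eq_sum_coeff (f : SAlg F m n) :
    ∃ s : Finset (Fin m → ℕ), f = ∑ β ∈ s, tm (monomial F β) (coeff β f) := by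
  have h := (TensorProduct.equivFinsuppOfBasisLeft (N := Ext F n)
    (DividedPow.basis F m)).symm_apply_apply f
  rw [TensorProduct.equivFinsuppOfBasisLeft_symm_apply] at h
  exact ⟨_, h.symm⟩

theorem coeff_ext {f g : SAlg F m n} (h : ∀ β, coeff β f = coeff β g) : f = g :=
  (TensorProduct.equivFinsuppOfBasisLeft (N := Ext F n) (DividedPow.basis F m)).injective
    (Finsupp.ext h)

theorem tm_monomial_induction {P : SAlg F m n → Prop} (z : SAlg F m n) (h0 : P 0)
    (ha : ∀ x y, P x → P y → P (x + y)) (ht : ∀ α ω, P (tm (monomial F α) ω)) : P z := by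
  obtain ⟨s, hs⟩ := eq_sum_coeff z
  rw [hs]
  exact Finset.sum_induction _ P ha h0 fun β _ => ht β _

theorem coord_partialDeriv (β : Fin m → ℕ) (i : Fin m) (a : DividedPow F m) :
    (DividedPow.basis F m).coord β (DividedPow.partialDeriv F i a) =
      (DividedPow.basis F m).coord (β + e i) a := by
  induction a using SpecialSuper.DividedPow.induction with
  | hz => simp
  | ha a b h1 h2 => simp only [map_add, h1, h2]
  | hs c a h => simp only [map_smul, h]
  | hm α =>
    rw [DividedPow.partialDeriv_monomial, coord_monomial]
    by_cases hα : α i = 0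
    · rw [if_pos hα, map_zero, if_neg]
      rintro rfl
      simp [DividedPow.e_same] at hα
    · obtain ⟨a, rfl⟩ := DividedPow.exists_add_e (Nat.pos_of_ne_zero hα)
      rw [if_neg hα, add_tsub_cancel_right, coord_monomial]
      simp

theorem coeff_pd_inl (β : Fin m → ℕ) (i : Fin m) (f : SAlg F m n) :
    coeff β (pd (Sum.inl i) f) = coeff (β + e i) f := by
  induction f using tm_induction with
  | ha x y hx hy => simp only [map_add, hx, hy]
  | ht a ω => rw [pd_inl_tm, coeff_tm, coeff_tm, coord_partialDeriv]

theorem coeff_pd_inr (β : Fin m → ℕ) (k : Fin n) (f : SAlg F m n) :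
    coeff β (pd (Sum.inr k) f) = ctr k (coeff β f) := by
  induction f using tm_induction with
  | ha x y hx hy => simp only [map_add, hx, hy]
  | ht a ω => rw [pd_inr_tm, coeff_tm, coeff_tm, map_smul]

theorem coeff_par (β : Fin m → ℕ) (f : SAlg F m n) :
    coeff β (par f) = CliffordAlgebra.involute (coeff β f) := by
  induction f using tm_induction with
  | ha x y hx hy => simp only [map_add, hx, hy]
  | ht a ω => rw [par_tm, coeff_tm, coeff_tm, map_smul]

theorem coeff_tm_one_mul (β : Fin m → ℕ) (ω : Ext F n) (f : SAlg F m n) :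
    coeff β (tm 1 ω * f) = ω * coeff β f := by
  induction f using tm_induction with
  | ha x y hx hy => simp only [map_add, mul_add, hx, hy]
  | ht a η => rw [tm_mul, coeff_tm, coeff_tm, one_mul, mul_smul_comm]

theorem coeff_theta_mul (β : Fin m → ℕ) (k : Fin n) (f : SAlg F m n) :
    coeff β (gen F (Sum.inr k) * f) = ExteriorAlgebra.ι F (Pi.single k 1) * coeff β f :=
  coeff_tm_one_mul β _ f

theorem add_sub_e {i : Fin m} {β : Fin m → ℕ} (h : β i ≠ 0) : β - e i + e i = β := by
  obtain ⟨a, rfl⟩ := DividedPow.exists_add_e (Nat.pos_of_ne_zero h)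
  rw [add_tsub_cancel_right]

theorem eq_tm_one_of_pd_inl {f : SAlg F m n} (h : ∀ i, pd (Sum.inl i) f = 0) :
    f = tm 1 (coeff 0 f) := by
  refine coeff_ext fun β => ?_
  rw [one_eq_monomial, coeff_tm_monomial]
  split_ifs with hβ
  · rw [hβ]
  · obtain ⟨i, hi⟩ : ∃ i, β i ≠ 0 := by
      by_contra hc
      push Not at hc
      exact hβ (funext fun i => (hc i).symm)
    rw [← add_sub_e hi, ← coeff_pd_inl, h, map_zero]

/-- Integration with respect to `x_i`, restricted to the `x^(α)` for which `α i` satisfies `P`. -/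
noncomputable def integ (P : ℕ → Prop) [DecidablePred P] (i : Fin m) :
    DividedPow F m →ₗ[F] DividedPow F m :=
  (DividedPow.basis F m).constr F fun α => if P (α i) then monomial F (α + e i) else 0

theorem integ_monomial (P : ℕ → Prop) [DecidablePred P] (i : Fin m) (α : Fin m → ℕ) :
    integ P i (monomial F α) = if P (α i) then monomial F (α + e i) else 0 := by
  rw [integ, ← basis_eq_monomial, Module.Basis.constr_basis]

/-- Integration with respect to `x_i` on `𝔄(m,n)`, restricted by `P`. -/
noncomputable def up (P : ℕ → Prop) [DecidablePred P] (i : Fin m) :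
    Module.End F (SAlg F m n) :=
  LinearMap.rTensor (Ext F n) (integ (F := F) P i)

theorem up_tm (P : ℕ → Prop) [DecidablePred P] (i : Fin m) (a : DividedPow F m) (ω : Ext F n) :
    up P i (tm a ω : SAlg F m n) = tm (integ P i a) ω := rfl

theorem up_tm_monomial (P : ℕ → Prop) [DecidablePred P] (i : Fin m) (α : Fin m → ℕ)
    (ω : Ext F n) :
    up P i (tm (monomial F α) ω : SAlg F m n) =
      if P (α i) then tm (monomial F (α + e i)) ω else 0 := by
  rw [up_tm, integ_monomial]
  split_ifs <;> simp

theorem par_up (P : ℕ → Prop) [DecidablePred P] (i : Fin m) (f : SAlg F m n) :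
    par (up P i f) = up P i (par f) := by
  induction f using tm_induction with
  | ha x y hx hy => simp only [map_add, hx, hy]
  | ht a ω => rw [up_tm, par_tm, par_tm, up_tm]

theorem pd_inl_tm_monomial_add (i : Fin m) (α : Fin m → ℕ) (ω : Ext F n) :
    pd (Sum.inl i) (tm (monomial F (α + e i)) ω : SAlg F m n) = tm (monomial F α) ω := by
  rw [pd_inl_tm, DividedPow.partialDeriv_monomial_add]

theorem pd_inl_tm_monomial (i : Fin m) (α : Fin m → ℕ) (ω : Ext F n) :
    pd (Sum.inl i) (tm (monomial F α) ω : SAlg F m n) =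
      if α i = 0 then 0 else tm (monomial F (α - e i)) ω := by
  rw [pd_inl_tm, DividedPow.partialDeriv_monomial]
  split_ifs <;> simp

theorem pd_up_self (i : Fin m) (f : SAlg F m n) :
    pd (Sum.inl i) (up (fun _ => True) i f) = f := by
  induction f using tm_monomial_induction with
  | h0 => simp
  | ha x y hx hy => simp only [map_add, hx, hy]
  | ht α ω => rw [up_tm_monomial, if_pos trivial, pd_inl_tm_monomial_add]

theorem pd_inl_up_ne (P : ℕ → Prop) [DecidablePred P] {i j : Fin m} (h : i ≠ j)
    (f : SAlg F m n) : pd (Sum.inl i) (up P j f) = up P j (pd (Sum.inl i) f) := by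
  induction f using tm_monomial_induction with
  | h0 => simp
  | ha x y hx hy => simp only [map_add, hx, hy]
  | ht α ω =>
    rw [up_tm_monomial, pd_inl_tm_monomial]
    have h1 : (α + e j) i = α i := by simp [DividedPow.e_ne h]
    have h2 : (α - e i) j = α j := by simp [DividedPow.e_ne h.symm]
    by_cases hP : P (α j) <;> by_cases h0 : α i = 0
    · rw [if_pos hP, if_pos h0, pd_inl_tm_monomial, h1, if_pos h0, map_zero]
    · obtain ⟨a, rfl⟩ := DividedPow.exists_add_e (Nat.pos_of_ne_zero h0)
      rw [add_tsub_cancel_right] at h2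
      rw [if_pos hP, if_neg h0, add_tsub_cancel_right, add_right_comm, pd_inl_tm_monomial_add,
        up_tm_monomial, h2, if_pos hP]
    · rw [if_neg hP, if_pos h0, map_zero, map_zero]
    · rw [if_neg hP, if_neg h0, map_zero, up_tm_monomial, h2, if_neg hP]

theorem pd_inr_up (P : ℕ → Prop) [DecidablePred P] (k : Fin n) (j : Fin m)
    (f : SAlg F m n) : pd (Sum.inr k) (up P j f) = up P j (pd (Sum.inr k) f) := by
  induction f using tm_induction with
  | ha x y hx hy => simp only [map_add, hx, hy]
  | ht a ω => rw [up_tm, pd_inr_tm, pd_inr_tm, up_tm]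

/-- The Poincaré lemma in the variables `x_1, …, x_m`. -/
theorem exists_primitive (g : Fin m → SAlg F m n)
    (hg : ∀ i j, pd (Sum.inl i) (g j) = pd (Sum.inl j) (g i)) :
    ∃ u, ∀ i, pd (Sum.inl i) u = g i := by
  suffices h : ∀ s : Finset (Fin m), ∃ u, ∀ i ∈ s, pd (Sum.inl i) u = g i by
    obtain ⟨u, hu⟩ := h Finset.univ
    exact ⟨u, fun i => hu i (Finset.mem_univ i)⟩
  intro s
  induction s using Finset.induction_on with
  | empty => exact ⟨0, by simp⟩
  | insert i s hi ih =>
    obtain ⟨u, hu⟩ := ih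
    -- The error in the `i`-th equation is integrated in `x_i`. By closedness it is annihilated by
    -- the earlier `D_j`, which commute with this integration, so the earlier equations survive.
    refine ⟨u + up (fun _ => True) i (g i - pd (Sum.inl i) u), fun j hj => ?_⟩
    by_cases h : j = i
    · subst h
      rw [map_add, pd_up_self, add_sub_cancel]
    · have hj' := Finset.mem_of_mem_insert_of_ne hj h
      rw [map_add, pd_inl_up_ne _ h, map_sub, hg j i, pd_inl_comm, hu j hj', sub_self, map_zero,
        add_zero]

/-- The number operator `x_r D_r`. -/
noncomputable def num (r : Fin m ⊕ Fin n) : Module.End F (SAlg F m n) := vf (gen F r) r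

theorem num_apply (r : Fin m ⊕ Fin n) (f : SAlg F m n) : num r f = gen F r * pd r f := rfl

theorem num_mem (r : Fin m ⊕ Fin n) : num r ∈ evenField F m n := vf_mem_evenField (par_gen r)

theorem num_gen (r s : Fin m ⊕ Fin n) :
    num r (gen F s : SAlg F m n) = if r = s then gen F r else 0 := vf_gen _ r s

theorem num_num_inr (k : Fin n) (f : SAlg F m n) :
    num (Sum.inr k) (num (Sum.inr k) f) = num (Sum.inr k) f := by
  rw [num_apply, num_apply, pd_inr_theta_mul_self, mul_sub]
  simp

theorem pd_inr_num_self (k : Fin n) (f : SAlg F m n) :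
    pd (Sum.inr k) (num (Sum.inr k) f) = pd (Sum.inr k) f := by
  rw [num_apply, pd_inr_theta_mul_self]; simp

theorem num_inr_theta_mul_self (k : Fin n) (f : SAlg F m n) :
    num (Sum.inr k) (gen F (Sum.inr k) * f) = gen F (Sum.inr k) * f := by
  rw [num_apply, pd_inr_theta_mul_self, mul_sub]
  simp

theorem num_inr_theta_mul_ne {k l : Fin n} (h : k ≠ l) (f : SAlg F m n) :
    num (Sum.inr k) (gen F (Sum.inr l) * f) = gen F (Sum.inr l) * num (Sum.inr k) f := by
  rw [num_apply, num_apply, pd_inr_theta_mul_ne h, mul_neg, ← mul_assoc, ← mul_assoc,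
    theta_mul_theta, neg_mul, neg_neg]

theorem pd_inr_num_ne {k l : Fin n} (h : k ≠ l) (f : SAlg F m n) :
    pd (Sum.inr k) (num (Sum.inr l) f) = num (Sum.inr l) (pd (Sum.inr k) f) := by
  rw [num_apply, num_apply, pd_inr_theta_mul_ne h, pd_inr_comm, mul_neg, neg_neg]

theorem pd_inl_num_inr (i : Fin m) (k : Fin n) (f : SAlg F m n) :
    pd (Sum.inl i) (num (Sum.inr k) f) = num (Sum.inr k) (pd (Sum.inl i) f) := by
  rw [num_apply, num_apply, pd_inl_theta_mul, pd_inl_comm]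

theorem num_inr_comm (k l : Fin n) (f : SAlg F m n) :
    num (Sum.inr k) (num (Sum.inr l) f) = num (Sum.inr l) (num (Sum.inr k) f) := by
  by_cases h : k = l
  · rw [h]
  · rw [num_apply (Sum.inr l), num_inr_theta_mul_ne h, num_apply (Sum.inr l),
      pd_inr_num_ne (Ne.symm h)]

theorem num_mul (h2 : (2 : F) ≠ 0) (r : Fin m ⊕ Fin n) (f g : SAlg F m n) :
    num r (f * g) = num r f * g + f * num r g := evenField.leibniz h2 (num_mem r) f g

theorem num_inl_tm (i : Fin m) (α : Fin m → ℕ) (ω : Ext F n) :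
    num (Sum.inl i) (tm (monomial F α) ω : SAlg F m n) = (α i : F) • tm (monomial F α) ω := by
  rw [num_apply, pd_inl_tm_monomial]
  by_cases h0 : α i = 0
  · simp [h0]
  · obtain ⟨a, rfl⟩ := DividedPow.exists_add_e (Nat.pos_of_ne_zero h0)
    rw [if_neg h0, add_tsub_cancel_right, gen, tm_mul, one_mul, DividedPow.monomial_mul,
      map_smul, LinearMap.smul_apply, add_comm (e i) a]
    congr 2
    rw [Finset.prod_eq_single i]
    · simp [DividedPow.e_same, add_comm]
    · intro j _ hj
      simp [DividedPow.e_ne hj]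
    · simp

/-- Induction on the odd variables: an element annihilated by `∂/∂θ_a` can be rewritten without the
generator `θ_a`, with the other coefficients adjusted. -/
theorem eq_zero_of_mem_thetaIdeal (s : Finset (Fin n)) : ∀ g : Fin n → SAlg F m n,
    (∀ k ∈ s, pd (Sum.inr k) (∑ l ∈ s, gen F (Sum.inr l) * g l) = 0) →
    ∑ l ∈ s, gen F (Sum.inr l) * g l = 0 := by
  induction s using Finset.induction_on with
  | empty => simp
  | insert a s ha ih =>
    intro g hg
    rw [Finset.sum_insert ha] at hg ⊢
    set S := ∑ l ∈ s, gen F (Sum.inr l) * g l with hS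
    -- Applying `θ_a ∂/∂θ_a` gives `0 = θ_a g_a + θ_a ∂S/∂θ_a`, which expresses the `θ_a` term
    -- through the others.
    have h1 : gen F (Sum.inr a) * g a + S =
        ∑ l ∈ s, gen F (Sum.inr l) * (g l - num (Sum.inr a) (g l)) := by
      have e1 := hg a (Finset.mem_insert_self a s)
      have e2 : num (Sum.inr a) (gen F (Sum.inr a) * g a + S) = 0 := by
        rw [num_apply, e1, mul_zero]
      rw [map_add, num_inr_theta_mul_self] at e2
      have e3 : num (Sum.inr a) S = ∑ l ∈ s, gen F (Sum.inr l) * num (Sum.inr a) (g l) := by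
        rw [hS, map_sum]
        refine Finset.sum_congr rfl fun l hl => num_inr_theta_mul_ne ?_ _
        rintro rfl
        exact ha hl
      simp only [mul_sub, Finset.sum_sub_distrib]
      rw [← e3, ← hS]
      rw [eq_neg_of_add_eq_zero_left e2]
      abel
    rw [h1] at hg ⊢
    exact ih _ fun k hk => hg k (Finset.mem_insert_of_mem hk)

theorem exists_sub_aug (ω : Ext F n) : ∃ g : Fin n → Ext F n,
    ω - algebraMap F _ (ExteriorAlgebra.algebraMapInv ω) =
      ∑ k, ExteriorAlgebra.ι F (Pi.single k 1) * g k := by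
  induction ω using CliffordAlgebra.left_induction with
  | algebraMap r =>
    refine ⟨0, ?_⟩
    have := ExteriorAlgebra.algebraMap_leftInverse (R := F) (Fin n → F) r
    change algebraMap F (Ext F n) r - algebraMap F (Ext F n)
      (ExteriorAlgebra.algebraMapInv (algebraMap F (Ext F n) r)) = _
    rw [this]
    simp
  | add x y hx hy =>
    obtain ⟨g, hg⟩ := hx
    obtain ⟨h, hh⟩ := hy
    refine ⟨g + h, ?_⟩
    simp only [map_add, Pi.add_apply, mul_add, Finset.sum_add_distrib, ← hg, ← hh]
    abel
  | ι_mul x v h =>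
    refine ⟨fun k => v k • x, ?_⟩
    have h1 : ExteriorAlgebra.algebraMapInv (ExteriorAlgebra.ι F v * x) = 0 := by
      simp [ExteriorAlgebra.algebraMapInv]
    change ExteriorAlgebra.ι F v * x - algebraMap F (Ext F n)
      (ExteriorAlgebra.algebraMapInv (ExteriorAlgebra.ι F v * x)) = _
    rw [h1, map_zero, sub_zero]
    have h2 : v = ∑ k, v k • (Pi.single k 1 : Fin n → F) := by
      ext j
      simp [Finset.sum_apply, Pi.single_apply]
    conv_lhs => rw [h2, map_sum, Finset.sum_mul]
    simp

/-- The augmentation `𝔄(m,n) → 𝔄(m)`. -/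
noncomputable def aug : SAlg F m n →ₗ[F] DividedPow F m :=
  (TensorProduct.rid F (DividedPow F m)).toLinearMap.comp
    (LinearMap.lTensor (DividedPow F m) ExteriorAlgebra.algebraMapInv.toLinearMap)

theorem aug_tm (a : DividedPow F m) (ω : Ext F n) :
    aug (tm a ω : SAlg F m n) = ExteriorAlgebra.algebraMapInv ω • a := rfl

theorem aug_tm_one (a : DividedPow F m) : aug (tm a 1 : SAlg F m n) = a := by
  rw [aug_tm, map_one, one_smul]

theorem exists_sub_aug_eq (f : SAlg F m n) : ∃ g : Fin n → SAlg F m n,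
    f - tm (aug f) 1 = ∑ k, gen F (Sum.inr k) * g k := by
  induction f using tm_induction with
  | ha x y hx hy =>
    obtain ⟨g, hg⟩ := hx
    obtain ⟨h, hh⟩ := hy
    refine ⟨g + h, ?_⟩
    simp only [map_add, Pi.add_apply, mul_add, Finset.sum_add_distrib, ← hg, ← hh,
      LinearMap.add_apply]
    abel
  | ht a ω =>
    obtain ⟨g, hg⟩ := exists_sub_aug ω
    refine ⟨fun k => tm a (g k), ?_⟩
    simp only [gen, tm_mul, one_mul, ← map_sum, ← hg, map_sub, aug_tm,
      Algebra.algebraMap_eq_smul_one, map_smul, LinearMap.smul_apply]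

/-- The difference from the augmentation lies in the ideal generated by the odd variables and is
still annihilated by all odd derivatives, hence is zero. -/
theorem eq_tm_aug {f : SAlg F m n} (h : ∀ k, pd (Sum.inr k) f = 0) : f = tm (aug f) 1 := by
  obtain ⟨g, hg⟩ := exists_sub_aug_eq f
  refine sub_eq_zero.mp (hg.trans (eq_zero_of_mem_thetaIdeal Finset.univ g fun k _ => ?_))
  rw [← hg, map_sub, h, pd_inr_tm, ctr_one, map_zero, sub_zero]

end Coefficients

/-! ### Scalars from the divided powers and monomials in the odd variables. -/

section Words

variable {F : Type*} [Field F] {m n : ℕ}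

/-- The inclusion of `𝔄(m)` in `𝔄(m,n)`. -/
noncomputable def sc (a : DividedPow F m) : SAlg F m n := tm a 1

theorem sc_add (a b : DividedPow F m) : (sc (a + b) : SAlg F m n) = sc a + sc b := by simp [sc]

theorem sc_sub (a b : DividedPow F m) : (sc (a - b) : SAlg F m n) = sc a - sc b := by simp [sc]

theorem sc_smul (c : F) (a : DividedPow F m) : (sc (c • a) : SAlg F m n) = c • sc a := by simp [sc]

@[simp] theorem sc_zero : (sc (0 : DividedPow F m) : SAlg F m n) = 0 := by simp [sc]

@[simp] theorem sc_one : (sc (1 : DividedPow F m) : SAlg F m n) = 1 := one_eq_tm.symm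

theorem sc_mul (a b : DividedPow F m) : (sc (a * b) : SAlg F m n) = sc a * sc b := by
  simp [sc, tm_mul]

theorem sc_comm (a : DividedPow F m) (f : SAlg F m n) : sc a * f = f * sc a := by
  induction f using tm_induction with
  | ha x y hx hy => rw [mul_add, add_mul, hx, hy]
  | ht b ω => rw [sc, tm_mul, tm_mul, one_mul, mul_one, mul_comm]

theorem sc_left_comm (a : DividedPow F m) (f g : SAlg F m n) :
    f * (sc a * g) = sc a * (f * g) := by
  rw [← mul_assoc, ← sc_comm, mul_assoc]

theorem sc_mul_tm (a b : DividedPow F m) (ω : Ext F n) :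
    sc a * (tm b ω : SAlg F m n) = tm (a * b) ω := by rw [sc, tm_mul, one_mul]

@[simp] theorem par_sc (a : DividedPow F m) : par (sc a : SAlg F m n) = sc a := by simp [sc]

@[simp] theorem pd_inl_sc (i : Fin m) (a : DividedPow F m) :
    (pd (Sum.inl i) (sc a) : SAlg F m n) = sc (DividedPow.partialDeriv F i a) := rfl

@[simp] theorem pd_inr_sc (k : Fin n) (a : DividedPow F m) :
    (pd (Sum.inr k) (sc a) : SAlg F m n) = 0 := by rw [sc, pd_inr_tm, ctr_one, map_zero]

theorem pd_inl_sc_mul (i : Fin m) (a : DividedPow F m) (f : SAlg F m n) :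
    pd (Sum.inl i) (sc a * f) =
      sc (DividedPow.partialDeriv F i a) * f + sc a * pd (Sum.inl i) f := by
  rw [pd_inl_mul, pd_inl_sc]

theorem pd_inr_sc_mul (k : Fin n) (a : DividedPow F m) (f : SAlg F m n) :
    pd (Sum.inr k) (sc a * f) = sc a * pd (Sum.inr k) f := by
  rw [pd_inr_mul, pd_inr_sc, par_sc, zero_mul, zero_add]

theorem aug_sc (a : DividedPow F m) : aug (sc a : SAlg F m n) = a := aug_tm_one a

theorem sc_injective : Function.Injective (sc : DividedPow F m → SAlg F m n) := fun a b h => by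
  rw [← aug_sc (n := n) a, h, aug_sc]

theorem gen_inl_eq_sc (i : Fin m) :
    (gen F (Sum.inl i) : SAlg F m n) = sc (monomial F (e i)) := rfl

theorem eq_sc_of_pd_inr {f : SAlg F m n} (h : ∀ k, pd (Sum.inr k) f = 0) :
    f = sc (aug f) := eq_tm_aug h

theorem eq_smul_one {f : SAlg F m n} (h : ∀ r, pd r f = 0) : ∃ c : F, f = c • 1 := by
  have h1 := eq_tm_one_of_pd_inl fun i => h (Sum.inl i)
  have h2 := eq_tm_aug fun k => h (Sum.inr k)
  refine ⟨ExteriorAlgebra.algebraMapInv (coeff 0 f), ?_⟩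
  rw [h2]
  conv_lhs => rw [h1, aug_tm]
  rw [← h2, map_smul, LinearMap.smul_apply, one_eq_tm]

/-- The product of the odd generators indexed by a list. -/
noncomputable def word (l : List (Fin n)) : SAlg F m n :=
  (l.map fun k => gen F (Sum.inr k)).prod

@[simp] theorem word_nil : (word [] : SAlg F m n) = 1 := rfl

theorem word_cons (k : Fin n) (l : List (Fin n)) :
    (word (k :: l) : SAlg F m n) = gen F (Sum.inr k) * word l := by simp [word]

theorem par_word (l : List (Fin n)) :
    par (word l : SAlg F m n) = (-1 : F) ^ l.length • word l := by
  induction l with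
  | nil => simp
  | cons k l ih => rw [word_cons, map_mul, ih, par_gen_inr, List.length_cons, pow_succ]; simp

@[simp] theorem pd_inl_word (i : Fin m) (l : List (Fin n)) :
    pd (Sum.inl i) (word l : SAlg F m n) = 0 := by
  induction l with
  | nil => simp
  | cons k l ih => rw [word_cons, pd_inl_theta_mul, ih, mul_zero]

theorem pd_inr_word {k : Fin n} {l : List (Fin n)} (h : k ∉ l) :
    pd (Sum.inr k) (word l : SAlg F m n) = 0 := by
  induction l with
  | nil => simp
  | cons a l ih =>
    rw [List.mem_cons, not_or] at h
    rw [word_cons, pd_inr_theta_mul_ne h.1, ih h.2, mul_zero, neg_zero]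

theorem pd_inr_word_cons {k : Fin n} {l : List (Fin n)} (h : k ∉ l) :
    pd (Sum.inr k) (word (k :: l) : SAlg F m n) = word l := by
  rw [word_cons, pd_inr_theta_mul_self, pd_inr_word h, mul_zero, sub_zero]

theorem word_perm {l l' : List (Fin n)} (h : l.Perm l') :
    ∃ c : F, c ≠ 0 ∧ (word l : SAlg F m n) = c • word l' := by
  induction h with
  | nil => exact ⟨1, one_ne_zero, by simp⟩
  | cons a _ ih =>
    obtain ⟨c, hc, ih⟩ := ih
    exact ⟨c, hc, by rw [word_cons, word_cons, ih, mul_smul_comm]⟩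
  | swap a b l =>
    refine ⟨-1, by simp, ?_⟩
    rw [word_cons, word_cons, word_cons, word_cons, ← mul_assoc, theta_mul_theta, neg_mul,
      mul_assoc, neg_one_smul]
  | trans _ _ h1 h2 =>
    obtain ⟨c, hc, h1⟩ := h1
    obtain ⟨d, hd, h2⟩ := h2
    exact ⟨c * d, mul_ne_zero hc hd, by rw [h1, h2, smul_smul]⟩

theorem word_eq_zero {l : List (Fin n)} (h : ¬ l.Nodup) : (word l : SAlg F m n) = 0 := by
  induction l with
  | nil => simp at h
  | cons a l ih =>
    by_cases ha : a ∈ l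
    · obtain ⟨c, -, hc⟩ := word_perm (F := F) (m := m) (List.perm_cons_erase ha)
      rw [word_cons, hc, word_cons, mul_smul_comm, theta_theta_mul, smul_zero]
    · rw [List.nodup_cons, not_and] at h
      rw [word_cons, ih (h ha), mul_zero]

/-- Being fixed by `θ_k ∂/∂θ_k` means being divisible by `θ_k`. The cofactor comes from iterated odd
derivatives of `v`, hence inherits every derivative condition satisfied by `v`; this last clause is
what later makes cofactors constant. -/
theorem exists_word_mul : ∀ {l : List (Fin n)} (_ : l.Nodup) {v : SAlg F m n}
    (_ : ∀ k ∈ l, num (Sum.inr k) v = v),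
    ∃ g, v = word l * g ∧ (∀ k ∈ l, pd (Sum.inr k) g = 0) ∧ (∀ r, pd r v = 0 → pd r g = 0) := by
  intro l
  induction l with
  | nil => exact fun _ v _ => ⟨v, by simp, by simp, fun r h => h⟩
  | cons a l ih =>
    intro hl v hv
    rw [List.nodup_cons] at hl
    -- Since `v = θ_a (∂v/∂θ_a)`, it suffices to factor the derivative through the remaining
    -- letters.
    obtain ⟨g, hg, h1, h2⟩ := ih hl.2 (v := pd (Sum.inr a) v) fun k hk => by
      have hka : a ≠ k := fun h => hl.1 (h ▸ hk)
      rw [← pd_inr_num_ne hka, hv k (List.mem_cons_of_mem a hk)]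
    refine ⟨g, ?_, ?_, fun r hr => h2 r ?_⟩
    · rw [word_cons, mul_assoc, ← hg]
      exact (hv a List.mem_cons_self).symm
    · intro k hk
      rcases List.mem_cons.mp hk with rfl | hk
      · exact h2 _ (pd_inr_pd_inr _ _)
      · exact h1 k hk
    · rw [pd_comm, hr, map_zero, smul_zero]

/-- The product of all odd generators. -/
noncomputable def top (F : Type*) [Field F] (m n : ℕ) : SAlg F m n := word (List.finRange n)

theorem par_top : par (top F m n) = (-1 : F) ^ n • top F m n := by
  rw [top, par_word, List.length_finRange]

@[simp] theorem pd_inl_top (i : Fin m) : pd (Sum.inl i) (top F m n) = 0 := pd_inl_word _ _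

theorem theta_mul_word {k : Fin n} {l : List (Fin n)} (h : k ∈ l) :
    gen F (Sum.inr k) * (word l : SAlg F m n) = 0 := by
  rw [← word_cons, word_eq_zero]
  simp [h]

@[simp] theorem theta_mul_top (k : Fin n) : gen F (Sum.inr k) * top F m n = 0 :=
  theta_mul_word (List.mem_finRange k)

theorem num_inr_word {k : Fin n} {l : List (Fin n)} (h : k ∈ l) :
    num (Sum.inr k) (word l : SAlg F m n) = word l := by
  obtain ⟨c, -, hc⟩ := word_perm (F := F) (m := m) (List.perm_cons_erase h)
  rw [hc, map_smul, word_cons, num_inr_theta_mul_self]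

@[simp] theorem num_inr_top (k : Fin n) : num (Sum.inr k) (top F m n) = top F m n :=
  num_inr_word (List.mem_finRange k)

theorem eq_top_mul_sc {v : SAlg F m n} (hv : ∀ k, num (Sum.inr k) v = v) :
    ∃ a, v = top F m n * sc a ∧ ∀ i, pd (Sum.inl i) v = 0 →
      DividedPow.partialDeriv F i a = 0 := by
  obtain ⟨g, hg, h1, h2⟩ := exists_word_mul (List.nodup_finRange n) fun k _ => hv k
  have hs := eq_sc_of_pd_inr fun k => h1 k (List.mem_finRange k)
  refine ⟨aug g, by rw [← hs, hg]; rfl, fun i hi => ?_⟩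
  have := h2 _ hi
  rw [hs, pd_inl_sc] at this
  exact sc_injective (this.trans sc_zero.symm)

theorem num_inr_sc_mul (k : Fin n) (a : DividedPow F m) (f : SAlg F m n) :
    num (Sum.inr k) (sc a * f) = sc a * num (Sum.inr k) f := by
  rw [num_apply, pd_inr_sc_mul, sc_left_comm, num_apply]

end Words

/-! ### The algebra `𝒮`, truncation and divergence. -/

section Special

variable {F : Type*} [Field F] {m n : ℕ} {p : ℕ} {t : Fin m → ℕ}

/-- The subspace `𝔄(m,n;t)`. -/
noncomputable def trunc (F : Type*) [Field F] (p : ℕ) {m : ℕ} (n : ℕ) (t : Fin m → ℕ) :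
    Submodule F (SAlg F m n) := SpecialSuper.truncAlg F p n t

theorem trunc_eq_span : trunc F p n t = Submodule.span F {z : SAlg F m n |
    ∃ (α : Fin m → ℕ) (ω : Ext F n), (∀ i, α i < p ^ t i) ∧ z = tm (monomial F α) ω} := rfl

theorem mem_trunc_iff {f : SAlg F m n} :
    f ∈ trunc F p n t ↔ ∀ β, coeff β f ≠ 0 → ∀ i, β i < p ^ t i := by
  constructor
  · intro hf β
    contrapose!
    intro hβ
    rw [trunc_eq_span] at hf
    induction hf using Submodule.span_induction with
    | zero => exact map_zero (coeff β)
    | add x y _ _ hx hy => rw [map_add, hx, hy, add_zero]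
    | smul c x _ hx => rw [map_smul, hx, smul_zero]
    | mem x hx =>
      obtain ⟨α, ω, hα, rfl⟩ := hx
      refine (coeff_tm_monomial β α ω).trans (if_neg ?_)
      rintro rfl
      obtain ⟨i, hi⟩ := hβ
      exact absurd (hα i) (not_lt.mpr hi)
  · intro h
    obtain ⟨s, hs⟩ := eq_sum_coeff f
    rw [hs]
    refine Submodule.sum_mem _ fun β _ => ?_
    by_cases h0 : coeff β f = 0
    · rw [h0, map_zero]; exact zero_mem _
    · rw [trunc_eq_span]; exact Submodule.subset_span ⟨β, _, h β h0, rfl⟩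

theorem tm_mem_trunc {α : Fin m → ℕ} (hα : ∀ i, α i < p ^ t i) (ω : Ext F n) :
    tm (monomial F α) ω ∈ trunc F p n t := by
  rw [trunc_eq_span]; exact Submodule.subset_span ⟨α, ω, hα, rfl⟩

theorem trunc_mul [Fact p.Prime] [CharP F p] {x y : SAlg F m n}
    (hx : x ∈ trunc F p n t) (hy : y ∈ trunc F p n t) : x * y ∈ trunc F p n t :=
  SpecialSuper.truncAlg_mul hx hy

theorem trunc_pd (r : Fin m ⊕ Fin n) {x : SAlg F m n} (hx : x ∈ trunc F p n t) :
    pd r x ∈ trunc F p n t := SpecialSuper.truncAlg_D r hx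

theorem trunc_sc {a : DividedPow F m} (ha : a ∈ DividedPow.truncated F p t) :
    (sc a : SAlg F m n) ∈ trunc F p n t := SpecialSuper.tmul_mem_truncAlg ha 1

theorem one_mem_truncated [Fact p.Prime] : (1 : DividedPow F m) ∈ DividedPow.truncated F p t :=
  Submodule.subset_span ⟨0, fun _ => pow_pos (Fact.out : p.Prime).pos _, rfl⟩

theorem monomial_mem_truncated {α : Fin m → ℕ} (hα : ∀ i, α i < p ^ t i) :
    monomial F α ∈ DividedPow.truncated F p t := Submodule.subset_span ⟨α, hα, rfl⟩

theorem e_lt [Fact p.Prime] (ht : ∀ i, 0 < t i) (i j : Fin m) : e i j < p ^ t j := by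
  by_cases h : j = i
  · subst h
    rw [DividedPow.e_same]
    exact Nat.one_lt_pow (ht j).ne' (Fact.out : p.Prime).one_lt
  · rw [DividedPow.e_ne h]
    exact pow_pos (Fact.out : p.Prime).pos _

theorem trunc_one [Fact p.Prime] : (1 : SAlg F m n) ∈ trunc F p n t := by
  rw [← sc_one]; exact trunc_sc one_mem_truncated

theorem trunc_gen [Fact p.Prime] (ht : ∀ i, 0 < t i) (r : Fin m ⊕ Fin n) :
    gen F r ∈ trunc F p n t := by
  rcases r with i | k
  · exact tm_mem_trunc (e_lt ht i) _
  · exact tm_mem_trunc (fun _ => pow_pos (Fact.out : p.Prime).pos _) _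

theorem trunc_word [Fact p.Prime] [CharP F p] (l : List (Fin n)) :
    (word l : SAlg F m n) ∈ trunc F p n t := by
  induction l with
  | nil => exact trunc_one
  | cons k l ih =>
    rw [word_cons]
    exact trunc_mul (tm_mem_trunc (fun _ => pow_pos (Fact.out : p.Prime).pos _) _) ih

/-- `D_{rs}(f)` for `f` of parity `τ(r) + τ(s)`. -/
noncomputable def dt (r s : Fin m ⊕ Fin n) (f : SAlg F m n) : Module.End F (SAlg F m n) :=
  (-1 : F) ^ (tau r * tau s) • vf (pd r f) s - (-1 : F) ^ (tau r + tau s) • vf (pd s f) r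

theorem dt_add (r s : Fin m ⊕ Fin n) (f g : SAlg F m n) : dt r s (f + g) = dt r s f + dt r s g := by
  simp only [dt, map_add, vf_add]; module

theorem dt_smul (r s : Fin m ⊕ Fin n) (c : F) (f : SAlg F m n) :
    dt r s (c • f) = c • dt r s f := by
  simp only [dt, map_smul, vf_smul]; module

/-- The even part of the special Lie superalgebra, as a space of operators. -/
noncomputable def spec (F : Type*) [Field F] (p : ℕ) {m : ℕ} (n : ℕ) (t : Fin m → ℕ) :
    Submodule F (Module.End F (SAlg F m n)) :=
  Submodule.span F {X | ∃ (r s : Fin m ⊕ Fin n) (f : SAlg F m n), f ∈ trunc F p n t ∧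
    par f = (-1 : F) ^ (tau r + tau s) • f ∧ X = dt r s f}

theorem dt_mem_spec {r s : Fin m ⊕ Fin n} {f : SAlg F m n} (hf : f ∈ trunc F p n t)
    (hp : par f = (-1 : F) ^ (tau r + tau s) • f) : dt r s f ∈ spec F p n t :=
  Submodule.subset_span ⟨r, s, f, hf, hp, rfl⟩

theorem evenGen_eq : SpecialSuper.evenGen F p n t =
    {X | ∃ (r s : Fin m ⊕ Fin n) (f : SAlg F m n), f ∈ trunc F p n t ∧
    par f = (-1 : F) ^ (tau r + tau s) • f ∧ X = dt r s f} := by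
  ext X
  constructor
  · rintro ⟨r, s, f, hf, hp, rfl⟩
    exact ⟨r, s, f, hf, hp, SpecialSuper.Dtwo_of_parity r s hp⟩
  · rintro ⟨r, s, f, hf, hp, rfl⟩
    exact ⟨r, s, f, hf, hp, (SpecialSuper.Dtwo_of_parity r s hp).symm⟩

theorem spec_eq : spec F p n t = Submodule.span F (SpecialSuper.evenGen F p n t) := by
  rw [evenGen_eq]; rfl

theorem spec_lie [Fact p.Prime] [CharP F p] (h2 : (2 : F) ≠ 0)
    {X Y : Module.End F (SAlg F m n)} (hX : X ∈ spec F p n t) (hY : Y ∈ spec F p n t) :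
    ⁅X, Y⁆ ∈ spec F p n t := by
  rw [spec_eq] at hX hY ⊢
  exact SpecialSuper.lie_mem_span h2 hX hY

theorem spec_le : spec F p n t ≤ evenField F m n := by
  refine Submodule.span_le.mpr ?_
  rintro X ⟨r, s, f, -, hf, rfl⟩
  refine sub_mem (Submodule.smul_mem _ _ (vf_mem_evenField ?_))
    (Submodule.smul_mem _ _ (vf_mem_evenField ?_))
  · rw [par_pd_of r hf, ← add_assoc, ← two_mul, pow_add, pow_mul]; simp
  · rw [par_pd_of s hf, add_left_comm, ← two_mul, pow_add, pow_mul _ 2]; simp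

/-- The divergence. -/
noncomputable def dv : Module.End F (SAlg F m n) →ₗ[F] SAlg F m n :=
  ∑ r, (-1 : F) ^ tau r • (pd r).comp (LinearMap.applyₗ (gen F r))

theorem dv_apply (X : Module.End F (SAlg F m n)) :
    dv X = ∑ r, (-1 : F) ^ tau r • pd r (X (gen F r)) := by
  simp [dv, LinearMap.sum_apply]

theorem dv_vf (f : SAlg F m n) (r : Fin m ⊕ Fin n) : dv (vf f r) = (-1 : F) ^ tau r • pd r f := by
  rw [dv_apply, Finset.sum_eq_single r]
  · simp
  · intro b _ hb
    rw [vf_gen_ne _ hb.symm, map_zero, smul_zero]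
  · simp

theorem dv_dt (r s : Fin m ⊕ Fin n) (f : SAlg F m n) : dv (dt r s f) = 0 := by
  rw [dt, map_sub, map_smul, map_smul, dv_vf, dv_vf, pd_comm s r]
  rcases tau_cases r with hr | hr <;> rcases tau_cases s with hs | hs <;> simp [hr, hs]

theorem dv_spec {X : Module.End F (SAlg F m n)} (hX : X ∈ spec F p n t) : dv X = 0 := by
  have : spec F p n t ≤ LinearMap.ker dv := by
    refine Submodule.span_le.mpr ?_
    rintro X ⟨r, s, f, -, -, rfl⟩
    exact dv_dt r s f
  exact this hX

theorem spec_apply_gen_mem {X : Module.End F (SAlg F m n)} (hX : X ∈ spec F p n t)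
    (a : Fin m ⊕ Fin n) : X (gen F a) ∈ trunc F p n t := by
  induction hX using Submodule.span_induction with
  | zero => simp
  | add x y _ _ hx hy => rw [LinearMap.add_apply]; exact add_mem hx hy
  | smul c x _ hx => rw [LinearMap.smul_apply]; exact Submodule.smul_mem _ _ hx
  | mem x h =>
    obtain ⟨r, s, f, hf, -, rfl⟩ := h
    rw [dt, LinearMap.sub_apply, LinearMap.smul_apply, LinearMap.smul_apply, vf_gen, vf_gen]
    refine sub_mem (Submodule.smul_mem _ _ ?_) (Submodule.smul_mem _ _ ?_)
    · split_ifs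
      · exact trunc_pd r hf
      · exact zero_mem _
    · split_ifs
      · exact trunc_pd s hf
      · exact zero_mem _

/-- The second order terms recombine into `X (div Y)` and `Y (div X)`. The products of first
derivatives `D_r X_a · D_a Y_r` cancel by supercommutativity after exchanging the summation indices.
-/
theorem dv_lie (h2 : (2 : F) ≠ 0) {X Y : Module.End F (SAlg F m n)} (hX : X ∈ evenField F m n)
    (hY : Y ∈ evenField F m n) : dv ⁅X, Y⁆ = X (dv Y) - Y (dv X) := by
  have key : ∀ a r : Fin m ⊕ Fin n,
      (-1 : F) ^ tau r • (pd r (X (gen F a)) * pd a (Y (gen F r))) =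
      (-1 : F) ^ tau a • (pd a (Y (gen F r)) * pd r (X (gen F a))) := by
    intro a r
    have := SpecialSuper.supercomm h2 (par_pd_of r (hX.1 a)) (par_pd_of a (hY.1 r))
    have h : pd r (X (gen F a)) * pd a (Y (gen F r)) =
      (-1 : F) ^ ((tau r + tau a) * (tau a + tau r)) •
        (pd a (Y (gen F r)) * pd r (X (gen F a))) := this
    rw [h, smul_smul]
    congr 1
    rcases tau_cases r with hr | hr <;> rcases tau_cases a with hs | hs <;> norm_num [hr, hs]
  have e : ∀ {Z W : Module.End F (SAlg F m n)}, Z ∈ evenField F m n →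
      ∑ r, (-1 : F) ^ tau r • pd r (Z (W (gen F r))) =
        (∑ r, ∑ a, (-1 : F) ^ tau r • (pd r (Z (gen F a)) * pd a (W (gen F r)))) + Z (dv W) := by
    intro Z W hZ
    rw [dv_apply, map_sum, ← Finset.sum_add_distrib]
    refine Finset.sum_congr rfl fun r _ => ?_
    rw [evenField.apply_pd hZ, smul_add, map_smul, Finset.smul_sum]
  rw [dv_apply]
  simp only [lie_apply_op, map_sub, smul_sub, Finset.sum_sub_distrib]
  rw [e hX, e hY, Finset.sum_comm,
    Finset.sum_congr rfl fun a _ => Finset.sum_congr rfl fun r _ => key a r]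
  abel

/-- The fields `g D_l` with `D_l g = 0`. -/
theorem vf_inr_mem_spec [Fact p.Prime] [CharP F p] (h2 : (2 : F) ≠ 0) {g : SAlg F m n}
    {l : Fin n} (hg : g ∈ trunc F p n t) (hp : par g = -g) (hl : pd (Sum.inr l) g = 0) :
    vf g (Sum.inr l) ∈ spec F p n t := by
  have h : dt (Sum.inr l) (Sum.inr l) (gen F (Sum.inr l) * g) = (-2 : F) • vf g (Sum.inr l) := by
    rw [dt, pd_inr_theta_mul_self, hl, mul_zero, sub_zero]
    simp only [tau]
    norm_num
    module
  refine (Submodule.smul_mem_iff _ (neg_ne_zero.mpr h2)).mp (h ▸ dt_mem_spec ?_ ?_)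
  · exact trunc_mul (tm_mem_trunc (fun _ => pow_pos (Fact.out : p.Prime).pos _) _) hg
  · rw [map_mul, par_gen_inr, hp]
    simp [tau]

/-- The divergence free field with leading term `g D_i`, completed by the odd index `s`. -/
noncomputable def cf (g : SAlg F m n) (i : Fin m) (s : Fin n) : Module.End F (SAlg F m n) :=
  vf g (Sum.inl i) + vf (gen F (Sum.inr s) * pd (Sum.inl i) g) (Sum.inr s)

theorem cf_add (f g : SAlg F m n) (i : Fin m) (s : Fin n) :
    cf (f + g) i s = cf f i s + cf g i s := by
  simp only [cf, map_add, mul_add, vf_add]; abel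

theorem cf_smul (c : F) (g : SAlg F m n) (i : Fin m) (s : Fin n) :
    cf (c • g) i s = c • cf g i s := by
  simp only [cf, map_smul, mul_smul_comm, vf_smul, smul_add]

/-- When `g` is free of `θ_s`, the second component of `cf` is exactly the one that cancels the
divergence `D_i g` of the first, and the field is a single generator of `𝒮`. -/
theorem cf_eq_dt {g : SAlg F m n} {s : Fin n} (hs : pd (Sum.inr s) g = 0) (i : Fin m) :
    cf g i s = dt (Sum.inl i) (Sum.inr s) (gen F (Sum.inr s) * g) := by
  rw [dt, pd_inr_theta_mul_self, hs, mul_zero, sub_zero, pd_inl_theta_mul, cf]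
  simp only [tau]
  norm_num
  abel

theorem cf_mem_spec [Fact p.Prime] [CharP F p] {g : SAlg F m n} {i : Fin m} {s : Fin n}
    (hg : g ∈ trunc F p n t) (hp : par g = g) (hs : pd (Sum.inr s) g = 0) :
    cf g i s ∈ spec F p n t := by
  rw [cf_eq_dt hs]
  refine dt_mem_spec ?_ ?_
  · exact trunc_mul (tm_mem_trunc (fun _ => pow_pos (Fact.out : p.Prime).pos _) _) hg
  · rw [map_mul, par_gen_inr, hp]
    simp [tau]

theorem cf_mem_evenField {g : SAlg F m n} (hp : par g = g) (i : Fin m) (s : Fin n) :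
    cf g i s ∈ evenField F m n := by
  refine add_mem (vf_inl_mem_evenField hp) (vf_inr_mem_evenField ?_)
  have h := par_pd (Sum.inl i) g
  rw [hp] at h
  rw [map_mul, par_gen_inr, h]
  simp [tau]

end Special

/-! ### Small elements of `𝒮` and their centralizer. -/

section Elements

variable {F : Type*} [Field F] {m n : ℕ} {p : ℕ} {t : Fin m → ℕ}

theorem vf_one (r : Fin m ⊕ Fin n) : vf (1 : SAlg F m n) r = pd r :=
  LinearMap.ext fun φ => by rw [vf_apply, one_mul]

theorem pd_inl_mem_evenField (j : Fin m) : pd (Sum.inl j) ∈ evenField F m n := by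
  rw [← vf_one]; exact vf_inl_mem_evenField (map_one _)

variable [Fact p.Prime] [CharP F p]

theorem pd_inl_mem_spec (hn : 2 < n) (j : Fin m) : pd (Sum.inl j) ∈ spec F p n t := by
  have h := cf_mem_spec (F := F) (p := p) (t := t) (i := j) (s := (⟨0, by omega⟩ : Fin n))
    trunc_one (map_one _) (pd_one _)
  rwa [cf, pd_one, mul_zero, vf_zero, add_zero, vf_one] at h

theorem vf_inl_mem_spec {g : SAlg F m n} {i : Fin m} (hg : g ∈ trunc F p n t)
    (hp : par g = g) (hi : pd (Sum.inl i) g = 0) {s : Fin n} (hs : pd (Sum.inr s) g = 0) :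
    vf g (Sum.inl i) ∈ spec F p n t := by
  have h := cf_mem_spec (i := i) hg hp hs
  rwa [cf, hi, mul_zero, vf_zero, add_zero] at h

theorem lower_mem_spec (hn : 2 < n) (ht : ∀ i, 0 < t i) {a b : Fin m} (hab : a ≠ b) :
    vf (gen F (Sum.inl a)) (Sum.inl b) ∈ spec F p n t :=
  vf_inl_mem_spec (trunc_gen ht _) (par_gen_inl a) (pd_gen_ne (by simpa using hab.symm))
    (s := ⟨0, by omega⟩) (pd_gen_ne (by simp))

theorem torus_mem_spec (ht : ∀ i, 0 < t i) (i : Fin m) (s : Fin n) :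
    num (Sum.inl i) + num (Sum.inr s) ∈ spec F p n t := by
  have h := cf_mem_spec (i := i) (s := s) (trunc_gen (F := F) (p := p) ht (Sum.inl i)) (par_gen_inl i)
    (pd_gen_ne (by simp))
  rwa [cf, pd_gen_self, mul_one] at h

/-- A third odd index serves as the completing index; this is one of the places where `n ≥ 3`
enters. -/
theorem pair_mem_spec (hn : 2 < n) (k l : Fin n) (i : Fin m) :
    vf (gen F (Sum.inr k) * gen F (Sum.inr l)) (Sum.inl i) ∈ spec F p n t := by
  obtain ⟨s, hs1, hs2⟩ := Fin.exists_ne_and_ne_of_two_lt k l hn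
  have h : ∀ k : Fin n, gen F (Sum.inr k) ∈ trunc F p n t := fun k =>
    tm_mem_trunc (fun _ => pow_pos (Fact.out : p.Prime).pos _) _
  refine vf_inl_mem_spec (trunc_mul (h k) (h l)) (by simp) ?_ (s := s) ?_
  · rw [pd_inl_theta_mul, pd_gen_ne (by simp), mul_zero]
  · rw [pd_inr_theta_mul_ne hs1, pd_gen_ne (by simpa using hs2), mul_zero, neg_zero]

theorem root_mem_spec (h2 : (2 : F) ≠ 0) {k l : Fin n} (hkl : k ≠ l) {f : DividedPow F m}
    (hf : f ∈ DividedPow.truncated F p t) :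
    vf (sc f * gen F (Sum.inr k)) (Sum.inr l) ∈ spec F p n t := by
  refine vf_inr_mem_spec h2 (trunc_mul (trunc_sc hf)
    (tm_mem_trunc (fun _ => pow_pos (Fact.out : p.Prime).pos _) _)) (by simp) ?_
  rw [pd_inr_sc_mul, pd_gen_ne (by simpa using hkl.symm), mul_zero]

omit [Fact p.Prime] [CharP F p] in
theorem lie_pd_inl_gen {z : Module.End F (SAlg F m n)} (hz : z ∈ evenField F m n) (j : Fin m)
    (r : Fin m ⊕ Fin n) : ⁅(pd (Sum.inl j) : Module.End F (SAlg F m n)), z⁆ (gen F r) = pd (Sum.inl j) (z (gen F r)) := by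
  rw [lie_apply_op, pd_gen]
  split_ifs
  · rw [evenField.apply_one hz, sub_zero]
  · rw [map_zero, sub_zero]

/-- The first three conditions force `z_k = c_k θ_k` with `c_k` constant. The last gives `c_k + c_l
= 0` for all `k ≠ l`, and three indices then yield `2 c_k = 0`. The lemma controls the odd
components of a field in three later arguments. -/
theorem theta_family_eq_zero (h2 : (2 : F) ≠ 0) (hn : 2 < n) {z : Fin n → SAlg F m n}
    (h0 : ∀ i k, pd (Sum.inl i) (z k) = 0) (h1 : ∀ k, num (Sum.inr k) (z k) = z k)
    (h3 : ∀ a k, a ≠ k → num (Sum.inr a) (z k) = 0)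
    (h4 : ∀ k l, k ≠ l → z k * gen F (Sum.inr l) + gen F (Sum.inr k) * z l = 0) (k : Fin n) :
    z k = 0 := by
  have hc : ∀ k, ∃ c : F, pd (Sum.inr k) (z k) = c • 1 := by
    intro k
    refine eq_smul_one fun r => ?_
    rcases r with i | a
    · rw [pd_inl_comm, h0, map_zero]
    · by_cases ha : a = k
      · subst ha; exact pd_inr_pd_inr _ _
      · rw [pd_inr_comm, ← pd_inr_num_self a, h3 a k ha, map_zero, map_zero, neg_zero]
  choose c hc using hc
  have hz : ∀ k, z k = c k • gen F (Sum.inr k) := by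
    intro k
    rw [← h1 k, num_apply, hc, mul_smul_comm, mul_one]
  have hs : ∀ k l, k ≠ l → c k + c l = 0 := by
    intro k l hkl
    have := h4 k l hkl
    rw [hz, hz l, smul_mul_assoc, mul_smul_comm, ← add_smul] at this
    have h5 := congrArg (fun f => aug (pd (Sum.inr l) (pd (Sum.inr k) f))) this
    simp only [map_smul, map_zero] at h5
    rw [pd_inr_theta_mul_self, pd_gen_ne (by simpa using hkl), mul_zero, sub_zero, pd_gen_self,
      ← sc_one, aug_sc] at h5
    have h6 : (1 : DividedPow F m) ≠ 0 := fun h => by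
      have := congrArg ((DividedPow.basis F m).coord 0) h
      rw [one_eq_monomial, coord_monomial] at this
      simp at this
    exact (smul_eq_zero.mp h5).resolve_right h6
  -- A second and a third odd index, so that the three pairwise relations can be combined.
  obtain ⟨l, hl, -⟩ := Fin.exists_ne_and_ne_of_two_lt k k hn
  obtain ⟨s, hs1, hs2⟩ := Fin.exists_ne_and_ne_of_two_lt k l hn
  have e1 := hs k l hl.symm
  have e2 := hs k s hs1.symm
  have e3 := hs l s hs2.symm
  have : (2 : F) * c k = 0 := by linear_combination e1 + e2 - e3
  rw [hz, (mul_eq_zero.mp this).resolve_left h2, zero_smul]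

/-- An even vector field which commutes with a few small elements of `𝒮` vanishes. -/
theorem eq_zero_of_commute (h2 : (2 : F) ≠ 0) (hm : 2 < m) (hn : 2 < n)
    {z : Module.End F (SAlg F m n)} (hz : z ∈ evenField F m n)
    (h1 : ∀ j, ⁅(pd (Sum.inl j) : Module.End F (SAlg F m n)), z⁆ = 0)
    (h3 : ∀ a b, a ≠ b → ⁅vf (gen F (Sum.inl a) : SAlg F m n) (Sum.inl b), z⁆ = 0)
    (h4 : ∀ i s, ⁅(num (Sum.inl i) + num (Sum.inr s) : Module.End F (SAlg F m n)), z⁆ = 0)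
    (h5 : ∀ k l i, k ≠ l → ⁅vf (gen F (Sum.inr k) * gen F (Sum.inr l) : SAlg F m n) (Sum.inl i), z⁆ = 0) :
    z = 0 := by
  -- Commuting with the translations makes all coefficients independent of the even variables. Each
  -- further bracket is then evaluated at a single well chosen generator.
  have c : ∀ j r, pd (Sum.inl j) (z (gen F r)) = 0 := fun j r => by
    rw [← lie_pd_inl_gen hz, h1, LinearMap.zero_apply]
  have i0 : Fin m := ⟨0, by omega⟩
  have e1 : ∀ a, z (gen F (Sum.inl a)) = 0 := by
    intro a
    obtain ⟨b, hb, -⟩ := Fin.exists_ne_and_ne_of_two_lt a a hm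
    have := LinearMap.congr_fun (h3 a b hb.symm) (gen F (Sum.inl b))
    rwa [lie_apply_op, vf_apply, c, mul_zero, vf_gen_self, zero_sub, LinearMap.zero_apply,
      neg_eq_zero] at this
  have e2 : ∀ k l, num (Sum.inr k) (z (gen F (Sum.inr l))) =
      if k = l then z (gen F (Sum.inr l)) else 0 := by
    intro k l
    have := LinearMap.congr_fun (h4 i0 k) (gen F (Sum.inr l))
    rw [lie_apply_op, LinearMap.add_apply, LinearMap.add_apply, num_apply (Sum.inl i0), c, mul_zero,
      zero_add, num_gen, num_gen, if_neg (by simp), zero_add, LinearMap.zero_apply] at this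
    rw [sub_eq_zero.mp this]
    by_cases h : k = l <;> simp [h]
  have e3 : ∀ k, z (gen F (Sum.inr k)) = 0 := by
    refine theta_family_eq_zero h2 hn (fun i k => c i _) (fun k => by simp [e2])
      (fun a k h => by simp [e2, h]) fun k l h => ?_
    have := LinearMap.congr_fun (h5 k l i0 h) (gen F (Sum.inl i0))
    rw [lie_apply_op, vf_apply, c, mul_zero, vf_gen_self, zero_sub, LinearMap.zero_apply,
      neg_eq_zero, evenField.leibniz h2 hz] at this
    exact this
  refine evenField.ext hz (zero_mem _) fun r => ?_
  rcases r with i | k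
  · simp [e1]
  · simp [e3]

end Elements

/-! ### Cocycles of `𝒮`: removing the values on translations and on one toral element. -/

section Cocycles

variable {F : Type*} [Field F] {m n : ℕ} {p : ℕ} {t : Fin m → ℕ}

/-- The commutator with `Q`, as a linear map. -/
noncomputable def adl (Q : Module.End F (SAlg F m n)) :
    Module.End F (Module.End F (SAlg F m n)) := LinearMap.mulLeft F Q - LinearMap.mulRight F Q

theorem adl_apply (Q X : Module.End F (SAlg F m n)) : adl Q X = ⁅Q, X⁆ := rfl

theorem commutator_smul {V : Type*} [AddCommGroup V] [Module F V] (c : F)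
    (X Y : Module.End F V) : ⁅X, c • Y⁆ = c • ⁅X, Y⁆ := by
  rw [Ring.lie_def, Ring.lie_def, mul_smul_comm, smul_mul_assoc, smul_sub]

theorem adl_pow_succ (H X : Module.End F (SAlg F m n)) (k : ℕ) :
    (adl H ^ (k + 1)) X = ⁅H, (adl H ^ k) X⁆ := by
  rw [pow_succ', Module.End.mul_apply, adl_apply]

theorem adl_add (Q R : Module.End F (SAlg F m n)) : adl (Q + R) = adl Q + adl R :=
  LinearMap.ext fun X => add_lie Q R X

/-- Linear maps which restrict to derivations of `𝒮` with values in the even vector fields. -/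
structure IsCocycle (p : ℕ) (t : Fin m → ℕ)
    (δ : Module.End F (Module.End F (SAlg F m n))) : Prop where
  lie : ∀ {X Y}, X ∈ spec F p n t → Y ∈ spec F p n t → δ ⁅X, Y⁆ = ⁅δ X, Y⁆ + ⁅X, δ Y⁆
  mem : ∀ {X}, X ∈ spec F p n t → δ X ∈ evenField F m n

theorem IsCocycle.add_adl {δ : Module.End F (Module.End F (SAlg F m n))} (hδ : IsCocycle p t δ)
    {Q : Module.End F (SAlg F m n)}
    (hQ : ∀ {X}, X ∈ spec F p n t → ⁅Q, X⁆ ∈ evenField F m n) : IsCocycle p t (δ + adl Q) where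
  lie {X Y} hX hY := by
    simp only [LinearMap.add_apply, adl_apply, hδ.lie hX hY, leibniz_lie Q X Y, add_lie, lie_add]
    abel
  mem {X} hX := add_mem (hδ.mem hX) (hQ hX)

theorem IsCocycle.add_adl_evenField (h2 : (2 : F) ≠ 0)
    {δ : Module.End F (Module.End F (SAlg F m n))} (hδ : IsCocycle p t δ)
    {Q : Module.End F (SAlg F m n)} (hQ : Q ∈ evenField F m n) : IsCocycle p t (δ + adl Q) :=
  hδ.add_adl fun hX => evenField.lie_mem h2 hQ (spec_le hX)

variable [Fact p.Prime] [CharP F p]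

omit [Fact p.Prime] [CharP F p] in
theorem lie_pd_inl_pd_inl (i j : Fin m) :
    ⁅(pd (Sum.inl i) : Module.End F (SAlg F m n)), (pd (Sum.inl j) : Module.End F (SAlg F m n))⁆ = 0 :=
  LinearMap.ext fun f => by
    rw [lie_apply_op, pd_inl_comm, sub_self, LinearMap.zero_apply]

/-- Since the `D_j` commute, the cocycle identity says that for each generator `x_r` the elements
`δ(D_j)(x_r)` satisfy the integrability condition. Their primitives are the coefficients of the
correcting field; they exist because `W` is not truncated. -/
theorem IsCocycle.exists_kill_pd (h2 : (2 : F) ≠ 0) (hn : 2 < n)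
    {δ : Module.End F (Module.End F (SAlg F m n))} (hδ : IsCocycle p t δ) :
    ∃ u ∈ evenField F m n, ∀ j, (δ + adl u) (pd (Sum.inl j)) = 0 := by
  have hs := fun j => pd_inl_mem_spec (F := F) (p := p) (t := t) hn j
  have hc : ∀ r i j, pd (Sum.inl i) (δ (pd (Sum.inl j)) (gen F r)) =
      pd (Sum.inl j) (δ (pd (Sum.inl i)) (gen F r)) := by
    intro r i j
    have h := hδ.lie (hs i) (hs j)
    rw [lie_pd_inl_pd_inl, map_zero, ← lie_skew (δ _) (pd (Sum.inl j)), neg_add_eq_sub,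
      eq_comm, sub_eq_zero] at h
    rw [← lie_pd_inl_gen (hδ.mem (hs j)), h, lie_pd_inl_gen (hδ.mem (hs i))]
  choose u hu using fun r : Fin m ⊕ Fin n =>
    exists_primitive (fun j => δ (pd (Sum.inl j)) (gen F r)) (hc r)
  -- The primitives need not have the right parity. Their averages do, and have the same derivatives
  -- because each `δ(D_j)` is even.
  let v : Fin m ⊕ Fin n → SAlg F m n :=
    fun r => (2 : F)⁻¹ • (u r + (-1 : F) ^ tau r • par (u r))
  have hv : ∀ r, par (v r) = (-1 : F) ^ tau r • v r := by
    intro r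
    simp only [v, map_smul, map_add, par_par]
    rw [smul_comm ((-1 : F) ^ tau r), smul_add ((-1 : F) ^ tau r), smul_smul ((-1 : F) ^ tau r), ← mul_pow]
    simp [add_comm]
  have hV := mem_evenField_sum hv
  refine ⟨_, hV, fun j => ?_⟩
  refine evenField.ext (add_mem (hδ.mem (hs j))
    (evenField.lie_mem h2 hV (pd_inl_mem_evenField j))) (zero_mem _) fun r => ?_
  have hp : par (pd (Sum.inl j) (u r)) = pd (Sum.inl j) (par (u r)) := by
    simpa [tau] using par_pd (Sum.inl j) (u r)
  have e1 : pd (Sum.inl j) (v r) = δ (pd (Sum.inl j)) (gen F r) := by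
    simp only [v, map_smul, map_add, ← hp, hu, evenField.par_gen (hδ.mem (hs j)), smul_smul]
    rw [← mul_pow, neg_one_mul, neg_neg, one_pow, one_smul, ← two_smul F, smul_smul,
      inv_mul_cancel₀ h2, one_smul]
  rw [LinearMap.add_apply, LinearMap.add_apply, adl_apply, ← lie_skew, LinearMap.neg_apply,
    lie_pd_inl_gen hV, sum_vf_gen, e1, add_neg_cancel, LinearMap.zero_apply]

theorem nontrivial_SAlg : Nontrivial (SAlg F m n) := by
  refine ⟨⟨sc (monomial F 0), 0, fun h => ?_⟩⟩
  rw [← sc_zero] at h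
  have := congrArg ((DividedPow.basis F m).coord 0) (sc_injective h)
  rw [coord_monomial] at this
  simp at this

omit [Fact p.Prime] in
theorem charP_end (V : Type*) [AddCommGroup V] [Module F V] [Nontrivial V] :
    CharP (Module.End F V) p :=
  charP_of_injective_algebraMap (algebraMap F (Module.End F V)).injective p

/-- Left and right multiplication by `H` commute, so in characteristic `p` the power of their
difference is the difference of their powers. -/
theorem adl_pow_char (H : Module.End F (SAlg F m n)) : adl H ^ p = adl (H ^ p) := by
  have := nontrivial_SAlg (F := F) (m := m) (n := n)
  have := charP_end (F := F) (p := p) (Module.End F (SAlg F m n))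
  have hc : Commute (LinearMap.mulLeft F H) (LinearMap.mulRight F H) :=
    LinearMap.ext fun X => (mul_assoc H X H).symm
  rw [adl, sub_pow_char_of_commute _ hc, LinearMap.pow_mulLeft, LinearMap.pow_mulRight, adl]

theorem adl_pow_char_pow (H : Module.End F (SAlg F m n)) (s : ℕ) :
    adl H ^ p ^ s = adl (H ^ p ^ s) := by
  induction s with
  | zero => simp
  | succ s ih => rw [pow_succ, pow_mul, ih, adl_pow_char, ← pow_mul]

/-- On monomials the even number operator has eigenvalues in the prime field; the odd one is
idempotent. -/
theorem num_pow_char (r : Fin m ⊕ Fin n) :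
    (num r : Module.End F (SAlg F m n)) ^ p = num r := by
  have hp : p ≠ 0 := (Fact.out : p.Prime).ne_zero
  rcases r with i | k
  · have h : ∀ (q : ℕ) (α : Fin m → ℕ) (ω : Ext F n),
        ((num (Sum.inl i) : Module.End F (SAlg F m n)) ^ q) (tm (monomial F α) ω) =
          (α i : F) ^ q • tm (monomial F α) ω := by
      intro q α ω
      induction q with
      | zero => simp
      | succ q ih => rw [pow_succ', Module.End.mul_apply, ih, map_smul, num_inl_tm, smul_smul,
          pow_succ]
    refine LinearMap.ext fun f => ?_
    induction f using tm_monomial_induction with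
    | h0 => simp
    | ha x y hx hy => rw [map_add, map_add, hx, hy]
    | ht α ω =>
      rw [h, num_inl_tm]
      congr 1
      exact map_natCast (frobenius F p) (α i)
  · have h : IsIdempotentElem (num (Sum.inr k) : Module.End F (SAlg F m n)) :=
      LinearMap.ext fun f => num_num_inr k f
    exact h.pow_eq hp

theorem num_inl_num_inr (i : Fin m) (k : Fin n) (f : SAlg F m n) :
    num (Sum.inl i) (num (Sum.inr k) f) = num (Sum.inr k) (num (Sum.inl i) f) := by
  induction f using tm_monomial_induction with
  | h0 => simp
  | ha x y hx hy => simp only [map_add, hx, hy]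
  | ht α ω =>
    rw [num_inl_tm, map_smul, num_apply (Sum.inr k), pd_inr_tm, gen, tm_mul, one_mul, num_inl_tm]

theorem num_inl_num_inl (i j : Fin m) (f : SAlg F m n) :
    num (Sum.inl i) (num (Sum.inl j) f) = num (Sum.inl j) (num (Sum.inl i) f) := by
  induction f using tm_monomial_induction with
  | h0 => simp
  | ha x y hx hy => simp only [map_add, hx, hy]
  | ht α ω => rw [num_inl_tm, num_inl_tm, map_smul, num_inl_tm, map_smul, num_inl_tm, smul_comm]

theorem num_commute (r s : Fin m ⊕ Fin n) :
    ⁅(num r : Module.End F (SAlg F m n)), (num s : Module.End F (SAlg F m n))⁆ = 0 := by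
  refine LinearMap.ext fun f => ?_
  rw [lie_apply_op, LinearMap.zero_apply, sub_eq_zero]
  rcases r with i | k <;> rcases s with j | l
  · exact num_inl_num_inl i j f
  · exact num_inl_num_inr i l f
  · exact (num_inl_num_inr j k f).symm
  · exact num_inr_comm k l f

theorem torus_pow_char (i : Fin m) (s : Fin n) :
    (num (Sum.inl i) + num (Sum.inr s) : Module.End F (SAlg F m n)) ^ p =
      num (Sum.inl i) + num (Sum.inr s) := by
  have := nontrivial_SAlg (F := F) (m := m) (n := n)
  have := charP_end (F := F) (p := p) (SAlg F m n)
  have hc : Commute (num (Sum.inl i) : Module.End F (SAlg F m n)) (num (Sum.inr s)) :=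
    LinearMap.ext fun f => num_inl_num_inr i s f
  rw [add_pow_char_of_commute _ hc, num_pow_char, num_pow_char]

/-- With `T = ad H` one has `T^p = T`, so the correction by `T^(p-2)(δ H)` leaves a value at `H`
commuting with `H`. Comparing the cocycle on `T^p Y` and on `T Y` shows that this value centralizes
`𝒮`, hence vanishes. The second conclusion protects normalizations already achieved on weight
vectors of `H`. -/
theorem IsCocycle.exists_kill_toral (h2 : (2 : F) ≠ 0) (hm : 2 < m) (hn : 2 < n)
    (ht : ∀ i, 0 < t i)
    {δ : Module.End F (Module.End F (SAlg F m n))} (hδ : IsCocycle p t δ)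
    {H : Module.End F (SAlg F m n)} (hH : H ∈ spec F p n t) (hp : H ^ p = H) :
    ∃ w ∈ evenField F m n, (δ + adl w) H = 0 ∧
      ∀ X ∈ spec F p n t, δ X = 0 → (∃ c : F, ⁅X, H⁆ = c • X) → (δ + adl w) X = 0 := by
  -- The correction is `(ad H)^(p-2)` applied to `δ H`; writing `p = q + 2` avoids natural
  -- subtraction.
  obtain ⟨q, rfl⟩ : ∃ q, p = q + 2 := ⟨p - 2, by have := (Fact.out : p.Prime).two_le; omega⟩
  have hA : adl H ^ (q + 2) = adl H := by rw [adl_pow_char, hp]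
  have hzm := hδ.mem hH
  have hEF : ∀ (k : ℕ) (v), v ∈ evenField F m n → (adl H ^ k) v ∈ evenField F m n := by
    intro k v hv
    induction k with
    | zero => simpa
    | succ k ih =>
      rw [adl_pow_succ]
      exact evenField.lie_mem h2 (spec_le hH) ih
  have hS : ∀ (k : ℕ) (v), v ∈ spec F (q + 2) n t → (adl H ^ k) v ∈ spec F (q + 2) n t := by
    intro k v hv
    induction k with
    | zero => simpa
    | succ k ih =>
      rw [adl_pow_succ]
      exact spec_lie h2 hH ih
  have hw := hEF q _ hzm
  have hδ' := hδ.add_adl_evenField h2 hw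
  refine ⟨_, hw, ?_, fun X hX h0 ⟨c, hc⟩ => ?_⟩
  · set δ' := δ + adl ((adl H ^ q) (δ H)) with hd
    have e0 : δ' H = δ H - (adl H ^ (q + 1)) (δ H) := by
      rw [hd, LinearMap.add_apply, adl_apply, ← lie_skew, ← adl_pow_succ, sub_eq_add_neg]
    have hz0 : ⁅H, δ' H⁆ = 0 := by
      rw [e0, lie_sub, ← adl_pow_succ, hA, adl_apply, sub_self]
    have hk : ∀ (k : ℕ) (Y), (adl H ^ k) ⁅δ' H, Y⁆ = ⁅δ' H, (adl H ^ k) Y⁆ := by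
      intro k Y
      induction k with
      | zero => simp
      | succ k ih =>
        rw [adl_pow_succ, adl_pow_succ, ih, leibniz_lie, hz0, zero_lie, zero_add]
    -- The commutator of the corrected cocycle with `T` is the bracket with its value at `H`, which
    -- commutes with `T`; so the commutator with `T^(k+1)` acquires the factor `k + 1`.
    have key : ∀ Y ∈ spec F (q + 2) n t, ∀ k : ℕ, δ' ((adl H ^ (k + 1)) Y) =
        ((k + 1 : ℕ) : F) • (adl H ^ k) ⁅δ' H, Y⁆ + (adl H ^ (k + 1)) (δ' Y) := by
      intro Y hY k
      induction k with
      | zero => simp [adl_apply, hδ'.lie hH hY]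
      | succ k ih =>
        rw [adl_pow_succ, hδ'.lie hH (hS _ _ hY), ih, lie_add, commutator_smul, ← hk,
          ← adl_pow_succ, ← adl_pow_succ, ← add_assoc]
        congr 1
        push_cast
        module
    have hcomm : ∀ Y ∈ spec F (q + 2) n t, ⁅Y, δ' H⁆ = 0 := by
      intro Y hY
      -- Here the factor is `p = 0`, and `T^p = T` on both sides.
      have h1 := key Y hY (q + 1)
      rw [hA, CharP.cast_eq_zero, zero_smul, zero_add, adl_apply, hδ'.lie hH hY] at h1
      rw [← lie_skew, neg_eq_zero]
      exact add_eq_right.mp h1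
    refine eq_zero_of_commute h2 hm hn (hδ'.mem hH) (fun j => hcomm _ (pd_inl_mem_spec hn j))
      (fun a b h => hcomm _ (lower_mem_spec hn ht h)) (fun i s => hcomm _ (torus_mem_spec ht i s))
      (fun k l i _ => hcomm _ (pair_mem_spec hn k l i))
  -- As `X` is a weight vector with `δ X = 0`, the cocycle identity for `[X, H]` makes `X` commute
  -- with `δ H`, and then with all `(ad H)^k (δ H)`.
  · have h1 : ⁅X, δ H⁆ = 0 := by
      have := hδ.lie hX hH
      rw [hc, map_smul, h0, smul_zero, zero_lie, zero_add] at this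
      exact this.symm
    have h3 : ∀ k : ℕ, ⁅X, (adl H ^ k) (δ H)⁆ = 0 := by
      intro k
      induction k with
      | zero => simpa
      | succ k ih =>
        rw [adl_pow_succ, leibniz_lie, ih, lie_zero, add_zero, hc,
          smul_commutator, ih, smul_zero]
    rw [LinearMap.add_apply, h0, zero_add, adl_apply, ← lie_skew, h3, neg_zero]

end Cocycles

/-! ### Derivations of the truncated divided power algebra that commute with the `D_i`. -/

section Derivations

variable {F : Type*} [Field F] {m : ℕ} {p : ℕ} {t : Fin m → ℕ}

theorem eq_smul_one_of_partialDeriv {a : DividedPow F m}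
    (h : ∀ i, DividedPow.partialDeriv F i a = 0) : ∃ c : F, a = c • 1 := by
  obtain ⟨c, hc⟩ := eq_smul_one (n := 0) (f := (sc a : SAlg F m 0)) (by
    rintro (i | k)
    · rw [pd_inl_sc, h, sc_zero]
    · exact pd_inr_sc k a)
  rw [← sc_one, ← sc_smul] at hc
  exact ⟨c, sc_injective hc⟩

theorem coord_zero_smul_one (c : F) :
    (DividedPow.basis F m).coord 0 (c • (1 : DividedPow F m)) = c := by
  rw [map_smul, one_eq_monomial, coord_monomial, if_pos rfl, smul_eq_mul, mul_one]

/-- If `p` divides all the inner binomial coefficients of `a`, then `a` is a power of `p`. Thus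
`x_i^(a)` is decomposable in the divided power algebra unless `a` is such a power. -/
theorem exists_not_dvd_choose {p : ℕ} [Fact p.Prime] {a : ℕ} (h0 : 0 < a)
    (h : ∀ s, a ≠ p ^ s) : ∃ b, 0 < b ∧ b < a ∧ ¬ p ∣ a.choose b := by
  by_contra! hc
  refine h _ (Choose.eq_pow_multiplicity_of_choose_modEq_zero_nat (p := p) h0 fun i hi => ?_)
  rw [Finset.mem_Icc] at hi
  exact (Nat.modEq_zero_iff_dvd).mpr (hc i (by omega) (by omega))

/-- A derivation of the truncated divided power algebra which commutes with all `D_i` is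
determined by the constant terms of the images of the `x_i^(p^s)`. -/
theorem truncated_derivation_eq_zero [Fact p.Prime] [CharP F p]
    {ψ : DividedPow F m →ₗ[F] DividedPow F m}
    (hD : ∀ j, ∀ f ∈ DividedPow.truncated F p t,
      ψ (DividedPow.partialDeriv F j f) = DividedPow.partialDeriv F j (ψ f))
    (hmul : ∀ f ∈ DividedPow.truncated F p t, ∀ g ∈ DividedPow.truncated F p t,
      ψ (f * g) = ψ f * g + f * ψ g)
    (hx : ∀ i s, s < t i →
      (DividedPow.basis F m).coord 0 (ψ (monomial F (Pi.single i (p ^ s)))) = 0)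
    {f : DividedPow F m} (hf : f ∈ DividedPow.truncated F p t) : ψ f = 0 := by
  have key : ∀ (N : ℕ) (α : Fin m → ℕ), (∀ i, α i < p ^ t i) → ∑ i, α i = N →
      ψ (monomial F α) = 0 := by
    intro N
    induction N using Nat.strong_induction_on with
    | _ N ih =>
    intro α hα hN
    -- By induction on the degree all derivatives of the value vanish, so the value is a constant.
    obtain ⟨c, hc⟩ := eq_smul_one_of_partialDeriv (a := ψ (monomial F α)) fun j => by
      rw [← hD j _ (monomial_mem_truncated hα), DividedPow.partialDeriv_monomial]
      split_ifs with hj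
      · exact map_zero _
      · refine ih _ ?_ (α - e j) (fun i => (Nat.sub_le _ _).trans_lt (hα i)) rfl
        rw [← hN]
        refine Finset.sum_lt_sum (fun i _ => Nat.sub_le _ _) ⟨j, Finset.mem_univ j, ?_⟩
        rw [Pi.sub_apply, SpecialSuper.DividedPow.e_same]
        omega
    suffices h : c = 0 by rw [hc, h, zero_smul]
    -- If `x^(α)` is, up to a nonzero binomial factor, a product of monomials of smaller degree, the
    -- Leibniz rule and induction kill the constant.
    have split : ∀ β γ : Fin m → ℕ, β + γ = α → ∑ i, β i ≠ 0 → ∑ i, γ i ≠ 0 →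
        ((∏ i, (β i + γ i).choose (β i) : ℕ) : F) ≠ 0 → c = 0 := by
      intro β γ h hb hg h0
      have hs : ∑ i, β i + ∑ i, γ i = N := by
        rw [← hN, ← h, ← Finset.sum_add_distrib]; rfl
      have hβ : ∀ i, β i < p ^ t i := fun i =>
        lt_of_le_of_lt (by rw [← h]; exact Nat.le_add_right _ _) (hα i)
      have hγ : ∀ i, γ i < p ^ t i := fun i =>
        lt_of_le_of_lt (by rw [← h]; exact Nat.le_add_left _ _) (hα i)
      have h1 := hmul _ (monomial_mem_truncated hβ) _ (monomial_mem_truncated hγ)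
      rw [ih _ (by omega) β hβ rfl, ih _ (by omega) γ hγ rfl, zero_mul, mul_zero, add_zero,
        DividedPow.monomial_mul, h, map_smul, hc, smul_smul] at h1
      have h2 := congrArg ((DividedPow.basis F m).coord 0) h1
      rw [coord_zero_smul_one, map_zero] at h2
      exact (mul_eq_zero.mp h2).resolve_left h0
    rcases Nat.eq_zero_or_pos N with rfl | hpos
    · have h0 : α = 0 := funext fun i => (Finset.sum_eq_zero_iff.mp hN) i (Finset.mem_univ i)
      have h1 := hmul 1 one_mem_truncated 1 one_mem_truncated
      rw [mul_one, mul_one, one_mul] at h1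
      have h2 : ψ (1 : DividedPow F m) = 0 := add_eq_left.mp h1.symm
      rw [h0, ← one_eq_monomial, h2] at hc
      rw [← coord_zero_smul_one (m := m) c, ← hc, map_zero]
    obtain ⟨i, -, hi⟩ := Finset.exists_ne_zero_of_sum_ne_zero (s := Finset.univ) (f := α)
      (by omega)
    have hle : Pi.single i (α i) ≤ α := by
      intro j
      by_cases hj : j = i
      · subst hj; simp
      · simp [hj]
    -- A monomial in at least two variables splits with coefficient `1`. A pure power splits unless
    -- its exponent is a power of `p`, which is the case covered by the hypothesis on constant
    -- terms.
    by_cases hg : α = Pi.single i (α i)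
    · by_cases hps : ∃ s, α i = p ^ s
      · obtain ⟨s, hs⟩ := hps
        have hst : s < t i :=
          (Nat.pow_lt_pow_iff_right (Fact.out : p.Prime).one_lt).mp (hs ▸ hα i)
        have h1 := hx i s hst
        rwa [← hs, ← hg, hc, coord_zero_smul_one] at h1
      · obtain ⟨b, hb0, hba, hb⟩ := exists_not_dvd_choose (p := p) (Nat.pos_of_ne_zero hi)
          (not_exists.mp hps)
        refine split (Pi.single i b) (Pi.single i (α i - b)) ?_ ?_ ?_ ?_
        · rw [← Pi.single_add, Nat.add_sub_cancel' hba.le, ← hg]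
        · rw [Finset.sum_pi_single']; simpa using hb0.ne'
        · rw [Finset.sum_pi_single']; simp; omega
        · rw [Finset.prod_eq_single i, Pi.single_eq_same, Pi.single_eq_same,
            Nat.add_sub_cancel' hba.le]
          · rwa [Ne, CharP.cast_eq_zero_iff F p]
          · intro j _ hj; simp [hj]
          · simp
    · refine split (Pi.single i (α i)) (α - Pi.single i (α i)) (add_tsub_cancel_of_le hle) ?_ ?_ ?_
      · rw [Finset.sum_pi_single']; simpa using hi
      · intro h0
        refine hg (le_antisymm (fun j => ?_) hle)
        have := (Finset.sum_eq_zero_iff.mp h0) j (Finset.mem_univ j)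
        rw [Pi.sub_apply] at this
        exact Nat.sub_eq_zero_iff_le.mp this
      · rw [Finset.prod_eq_one, Nat.cast_one]
        · exact one_ne_zero
        intro j _
        by_cases hj : j = i
        · subst hj; simp
        · simp [hj]
  induction hf using Submodule.span_induction with
  | mem x h => obtain ⟨α, hα, rfl⟩ := h; exact key _ α hα rfl
  | zero => exact map_zero _
  | add x y _ _ hx hy => rw [map_add, hx, hy, add_zero]
  | smul c x _ hx => rw [map_smul, hx, smul_zero]

end Derivations

/-! ### Brackets of vector fields and eigenvalues of odd number operators. -/

section Brackets

variable {F : Type*} [Field F] {m n : ℕ} {p : ℕ} {t : Fin m → ℕ}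

theorem lie_vf_vf (h2 : (2 : F) ≠ 0) {f : SAlg F m n} {r : Fin m ⊕ Fin n}
    (hf : par f = (-1 : F) ^ tau r • f) (g : SAlg F m n) (s : Fin m ⊕ Fin n) :
    ⁅vf f r, vf g s⁆ = vf (f * pd r g) s - vf (g * pd s f) r := by
  rw [evenField.lie_vf h2 (vf_mem_evenField hf), vf_apply, Finset.sum_eq_single r, vf_gen_self]
  · intro a _ ha
    rw [vf_gen_ne _ ha.symm, map_zero, mul_zero, vf_zero]
  · simp

theorem lie_inl_vf (h2 : (2 : F) ≠ 0) {f : SAlg F m n} {i : Fin m} (hf : par f = f)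
    (g : SAlg F m n) (s : Fin m ⊕ Fin n) :
    ⁅vf f (Sum.inl i), vf g s⁆ = vf (f * pd (Sum.inl i) g) s - vf (g * pd s f) (Sum.inl i) :=
  lie_vf_vf h2 (by simpa [tau] using hf) g s

theorem lie_inr_vf (h2 : (2 : F) ≠ 0) {f : SAlg F m n} {k : Fin n} (hf : par f = -f)
    (g : SAlg F m n) (s : Fin m ⊕ Fin n) :
    ⁅vf f (Sum.inr k), vf g s⁆ = vf (f * pd (Sum.inr k) g) s - vf (g * pd s f) (Sum.inr k) :=
  lie_vf_vf h2 (by simpa [tau] using hf) g s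

theorem lie_pd_inl_vf (j : Fin m) (g : SAlg F m n) (s : Fin m ⊕ Fin n) :
    ⁅(pd (Sum.inl j) : Module.End F (SAlg F m n)), vf g s⁆ = vf (pd (Sum.inl j) g) s :=
  LinearMap.ext fun φ => by
    rw [lie_apply_op, vf_apply, vf_apply, vf_apply, pd_inl_mul, pd_inl_comm, add_sub_cancel_right]

theorem lie_num_vf (h2 : (2 : F) ≠ 0) (r : Fin m ⊕ Fin n) (g : SAlg F m n) (s : Fin m ⊕ Fin n) :
    ⁅(num r : Module.End F (SAlg F m n)), vf g s⁆ =
      vf (num r g) s - if r = s then vf g s else 0 := by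
  have h : (num r : Module.End F (SAlg F m n)) = vf (gen F r) r :=
    LinearMap.ext fun φ => by rw [num_apply, vf_apply]
  rw [h, lie_vf_vf h2 (par_gen r), ← num_apply, ← h, pd_gen]
  by_cases hs : r = s
  · subst hs; simp
  · rw [if_neg (Ne.symm hs), if_neg hs, mul_zero, vf_zero]

theorem lie_pd_inl_num (j : Fin m) (r : Fin m ⊕ Fin n) :
    ⁅(pd (Sum.inl j) : Module.End F (SAlg F m n)), (num r : Module.End F (SAlg F m n))⁆ =
      if Sum.inl j = r then pd (Sum.inl j) else 0 := by
  have h : (num r : Module.End F (SAlg F m n)) = vf (gen F r) r :=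
    LinearMap.ext fun φ => by rw [num_apply, vf_apply]
  rw [h, lie_pd_inl_vf, pd_gen]
  split_ifs with hr
  · rw [hr, vf_one]
  · exact vf_zero _

/-- The two odd number operators are commuting idempotents, so their difference has only the
eigenvalues `0`, `1` and `-1`. -/
theorem num_sub_eigen {c : F} (h0 : c ≠ 0) (h1 : c ≠ 1) (h2 : c ≠ -1) {k l : Fin n}
    {v : SAlg F m n} (h : num (Sum.inr k) v - num (Sum.inr l) v = c • v) : v = 0 := by
  have e1 := congrArg (num (Sum.inr k)) h
  have e2 := congrArg (num (Sum.inr l)) h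
  rw [map_sub, num_num_inr, map_smul] at e1 e2
  rw [num_inr_comm l k] at e2
  set a := num (Sum.inr k) v with ha
  set b := num (Sum.inr l) v with hb
  set d := num (Sum.inr k) b with hd
  have hda : num (Sum.inr l) a = d := by rw [ha, hd, hb, num_inr_comm]
  have hdd : num (Sum.inr l) d = d := by rw [← hda, num_num_inr]
  have e3 := congrArg (num (Sum.inr l)) e1
  rw [map_sub, map_smul, hda, hdd, sub_self, eq_comm, smul_eq_zero] at e3
  have hz := e3.resolve_left h0
  rw [hz] at e1 e2
  have ea : (c - 1) • a = 0 := by rw [sub_smul, one_smul, ← e1, sub_zero, sub_self]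
  have eb : (c + 1) • b = 0 := by rw [add_smul, one_smul, ← e2, zero_sub, neg_add_cancel]
  have ea' := (smul_eq_zero.mp ea).resolve_left (sub_ne_zero.mpr h1)
  have eb' := (smul_eq_zero.mp eb).resolve_left (fun h => h2 (eq_neg_of_add_eq_zero_left h))
  rw [ea', eb', sub_zero, eq_comm, smul_eq_zero] at h
  exact h.resolve_left h0

/-- For commuting idempotents the eigenvalue `1` of the difference occurs only as `1 - 0`. -/
theorem num_eq_of_sub_eq (h2 : (2 : F) ≠ 0) {k l : Fin n} {v : SAlg F m n}
    (h : num (Sum.inr k) v - num (Sum.inr l) v = v) :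
    num (Sum.inr k) v = v ∧ num (Sum.inr l) v = 0 := by
  have e1 := congrArg (num (Sum.inr k)) h
  have e2 := congrArg (num (Sum.inr l)) h
  rw [map_sub, num_num_inr, sub_eq_self] at e1
  rw [map_sub, num_num_inr, num_inr_comm, e1, zero_sub] at e2
  have e3 : (2 : F) • num (Sum.inr l) v = 0 := by
    rw [two_smul]; nth_rw 1 [← e2]; exact neg_add_cancel _
  have e4 := (smul_eq_zero.mp e3).resolve_left h2
  exact ⟨by rwa [e4, sub_zero] at h, e4⟩

end Brackets

/-! ### Cocycles that respect the weights of the torus. -/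

section Graded

variable {F : Type*} [Field F] {m n : ℕ} {p : ℕ} {t : Fin m → ℕ}

/-- Cocycles which vanish on the translations and on the toral elements. -/
structure IsGraded (p : ℕ) (t : Fin m → ℕ)
    (δ : Module.End F (Module.End F (SAlg F m n))) : Prop extends IsCocycle p t δ where
  pd_eq : ∀ j, δ (pd (Sum.inl j)) = 0
  torus_eq : ∀ i s, δ (num (Sum.inl i) + num (Sum.inr s)) = 0

theorem lie_pd_inl_torus (j i : Fin m) (s : Fin n) :
    ⁅(pd (Sum.inl j) : Module.End F (SAlg F m n)),
      (num (Sum.inl i) + num (Sum.inr s) : Module.End F (SAlg F m n))⁆ =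
      (if j = i then (1 : F) else 0) • pd (Sum.inl j) := by
  rw [lie_add, lie_pd_inl_num, lie_pd_inl_num]
  by_cases h : j = i <;> simp [h]

theorem lie_torus_torus (j i : Fin m) (s' s : Fin n) :
    ⁅(num (Sum.inl j) + num (Sum.inr s') : Module.End F (SAlg F m n)),
      (num (Sum.inl i) + num (Sum.inr s) : Module.End F (SAlg F m n))⁆ = 0 := by
  simp only [lie_add, add_lie, num_commute, add_zero]

variable [Fact p.Prime] [CharP F p]

/-- The toral elements are treated one at a time. Translations and the other toral elements are
weight vectors for each of them, so what has been removed stays removed. -/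
theorem IsCocycle.exists_isGraded (h2 : (2 : F) ≠ 0) (hm : 2 < m) (hn : 2 < n)
    (ht : ∀ i, 0 < t i)
    {δ : Module.End F (Module.End F (SAlg F m n))} (hδ : IsCocycle p t δ) :
    ∃ u ∈ evenField F m n, IsGraded p t (δ + adl u) := by
  have key : ∀ S : Finset (Fin m × Fin n), ∃ u ∈ evenField F m n,
      (∀ j, (δ + adl u) (pd (Sum.inl j)) = 0) ∧
      ∀ x ∈ S, (δ + adl u) (num (Sum.inl x.1) + num (Sum.inr x.2)) = 0 := by
    intro S
    induction S using Finset.induction_on with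
    | empty =>
      obtain ⟨u, hu, h⟩ := hδ.exists_kill_pd h2 hn
      exact ⟨u, hu, h, by simp⟩
    | insert a S _ ih =>
      obtain ⟨u, hu, h, hS⟩ := ih
      obtain ⟨w, hw, hw1, hw2⟩ := (hδ.add_adl_evenField h2 hu).exists_kill_toral h2 hm hn ht
        (torus_mem_spec ht a.1 a.2) (torus_pow_char a.1 a.2)
      refine ⟨u + w, add_mem hu hw, fun j => ?_, fun x hx => ?_⟩
      · rw [adl_add, ← add_assoc]
        exact hw2 _ (pd_inl_mem_spec hn j) (h j) ⟨_, lie_pd_inl_torus j _ _⟩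
      · rw [adl_add, ← add_assoc]
        rcases Finset.mem_insert.mp hx with rfl | hx
        · exact hw1
        · exact hw2 _ (torus_mem_spec ht _ _) (hS x hx)
            ⟨0, by rw [lie_torus_torus, zero_smul]⟩
  obtain ⟨u, hu, h, hS⟩ := key Finset.univ
  exact ⟨u, hu, hδ.add_adl_evenField h2 hu, h, fun i s => hS (i, s) (Finset.mem_univ _)⟩

end Graded

/-! ### The outer derivations given by `p`-power iterates of the translations. -/

section Frobenius

variable {F : Type*} [Field F] {m n : ℕ} {p : ℕ} {t : Fin m → ℕ} [Fact p.Prime] [CharP F p]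

/-- In characteristic `p` the bracket with `D_j^(p^s)` is an iterated bracket with `D_j`; hence such
a power preserves every space that `ad D_j` preserves. -/
theorem lie_pd_pow (j : Fin m) (s : ℕ) (X : Module.End F (SAlg F m n)) :
    ⁅(pd (Sum.inl j) : Module.End F (SAlg F m n)) ^ p ^ s, X⁆ =
      (adl (pd (Sum.inl j)) ^ p ^ s) X := by
  rw [adl_pow_char_pow, adl_apply]

omit [Fact p.Prime] [CharP F p] in
theorem adl_pd_pow_mem {W : Submodule F (Module.End F (SAlg F m n))} (j : Fin m)
    (hW : ∀ X ∈ W, ⁅(pd (Sum.inl j) : Module.End F (SAlg F m n)), X⁆ ∈ W) (k : ℕ)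
    {X : Module.End F (SAlg F m n)} (hX : X ∈ W) : (adl (pd (Sum.inl j)) ^ k) X ∈ W := by
  induction k with
  | zero => simpa
  | succ k ih => rw [adl_pow_succ]; exact hW _ ih

omit [Fact p.Prime] [CharP F p] in
theorem adl_pd_pow_vf (j : Fin m) (k : ℕ) (g : SAlg F m n) (r : Fin m ⊕ Fin n) :
    (adl (pd (Sum.inl j)) ^ k) (vf g r) = vf ((pd (Sum.inl j) ^ k) g) r := by
  induction k with
  | zero => simp
  | succ k ih => rw [adl_pow_succ, ih, lie_pd_inl_vf, pow_succ', Module.End.mul_apply]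

omit [Fact p.Prime] [CharP F p] in
theorem adl_pow_eq_zero {Q X : Module.End F (SAlg F m n)} (h : ⁅Q, ⁅Q, X⁆⁆ = 0) {k : ℕ}
    (hk : 2 ≤ k) : (adl Q ^ k) X = 0 := by
  obtain ⟨k, rfl⟩ := Nat.exists_eq_add_of_le hk
  rw [add_comm, pow_add, Module.End.mul_apply, pow_two, Module.End.mul_apply, adl_apply, adl_apply,
    h, map_zero]

/-- The combination `∑ c_js D_j^(p^(s+1))` of iterated translations. -/
noncomputable def frob (p : ℕ) (t : Fin m → ℕ) (n : ℕ) (c : (Σ j, Fin (t j - 1)) → F) :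
    Module.End F (SAlg F m n) :=
  -- The shift `+ 1` leaves out `D_j` itself, which is inner: the exponents run over `p^s` with `0 <
  -- s < t_j`.
  ∑ x : Σ j, Fin (t j - 1), c x • (pd (Sum.inl x.1) : Module.End F (SAlg F m n)) ^ p ^ (x.2.1 + 1)

theorem lie_frob (c : (Σ j, Fin (t j - 1)) → F) (X : Module.End F (SAlg F m n)) :
    ⁅frob p t n c, X⁆ = ∑ x : Σ j, Fin (t j - 1), c x •
      (adl (pd (Sum.inl x.1)) ^ p ^ (x.2.1 + 1)) X := by
  rw [Ring.lie_def, frob, Finset.sum_mul, Finset.mul_sum, ← Finset.sum_sub_distrib]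
  refine Finset.sum_congr rfl fun x _ => ?_
  rw [smul_mul_assoc, mul_smul_comm, ← smul_sub, ← Ring.lie_def, lie_pd_pow]

theorem lie_frob_mem_spec (h2 : (2 : F) ≠ 0) (hn : 2 < n) (c : (Σ j, Fin (t j - 1)) → F)
    {X : Module.End F (SAlg F m n)} (hX : X ∈ spec F p n t) : ⁅frob p t n c, X⁆ ∈ spec F p n t := by
  rw [lie_frob]
  exact Submodule.sum_mem _ fun x _ => Submodule.smul_mem _ _
    (adl_pd_pow_mem _ (fun X hX => spec_lie h2 (pd_inl_mem_spec hn _) hX) _ hX)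

theorem two_le_pow (p : ℕ) [Fact p.Prime] (s : ℕ) : 2 ≤ p ^ (s + 1) :=
  (Fact.out : p.Prime).two_le.trans (Nat.le_self_pow (Nat.succ_ne_zero s) p)

/-- All exponents are at least `p ≥ 2`, so two vanishing brackets with each `D_j` suffice. This
applies to the translations, to the toral elements and to the small test elements of `𝒮`. -/
theorem lie_frob_eq_zero (c : (Σ j, Fin (t j - 1)) → F) {X : Module.End F (SAlg F m n)}
    (h : ∀ j, ⁅(pd (Sum.inl j) : Module.End F (SAlg F m n)),
      ⁅(pd (Sum.inl j) : Module.End F (SAlg F m n)), X⁆⁆ = 0) : ⁅frob p t n c, X⁆ = 0 := by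
  rw [lie_frob]
  exact Finset.sum_eq_zero fun x _ => by rw [adl_pow_eq_zero (h _) (two_le_pow p _), smul_zero]

/-- The truncated derivation `∑ c_js D_j^(p^(s+1))`. -/
noncomputable def frobDeriv (p : ℕ) (t : Fin m → ℕ) (c : (Σ j, Fin (t j - 1)) → F) :
    DividedPow F m →ₗ[F] DividedPow F m :=
  ∑ x : Σ j, Fin (t j - 1), c x •
    (DividedPow.partialDeriv F x.1 : Module.End F (DividedPow F m)) ^ p ^ (x.2.1 + 1)

omit [Fact p.Prime] [CharP F p] in
theorem pd_pow_sc_mul (j : Fin m) (k : ℕ) (a : DividedPow F m) {g : SAlg F m n}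
    (hg : pd (Sum.inl j) g = 0) :
    ((pd (Sum.inl j) : Module.End F (SAlg F m n)) ^ k) (sc a * g) =
      sc (((DividedPow.partialDeriv F j : Module.End F (DividedPow F m)) ^ k) a) * g := by
  induction k with
  | zero => simp
  | succ k ih =>
    rw [pow_succ', Module.End.mul_apply, ih, pd_inl_sc_mul, hg, mul_zero, add_zero, pow_succ',
      Module.End.mul_apply]

/-- The element `f θ_k D_l`. -/
noncomputable def root (f : DividedPow F m) (k l : Fin n) : Module.End F (SAlg F m n) :=
  vf (sc f * gen F (Sum.inr k)) (Sum.inr l)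

theorem lie_frob_root (c : (Σ j, Fin (t j - 1)) → F) (f : DividedPow F m) (k l : Fin n) :
    ⁅frob p t n c, root f k l⁆ = root (frobDeriv p t c f) k l := by
  have h : ∀ (s : Finset (Σ j, Fin (t j - 1))) (g : (Σ j, Fin (t j - 1)) → DividedPow F m),
      root (n := n) (∑ x ∈ s, g x) k l = ∑ x ∈ s, root (g x) k l := by
    intro s g
    induction s using Finset.cons_induction with
    | empty => simp [root]
    | cons a s ha ih =>
      rw [Finset.sum_cons, Finset.sum_cons, ← ih, root, root, root, sc_add, add_mul, vf_add]
  rw [lie_frob, frobDeriv, LinearMap.sum_apply, h]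
  refine Finset.sum_congr rfl fun x _ => ?_
  rw [root, adl_pd_pow_vf, pd_pow_sc_mul _ _ _ (pd_gen_ne (by simp)), LinearMap.smul_apply, root,
    sc_smul, smul_mul_assoc, vf_smul]

omit [Fact p.Prime] [CharP F p] in
theorem coord_zero_partialDeriv_pow (j : Fin m) (k : ℕ) (a : DividedPow F m) :
    (DividedPow.basis F m).coord 0
      (((DividedPow.partialDeriv F j : Module.End F (DividedPow F m)) ^ k) a) =
      (DividedPow.basis F m).coord (Pi.single j k) a := by
  have : ∀ β, (DividedPow.basis F m).coord β
      (((DividedPow.partialDeriv F j : Module.End F (DividedPow F m)) ^ k) a) =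
      (DividedPow.basis F m).coord (β + Pi.single j k) a := by
    induction k with
    | zero => simp
    | succ k ih =>
      intro β
      rw [pow_succ', Module.End.mul_apply, coord_partialDeriv, ih, add_assoc, e, ← Pi.single_add,
        add_comm 1 k]
  rw [this, zero_add]

omit [CharP F p] in
-- The constant term of `D_j^k f` is the coefficient of `x_j^(k)` in `f`, so the monomials
-- `x_j^(p^(s+1))` are dual to the operators in the sum.
theorem coord_zero_frobDeriv (c : (Σ j, Fin (t j - 1)) → F) (x : Σ j, Fin (t j - 1)) :
    (DividedPow.basis F m).coord 0
      (frobDeriv p t c (monomial F (Pi.single x.1 (p ^ (x.2.1 + 1))))) = c x := by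
  classical
  rw [frobDeriv, LinearMap.sum_apply, map_sum, Finset.sum_eq_single x]
  · rw [LinearMap.smul_apply, map_smul, coord_zero_partialDeriv_pow, coord_monomial, if_pos rfl,
      smul_eq_mul, mul_one]
  · intro y _ hy
    rw [LinearMap.smul_apply, map_smul, coord_zero_partialDeriv_pow, coord_monomial, if_neg,
      smul_zero]
    intro h
    apply hy
    have h1 := congrFun h x.1
    rw [Pi.single_eq_same] at h1
    have hp := (Fact.out : p.Prime)
    by_cases hxy : x.1 = y.1
    · obtain ⟨i, a⟩ := x
      obtain ⟨j, b⟩ := y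
      obtain rfl : i = j := hxy
      rw [Pi.single_eq_same] at h1
      have := Nat.pow_right_injective hp.two_le h1
      simp only [Nat.add_right_cancel_iff] at this
      rw [Fin.ext this]
    · rw [Pi.single_eq_of_ne hxy] at h1
      exact absurd h1 (pow_pos hp.pos _).ne'
  · simp

end Frobenius

/-! ### Cocycles on the root elements `f θ_k D_l`. -/

section Roots

variable {F : Type*} [Field F] {m n : ℕ} {p : ℕ} {t : Fin m → ℕ}
  {δ : Module.End F (Module.End F (SAlg F m n))}

theorem IsCocycle.lie_eq (hδ : IsCocycle p t δ) {X Y : Module.End F (SAlg F m n)}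
    (hX : X ∈ spec F p n t) (h : δ X = 0) (hY : Y ∈ spec F p n t) : δ ⁅X, Y⁆ = ⁅X, δ Y⁆ := by
  rw [hδ.lie hX hY, h, zero_lie, zero_add]

theorem IsCocycle.lie_eq_zero (hδ : IsCocycle p t δ) {X Y : Module.End F (SAlg F m n)}
    (hX : X ∈ spec F p n t) (h : δ X = 0) (hY : Y ∈ spec F p n t) (h' : δ Y = 0) :
    δ ⁅X, Y⁆ = 0 := by
  rw [hδ.lie_eq hX h hY, h', lie_zero]

/-- Vanishing of a cocycle propagates weights: if `X` has weight `c`, so has `δ X`. -/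
theorem IsCocycle.weight (hδ : IsCocycle p t δ) {H X : Module.End F (SAlg F m n)}
    (hH : H ∈ spec F p n t) (h : δ H = 0) (hX : X ∈ spec F p n t) {c : F} (hc : ⁅H, X⁆ = c • X)
    (f : SAlg F m n) : H (δ X f) = c • δ X f + δ X (H f) := by
  have h1 := LinearMap.congr_fun (hδ.lie_eq hH h hX) f
  rw [hc, map_smul, lie_apply_op, LinearMap.smul_apply] at h1
  rw [h1, sub_add_cancel]

theorem root_add (f g : DividedPow F m) (k l : Fin n) :
    root (f + g) k l = root f k l + root g k l := by
  rw [root, root, root, sc_add, add_mul, vf_add]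

theorem root_smul (c : F) (f : DividedPow F m) (k l : Fin n) :
    root (c • f) k l = c • root f k l := by
  rw [root, root, sc_smul, smul_mul_assoc, vf_smul]

theorem root_zero (k l : Fin n) : root (0 : DividedPow F m) k l = 0 := by
  rw [root, sc_zero, zero_mul, vf_zero]

theorem par_sc_theta (f : DividedPow F m) (k : Fin n) :
    par (sc f * gen F (Sum.inr k) : SAlg F m n) = -(sc f * gen F (Sum.inr k)) := by simp

theorem root_mem_evenField (f : DividedPow F m) (k l : Fin n) : root f k l ∈ evenField F m n :=
  vf_inr_mem_evenField (par_sc_theta f k)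

theorem root_gen_self (f : DividedPow F m) (k l : Fin n) :
    root f k l (gen F (Sum.inr l)) = sc f * gen F (Sum.inr k) := vf_gen_self _ _

/-- The coefficient of `θ_k D_k`-type: reads `f` off `f θ_k D_l`. -/
theorem aug_pd_root (f : DividedPow F m) (k l : Fin n) :
    aug (pd (Sum.inr k) (root f k l (gen F (Sum.inr l)))) = f := by
  rw [root_gen_self, pd_inr_sc_mul, pd_gen_self, mul_one, aug_sc]

theorem root_injective {f g : DividedPow F m} {k l : Fin n} (h : root f k l = root g k l) :
    f = g := by
  rw [← aug_pd_root f k l, h, aug_pd_root]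

theorem lie_pd_inl_root (j : Fin m) (f : DividedPow F m) (k l : Fin n) :
    ⁅(pd (Sum.inl j) : Module.End F (SAlg F m n)), root f k l⁆ =
      root (DividedPow.partialDeriv F j f) k l := by
  rw [root, lie_pd_inl_vf, pd_inl_sc_mul, pd_gen_ne (by simp), mul_zero, add_zero, root]

/-- Multiplication of scalars is encoded in brackets of root elements; this is how a cocycle on `𝒮`
becomes a derivation of an associative algebra. -/
theorem lie_root_root (h2 : (2 : F) ≠ 0) (f g : DividedPow F m) {k l s : Fin n} (hks : k ≠ s) :
    ⁅root f k l, root g l s⁆ = root (f * g) k s := by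
  rw [root, root, lie_inr_vf h2 (par_sc_theta f k), pd_inr_sc_mul, pd_gen_self, pd_inr_sc_mul,
    pd_gen_ne (by simpa using hks.symm), mul_zero, mul_zero, vf_zero, sub_zero, mul_one, root,
    sc_mul, mul_assoc, mul_assoc, sc_comm g]

theorem lie_num_root (h2 : (2 : F) ≠ 0) (a : Fin n) (f : DividedPow F m) (k l : Fin n) :
    ⁅(num (Sum.inr a) : Module.End F (SAlg F m n)), root f k l⁆ =
      ((if a = k then 1 else 0) - (if a = l then 1 else 0) : F) • root f k l := by
  rw [root, lie_num_vf h2, num_inr_sc_mul, num_gen]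
  have e' : ∀ P : Prop, [Decidable P] → ∀ x : Module.End F (SAlg F m n),
      (if P then x else 0) = (if P then (1 : F) else 0) • x := fun P _ x => by split_ifs <;> simp
  by_cases hk : a = k
  · subst hk
    simp only [if_true, Sum.inr.injEq, sub_smul, one_smul, e' (a = l)]
  · simp only [hk, if_false, Sum.inr.injEq, e' (a = l), mul_zero, vf_zero, zero_sub, neg_smul]

variable [Fact p.Prime] [CharP F p]

theorem num_sub_mem_spec (hm : 2 < m) (ht : ∀ i, 0 < t i) (a b : Fin n) :
    (num (Sum.inr a) - num (Sum.inr b) : Module.End F (SAlg F m n)) ∈ spec F p n t := by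
  have h := sub_mem (torus_mem_spec (F := F) (p := p) ht (⟨0, by omega⟩ : Fin m) a)
    (torus_mem_spec (F := F) (p := p) ht (⟨0, by omega⟩ : Fin m) b)
  rwa [add_sub_add_left_eq_sub] at h

omit [Fact p.Prime] [CharP F p] in
theorem IsGraded.num_sub_eq (hδ : IsGraded p t δ) (hm : 2 < m) (a b : Fin n) :
    δ (num (Sum.inr a) - num (Sum.inr b)) = 0 := by
  have h := congrArg₂ (· - ·) (hδ.torus_eq ⟨0, by omega⟩ a) (hδ.torus_eq ⟨0, by omega⟩ b)
  rwa [← map_sub, add_sub_add_left_eq_sub, sub_zero] at h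

/-- The weight equations for the coefficients of `δ X`, when `X` is a weight vector. -/
theorem IsGraded.num_sub_apply (hδ : IsGraded p t δ) (hm : 2 < m) (ht : ∀ i, 0 < t i)
    {X : Module.End F (SAlg F m n)} (hX : X ∈ spec F p n t) (a b : Fin n) {c : F}
    (hc : ⁅(num (Sum.inr a) - num (Sum.inr b) : Module.End F (SAlg F m n)), X⁆ = c • X)
    (r : Fin m ⊕ Fin n) :
    num (Sum.inr a) (δ X (gen F r)) - num (Sum.inr b) (δ X (gen F r)) =
      (c + ((if Sum.inr a = r then 1 else 0) - (if Sum.inr b = r then 1 else 0))) •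
        δ X (gen F r) := by
  have h := hδ.weight (num_sub_mem_spec hm ht a b) (hδ.num_sub_eq hm a b) hX hc (gen F r)
  rw [LinearMap.sub_apply, LinearMap.sub_apply, num_gen, num_gen] at h
  rw [h, add_smul, map_sub]
  by_cases ha : Sum.inr a = r <;> by_cases hb : Sum.inr b = r <;> simp [ha, hb]

theorem root_mem (h2 : (2 : F) ≠ 0) {k l : Fin n} (hkl : k ≠ l)
    {f : DividedPow F m} (hf : f ∈ DividedPow.truncated F p t) : root f k l ∈ spec F p n t :=
  root_mem_spec h2 hkl hf

/-- A weight argument for the differences `θ_a D_a - θ_b D_b`. All components of the image other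
than the one along `D_l` would carry an impossible eigenvalue, and the remaining one is divisible by
`θ_k` and involves no other odd variable. -/
theorem IsGraded.exists_root (hδ : IsGraded p t δ) (h2 : (2 : F) ≠ 0) (h3 : (3 : F) ≠ 0)
    (hm : 2 < m) (ht : ∀ i, 0 < t i) {k l : Fin n} (hkl : k ≠ l)
    {f : DividedPow F m} (hf : f ∈ DividedPow.truncated F p t) :
    ∃ φ, δ (root f k l) = root φ k l := by
  have hX : root f k l ∈ spec F p n t := root_mem h2 hkl hf
  have hw : ∀ a b, ⁅(num (Sum.inr a) - num (Sum.inr b) : Module.End F (SAlg F m n)), root f k l⁆ =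
      (((if a = k then 1 else 0) - (if a = l then 1 else 0)) -
        ((if b = k then 1 else 0) - (if b = l then 1 else 0)) : F) • root f k l := fun a b => by
    rw [sub_lie, lie_num_root h2, lie_num_root h2, ← sub_smul]
  have key := fun a b r => hδ.num_sub_apply hm ht hX a b (hw a b) r
  -- For the operator with `a = k` and `b = l` such a component has weight `3` if it stands at `θ_k`
  -- and `2` otherwise. As `p > 3`, neither is one of `0`, `1`, `-1`.
  have hz : ∀ r, r ≠ Sum.inr l → δ (root f k l) (gen F r) = 0 := by
    intro r hr
    have h := key k l r
    have e1 : (2 : F) - 1 = 1 := by norm_num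
    have e2 : (2 : F) + 1 = 3 := by norm_num
    have e3 : (3 : F) - 1 = 2 := by norm_num
    have e4 : (3 : F) + 1 = 2 * 2 := by norm_num
    by_cases hrk : Sum.inr k = r
    · have hc : ((1 : F) - 0 - (0 - 1) + (1 - 0)) = 3 := by norm_num
      rw [if_pos rfl, if_pos rfl, if_neg hkl, if_neg hkl.symm, if_pos hrk, if_neg hr.symm, hc] at h
      refine num_sub_eigen h3 (fun h => ?_) (fun h => ?_) h
      · rw [h, sub_self] at e3; exact h2 e3.symm
      · rw [h, neg_add_cancel] at e4; exact mul_ne_zero h2 h2 e4.symm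
    · have hc : ((1 : F) - 0 - (0 - 1) + (0 - 0)) = 2 := by norm_num
      rw [if_pos rfl, if_pos rfl, if_neg hkl, if_neg hkl.symm, if_neg hrk, if_neg hr.symm, hc] at h
      refine num_sub_eigen h2 (fun h => ?_) (fun h => ?_) h
      · rw [h, sub_self] at e1; exact one_ne_zero e1.symm
      · rw [h, neg_add_cancel] at e2; exact h3 e2.symm
  set v := δ (root f k l) (gen F (Sum.inr l)) with hv
  -- At `θ_l` the weight is `1` for every `b ≠ k`: if `b = l`, the weight `2` of the root element is
  -- lowered by `1`.
  have hb : ∀ b, b ≠ k → num (Sum.inr k) v = v ∧ num (Sum.inr b) v = 0 := by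
    intro b hbk
    have h := key k b (Sum.inr l)
    refine num_eq_of_sub_eq h2 (h.trans ?_)
    rw [← hv]
    by_cases hbl : b = l
    · subst hbl; simp [hkl, hbk]
    · simp [hkl, hbk, hbl]
  have hd : ∀ a, pd (Sum.inr a) (pd (Sum.inr k) v) = 0 := by
    intro a
    by_cases ha : a = k
    · subst ha; exact pd_inr_pd_inr _ _
    · rw [pd_inr_comm, ← pd_inr_num_self a, (hb a ha).2, map_zero, map_zero, neg_zero]
  refine ⟨aug (pd (Sum.inr k) v), evenField.ext (hδ.mem hX) (root_mem_evenField _ _ _) fun r => ?_⟩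
  by_cases hr : r = Sum.inr l
  · rw [hr, root_gen_self, ← eq_sc_of_pd_inr hd, ← hv, comm_theta]
    have hpar : par (pd (Sum.inr k) v) = pd (Sum.inr k) v := by
      rw [eq_sc_of_pd_inr hd, par_sc]
    rw [hpar, ← num_apply, (hb l hkl.symm).1]
  · rw [hz r hr, root, vf_gen_ne _ (Ne.symm hr)]

/-- The action of a cocycle on the coefficient of `f θ_k D_l`. -/
noncomputable def rootCoeff (δ : Module.End F (Module.End F (SAlg F m n))) (k l : Fin n) :
    DividedPow F m →ₗ[F] DividedPow F m where
  toFun f := aug (pd (Sum.inr k) (δ (root f k l) (gen F (Sum.inr l))))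
  map_add' f g := by rw [root_add, map_add, LinearMap.add_apply, map_add, map_add]
  map_smul' c f := by
    rw [root_smul, map_smul, LinearMap.smul_apply, map_smul, map_smul, RingHom.id_apply]

omit [Fact p.Prime] [CharP F p] in
theorem rootCoeff_eq {k l : Fin n} {f φ : DividedPow F m} (h : δ (root f k l) = root φ k l) :
    rootCoeff δ k l f = φ := by
  rw [rootCoeff, LinearMap.coe_mk, AddHom.coe_mk, h, aug_pd_root]

theorem IsGraded.apply_root (hδ : IsGraded p t δ) (h2 : (2 : F) ≠ 0) (h3 : (3 : F) ≠ 0)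
    (hm : 2 < m) (ht : ∀ i, 0 < t i) {k l : Fin n} (hkl : k ≠ l)
    {f : DividedPow F m} (hf : f ∈ DividedPow.truncated F p t) :
    δ (root f k l) = root (rootCoeff δ k l f) k l := by
  obtain ⟨φ, h⟩ := hδ.exists_root h2 h3 hm ht hkl hf
  rw [rootCoeff_eq h, h]

theorem IsGraded.rootCoeff_mul (hδ : IsGraded p t δ) (h2 : (2 : F) ≠ 0) (h3 : (3 : F) ≠ 0)
    (hm : 2 < m) (ht : ∀ i, 0 < t i) {k l s : Fin n} (hkl : k ≠ l) (hls : l ≠ s) (hks : k ≠ s)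
    {f g : DividedPow F m} (hf : f ∈ DividedPow.truncated F p t)
    (hg : g ∈ DividedPow.truncated F p t) :
    rootCoeff δ k s (f * g) = rootCoeff δ k l f * g + f * rootCoeff δ l s g := by
  apply rootCoeff_eq
  rw [← lie_root_root h2 f g hks, hδ.lie (root_mem h2 hkl hf) (root_mem h2 hls hg),
    hδ.apply_root h2 h3 hm ht hkl hf, hδ.apply_root h2 h3 hm ht hls hg, lie_root_root h2 _ _ hks,
    lie_root_root h2 _ _ hks, root_add]

theorem IsGraded.rootCoeff_partialDeriv (hδ : IsGraded p t δ) (h2 : (2 : F) ≠ 0)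
    (h3 : (3 : F) ≠ 0) (hm : 2 < m) (hn : 2 < n) (ht : ∀ i, 0 < t i) {k l : Fin n} (hkl : k ≠ l)
    (j : Fin m) {f : DividedPow F m} (hf : f ∈ DividedPow.truncated F p t) :
    rootCoeff δ k l (DividedPow.partialDeriv F j f) =
      DividedPow.partialDeriv F j (rootCoeff δ k l f) := by
  apply rootCoeff_eq
  rw [← lie_pd_inl_root, hδ.lie_eq (pd_inl_mem_spec hn j) (hδ.pd_eq j) (root_mem h2 hkl hf),
    hδ.apply_root h2 h3 hm ht hkl hf, lie_pd_inl_root]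

/-- The derivatives of the value vanish, so the value is a constant. The toral element `x_i D_i +
θ_s D_s` with `s` different from `k` and `l` has weight `1` on `x_i θ_k D_l` and weight `0` on a
constant multiple of `θ_k D_l`. Hence the exponent `p^0` needs no Frobenius correction. -/
theorem IsGraded.rootCoeff_x (hδ : IsGraded p t δ) (h2 : (2 : F) ≠ 0)
    (h3 : (3 : F) ≠ 0) (hm : 2 < m) (hn : 2 < n) (ht : ∀ i, 0 < t i) {k l : Fin n} (hkl : k ≠ l)
    (h1 : rootCoeff δ k l 1 = 0) (i : Fin m) : rootCoeff δ k l (monomial F (e i)) = 0 := by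
  have hxt : monomial F (e i) ∈ DividedPow.truncated F p t :=
    monomial_mem_truncated (e_lt ht i)
  obtain ⟨c, hc⟩ := eq_smul_one_of_partialDeriv (a := rootCoeff δ k l (monomial F (e i))) fun j => by
    rw [← hδ.rootCoeff_partialDeriv h2 h3 hm hn ht hkl j hxt, DividedPow.partialDeriv_monomial]
    split_ifs with hj
    · exact map_zero _
    · have hij : j = i := by
        by_contra h; exact hj (SpecialSuper.DividedPow.e_ne h)
      rw [hij, tsub_self, ← one_eq_monomial, h1]
  obtain ⟨s, hs1, hs2⟩ := Fin.exists_ne_and_ne_of_two_lt k l hn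
  have hw : ∀ f : DividedPow F m,
      ⁅(num (Sum.inl i) + num (Sum.inr s) : Module.End F (SAlg F m n)), root f k l⁆ =
        vf (num (Sum.inl i) (sc f * gen F (Sum.inr k))) (Sum.inr l) := by
    intro f
    rw [add_lie, lie_num_root h2, if_neg hs1, if_neg hs2, sub_zero, zero_smul, add_zero, root,
      lie_num_vf h2, if_neg (by simp), sub_zero]
  have hx : num (Sum.inl i) (sc (monomial F (e i)) * gen F (Sum.inr k) : SAlg F m n) =
      sc (monomial F (e i)) * gen F (Sum.inr k) := by
    rw [num_apply, pd_inl_sc_mul, pd_gen_ne (by simp), mul_zero, add_zero, ← pd_inl_sc,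
      ← gen_inl_eq_sc, pd_gen_self, one_mul]
  have h := hδ.lie_eq (torus_mem_spec ht i s) (hδ.torus_eq i s) (root_mem h2 hkl hxt)
  have h' := (hw (monomial F (e i))).trans (congrArg (fun z => vf z (Sum.inr l)) hx)
  rw [root] at h'
  have h4 : num (Sum.inl i) (sc (c • (1 : DividedPow F m)) * gen F (Sum.inr k) : SAlg F m n) = 0 := by
    rw [sc_smul, sc_one, smul_mul_assoc, one_mul, map_smul, num_gen, if_neg (by simp), smul_zero]
  change δ ⁅_, root (monomial F (e i)) k l⁆ = ⁅_, δ (root (monomial F (e i)) k l)⁆ at h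
  rw [hδ.apply_root h2 h3 hm ht hkl hxt, hw (rootCoeff δ k l _), hc, h4, vf_zero, root, h'] at h
  exact rootCoeff_eq (by rw [root, h, root_zero])

/-- After subtracting a toral derivation and iterated translations, a graded cocycle vanishes on
all `f θ_k D_l`. -/
theorem IsGraded.root_eq_zero (hδ : IsGraded p t δ) (h2 : (2 : F) ≠ 0)
    (h3 : (3 : F) ≠ 0) (hm : 2 < m) (hn : 2 < n) (ht : ∀ i, 0 < t i)
    (h1 : ∀ k l, k ≠ l → rootCoeff δ k l 1 = 0) {k₀ l₀ : Fin n} (h₀ : k₀ ≠ l₀)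
    (hx : ∀ i s, s + 1 < t i → (DividedPow.basis F m).coord 0
      (rootCoeff δ k₀ l₀ (monomial F (Pi.single i (p ^ (s + 1))))) = 0)
    {k l : Fin n} (hkl : k ≠ l) {f : DividedPow F m} (hf : f ∈ DividedPow.truncated F p t) :
    δ (root f k l) = 0 := by
  -- Putting `1` for one factor in the product rule shows that the coefficient maps depend on
  -- neither index; their common value is an honest derivation.
  have hfst : ∀ k l s : Fin n, k ≠ l → l ≠ s → k ≠ s → ∀ g ∈ DividedPow.truncated F p t,
      rootCoeff δ k s g = rootCoeff δ l s g := by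
    intro k l s hkl hls hks g hg
    have h := hδ.rootCoeff_mul h2 h3 hm ht hkl hls hks one_mem_truncated hg
    rwa [h1 k l hkl, zero_mul, zero_add, one_mul, one_mul] at h
  have hsnd : ∀ k l s : Fin n, k ≠ l → l ≠ s → k ≠ s → ∀ g ∈ DividedPow.truncated F p t,
      rootCoeff δ k s g = rootCoeff δ k l g := by
    intro k l s hkl hls hks g hg
    have h := hδ.rootCoeff_mul h2 h3 hm ht hkl hls hks hg one_mem_truncated
    rwa [h1 l s hls, mul_zero, add_zero, mul_one, mul_one] at h
  have hmul : ∀ f ∈ DividedPow.truncated F p t, ∀ g ∈ DividedPow.truncated F p t,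
      rootCoeff δ k₀ l₀ (f * g) = rootCoeff δ k₀ l₀ f * g + f * rootCoeff δ k₀ l₀ g := by
    intro f hf g hg
    obtain ⟨s, hs1, hs2⟩ := Fin.exists_ne_and_ne_of_two_lt k₀ l₀ hn
    rw [hδ.rootCoeff_mul h2 h3 hm ht hs1.symm hs2 h₀ hf hg,
      ← hfst k₀ s l₀ hs1.symm hs2 h₀ g hg, ← hsnd k₀ s l₀ hs1.symm hs2 h₀ f hf]
  have hz : ∀ f ∈ DividedPow.truncated F p t, rootCoeff δ k₀ l₀ f = 0 := by
    intro f hf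
    refine truncated_derivation_eq_zero
      (fun j f hf => hδ.rootCoeff_partialDeriv h2 h3 hm hn ht h₀ j hf) hmul (fun i s hs => ?_) hf
    rcases s with _ | s
    · rw [pow_zero]
      change (DividedPow.basis F m).coord 0 (rootCoeff δ k₀ l₀ (monomial F (e i))) = 0
      rw [hδ.rootCoeff_x h2 h3 hm hn ht h₀ (h1 _ _ h₀), map_zero]
    · exact hx i s hs
  have hz' : rootCoeff δ k l f = 0 := by
    rw [← hz f hf]
    obtain ⟨s, hs1, hs2⟩ := Fin.exists_ne_and_ne_of_two_lt k k₀ hn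
    have e1 : ∀ a b c, a ≠ b → a ≠ c → rootCoeff δ a b f = rootCoeff δ a c f := by
      intro a b c hab hac
      by_cases hbc : b = c
      · rw [hbc]
      · exact hsnd a c b hac (Ne.symm hbc) hab f hf
    rw [e1 k l s hkl hs1.symm, ← e1 k₀ s l₀ hs2.symm h₀]
    by_cases hk : k = k₀
    · rw [hk]
    · exact hfst k k₀ s hk hs2.symm hs1.symm f hf
  rw [hδ.apply_root h2 h3 hm ht hkl hf, hz', root_zero]

end Roots

/-! ### Corrections by the odd torus and by Frobenius powers. -/

section Reduction

variable {F : Type*} [Field F] {m n : ℕ} {p : ℕ} {t : Fin m → ℕ}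
  {δ : Module.End F (Module.End F (SAlg F m n))}

theorem sum_smul_lie {ι : Type*} (s : Finset ι) (c : ι → F) (A : ι → Module.End F (SAlg F m n))
    (X : Module.End F (SAlg F m n)) : ⁅∑ x ∈ s, c x • A x, X⁆ = ∑ x ∈ s, c x • ⁅A x, X⁆ := by
  rw [Ring.lie_def, Finset.sum_mul, Finset.mul_sum, ← Finset.sum_sub_distrib]
  refine Finset.sum_congr rfl fun x _ => ?_
  rw [smul_mul_assoc, mul_smul_comm, ← smul_sub, ← Ring.lie_def]

theorem IsGraded.add_adl (hδ : IsGraded p t δ) {Q : Module.End F (SAlg F m n)}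
    (hQ : ∀ {X}, X ∈ spec F p n t → ⁅Q, X⁆ ∈ evenField F m n)
    (h1 : ∀ j, ⁅Q, (pd (Sum.inl j) : Module.End F (SAlg F m n))⁆ = 0)
    (h2 : ∀ i s, ⁅Q, (num (Sum.inl i) + num (Sum.inr s) : Module.End F (SAlg F m n))⁆ = 0) :
    IsGraded p t (δ + adl Q) where
  toIsCocycle := hδ.toIsCocycle.add_adl hQ
  pd_eq j := by rw [LinearMap.add_apply, hδ.pd_eq, adl_apply, h1, add_zero]
  torus_eq i s := by rw [LinearMap.add_apply, hδ.torus_eq, adl_apply, h2, add_zero]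

/-- The combination `∑ b_k θ_k D_k`. -/
noncomputable def thetaTorus (m : ℕ) {n : ℕ} (b : Fin n → F) : Module.End F (SAlg F m n) :=
  ∑ k, b k • (num (Sum.inr k) : Module.End F (SAlg F m n))

theorem thetaTorus_mem (b : Fin n → F) : thetaTorus m b ∈ evenField F m n :=
  Submodule.sum_mem _ fun _ _ => Submodule.smul_mem _ _ (num_mem _)

theorem lie_thetaTorus (b : Fin n → F) {X : Module.End F (SAlg F m n)} {d : Fin n → F}
    (h : ∀ k, ⁅(num (Sum.inr k) : Module.End F (SAlg F m n)), X⁆ = d k • X) :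
    ⁅thetaTorus m b, X⁆ = (∑ k, b k * d k) • X := by
  rw [thetaTorus, sum_smul_lie, Finset.sum_smul]
  exact Finset.sum_congr rfl fun k _ => by rw [h, smul_smul]

theorem lie_thetaTorus_eq_zero (b : Fin n → F) {X : Module.End F (SAlg F m n)}
    (h : ∀ k, ⁅(num (Sum.inr k) : Module.End F (SAlg F m n)), X⁆ = 0) :
    ⁅thetaTorus m b, X⁆ = 0 := by
  rw [lie_thetaTorus b (d := 0) fun k => by rw [h, Pi.zero_apply, zero_smul]]
  simp

theorem IsGraded.add_thetaTorus (hδ : IsGraded p t δ) (h2 : (2 : F) ≠ 0) (b : Fin n → F) :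
    IsGraded p t (δ + adl (thetaTorus m b)) := by
  refine hδ.add_adl (fun hX => evenField.lie_mem h2 (thetaTorus_mem b) (spec_le hX)) (fun j => ?_)
    fun i s => ?_
  · refine lie_thetaTorus_eq_zero b fun k => ?_
    rw [← lie_skew, lie_pd_inl_num, if_neg (by simp), neg_zero]
  · refine lie_thetaTorus_eq_zero b fun k => ?_
    rw [lie_add, num_commute, num_commute, add_zero]

theorem lie_thetaTorus_root (h2 : (2 : F) ≠ 0) (b : Fin n → F) (f : DividedPow F m)
    (k l : Fin n) : ⁅thetaTorus m b, root f k l⁆ = (b k - b l) • root f k l := by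
  rw [lie_thetaTorus b fun a => lie_num_root h2 a f k l]
  congr 1
  simp [mul_sub, Finset.sum_sub_distrib]

theorem rootCoeff_add_adl {Q : Module.End F (SAlg F m n)} {k l : Fin n} {f φ : DividedPow F m}
    (h : ⁅Q, root f k l⁆ = root φ k l) :
    rootCoeff (δ + adl Q) k l f = rootCoeff δ k l f + φ := by
  simp only [rootCoeff, LinearMap.coe_mk, AddHom.coe_mk, LinearMap.add_apply, map_add, adl_apply,
    h, aug_pd_root]

variable [Fact p.Prime] [CharP F p]

theorem IsGraded.add_frob (hδ : IsGraded p t δ) (h2 : (2 : F) ≠ 0) (hn : 2 < n)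
    (c : (Σ j, Fin (t j - 1)) → F) : IsGraded p t (δ + adl (frob p t n c)) := by
  refine hδ.add_adl (fun hX => spec_le (lie_frob_mem_spec h2 hn c hX)) (fun j => ?_) fun i s => ?_
  · exact lie_frob_eq_zero c fun a => by rw [lie_pd_inl_pd_inl, lie_zero]
  · exact lie_frob_eq_zero c fun a => by
      rw [lie_pd_inl_torus, commutator_smul, lie_pd_inl_pd_inl, smul_zero]

/-- The values at `1` are constants `c_kl` with `c_ks = c_kl + c_ls`, so they have the form `b_l -
b_k`; the odd torus acts on `θ_k D_l` by `b_k - b_l`. -/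
theorem IsGraded.exists_rootCoeff_one (hδ : IsGraded p t δ) (h2 : (2 : F) ≠ 0)
    (h3 : (3 : F) ≠ 0) (hm : 2 < m) (hn : 2 < n) (ht : ∀ i, 0 < t i) :
    ∃ b : Fin n → F, ∀ k l, k ≠ l → rootCoeff (δ + adl (thetaTorus m b)) k l 1 = 0 := by
  have hc : ∀ k l, ∃ c : F, k ≠ l → rootCoeff δ k l 1 = c • 1 := by
    intro k l
    by_cases hkl : k = l
    · exact ⟨0, fun h => (h hkl).elim⟩
    · obtain ⟨c, hc⟩ := eq_smul_one_of_partialDeriv (a := rootCoeff δ k l 1) fun j => by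
        rw [← hδ.rootCoeff_partialDeriv h2 h3 hm hn ht hkl j one_mem_truncated, partialDeriv_one,
          map_zero]
      exact ⟨c, fun _ => hc⟩
  choose c hc using hc
  have hadd : ∀ k l s, k ≠ l → l ≠ s → k ≠ s → c k s = c k l + c l s := by
    intro k l s hkl hls hks
    have h := hδ.rootCoeff_mul h2 h3 hm ht hkl hls hks one_mem_truncated one_mem_truncated
    rw [mul_one, mul_one, one_mul, hc k s hks, hc k l hkl, hc l s hls, ← add_smul] at h
    simpa only [coord_zero_smul_one] using congrArg ((DividedPow.basis F m).coord 0) h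
  have hneg : ∀ k l, k ≠ l → c k l + c l k = 0 := by
    intro k l hkl
    obtain ⟨s, hs1, hs2⟩ := Fin.exists_ne_and_ne_of_two_lt k l hn
    have e1 := hadd k l s hkl hs2.symm hs1.symm
    have e2 := hadd l k s hkl.symm hs1.symm hs2.symm
    linear_combination -e1 - e2
  let o : Fin n := ⟨0, by omega⟩
  -- A potential for the additive family, normalized to vanish at the base index `o`.
  refine ⟨fun k => if k = o then 0 else -c k o, fun k l hkl => ?_⟩
  have h := lie_thetaTorus_root (m := m) h2 (fun k => if k = o then 0 else -c k o) 1 k l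
  rw [← root_smul] at h
  rw [rootCoeff_add_adl h, hc k l hkl, ← add_smul]
  suffices c k l + ((if k = o then 0 else -c k o) - (if l = o then 0 else -c l o)) = 0 by
    rw [this, zero_smul]
  by_cases hk : k = o
  · have hl : l ≠ o := fun h => hkl (hk.trans h.symm)
    rw [if_pos hk, if_neg hl, ← hk]
    linear_combination hneg k l hkl
  · by_cases hl : l = o
    · rw [if_neg hk, if_pos hl, hl]
      ring
    · rw [if_neg hk, if_neg hl]
      linear_combination -(hadd k l o hkl hl hk)

/-- Graded cocycles which vanish on all `f θ_k D_l`. -/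
structure IsReduced (p : ℕ) (t : Fin m → ℕ)
    (δ : Module.End F (Module.End F (SAlg F m n))) : Prop extends IsGraded p t δ where
  root_eq : ∀ {k l}, k ≠ l → ∀ {f}, f ∈ DividedPow.truncated F p t → δ (root f k l) = 0

theorem IsGraded.exists_isReduced (hδ : IsGraded p t δ) (h2 : (2 : F) ≠ 0)
    (h3 : (3 : F) ≠ 0) (hm : 2 < m) (hn : 2 < n) (ht : ∀ i, 0 < t i) :
    ∃ b c, IsReduced p t (δ + adl (thetaTorus m b) + adl (frob p t n c)) := by
  obtain ⟨b, hb⟩ := hδ.exists_rootCoeff_one h2 h3 hm hn ht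
  have hδ' := hδ.add_thetaTorus h2 b
  set δ' := δ + adl (thetaTorus m b)
  let k₀ : Fin n := ⟨0, by omega⟩
  let l₀ : Fin n := ⟨1, by omega⟩
  have h₀ : k₀ ≠ l₀ := by simp [k₀, l₀]
  -- Minus the obstructing constant terms. All coefficient maps will agree, so reading them at one
  -- pair of indices is enough.
  let c : (Σ j, Fin (t j - 1)) → F := fun x =>
    -(DividedPow.basis F m).coord 0
      (rootCoeff δ' k₀ l₀ (monomial F (Pi.single x.1 (p ^ (x.2.1 + 1)))))
  have hδ'' := hδ'.add_frob h2 hn c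
  refine ⟨b, c, hδ'', fun hkl f hf => hδ''.root_eq_zero h2 h3 hm hn ht (fun k l hkl => ?_) h₀
    (fun i s hs => ?_) hkl hf⟩
  · rw [rootCoeff_add_adl (φ := 0), hb k l hkl, add_zero]
    rw [root_zero]
    exact lie_frob_eq_zero c fun j => by
      rw [lie_pd_inl_root, partialDeriv_one, root_zero, lie_zero]
  · rw [rootCoeff_add_adl (lie_frob_root c _ _ _), map_add,
      coord_zero_frobDeriv c ⟨i, ⟨s, by omega⟩⟩]
    exact add_neg_cancel _

omit [Fact p.Prime] [CharP F p] in
theorem IsGraded.pd_inl_apply_eq_zero (hδ : IsGraded p t δ) {X : Module.End F (SAlg F m n)}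
    (hX : X ∈ spec F p n t) {j : Fin m} (hj : pd (Sum.inl j) ∈ spec F p n t)
    (h : δ ⁅(pd (Sum.inl j) : Module.End F (SAlg F m n)), X⁆ = 0) (r : Fin m ⊕ Fin n) :
    pd (Sum.inl j) (δ X (gen F r)) = 0 := by
  rw [← lie_pd_inl_gen (hδ.mem hX), ← hδ.lie_eq hj (hδ.pd_eq j) hX, h, LinearMap.zero_apply]

theorem inl_sub_mem_spec (hn : 2 < n) (ht : ∀ i, 0 < t i) (a b : Fin m) :
    (num (Sum.inl a) - num (Sum.inl b) : Module.End F (SAlg F m n)) ∈ spec F p n t := by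
  have h := sub_mem (torus_mem_spec (F := F) (p := p) ht a (⟨0, by omega⟩ : Fin n))
    (torus_mem_spec (F := F) (p := p) ht b (⟨0, by omega⟩ : Fin n))
  rwa [add_sub_add_right_eq_sub] at h

omit [Fact p.Prime] [CharP F p] in
theorem IsGraded.inl_sub_eq (hδ : IsGraded p t δ) (hn : 2 < n) (a b : Fin m) :
    δ (num (Sum.inl a) - num (Sum.inl b)) = 0 := by
  have h := congrArg₂ (· - ·) (hδ.torus_eq a ⟨0, by omega⟩) (hδ.torus_eq b ⟨0, by omega⟩)
  rwa [← map_sub, add_sub_add_right_eq_sub, sub_zero] at h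

/-- Weights with respect to `N_a - N_b` for a field with constant coefficients. -/
theorem IsGraded.inl_sub_apply (hδ : IsGraded p t δ) (hn : 2 < n) (ht : ∀ i, 0 < t i)
    {X : Module.End F (SAlg F m n)} (hX : X ∈ spec F p n t) (a b : Fin m) {c : F}
    (hc : ⁅(num (Sum.inl a) - num (Sum.inl b) : Module.End F (SAlg F m n)), X⁆ = c • X)
    {r : Fin m ⊕ Fin n} (h0 : ∀ j, pd (Sum.inl j) (δ X (gen F r)) = 0) :
    (c + ((if Sum.inl a = r then 1 else 0) - (if Sum.inl b = r then 1 else 0))) •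
        δ X (gen F r) = 0 := by
  have h := hδ.weight (inl_sub_mem_spec hn ht a b) (hδ.inl_sub_eq hn a b) hX hc (gen F r)
  rw [LinearMap.sub_apply, LinearMap.sub_apply, num_gen, num_gen, num_apply, num_apply, h0, h0,
    mul_zero, mul_zero, sub_zero] at h
  rw [h, add_smul, map_sub]
  by_cases ha : Sum.inl a = r <;> by_cases hb : Sum.inl b = r <;> simp [ha, hb]

/-- The image has coefficients independent of the even variables. Under `x_a D_a - x_b D_b` its
components would have to satisfy an equation with factor `1`, `2` or `3`, and none of these is zero.
-/
theorem IsGraded.lower_eq_zero (hδ : IsGraded p t δ) (h2 : (2 : F) ≠ 0) (h3 : (3 : F) ≠ 0)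
    (hn : 2 < n) (ht : ∀ i, 0 < t i) {a b : Fin m} (hab : a ≠ b) :
    δ (vf (gen F (Sum.inl a)) (Sum.inl b)) = 0 := by
  have hX := lower_mem_spec (F := F) (p := p) hn ht hab
  have hc : ⁅(num (Sum.inl a) - num (Sum.inl b) : Module.End F (SAlg F m n)),
      (vf (gen F (Sum.inl a)) (Sum.inl b) : Module.End F (SAlg F m n))⁆ =
      (2 : F) • vf (gen F (Sum.inl a)) (Sum.inl b) := by
    rw [sub_lie, lie_num_vf h2, lie_num_vf h2, num_gen, num_gen, if_pos rfl, if_pos rfl,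
      if_neg (by simpa using hab), if_neg (by simpa using hab.symm), vf_zero, two_smul]
    abel
  have h0 : ∀ r j, pd (Sum.inl j) (δ (vf (gen F (Sum.inl a)) (Sum.inl b)) (gen F r)) = 0 := by
    refine fun r j => hδ.pd_inl_apply_eq_zero hX (pd_inl_mem_spec hn j) ?_ r
    rw [lie_pd_inl_vf, pd_gen]
    split_ifs
    · rw [vf_one, hδ.pd_eq]
    · rw [vf_zero, map_zero]
  refine evenField.ext (hδ.mem hX) (zero_mem _) fun r => ?_
  have h := hδ.inl_sub_apply hn ht hX a b hc (h0 r)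
  refine (smul_eq_zero.mp h).resolve_left ?_
  by_cases ha : Sum.inl a = r
  · have hb : Sum.inl b ≠ r := fun h => hab (Sum.inl_injective (ha.trans h.symm))
    rw [if_pos ha, if_neg hb]
    convert h3 using 1
    norm_num
  · rw [if_neg ha]
    split_ifs
    · norm_num
    · simpa using h2

theorem lie_num_pair (h2 : (2 : F) ≠ 0) (a : Fin n) {k l : Fin n} (hkl : k ≠ l) (i : Fin m) :
    ⁅(num (Sum.inr a) : Module.End F (SAlg F m n)),
      vf (gen F (Sum.inr k) * gen F (Sum.inr l)) (Sum.inl i)⁆ =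
      ((if a = k then 1 else 0) + (if a = l then 1 else 0) : F) •
        vf (gen F (Sum.inr k) * gen F (Sum.inr l)) (Sum.inl i) := by
  rw [lie_num_vf h2, if_neg (by simp), sub_zero, num_mul h2, num_gen, num_gen]
  by_cases hk : a = k
  · have hl : a ≠ l := fun h => hkl (hk.symm.trans h)
    simp [hk, hkl]
  · by_cases hl : a = l <;> simp [hk, hl, hkl.symm]

/-- The image has coefficients independent of the even variables. Even weights leave only the
component along `D_i`, and odd weights force that component to be a multiple of `θ_k θ_l`. -/
theorem IsGraded.exists_pair (hδ : IsGraded p t δ) (h2 : (2 : F) ≠ 0) (hm : 2 < m)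
    (hn : 2 < n) (ht : ∀ i, 0 < t i) {k l : Fin n} (hkl : k ≠ l) (i : Fin m) :
    ∃ c : F, δ (vf (gen F (Sum.inr k) * gen F (Sum.inr l)) (Sum.inl i)) =
      c • vf (gen F (Sum.inr k) * gen F (Sum.inr l)) (Sum.inl i) := by
  have hX := pair_mem_spec (F := F) (p := p) (t := t) hn k l i
  set X : Module.End F (SAlg F m n) := vf (gen F (Sum.inr k) * gen F (Sum.inr l)) (Sum.inl i)
    with hXd
  have hn0 : ∀ a : Fin m, num (Sum.inl a) (gen F (Sum.inr k) * gen F (Sum.inr l) : SAlg F m n) = 0 := by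
    intro a
    rw [num_apply, pd_inl_theta_mul, pd_gen_ne (by simp), mul_zero, mul_zero]
  have hl : ∀ a : Fin m, ⁅(num (Sum.inl a) : Module.End F (SAlg F m n)), X⁆ =
      (if a = i then (-1 : F) else 0) • X := by
    intro a
    rw [hXd, lie_num_vf h2, hn0, vf_zero]
    by_cases ha : a = i <;> simp [ha]
  have h0 : ∀ r j, pd (Sum.inl j) (δ X (gen F r)) = 0 := by
    refine fun r j => hδ.pd_inl_apply_eq_zero hX (pd_inl_mem_spec hn j) ?_ r
    rw [hXd, lie_pd_inl_vf, pd_inl_theta_mul, pd_gen_ne (by simp), mul_zero, vf_zero, map_zero]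
  have hr : ∀ r, r ≠ Sum.inl i → δ X (gen F r) = 0 := by
    intro r hr
    -- An even index different from `i` and from the component considered; the weight of `x_i D_i -
    -- x_a D_a` is then `-1`. This needs `m ≥ 3`.
    obtain ⟨a, hai, har⟩ : ∃ a, a ≠ i ∧ Sum.inl a ≠ r := by
      rcases r with b | s
      · obtain ⟨a, h1, h3⟩ := Fin.exists_ne_and_ne_of_two_lt i b hm
        exact ⟨a, h1, by simpa using h3⟩
      · obtain ⟨a, h1, -⟩ := Fin.exists_ne_and_ne_of_two_lt i i hm
        exact ⟨a, h1, by simp⟩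
    have hc : ⁅(num (Sum.inl i) - num (Sum.inl a) : Module.End F (SAlg F m n)), X⁆ =
        (-1 : F) • X := by
      rw [sub_lie, hl, hl, if_pos rfl, if_neg hai, zero_smul, sub_zero]
    have h := hδ.inl_sub_apply hn ht hX i a hc (h0 r)
    rw [if_neg hr.symm, if_neg har, sub_self, add_zero] at h
    exact (smul_eq_zero.mp h).resolve_left (by simp)
  set v := δ X (gen F (Sum.inl i)) with hv
  have hw : ∀ s, num (Sum.inr s) v = ((if s = k then 1 else 0) + (if s = l then 1 else 0) : F) • v := by
    intro s
    have hc : ⁅(num (Sum.inl i) + num (Sum.inr s) : Module.End F (SAlg F m n)), X⁆ =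
        (-1 + ((if s = k then 1 else 0) + (if s = l then 1 else 0)) : F) • X := by
      rw [add_lie, hl, if_pos rfl, lie_num_pair h2 s hkl, ← add_smul]
    have h := hδ.weight (torus_mem_spec ht i s) (hδ.torus_eq i s) hX hc (gen F (Sum.inl i))
    rw [LinearMap.add_apply, LinearMap.add_apply, num_gen, num_gen, if_pos rfl,
      if_neg (show ¬(Sum.inr s : Fin m ⊕ Fin n) = Sum.inl i from Sum.inr_ne_inl),
      add_zero, num_apply (Sum.inl i), ← hv, h0, mul_zero, zero_add, add_smul, neg_one_smul] at h
    rw [h]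
    abel
  obtain ⟨g, hg, hg1, hg2⟩ := exists_word_mul (l := [k, l]) (by simpa using hkl) (v := v) (by
    intro s hs
    rw [hw]
    rcases List.mem_pair.mp hs with rfl | rfl
    · rw [if_pos rfl, if_neg hkl, add_zero, one_smul]
    · rw [if_pos rfl, if_neg hkl.symm, zero_add, one_smul])
  obtain ⟨c, hc⟩ := eq_smul_one (f := g) (by
    rintro (j | s)
    · exact hg2 _ (h0 _ j)
    · by_cases hs : s ∈ [k, l]
      · exact hg1 s hs
      · refine hg2 _ ?_
        rw [← pd_inr_num_self, hw]
        simp only [List.mem_cons, List.not_mem_nil, or_false, not_or] at hs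
        rw [if_neg hs.1, if_neg hs.2, add_zero, zero_smul, map_zero])
  refine ⟨c, evenField.ext (hδ.mem hX) (Submodule.smul_mem _ _ (spec_le hX)) fun r => ?_⟩
  rw [LinearMap.smul_apply]
  by_cases h : r = Sum.inl i
  · rw [h, ← hv, hXd, vf_gen_self, hg, hc, word_cons, word_cons, word_nil, mul_one, mul_smul_comm,
      mul_one]
  · rw [hr r h, hXd, vf_gen_ne _ (Ne.symm h), smul_zero]

/-- Reduced cocycles which also vanish on the `θ_k θ_l D_i`. -/
structure IsSmall (p : ℕ) (t : Fin m → ℕ)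
    (δ : Module.End F (Module.End F (SAlg F m n))) : Prop extends IsReduced p t δ where
  pair_eq : ∀ {k l}, k ≠ l → ∀ i, δ (vf (gen F (Sum.inr k) * gen F (Sum.inr l)) (Sum.inl i)) = 0

/-- A single scalar must be removed. The operator `∑ θ_k D_k` commutes with the root elements, so
the earlier reduction is preserved, and it has weight `2` on `θ_k θ_l D_i`. Brackets with `x_a D_b`
and `θ_a D_k` carry the vanishing from one such element to all of them. -/
theorem IsReduced.exists_isSmall (hδ : IsReduced p t δ) (h2 : (2 : F) ≠ 0)
    (h3 : (3 : F) ≠ 0) (hm : 2 < m) (hn : 2 < n) (ht : ∀ i, 0 < t i) :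
    ∃ b, IsSmall p t (δ + adl (thetaTorus m b)) := by
  let k₀ : Fin n := ⟨0, by omega⟩
  let l₀ : Fin n := ⟨1, by omega⟩
  let i₀ : Fin m := ⟨0, by omega⟩
  have h₀ : k₀ ≠ l₀ := by simp [k₀, l₀]
  obtain ⟨c, hc⟩ := hδ.exists_pair h2 hm hn ht h₀ i₀
  -- The division by `2` reflects that both odd factors contribute to the weight.
  have hδ' := hδ.add_thetaTorus h2 fun _ => -c / 2
  have hroot : ∀ {k l}, k ≠ l → ∀ {f}, f ∈ DividedPow.truncated F p t →
      (δ + adl (thetaTorus m fun _ : Fin n => -c / 2)) (root f k l) = 0 := by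
    intro k l hkl f hf
    rw [LinearMap.add_apply, hδ.root_eq hkl hf, adl_apply, lie_thetaTorus_root h2, sub_self,
      zero_smul, add_zero]
  have hpair : (δ + adl (thetaTorus m fun _ : Fin n => -c / 2))
      (vf (gen F (Sum.inr k₀) * gen F (Sum.inr l₀)) (Sum.inl i₀)) = 0 := by
    rw [LinearMap.add_apply, hc, adl_apply, lie_thetaTorus _ fun a => lie_num_pair h2 a h₀ i₀,
      ← add_smul, ← Finset.mul_sum, Finset.sum_add_distrib, Finset.sum_ite_eq', Finset.sum_ite_eq',
      if_pos (Finset.mem_univ _), if_pos (Finset.mem_univ _)]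
    have : c + -c / 2 * (1 + 1) = 0 := by field_simp; ring
    rw [this, zero_smul]
  have hlow := fun {a b : Fin m} (hab : a ≠ b) => hδ'.lower_eq_zero h2 h3 hn ht hab
  set δ' := δ + adl (thetaTorus m fun _ => -c / 2)
  refine ⟨_, ⟨hδ', hroot⟩, ?_⟩
  have hfst : ∀ a k l : Fin n, a ≠ k → k ≠ l → ∀ i : Fin m,
      δ' (vf (gen F (Sum.inr k) * gen F (Sum.inr l)) (Sum.inl i)) = 0 →
      δ' (vf (gen F (Sum.inr a) * gen F (Sum.inr l)) (Sum.inl i)) = 0 := by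
    intro a k l hak hkl i h
    have h1 := hδ'.lie_eq_zero (root_mem h2 hak one_mem_truncated) (hroot hak one_mem_truncated)
      (pair_mem_spec hn k l i) h
    rwa [root, sc_one, one_mul, lie_inr_vf h2 (par_gen_inr a), pd_inr_theta_mul_self,
      pd_gen_ne (by simpa using hkl), mul_zero, sub_zero, pd_gen_ne (by simp), mul_zero, vf_zero,
      sub_zero] at h1
  have hflip : ∀ (k l : Fin n) (i : Fin m),
      δ' (vf (gen F (Sum.inr k) * gen F (Sum.inr l)) (Sum.inl i)) = 0 →
      δ' (vf (gen F (Sum.inr l) * gen F (Sum.inr k)) (Sum.inl i)) = 0 := by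
    intro k l i h
    rw [theta_mul_theta, vf_neg, map_neg, h, neg_zero]
  intro k l hkl i
  have hi : δ' (vf (gen F (Sum.inr k₀) * gen F (Sum.inr l₀)) (Sum.inl i)) = 0 := by
    by_cases hi : i₀ = i
    · rw [← hi]; exact hpair
    · have h1 := hδ'.lie_eq_zero (pair_mem_spec hn k₀ l₀ i₀) hpair (lower_mem_spec hn ht hi)
        (hlow hi)
      rwa [lie_inl_vf h2 (by simp), pd_gen_self, mul_one, pd_inl_theta_mul, pd_gen_ne (by simp),
        mul_zero, mul_zero, vf_zero, sub_zero] at h1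
  have hl : ∀ k, k ≠ l₀ → δ' (vf (gen F (Sum.inr k) * gen F (Sum.inr l₀)) (Sum.inl i)) = 0 := by
    intro k hk
    by_cases hkk : k = k₀
    · rw [hkk]; exact hi
    · exact hfst k k₀ l₀ hkk h₀ i hi
  by_cases hll : l = l₀
  · rw [hll] at hkl ⊢; exact hl k hkl
  · have h1 := hflip _ _ _ (hl l hll)
    by_cases hkk : k = l₀
    · rw [hkk]; exact h1
    · exact hfst k l₀ l hkk (Ne.symm hll) i h1

end Reduction

/-! ### Elements with odd factors obtained by brackets from the small ones. -/

section Generation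

variable {F : Type*} [Field F] {m n : ℕ} {p : ℕ} {t : Fin m → ℕ}
  {δ : Module.End F (Module.End F (SAlg F m n))}

/-- Brackets with `θ_l D_k` turn a root element into a toral difference, as in `sl_2`. -/
theorem lie_vf_swap (h2 : (2 : F) ≠ 0) {h : SAlg F m n} (hh : par h = h) {k l : Fin n}
    (hk : pd (Sum.inr k) h = 0) :
    ⁅vf (h * gen F (Sum.inr k)) (Sum.inr l), vf (gen F (Sum.inr l)) (Sum.inr k)⁆ =
      vf (h * gen F (Sum.inr k)) (Sum.inr k) - vf (h * gen F (Sum.inr l)) (Sum.inr l) := by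
  rw [lie_inr_vf h2 (by simp [hh]), pd_gen_self, mul_one, pd_even_mul hh, hk, zero_mul, zero_add,
    pd_gen_self, mul_one, even_comm h2 hh (gen F (Sum.inr l))]

/-- Multiplication by the even element `g` through the toral field `g (θ_d D_d - θ_s D_s)`. -/
theorem lie_toral_vf (h2 : (2 : F) ≠ 0) {g h : SAlg F m n} (hg : par g = g) {d s : Fin n}
    (hds : d ≠ s) (hgs : pd (Sum.inr s) g = 0) (hd : num (Sum.inr d) h = h)
    (hs : pd (Sum.inr s) h = 0) :
    ⁅vf (g * gen F (Sum.inr d)) (Sum.inr d) - vf (g * gen F (Sum.inr s)) (Sum.inr s),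
      vf h (Sum.inr s)⁆ = (2 : F) • vf (g * h) (Sum.inr s) := by
  rw [sub_lie, lie_inr_vf h2 (by simp [hg]), lie_inr_vf h2 (by simp [hg]), mul_assoc g,
    ← num_apply, hd, pd_even_mul hg, pd_even_mul hg, hgs, pd_gen_ne (by simpa using hds.symm),
    pd_gen_self, hs, even_comm h2 hg h, two_smul]
  simp

/-- The coefficient `h` contains `θ_d` but not `θ_s`, so the toral difference multiplies it by `g`.
Here, unlike for a field along `D_s` alone, no factor `2` appears, because the terms from `θ_s D_s`
only adjust the completing component. -/
theorem lie_toral_cf (h2 : (2 : F) ≠ 0) {g h : SAlg F m n} (hg : par g = g)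
    (hgx : ∀ i, pd (Sum.inl i) g = 0) {d s : Fin n}
    (hds : d ≠ s) (hgs : pd (Sum.inr s) g = 0) (hd : num (Sum.inr d) h = h)
    (hs : pd (Sum.inr s) h = 0) (i : Fin m) :
    ⁅vf (g * gen F (Sum.inr d)) (Sum.inr d) - vf (g * gen F (Sum.inr s)) (Sum.inr s),
      cf h i s⁆ = cf (g * h) i s := by
  have e1 : ∀ a : Fin n, pd (Sum.inl i) (g * gen F (Sum.inr a)) = 0 := fun a => by
    rw [pd_inl_mul, hgx, pd_gen_ne (by simp), zero_mul, mul_zero, add_zero]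
  have e2 : ∀ a : Fin n, par (g * gen F (Sum.inr a)) = -(g * gen F (Sum.inr a)) := fun a => by
    simp [hg]
  have e3 : pd (Sum.inr s) (gen F (Sum.inr s) * pd (Sum.inl i) h) = pd (Sum.inl i) h := by
    rw [pd_inr_theta_mul_self, ← pd_inl_comm, hs, map_zero, mul_zero, sub_zero]
  have e4 : num (Sum.inr d) (gen F (Sum.inr s) * pd (Sum.inl i) h) =
      gen F (Sum.inr s) * pd (Sum.inl i) h := by
    rw [num_inr_theta_mul_ne hds, ← pd_inl_num_inr, hd]
  have e5 : pd (Sum.inr s) (g * gen F (Sum.inr d)) = 0 := by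
    rw [pd_even_mul hg, hgs, pd_gen_ne (by simpa using hds.symm), zero_mul, mul_zero, add_zero]
  have e6 : pd (Sum.inr s) (g * gen F (Sum.inr s)) = g := by
    rw [pd_even_mul hg, hgs, pd_gen_self, zero_mul, mul_one, zero_add]
  rw [cf, sub_lie, lie_add, lie_add, lie_inr_vf h2 (e2 d), lie_inr_vf h2 (e2 s),
    lie_inr_vf h2 (e2 d), lie_inr_vf h2 (e2 s), e1, e1, e3, e5, e6, hs, mul_assoc g, mul_assoc g,
    ← num_apply, ← num_apply, hd, e4, mul_zero, mul_zero, mul_zero, vf_zero, vf_zero, vf_zero, cf,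
    mul_assoc, mul_assoc, even_comm h2 hg (gen F (Sum.inr s) * pd (Sum.inl i) h), mul_assoc,
    pd_inl_mul, hgx, zero_mul, zero_add, ← even_comm h2 hg (pd (Sum.inl i) h)]
  abel

theorem tm_mem_span_word (a : DividedPow F m) (ω : Ext F n) :
    tm a ω ∈ Submodule.span F {x : SAlg F m n | ∃ l, x = sc a * word l} := by
  have hmul : ∀ (k : Fin n) (x : SAlg F m n),
      x ∈ Submodule.span F {x : SAlg F m n | ∃ l, x = sc a * word l} →
      gen F (Sum.inr k) * x ∈ Submodule.span F {x : SAlg F m n | ∃ l, x = sc a * word l} := by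
    intro k x hx
    induction hx using Submodule.span_induction with
    | zero => simp
    | add x y _ _ hx hy => rw [mul_add]; exact add_mem hx hy
    | smul c x _ hx => rw [mul_smul_comm]; exact Submodule.smul_mem _ _ hx
    | mem x hx =>
      obtain ⟨l, rfl⟩ := hx
      refine Submodule.subset_span ⟨k :: l, ?_⟩
      rw [sc_left_comm, word_cons]
  induction ω using CliffordAlgebra.left_induction with
  | algebraMap r =>
    rw [Algebra.algebraMap_eq_smul_one, map_smul]
    exact Submodule.smul_mem _ _ (Submodule.subset_span ⟨[], by simp [sc]⟩)
  | add x y hx hy => rw [map_add]; exact add_mem hx hy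
  | ι_mul x v h =>
    have h2 : v = ∑ k, v k • (Pi.single k 1 : Fin n → F) := by
      ext j
      simp [Finset.sum_apply, Pi.single_apply]
    change tm a (ExteriorAlgebra.ι F v * x) ∈ _
    rw [h2, map_sum, Finset.sum_mul, map_sum]
    refine Submodule.sum_mem _ fun k _ => ?_
    rw [map_smul, smul_mul_assoc, map_smul]
    have := hmul k _ h
    rw [gen, tm_mul, one_mul] at this
    exact Submodule.smul_mem _ _ this

/-- Homogeneous truncated elements are combinations of words of the right length. -/
theorem mem_span_word (h2 : (2 : F) ≠ 0) {q : ℕ} {f : SAlg F m n} (hf : f ∈ trunc F p n t)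
    (hq : par f = (-1 : F) ^ q • f) :
    f ∈ Submodule.span F {x : SAlg F m n | ∃ a l, a ∈ DividedPow.truncated F p t ∧ l.Nodup ∧
      Even (l.length + q) ∧ x = sc a * word l} := by
  -- The parity projector `f ↦ f + (-1)^q par f` keeps the words of the right parity and doubles an
  -- element that is already homogeneous.
  set S := Submodule.span F {x : SAlg F m n | ∃ a l, a ∈ DividedPow.truncated F p t ∧ l.Nodup ∧
      Even (l.length + q) ∧ x = sc a * word l}
  have key : ∀ g ∈ trunc F p n t, g + (-1 : F) ^ q • par g ∈ S := by
    intro g hg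
    rw [trunc_eq_span] at hg
    induction hg using Submodule.span_induction with
    | zero => simp
    | add x y _ _ hx hy =>
      rw [map_add, smul_add, add_add_add_comm]; exact add_mem hx hy
    | smul c x _ hx =>
      rw [map_smul, smul_comm, ← smul_add]; exact Submodule.smul_mem _ _ hx
    | mem x hx =>
      obtain ⟨α, ω, hα, rfl⟩ := hx
      have h := tm_mem_span_word (monomial F α) ω
      generalize (tm (monomial F α) ω : SAlg F m n) = x at h ⊢
      induction h using Submodule.span_induction with
      | zero => simp
      | add x y _ _ hx hy =>
        rw [map_add, smul_add, add_add_add_comm]; exact add_mem hx hy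
      | smul c x _ hx =>
        rw [map_smul, smul_comm, ← smul_add]; exact Submodule.smul_mem _ _ hx
      | mem x hx =>
        obtain ⟨l, rfl⟩ := hx
        by_cases hl : l.Nodup
        · rw [map_mul, par_sc, par_word, mul_smul_comm, smul_smul, ← pow_add, add_comm q]
          rcases Nat.even_or_odd (l.length + q) with he | ho
          · rw [he.neg_one_pow, one_smul]
            have := Submodule.subset_span (R := F) (s := {x : SAlg F m n | ∃ a l,
              a ∈ DividedPow.truncated F p t ∧ l.Nodup ∧ Even (l.length + q) ∧
              x = sc a * word l}) ⟨_, l, monomial_mem_truncated hα, hl, he, rfl⟩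
            exact add_mem this this
          · rw [ho.neg_one_pow, neg_one_smul, add_neg_cancel]; exact zero_mem _
        · rw [word_eq_zero hl, mul_zero, map_zero, smul_zero, add_zero]; exact zero_mem _
  have h := key f hf
  rw [hq, smul_smul, ← mul_pow, neg_one_mul, neg_neg, one_pow, one_smul, ← two_smul F] at h
  exact (Submodule.smul_mem_iff _ h2).mp h

/-- The elements of `𝒮` on which a cocycle vanishes. -/
noncomputable def killed (p : ℕ) (t : Fin m → ℕ)
    (δ : Module.End F (Module.End F (SAlg F m n))) : Submodule F (Module.End F (SAlg F m n)) :=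
  spec F p n t ⊓ LinearMap.ker δ

variable [Fact p.Prime] [CharP F p]

theorem IsCocycle.lie_mem_killed (hδ : IsCocycle p t δ) (h2 : (2 : F) ≠ 0)
    {X Y : Module.End F (SAlg F m n)} (hX : X ∈ killed p t δ) (hY : Y ∈ killed p t δ) :
    ⁅X, Y⁆ ∈ killed p t δ :=
  ⟨spec_lie h2 hX.1 hY.1, hδ.lie_eq_zero hX.1 hX.2 hY.1 hY.2⟩

theorem IsReduced.root_mem_killed (hδ : IsReduced p t δ) (h2 : (2 : F) ≠ 0) {k l : Fin n}
    (hkl : k ≠ l) {f : DividedPow F m} (hf : f ∈ DividedPow.truncated F p t) :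
    root f k l ∈ killed p t δ := ⟨root_mem h2 hkl hf, hδ.root_eq hkl hf⟩

theorem IsReduced.theta_mem_killed (hδ : IsReduced p t δ) (h2 : (2 : F) ≠ 0) {k l : Fin n}
    (hkl : k ≠ l) : vf (gen F (Sum.inr k)) (Sum.inr l) ∈ killed p t δ := by
  have h := hδ.root_mem_killed h2 hkl one_mem_truncated
  rwa [root, sc_one, one_mul] at h

theorem IsSmall.pair_mem_killed (hδ : IsSmall p t δ) (hn : 2 < n) {k l : Fin n} (hkl : k ≠ l)
    (i : Fin m) : vf (gen F (Sum.inr k) * gen F (Sum.inr l)) (Sum.inl i) ∈ killed p t δ :=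
  ⟨pair_mem_spec hn k l i, hδ.pair_eq hkl i⟩

omit [Fact p.Prime] [CharP F p] in
theorem pd_inr_pair {a b c : Fin n} (hca : c ≠ a) (hcb : c ≠ b) :
    pd (Sum.inr c) (gen F (Sum.inr a) * gen F (Sum.inr b) : SAlg F m n) = 0 := by
  rw [pd_inr_theta_mul_ne hca, pd_gen_ne (by simpa using hcb), mul_zero, neg_zero]

omit [Fact p.Prime] [CharP F p] in
theorem pd_inl_pair (i : Fin m) (a b : Fin n) :
    pd (Sum.inl i) (gen F (Sum.inr a) * gen F (Sum.inr b) : SAlg F m n) = 0 := by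
  rw [pd_inl_theta_mul, pd_gen_ne (by simp), mul_zero]

/-- Bracketing `θ_a θ_b D_i` with `x_i θ_d D_s` gives `θ_a θ_b θ_d D_s`, and a swap with `θ_s D_d`
yields the toral difference with coefficient `θ_a θ_b`. These elements lengthen words by two
letters. -/
theorem IsSmall.toral_mem_killed (hδ : IsSmall p t δ) (h2 : (2 : F) ≠ 0) (hm : 2 < m)
    (hn : 2 < n) (ht : ∀ i, 0 < t i) {a b d s : Fin n} (hab : a ≠ b) (hda : d ≠ a) (hdb : d ≠ b)
    (hsa : s ≠ a) (hsb : s ≠ b) (hds : d ≠ s) :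
    vf (gen F (Sum.inr a) * gen F (Sum.inr b) * gen F (Sum.inr d)) (Sum.inr d) -
      vf (gen F (Sum.inr a) * gen F (Sum.inr b) * gen F (Sum.inr s)) (Sum.inr s) ∈
        killed p t δ := by
  let i : Fin m := ⟨0, by omega⟩
  have h1 := hδ.lie_mem_killed h2 (hδ.pair_mem_killed hn hab i)
    (hδ.root_mem_killed h2 hds (monomial_mem_truncated (e_lt ht i)))
  rw [root, ← gen_inl_eq_sc, lie_inl_vf h2 (by simp), pd_inr_pair hsa hsb, mul_zero, vf_zero,
    sub_zero, pd_inl_mul, pd_gen_self, pd_gen_ne (by simp), mul_zero, add_zero, one_mul] at h1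
  have h3 := hδ.lie_mem_killed h2 h1 (hδ.theta_mem_killed h2 hds.symm)
  rwa [lie_vf_swap h2 (by simp) (pd_inr_pair hda hdb)] at h3

omit [Fact p.Prime] [CharP F p] in
theorem pd_inr_sc_word {s : Fin n} {l : List (Fin n)} (h : s ∉ l) (f : DividedPow F m) :
    pd (Sum.inr s) (sc f * word l : SAlg F m n) = 0 := by
  rw [pd_inr_sc_mul, pd_inr_word h, mul_zero]

omit [Fact p.Prime] [CharP F p] in
theorem num_inr_sc_word {d : Fin n} {l : List (Fin n)} (h : d ∈ l) (f : DividedPow F m) :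
    num (Sum.inr d) (sc f * word l : SAlg F m n) = sc f * word l := by
  rw [num_inr_sc_mul, num_inr_word h]

omit [Fact p.Prime] [CharP F p] in
theorem pair_mul_sc_word (a b : Fin n) (l : List (Fin n)) (f : DividedPow F m) :
    gen F (Sum.inr a) * gen F (Sum.inr b) * (sc f * word l : SAlg F m n) =
      sc f * word (a :: b :: l) := by
  rw [sc_left_comm, word_cons, word_cons, mul_assoc]

/-- Induction in steps of two: words of length one are root elements, and toral differences with
coefficient `θ_a θ_b` add two letters. -/
theorem IsSmall.vf_word_mem_killed (hδ : IsSmall p t δ) (h2 : (2 : F) ≠ 0) (hm : 2 < m)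
    (hn : 2 < n) (ht : ∀ i, 0 < t i) {f : DividedPow F m}
    (hf : f ∈ DividedPow.truncated F p t) {s : Fin n} : ∀ l : List (Fin n), l.Nodup →
    Odd l.length → s ∉ l → vf (sc f * word l) (Sum.inr s) ∈ killed p t δ
  | [], _, h, _ => by simp at h
  | [k], _, _, hs => by
    rw [word_cons, word_nil, mul_one]
    exact hδ.root_mem_killed h2 (by simpa [eq_comm] using hs) hf
  | a :: b :: [], _, h, _ => by simp at h; exact absurd h (by decide)
  | a :: b :: d :: l, hl, ho, hs => by
    have ho' : Odd (d :: l).length := by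
      simp only [List.length_cons] at ho ⊢
      rcases ho with ⟨r, hr⟩
      exact ⟨r - 1, by omega⟩
    simp only [List.nodup_cons, List.mem_cons, not_or] at hl hs
    have ih := vf_word_mem_killed hδ h2 hm hn ht hf (s := s) (d :: l)
      (by simpa using hl.2.2) ho' (by simp [hs.2.2])
    have h := hδ.lie_mem_killed h2 (hδ.toral_mem_killed h2 hm hn ht hl.1.1 (Ne.symm hl.1.2.1)
      (Ne.symm hl.2.1.1) hs.1 hs.2.1 (Ne.symm hs.2.2.1)) ih
    rw [lie_toral_vf h2 (by simp) (Ne.symm hs.2.2.1) (pd_inr_pair hs.1 hs.2.1)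
      (num_inr_sc_word (by simp) f) (pd_inr_sc_word (by simp [hs.2.2]) f), pair_mul_sc_word] at h
    exact (Submodule.smul_mem_iff _ h2).mp h

/-- The same induction, starting with the two-letter words, which arise from the bracket of `θ_a θ_s
D_i` with `f θ_c D_s`. The empty word cannot be reached in this way and is treated separately. -/
theorem IsSmall.cf_word_mem_killed (hδ : IsSmall p t δ) (h2 : (2 : F) ≠ 0) (hm : 2 < m)
    (hn : 2 < n) (ht : ∀ i, 0 < t i) {f : DividedPow F m}
    (hf : f ∈ DividedPow.truncated F p t) (i : Fin m) {s : Fin n} : ∀ l : List (Fin n), l ≠ [] →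
    l.Nodup → Even l.length → s ∉ l → cf (sc f * word l) i s ∈ killed p t δ
  | [], h, _, _, _ => (h rfl).elim
  | [k], _, _, h, _ => by simp at h
  | [c, a], _, hl, _, hs => by
    simp only [List.nodup_cons, List.mem_cons, not_or, List.not_mem_nil, not_false_eq_true,
      or_false] at hl hs
    have h := hδ.lie_mem_killed h2 (hδ.pair_mem_killed hn (Ne.symm hs.2) i)
      (hδ.root_mem_killed h2 (Ne.symm hs.1) hf)
    rw [root, lie_inl_vf h2 (by simp), pd_inr_theta_mul_ne hs.2, pd_gen_self, mul_one,
      pd_inl_sc_mul, pd_gen_ne (by simp), mul_zero, add_zero, mul_neg, vf_neg, sub_neg_eq_add] at h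
    rw [cf, word_cons, word_cons, word_nil, mul_one, ← mul_assoc (sc f), pd_inl_mul, pd_inl_sc_mul,
      pd_gen_ne (by simp), pd_gen_ne (by simp), mul_zero, mul_zero, add_zero, add_zero]
    convert h using 1
    rw [add_comm]
    congr 2
    rw [mul_assoc, sc_left_comm, sc_left_comm, theta_mul_theta c a, mul_neg, ← mul_assoc,
      theta_mul_theta s a, neg_mul, neg_neg]
  | a :: b :: d :: l, _, hl, ho, hs => by
    have ho' : Even (d :: l).length := by
      simp only [List.length_cons] at ho ⊢
      rcases ho with ⟨r, hr⟩
      exact ⟨r - 1, by omega⟩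
    simp only [List.nodup_cons, List.mem_cons, not_or] at hl hs
    have ih := cf_word_mem_killed hδ h2 hm hn ht hf i (s := s) (d :: l) (by simp)
      (by simpa using hl.2.2) ho' (by simp [hs.2.2])
    have h := hδ.lie_mem_killed h2 (hδ.toral_mem_killed h2 hm hn ht hl.1.1 (Ne.symm hl.1.2.1)
      (Ne.symm hl.2.1.1) hs.1 hs.2.1 (Ne.symm hs.2.2.1)) ih
    rwa [lie_toral_cf h2 (by simp) (fun i => pd_inl_pair i a b) (Ne.symm hs.2.2.1)
      (pd_inr_pair hs.1 hs.2.1)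
      (num_inr_sc_word (by simp) f) (pd_inr_sc_word (by simp [hs.2.2]) f), pair_mul_sc_word] at h

end Generation

/-! ### The remaining fields `a D_i + ...` with purely even leading coefficient. -/

section Vanishing

variable {F : Type*} [Field F] {m n : ℕ} {p : ℕ} {t : Fin m → ℕ}
  {δ : Module.End F (Module.End F (SAlg F m n))}

theorem lie_pd_inl_cf (j : Fin m) (g : SAlg F m n) (i : Fin m) (s : Fin n) :
    ⁅(pd (Sum.inl j) : Module.End F (SAlg F m n)), cf g i s⁆ = cf (pd (Sum.inl j) g) i s := by
  rw [cf, lie_add, lie_pd_inl_vf, lie_pd_inl_vf, pd_inl_theta_mul, pd_inl_comm, cf]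

theorem lie_root_cf (h2 : (2 : F) ≠ 0) (h f : DividedPow F m) (k l : Fin n) (i : Fin m)
    (s : Fin n) : ⁅root h k l, (cf (sc f) i s : Module.End F (SAlg F m n))⁆ =
      root (-(f * DividedPow.partialDeriv F i h) +
        ((if l = s then 1 else 0) - (if s = k then 1 else 0) : F) •
          (h * DividedPow.partialDeriv F i f)) k l := by
  have e : ∀ P : Prop, [Decidable P] → ∀ x : SAlg F m n,
      (if P then x else 0) = (if P then (1 : F) else 0) • x := fun P _ x => by split_ifs <;> simp
  rw [cf, lie_add, root, lie_inr_vf h2 (par_sc_theta h k), lie_inr_vf h2 (par_sc_theta h k),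
    pd_inr_sc, mul_zero, vf_zero, pd_inl_sc, pd_inl_sc_mul, pd_gen_ne (by simp), mul_zero, add_zero,
    pd_inr_theta_mul, pd_inr_sc, mul_zero, sub_zero, pd_inr_sc_mul, pd_gen, root, sc_add, sc_smul,
    sub_smul, zero_sub, add_mul, vf_add, e (l = s)]
  have h1 : vf (sc h * gen F (Sum.inr k) * ((if l = s then (1 : F) else 0) •
      sc (DividedPow.partialDeriv F i f) : SAlg F m n)) (Sum.inr s) =
      vf ((if l = s then (1 : F) else 0) • (sc (h * DividedPow.partialDeriv F i f) *
        gen F (Sum.inr k) : SAlg F m n)) (Sum.inr l) := by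
    by_cases hl : l = s
    · rw [if_pos hl, one_smul, one_smul, hl, sc_mul, mul_assoc, mul_assoc, sc_comm _ (gen F _)]
    · rw [if_neg hl, zero_smul, zero_smul, mul_zero, vf_zero, vf_zero]
  have h3 : (gen F (Sum.inr s) * sc (DividedPow.partialDeriv F i f) *
      (sc h * if (Sum.inr s : Fin m ⊕ Fin n) = Sum.inr k then 1 else 0) : SAlg F m n) =
      (if s = k then (1 : F) else 0) • (sc (h * DividedPow.partialDeriv F i f) *
        gen F (Sum.inr k) : SAlg F m n) := by
    by_cases hs : s = k
    · rw [if_pos (by rw [hs]), if_pos hs, one_smul, mul_one, hs, mul_assoc, ← sc_mul, ← sc_comm,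
        mul_comm h]
    · rw [if_neg (by simpa using hs), if_neg hs, zero_smul, mul_zero, mul_zero]
  have h4 : (sc (-(f * DividedPow.partialDeriv F i h)) : SAlg F m n) =
      -(sc (f * DividedPow.partialDeriv F i h)) := by
    rw [← neg_one_smul F, sc_smul, neg_one_smul]
  rw [h1, h3, h4, sub_mul, vf_sub, neg_mul, vf_neg, smul_mul_assoc, smul_mul_assoc, sc_mul f,
    mul_assoc (sc f)]

theorem lie_pair_cf (h2 : (2 : F) ≠ 0) {k l s : Fin n} (hsk : s ≠ k) (hsl : s ≠ l) (j i : Fin m)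
    {f : SAlg F m n} :
    ⁅vf (gen F (Sum.inr k) * gen F (Sum.inr l)) (Sum.inl j), cf f i s⁆ =
      cf (gen F (Sum.inr k) * gen F (Sum.inr l) * pd (Sum.inl j) f) i s := by
  have hg : par (gen F (Sum.inr k) * gen F (Sum.inr l) : SAlg F m n) =
    gen F (Sum.inr k) * gen F (Sum.inr l) := by simp
  rw [cf, lie_add, lie_inl_vf h2 hg, lie_inl_vf h2 hg, pd_inl_pair, pd_inr_pair hsk hsl, mul_zero,
    mul_zero, vf_zero, sub_zero, sub_zero, cf, pd_even_mul hg (Sum.inl i), pd_inl_pair, zero_mul,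
    zero_add, pd_inl_theta_mul j s, pd_inl_comm j (Sum.inl i), ← mul_assoc, ← mul_assoc,
    ← even_comm h2 hg (gen F (Sum.inr s))]

theorem lie_cf_cf (h2 : (2 : F) ≠ 0) (f g : DividedPow F m) (a b : Fin m) (s : Fin n) :
    ⁅(cf (sc f) a s : Module.End F (SAlg F m n)), (cf (sc g) b s : Module.End F (SAlg F m n))⁆ =
      cf (sc (f * DividedPow.partialDeriv F a g)) b s -
        cf (sc (g * DividedPow.partialDeriv F b f)) a s := by
  have hX : (cf (sc f) a s : Module.End F (SAlg F m n)) ∈ evenField F m n :=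
    cf_mem_evenField (par_sc f) a s
  have hY : (cf (sc g) b s : Module.End F (SAlg F m n)) ∈ evenField F m n :=
    cf_mem_evenField (par_sc g) b s
  have hgen : ∀ (f : DividedPow F m) (a : Fin m) (h : DividedPow F m),
      (cf (sc f) a s : Module.End F (SAlg F m n)) (sc h) =
        sc (f * DividedPow.partialDeriv F a h) := by
    intro f a h
    rw [cf, LinearMap.add_apply, vf_apply, vf_apply, pd_inr_sc, mul_zero, add_zero, pd_inl_sc,
      sc_mul]
  have hth : ∀ (f : DividedPow F m) (a : Fin m) (k : Fin n),
      (cf (sc f) a s : Module.End F (SAlg F m n)) (gen F (Sum.inr k)) =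
        sc (if k = s then DividedPow.partialDeriv F a f else 0) * gen F (Sum.inr k) := by
    intro f a k
    rw [cf, LinearMap.add_apply, vf_gen_ne _ (by simp), vf_gen, zero_add, pd_inl_sc]
    by_cases hk : k = s
    · rw [if_pos (by rw [hk]), if_pos hk, hk, sc_comm]
    · rw [if_neg (by simpa [eq_comm] using hk), if_neg hk, sc_zero, zero_mul]
  have hinl : ∀ (f : DividedPow F m) (a i : Fin m),
      (cf (sc f) a s : Module.End F (SAlg F m n)) (gen F (Sum.inl i)) =
        sc (if a = i then f else 0) := by
    intro f a i
    rw [cf, LinearMap.add_apply, vf_gen, vf_gen_ne _ (by simp), add_zero]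
    by_cases hk : a = i
    · rw [if_pos (by rw [hk]), if_pos hk]
    · rw [if_neg (by simpa [eq_comm] using hk), if_neg hk, sc_zero]
  refine evenField.ext (evenField.lie_mem h2 hX hY) (sub_mem (cf_mem_evenField (par_sc _) _ _)
    (cf_mem_evenField (par_sc _) _ _)) fun r => ?_
  rw [lie_apply_op, LinearMap.sub_apply]
  rcases r with i | k
  · rw [hinl, hinl, hinl, hinl, hgen, hgen, ← sc_sub, ← sc_sub]
    by_cases ha : a = i <;> by_cases hb : b = i <;> simp [ha, hb]
  · rw [hth, hth, hth, hth, evenField.leibniz h2 hX, evenField.leibniz h2 hY, hgen, hgen, hth, hth]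
    by_cases hk : k = s
    · simp only [if_pos hk, DividedPow.partialDeriv_mul, DividedPow.partialDeriv_comm F b a,
        ← mul_assoc, ← sc_mul, ← add_mul, ← sub_mul, ← sc_add, ← sc_sub]
      congr 2
      ring
    · simp [if_neg hk]

theorem monomial_e_mul_partialDeriv (l : Fin m) (α : Fin m → ℕ) :
    monomial F (e l) * DividedPow.partialDeriv F l (monomial F α) = (α l : F) • monomial F α := by
  have h := num_inl_tm (F := F) (n := 0) l α 1
  rw [num_apply, pd_inl_tm, gen, tm_mul, one_mul] at h
  have h' := congrArg aug h
  rwa [map_smul, aug_tm_one, aug_tm_one] at h'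

theorem monomial_e_mul_partialDeriv_comm {h l : Fin m} (hl : l ≠ h) (x : DividedPow F m) :
    monomial F (e h) * DividedPow.partialDeriv F l x =
      DividedPow.partialDeriv F l (monomial F (e h) * x) := by
  rw [DividedPow.partialDeriv_mul, DividedPow.partialDeriv_monomial,
    if_pos (SpecialSuper.DividedPow.e_ne hl), zero_mul, zero_add]

variable [Fact p.Prime] [CharP F p]

/-- Changing the completing index alters the field by `(D_i a)(θ_s D_s - θ_s' D_s')`, a bracket of
two root elements. The value of a reduced cocycle therefore does not depend on that index. -/
theorem IsReduced.cf_sub_cf_mem_killed (hδ : IsReduced p t δ) (h2 : (2 : F) ≠ 0)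
    {a : DividedPow F m} (ha : a ∈ DividedPow.truncated F p t) (i : Fin m) (s s' : Fin n) :
    (cf (sc a) i s - cf (sc a) i s' : Module.End F (SAlg F m n)) ∈ killed p t δ := by
  by_cases hs : s = s'
  · rw [hs, sub_self]; exact zero_mem _
  · have h := hδ.lie_mem_killed h2 (hδ.root_mem_killed h2 hs
      (SpecialSuper.DividedPow.truncated_partialDeriv F p t i ha))
      (hδ.theta_mem_killed h2 (Ne.symm hs))
    rw [root, lie_vf_swap h2 (par_sc _) (pd_inr_sc _ _)] at h
    rwa [cf, cf, pd_inl_sc, ← sc_comm, ← sc_comm, add_sub_add_left_eq_sub]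

theorem trunc_sc_cf_mem_spec {a : DividedPow F m} (ha : a ∈ DividedPow.truncated F p t) (i : Fin m)
    (s : Fin n) : (cf (sc a) i s : Module.End F (SAlg F m n)) ∈ spec F p n t :=
  cf_mem_spec (trunc_sc ha) (par_sc a) (pd_inr_sc s a)

omit [Fact p.Prime] [CharP F p] in
theorem lie_num_inr_cf (h2 : (2 : F) ≠ 0) (k : Fin n) (a : DividedPow F m) (i : Fin m)
    (s : Fin n) :
    ⁅(num (Sum.inr k) : Module.End F (SAlg F m n)), (cf (sc a) i s : Module.End F (SAlg F m n))⁆ =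
      0 := by
  have h0 : ∀ b : DividedPow F m, num (Sum.inr k) (sc b : SAlg F m n) = 0 := fun b => by
    rw [num_apply, pd_inr_sc, mul_zero]
  rw [cf, lie_add, lie_num_vf h2, lie_num_vf h2, pd_inl_sc, h0, vf_zero, if_neg (by simp), sub_zero,
    zero_add]
  by_cases hs : k = s
  · rw [hs, if_pos rfl, num_inr_theta_mul_self, sub_self]
  · rw [if_neg (by simpa using hs), num_inr_theta_mul_ne hs, h0, mul_zero, vf_zero, sub_zero]

/-- If `δ` vanishes on the `D_j a D_i + ...`, then `δ (a D_i + ...)` is a combination of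
the `θ_1 ⋯ θ_n D_j`. -/
theorem IsSmall.apply_cf (hδ : IsSmall p t δ) (h2 : (2 : F) ≠ 0) (hm : 2 < m)
    (hn : 2 < n) (ht : ∀ i, 0 < t i) {a : DividedPow F m} (ha : a ∈ DividedPow.truncated F p t)
    (i : Fin m) (s : Fin n)
    (hk : ∀ j, (cf (sc (DividedPow.partialDeriv F j a)) i s : Module.End F (SAlg F m n)) ∈
      killed p t δ) :
    (∀ r j, pd (Sum.inl j) (δ (cf (sc a) i s) (gen F r)) = 0) ∧
    (∀ k, δ (cf (sc a) i s) (gen F (Sum.inr k)) = 0) ∧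
    ∀ j k, num (Sum.inr k) (δ (cf (sc a) i s) (gen F (Sum.inl j))) =
      δ (cf (sc a) i s) (gen F (Sum.inl j)) := by
  have hX := trunc_sc_cf_mem_spec (n := n) ha i s
  have hy := hδ.mem hX
  have h0 : ∀ r j, pd (Sum.inl j) (δ (cf (sc a) i s) (gen F r)) = 0 := fun r j => by
    refine hδ.pd_inl_apply_eq_zero hX (pd_inl_mem_spec hn j) ?_ r
    rw [lie_pd_inl_cf, pd_inl_sc]
    exact (hk j).2
  -- The bracket of a root element with this field is again a root element, on which the cocycle
  -- vanishes.
  have hroot : ∀ (h : DividedPow F m), h ∈ DividedPow.truncated F p t → ∀ k l : Fin n, k ≠ l →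
      ⁅root h k l, δ (cf (sc a) i s)⁆ = 0 := by
    intro h hh k l hkl
    rw [← hδ.lie_eq (root_mem h2 hkl hh) (hδ.root_eq hkl hh) hX, lie_root_cf h2]
    refine hδ.root_eq hkl (add_mem (neg_mem ?_) (Submodule.smul_mem _ _ ?_))
    · exact SpecialSuper.DividedPow.truncated_mul F p t ha
        (SpecialSuper.DividedPow.truncated_partialDeriv F p t i hh)
    · exact SpecialSuper.DividedPow.truncated_mul F p t hh
        (SpecialSuper.DividedPow.truncated_partialDeriv F p t i ha)
  refine ⟨h0, fun k => ?_, fun j k => ?_⟩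
  · refine theta_family_eq_zero h2 hn (z := fun k => δ (cf (sc a) i s) (gen F (Sum.inr k)))
      (fun i k => h0 _ i) (fun k => ?_) (fun b k hbk => ?_) (fun k l hkl => ?_) k
    · obtain ⟨b, hb, -⟩ := Fin.exists_ne_and_ne_of_two_lt k k hn
      refine (num_eq_of_sub_eq h2 (l := b) ?_).1
      rw [hδ.num_sub_apply hm ht hX k b (c := 0)
        (by rw [sub_lie, lie_num_inr_cf h2, lie_num_inr_cf h2, sub_zero, zero_smul]),
        if_pos rfl, if_neg (by simpa using hb)]
      simp
    · refine (num_eq_of_sub_eq h2 (k := k) ?_).2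
      rw [hδ.num_sub_apply hm ht hX k b (c := 0)
        (by rw [sub_lie, lie_num_inr_cf h2, lie_num_inr_cf h2, sub_zero, zero_smul]),
        if_pos rfl, if_neg (by simpa using hbk)]
      simp
    -- The completing index is moved outside `{k, l}`, so that the bracket with `θ_k θ_l D_i` is a
    -- field with a two-letter word, already known to be killed.
    · rw [← evenField.leibniz h2 hy]
      obtain ⟨s', hs1, hs2⟩ := Fin.exists_ne_and_ne_of_two_lt k l hn
      have hss : δ (cf (sc a) i s) = δ (cf (sc a) i s') := by
        rw [← sub_eq_zero, ← map_sub]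
        exact (hδ.cf_sub_cf_mem_killed h2 ha i s s').2
      have hX' := trunc_sc_cf_mem_spec (n := n) ha i s'
      have h := hδ.lie_eq (pair_mem_spec hn k l i) (hδ.pair_eq hkl i) hX'
      have hz := (hδ.cf_word_mem_killed h2 hm hn ht
        (SpecialSuper.DividedPow.truncated_partialDeriv F p t i ha) i (s := s') [k, l] (by simp)
        (by simpa using hkl) (by simp) (by simp [hs1, hs2])).2
      rw [lie_pair_cf h2 hs1 hs2, pd_inl_sc, ← sc_comm, ← mul_one (_ * gen F (Sum.inr l)),
        ← word_nil, mul_assoc, ← word_cons, ← word_cons, hz, ← hss] at h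
      have h' := LinearMap.congr_fun h (gen F (Sum.inl i))
      rwa [lie_apply_op, vf_apply, vf_gen_self, h0, mul_zero, zero_sub, LinearMap.zero_apply,
        eq_comm, neg_eq_zero, word_cons, word_cons, word_nil, mul_one] at h'
  -- Commuting with both `θ_k D_l` and `x_j θ_k D_l` gives `θ_k y(x_j) = 0` for the image field `y`,
  -- that is, `y(x_j)` is divisible by `θ_k`.
  · obtain ⟨l, hl, -⟩ := Fin.exists_ne_and_ne_of_two_lt k k hn
    have e1 := LinearMap.congr_fun (hroot 1 one_mem_truncated k l hl.symm) (gen F (Sum.inr l))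
    have e2 := LinearMap.congr_fun (hroot _ (monomial_mem_truncated (e_lt ht j)) k l hl.symm)
      (gen F (Sum.inr l))
    rw [lie_apply_op, root_gen_self, root, vf_apply, sc_one, one_mul, LinearMap.zero_apply,
      sub_eq_zero] at e1
    rw [lie_apply_op, root_gen_self, root, vf_apply, mul_assoc, e1, evenField.leibniz h2 hy,
      ← gen_inl_eq_sc, LinearMap.zero_apply, sub_add_cancel_right, neg_eq_zero,
      even_comm h2 (evenField.par_inl hy j)] at e2
    have e3 := congrArg (pd (Sum.inr k)) e2
    rw [pd_inr_theta_mul_self, map_zero, sub_eq_zero] at e3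
    exact e3.symm

end Vanishing

/-! ### Weight and degree induction, and vanishing on all of `𝒮`. -/

section Vanishing

variable {F : Type*} [Field F] {m n : ℕ} {p : ℕ} {t : Fin m → ℕ}
  {δ : Module.End F (Module.End F (SAlg F m n))}

theorem num_inl_sc_monomial (b : Fin m) (α : Fin m → ℕ) :
    num (Sum.inl b) (sc (monomial F α) : SAlg F m n) = (α b : F) • sc (monomial F α) :=
  num_inl_tm b α 1

theorem lie_num_inl_cf (h2 : (2 : F) ≠ 0) (b : Fin m) (α : Fin m → ℕ) (i : Fin m) (s : Fin n) :
    ⁅(num (Sum.inl b) : Module.End F (SAlg F m n)),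
      (cf (sc (monomial F α)) i s : Module.End F (SAlg F m n))⁆ =
      ((α b : F) - if b = i then 1 else 0) • cf (sc (monomial F α)) i s := by
  have h1 : num (Sum.inl b) (gen F (Sum.inr s) *
      sc (DividedPow.partialDeriv F i (monomial F α)) : SAlg F m n) =
      ((α b : F) - if b = i then 1 else 0) • (gen F (Sum.inr s) *
        sc (DividedPow.partialDeriv F i (monomial F α))) := by
    rw [num_apply, pd_inl_theta_mul, ← mul_assoc, gen_inl_comm, mul_assoc, ← num_apply,
      DividedPow.partialDeriv_monomial]
    split_ifs with h0 hb hb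
    · simp
    · simp
    · rw [num_inl_sc_monomial, mul_smul_comm, hb, Pi.sub_apply, SpecialSuper.DividedPow.e_same,
        Nat.cast_sub (Nat.one_le_iff_ne_zero.mpr h0), Nat.cast_one]
    · rw [num_inl_sc_monomial, mul_smul_comm, Pi.sub_apply, SpecialSuper.DividedPow.e_ne hb,
        Nat.sub_zero, sub_zero]
  rw [cf, lie_add, lie_num_vf h2, lie_num_vf h2, pd_inl_sc, h1, num_inl_sc_monomial,
    if_neg (show ¬(Sum.inl b : Fin m ⊕ Fin n) = Sum.inr s from Sum.inl_ne_inr), sub_zero, vf_smul,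
    vf_smul, smul_add]
  by_cases hb : b = i
  · rw [if_pos (by rw [hb]), if_pos hb, sub_smul _ _ (vf (sc _) _), one_smul]
  · rw [if_neg (by simpa using hb), if_neg hb, sub_zero, sub_zero]

variable [Fact p.Prime] [CharP F p]

/-- A nonzero image has a component along some `D_j` that is constant in the even variables and
divisible by every odd variable, hence fixed by every `x_b D_b + θ_s D_s`. Comparison with the
weight of `x^(α) D_i` gives the congruences on `α`. -/
theorem IsSmall.weight_of_ne_zero (hδ : IsSmall p t δ) (h2 : (2 : F) ≠ 0) (hm : 2 < m)
    (hn : 2 < n) (ht : ∀ i, 0 < t i) {α : Fin m → ℕ} (hα : ∀ i, α i < p ^ t i)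
    (i : Fin m) (s : Fin n)
    (hk : ∀ j, (cf (sc (DividedPow.partialDeriv F j (monomial F α))) i s :
      Module.End F (SAlg F m n)) ∈ killed p t δ)
    (h : δ (cf (sc (monomial F α)) i s) ≠ 0) :
    ∃ j, ∀ b, (α b : F) - (if b = i then 1 else 0) + (if b = j then 1 else 0) = 1 := by
  have ha : monomial F α ∈ DividedPow.truncated F p t := monomial_mem_truncated hα
  obtain ⟨h0, hθ, hN⟩ := hδ.apply_cf h2 hm hn ht ha i s hk
  have hX := trunc_sc_cf_mem_spec (n := n) ha i s
  obtain ⟨j, hj⟩ : ∃ j, δ (cf (sc (monomial F α)) i s) (gen F (Sum.inl j)) ≠ 0 := by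
    by_contra! hc
    refine h (evenField.ext (hδ.mem hX) (zero_mem _) fun r => ?_)
    rcases r with j | k
    · exact hc j
    · exact hθ k
  refine ⟨j, fun b => ?_⟩
  have hw := hδ.weight (torus_mem_spec ht b s) (hδ.torus_eq b s) hX
    (by rw [add_lie, lie_num_inr_cf h2, add_zero]; exact lie_num_inl_cf h2 b α i s)
    (gen F (Sum.inl j))
  rw [LinearMap.add_apply, LinearMap.add_apply, hN, num_apply, h0, mul_zero, zero_add, num_gen,
    num_gen, if_neg (show ¬(Sum.inr s : Fin m ⊕ Fin n) = Sum.inl j from Sum.inr_ne_inl),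
    add_zero] at hw
  set v := δ (cf (sc (monomial F α)) i s) (gen F (Sum.inl j)) with hv
  have hw' : ((α b : F) - (if b = i then 1 else 0) + (if b = j then 1 else 0) - 1) • v = 0 := by
    rw [sub_smul, one_smul, add_smul, sub_eq_zero]
    conv_rhs => rw [hw]
    congr 1
    by_cases hb : b = j
    · subst hb; simp [hv]
    · simp [hb]
  exact sub_eq_zero.mp ((smul_eq_zero.mp hw').resolve_right hj)

omit [Fact p.Prime] [CharP F p] in
theorem sum_monomial_sub_e_lt {α : Fin m → ℕ} {j : Fin m} (hj : α j ≠ 0) :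
    ∑ i, (α - e j) i < ∑ i, α i := by
  refine Finset.sum_lt_sum (fun i _ => Nat.sub_le _ _) ⟨j, Finset.mem_univ j, ?_⟩
  rw [Pi.sub_apply, SpecialSuper.DividedPow.e_same]
  omega

/-- The elements `x^(α) D_i + ...` are killed. -/
theorem IsSmall.cf_monomial_mem_killed (hδ : IsSmall p t δ) (h2 : (2 : F) ≠ 0) (hm : 2 < m)
    (hn : 2 < n) (ht : ∀ i, 0 < t i) (N : ℕ) : ∀ α : Fin m → ℕ, (∀ i, α i < p ^ t i) →
    ∑ i, α i = N → ∀ (i : Fin m) (s : Fin n),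
    (cf (sc (monomial F α)) i s : Module.End F (SAlg F m n)) ∈ killed p t δ := by
  induction N using Nat.strong_induction_on with
  | _ N ih =>
  intro α hα hN i s
  have hD : ∀ (j i : Fin m), (cf (sc (DividedPow.partialDeriv F j (monomial F α))) i s :
      Module.End F (SAlg F m n)) ∈ killed p t δ := by
    intro j i
    rw [DividedPow.partialDeriv_monomial]
    split_ifs with hj
    · rw [sc_zero, cf, map_zero, mul_zero, vf_zero, vf_zero, add_zero]
      exact zero_mem _
    · exact ih _ (hN ▸ sum_monomial_sub_e_lt hj) _
        (fun i => (Nat.sub_le _ _).trans_lt (hα i)) rfl i s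
  refine ⟨trunc_sc_cf_mem_spec (monomial_mem_truncated hα) i s, ?_⟩
  by_contra hne
  obtain ⟨j, hj⟩ := hδ.weight_of_ne_zero h2 hm hn ht hα i s (fun j => hD j i) hne
  -- The bracket of `x_l x_h D_h + ...` with `(D_l x^(α)) D_i + ...` is a multiple of `x^(α) D_i +
  -- ...`, with coefficient `α_l α_h`, diminished by `α_l` if `h = i`. The inequality on `α` makes
  -- the first factor have smaller degree, so both factors are killed by induction.
  have bracket : ∀ l h : Fin m, l ≠ h → l ≠ i → e l + e h + e i ≤ α →
      ((α l : F) * α h - if h = i then (α l : F) else 0) = 1 → False := by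
    intro l h hlh hli hle' hc
    have hle : e l + e h ≤ α := le_trans le_self_add hle'
    have hlt : ∑ b, (e l + e h) b < N := by
      have h1 : ∑ b, (e l + e h + e i) b ≤ N := hN ▸ Finset.sum_le_sum fun b _ => hle' b
      have h3 : ∑ b, e i b = 1 := by rw [e, Finset.sum_pi_single']; simp
      simp only [Pi.add_apply, Finset.sum_add_distrib] at h1 ⊢
      omega
    have h1 := ih _ hlt (e l + e h) (fun b => (hle b).trans_lt (hα b)) rfl h s
    have h3 := LinearMap.mem_ker.mp (hδ.lie_mem_killed h2 h1 (hD l i)).2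
    have hx : monomial F (e l + e h) = monomial F (e l) * monomial F (e h) := by
      rw [DividedPow.monomial_mul, Finset.prod_eq_one, Nat.cast_one, one_smul]
      intro b _
      by_cases hb : b = h
      · rw [hb, SpecialSuper.DividedPow.e_ne (Ne.symm hlh), Nat.choose_zero_right]
      · rw [SpecialSuper.DividedPow.e_ne hb, add_zero, Nat.choose_self]
    have e1 : monomial F (e l + e h) * DividedPow.partialDeriv F h
        (DividedPow.partialDeriv F l (monomial F α)) = ((α l : F) * α h) • monomial F α := by
      rw [hx, mul_assoc, DividedPow.partialDeriv_comm, monomial_e_mul_partialDeriv_comm hlh,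
        monomial_e_mul_partialDeriv, map_smul, mul_smul_comm, monomial_e_mul_partialDeriv,
        smul_smul, mul_comm]
    have e2 : DividedPow.partialDeriv F l (monomial F α) * DividedPow.partialDeriv F i
        (monomial F (e l + e h)) = (if h = i then (α l : F) else 0) • monomial F α := by
      rw [hx, DividedPow.partialDeriv_mul, DividedPow.partialDeriv_monomial F i (e l),
        if_pos (SpecialSuper.DividedPow.e_ne hli.symm), zero_mul, zero_add]
      split_ifs with hi
      · rw [← hi, DividedPow.partialDeriv_monomial F h (e h), if_neg (by simp [e]), tsub_self,
          ← one_eq_monomial, mul_one, mul_comm, monomial_e_mul_partialDeriv]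
      · rw [DividedPow.partialDeriv_monomial F i (e h),
          if_pos (SpecialSuper.DividedPow.e_ne (Ne.symm hi)),
          mul_zero, mul_zero, zero_smul]
    rw [lie_cf_cf h2, e1, e2] at h3
    split_ifs at h3 hc with hi
    · rw [hi, sc_smul, sc_smul, cf_smul, cf_smul, ← sub_smul, ← hi, hc, one_smul, hi] at h3
      exact hne h3
    · have hz : (cf (sc (0 : DividedPow F m)) h s : Module.End F (SAlg F m n)) = 0 := by
        rw [sc_zero, cf, map_zero, mul_zero, vf_zero, vf_zero, add_zero]
      rw [sub_zero] at hc
      rw [hc, one_smul, zero_smul, hz, sub_zero] at h3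
      exact hne h3
  -- If `j = i`, the congruences say that every exponent is `1` in `F`; with `l`, `h` and `i`
  -- distinct the coefficient is `1`.
  by_cases hij : j = i
  · subst hij
    have h1 : ∀ b, (α b : F) = 1 := fun b => by simpa using hj b
    have hpos : ∀ b, α b ≠ 0 := fun b hb => by have := h1 b; simp [hb] at this
    obtain ⟨h, hhj, -⟩ := Fin.exists_ne_and_ne_of_two_lt j j hm
    obtain ⟨l, hlj, hlh⟩ := Fin.exists_ne_and_ne_of_two_lt j h hm
    refine bracket l h hlh hlj (fun b => ?_) (by rw [if_neg hhj, h1, h1]; norm_num)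
    have := hpos b
    simp only [Pi.add_apply, e, Pi.single_apply]
    by_cases hb1 : b = l
    · rw [if_pos hb1, if_neg (hb1 ▸ hlh), if_neg (hb1 ▸ hlj)]; omega
    · rw [if_neg hb1]
      by_cases hb2 : b = h
      · rw [if_pos hb2, if_neg (hb2 ▸ hhj)]; omega
      · rw [if_neg hb2]; split_ifs <;> omega
  -- If `j ≠ i`, then `α_i` is `2` in `F` and `α_l` is `1` for the third index `l`; taking `h = i`
  -- gives the coefficient `2 - 1`. The exponent `α_i` itself is at least `2`, as it is neither `0`
  -- nor `1`.
  · have hi : (α i : F) = 2 := by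
      have := hj i
      rw [if_pos rfl, if_neg (Ne.symm hij), add_zero] at this
      linear_combination this
    obtain ⟨l, hli, hlj⟩ := Fin.exists_ne_and_ne_of_two_lt i j hm
    have hl : (α l : F) = 1 := by
      have := hj l
      rwa [if_neg hli, if_neg hlj, add_zero, sub_zero] at this
    have hl0 : α l ≠ 0 := fun h => by simp [h] at hl
    have hi0 : α i ≠ 0 := fun h => by rw [h, Nat.cast_zero] at hi; exact h2 hi.symm
    have hi1 : α i ≠ 1 := fun h => by
      rw [h, Nat.cast_one] at hi
      exact one_ne_zero (by linear_combination -hi : (1 : F) = 0)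
    refine bracket l i hli hli (fun b => ?_) (by rw [if_pos rfl, hl, hi]; norm_num)
    simp only [Pi.add_apply, e, Pi.single_apply]
    by_cases hb1 : b = l
    · rw [if_pos hb1, if_neg (hb1 ▸ hli), hb1]; omega
    · rw [if_neg hb1]
      by_cases hb2 : b = i
      · rw [if_pos hb2, hb2]; omega
      · rw [if_neg hb2]; omega

theorem IsSmall.cf_mem_killed (hδ : IsSmall p t δ) (h2 : (2 : F) ≠ 0) (hm : 2 < m)
    (hn : 2 < n) (ht : ∀ i, 0 < t i) {f : DividedPow F m}
    (hf : f ∈ DividedPow.truncated F p t) (i : Fin m) {s : Fin n} {l : List (Fin n)}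
    (hl : l.Nodup) (he : Even l.length) (hs : s ∉ l) : cf (sc f * word l) i s ∈ killed p t δ := by
  by_cases h0 : l = []
  · rw [h0, word_nil, mul_one]
    induction hf using Submodule.span_induction with
    | mem x h =>
      obtain ⟨α, hα, rfl⟩ := h
      exact hδ.cf_monomial_mem_killed h2 hm hn ht _ α hα rfl i s
    | zero => rw [sc_zero, cf, map_zero, mul_zero, vf_zero, vf_zero, add_zero]; exact zero_mem _
    | add x y _ _ hx hy => rw [sc_add, cf_add]; exact add_mem hx hy
    | smul c x _ hx => rw [sc_smul, cf_smul]; exact Submodule.smul_mem _ _ hx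
  · exact hδ.cf_word_mem_killed h2 hm hn ht hf i l h0 hl he hs

omit [Fact p.Prime] [CharP F p] in
theorem dt_swap (r s : Fin m ⊕ Fin n) (f : SAlg F m n) :
    dt r s f = -(-1 : F) ^ (tau r * tau s + tau r + tau s) • dt s r f := by
  rw [dt, dt, mul_comm (tau s), add_comm (tau s)]
  rcases tau_cases r with hr | hr <;> rcases tau_cases s with hs | hs <;>
    simp only [hr, hs] <;> norm_num
  all_goals abel

/-- If an odd index is missing from the word, it completes both components and the completing terms
cancel. If the word is full, two letters are split off and the generator is a bracket with `θ_a θ_b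
D_i`, with `a` as completing index. -/
theorem IsSmall.dt_inl_inl_mem_killed (hδ : IsSmall p t δ) (h2 : (2 : F) ≠ 0) (hm : 2 < m)
    (hn : 2 < n) (ht : ∀ i, 0 < t i) {f : DividedPow F m}
    (hf : f ∈ DividedPow.truncated F p t) (i j : Fin m) {l : List (Fin n)}
    (hl : l.Nodup) (he : Even l.length) :
    dt (Sum.inl i) (Sum.inl j) (sc f * word l) ∈ killed p t δ := by
  have hD := fun i => SpecialSuper.DividedPow.truncated_partialDeriv F p t i hf
  have hdt : ∀ h : SAlg F m n, dt (Sum.inl i) (Sum.inl j) h =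
      vf (pd (Sum.inl i) h) (Sum.inl j) - vf (pd (Sum.inl j) h) (Sum.inl i) := fun h => by
    rw [dt]; simp [tau]
  have hw : ∀ (i : Fin m) (f : DividedPow F m) (l : List (Fin n)),
      pd (Sum.inl i) (sc f * word l) = sc (DividedPow.partialDeriv F i f) * word l := fun i f l => by
    rw [pd_inl_sc_mul, pd_inl_word, mul_zero, add_zero]
  by_cases hs : ∃ s, s ∉ l
  · obtain ⟨s, hs⟩ := hs
    have h := sub_mem (hδ.cf_mem_killed h2 hm hn ht (hD i) j hl he hs)
      (hδ.cf_mem_killed h2 hm hn ht (hD j) i hl he hs)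
    rw [cf, cf, hw, hw, DividedPow.partialDeriv_comm F i j, add_sub_add_right_eq_sub] at h
    rwa [hdt, hw, hw]
  · push Not at hs
    match l, hl, he, hs with
    | [], _, _, hs => exact absurd (hs ⟨0, by omega⟩) (by simp)
    | [k], _, he, _ => simp at he
    | a :: b :: l, hl, he, _ =>
      simp only [List.nodup_cons, List.mem_cons, not_or] at hl
      have he' : Even l.length := by
        simp only [List.length_cons] at he
        rcases he with ⟨r, hr⟩
        exact ⟨r - 1, by omega⟩
      have hg : par (gen F (Sum.inr a) * gen F (Sum.inr b) : SAlg F m n) =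
        gen F (Sum.inr a) * gen F (Sum.inr b) := by simp
      have hba : pd (Sum.inr a) (gen F (Sum.inr a) * gen F (Sum.inr b) : SAlg F m n) =
          gen F (Sum.inr b) := by
        rw [pd_inr_theta_mul_self, pd_gen_ne (by simpa using hl.1.1), mul_zero, sub_zero]
      have h := hδ.lie_mem_killed h2 (hδ.pair_mem_killed hn hl.1.1 i)
        (hδ.cf_mem_killed h2 hm hn ht hf j hl.2.2 he' hl.1.2)
      have e1 : par (word l : SAlg F m n) = word l := by
        rw [par_word, he'.neg_one_pow, one_smul]
      have e3 : ∀ x : DividedPow F m, gen F (Sum.inr a) * (sc x * word l) * gen F (Sum.inr b) =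
          (gen F (Sum.inr a) * gen F (Sum.inr b) * (sc x * word l) : SAlg F m n) := by
        intro x
        rw [mul_assoc (gen F (Sum.inr a)), even_comm h2 (f := sc x * word l), mul_assoc]
        rw [map_mul, par_sc, e1]
      have e4 : ∀ x : SAlg F m n,
          gen F (Sum.inr a) * gen F (Sum.inr b) * (gen F (Sum.inr a) * x) = 0 := fun x => by
        rw [theta_mul_theta a b, neg_mul, mul_assoc, theta_theta_mul, mul_zero, neg_zero]
      rw [cf, lie_add, lie_inl_vf h2 hg, lie_inl_vf h2 hg, hba, pd_inl_pair, mul_zero, vf_zero,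
        sub_zero, pd_inl_theta_mul, e4, vf_zero, zero_sub, hw, hw, e3, pair_mul_sc_word,
        pair_mul_sc_word] at h
      rwa [hdt, hw, hw, sub_eq_add_neg]

theorem IsSmall.vf_sc_word_mem_killed (hδ : IsSmall p t δ) (h2 : (2 : F) ≠ 0) (hm : 2 < m)
    (hn : 2 < n) (ht : ∀ i, 0 < t i) {f : DividedPow F m}
    (hf : f ∈ DividedPow.truncated F p t) {k l : Fin n} {w : List (Fin n)}
    (hw : w.Nodup) (he : Even w.length) (hk : k ∈ w) (hl : k = l ∨ l ∉ w) :
    vf (pd (Sum.inr k) (sc f * word w)) (Sum.inr l) ∈ killed p t δ := by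
  have hp := List.perm_cons_erase hk
  obtain ⟨c, -, hc⟩ := word_perm (F := F) (m := m) hp
  have hw' := hp.nodup_iff.mp hw
  rw [List.nodup_cons] at hw'
  rw [hc, pd_inr_sc_mul, map_smul, pd_inr_word_cons hw'.1, mul_smul_comm, vf_smul]
  refine Submodule.smul_mem _ _ (hδ.vf_word_mem_killed h2 hm hn ht hf _ hw'.2 ?_ ?_)
  · have := hp.length_eq
    rw [List.length_cons] at this
    rw [this] at he
    exact Nat.not_even_iff_odd.mp fun h => by
      rw [Nat.even_add_one] at he; exact he h
  · rcases hl with rfl | hl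
    · exact hw'.1
    · exact fun h => hl (List.mem_of_mem_erase h)

/-- The terms are separately killed unless `k` and `l` are distinct letters of the word. In that
case the two of them form a toral difference, which comes from a swap. -/
theorem IsSmall.dt_inr_inr_mem_killed (hδ : IsSmall p t δ) (h2 : (2 : F) ≠ 0) (hm : 2 < m)
    (hn : 2 < n) (ht : ∀ i, 0 < t i) {f : DividedPow F m}
    (hf : f ∈ DividedPow.truncated F p t) (k l : Fin n) {w : List (Fin n)}
    (hw : w.Nodup) (he : Even w.length) :
    dt (Sum.inr k) (Sum.inr l) (sc f * word w) ∈ killed p t δ := by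
  have hdt : ∀ h : SAlg F m n, dt (Sum.inr k) (Sum.inr l) h =
      -(vf (pd (Sum.inr k) h) (Sum.inr l)) - vf (pd (Sum.inr l) h) (Sum.inr k) := fun h => by
    rw [dt]; simp [tau]
  have hz : ∀ (k l : Fin n), k ∉ w →
      vf (pd (Sum.inr k) (sc f * word w)) (Sum.inr l) ∈ killed p t δ := fun k l hk => by
    rw [pd_inr_sc_word hk, vf_zero]; exact zero_mem _
  rw [hdt]
  by_cases hkl : k = l
  · subst hkl
    have : vf (pd (Sum.inr k) (sc f * word w)) (Sum.inr k) ∈ killed p t δ := by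
      by_cases hk : k ∈ w
      · exact hδ.vf_sc_word_mem_killed h2 hm hn ht hf hw he hk (Or.inl rfl)
      · exact hz k k hk
    exact sub_mem (neg_mem this) this
  by_cases hk : k ∈ w
  · by_cases hl : l ∈ w
    · have hp : w.Perm (k :: l :: (w.erase k).erase l) :=
        (List.perm_cons_erase hk).trans
          ((List.perm_cons_erase ((List.mem_erase_of_ne (Ne.symm hkl)).mpr hl)).cons k)
      obtain ⟨c, -, hc⟩ := word_perm (F := F) (m := m) hp
      have hw' := hp.nodup_iff.mp hw
      simp only [List.nodup_cons, List.mem_cons, not_or] at hw'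
      set w' := (w.erase k).erase l
      have he' : Even w'.length := by
        have := hp.length_eq
        simp only [List.length_cons] at this
        rw [this] at he
        rcases he with ⟨r, hr⟩
        exact ⟨r - 1, by omega⟩
      have hh : par (sc f * word w' : SAlg F m n) = sc f * word w' := by
        rw [map_mul, par_sc, par_word, he'.neg_one_pow, one_smul]
      have hodd : vf (sc f * word w' * gen F (Sum.inr k)) (Sum.inr l) ∈ killed p t δ := by
        rw [even_comm h2 hh, sc_left_comm, ← word_cons]
        refine hδ.vf_word_mem_killed h2 hm hn ht hf _ (List.nodup_cons.mpr ⟨hw'.1.2, hw'.2.2⟩)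
          (by rw [List.length_cons]; exact he'.add_one) ?_
        simp [Ne.symm hkl, hw'.2.1]
      have h := hδ.lie_mem_killed h2 hodd (hδ.theta_mem_killed h2 (Ne.symm hkl))
      rw [lie_vf_swap h2 hh (pd_inr_sc_word hw'.1.2 f)] at h
      have e1 : pd (Sum.inr k) (sc f * word w : SAlg F m n) =
          c • (sc f * word w' * gen F (Sum.inr l)) := by
        rw [hc, pd_inr_sc_mul, map_smul, pd_inr_word_cons (by simp [hkl, hw'.1.2]), word_cons,
          mul_smul_comm, even_comm h2 hh, sc_left_comm]
      have e3 : pd (Sum.inr l) (sc f * word w : SAlg F m n) =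
          -(c • (sc f * word w' * gen F (Sum.inr k))) := by
        rw [hc, pd_inr_sc_mul, map_smul, word_cons, pd_inr_theta_mul_ne (Ne.symm hkl),
          pd_inr_word_cons hw'.2.1, mul_smul_comm, even_comm h2 hh, sc_left_comm, mul_neg, smul_neg]
      rw [e1, e3, vf_neg, sub_neg_eq_add, vf_smul, vf_smul, neg_add_eq_sub, ← smul_sub]
      exact Submodule.smul_mem _ _ h
    · exact sub_mem (neg_mem (hδ.vf_sc_word_mem_killed h2 hm hn ht hf hw he hk (Or.inr hl)))
        (hz _ _ hl)
  · by_cases hl : l ∈ w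
    · exact sub_mem (neg_mem (hz _ _ hk))
        (hδ.vf_sc_word_mem_killed h2 hm hn ht hf hw he hl (Or.inr hk))
    · exact sub_mem (neg_mem (hz _ _ hk)) (hz _ _ hl)

theorem IsSmall.dt_inl_inr_mem_killed (hδ : IsSmall p t δ) (h2 : (2 : F) ≠ 0) (hm : 2 < m)
    (hn : 2 < n) (ht : ∀ i, 0 < t i) {f : DividedPow F m}
    (hf : f ∈ DividedPow.truncated F p t) (i : Fin m) (s : Fin n) {w : List (Fin n)}
    (hw : w.Nodup) (ho : Odd w.length) :
    dt (Sum.inl i) (Sum.inr s) (sc f * word w) ∈ killed p t δ := by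
  by_cases hs : s ∈ w
  · have hp := List.perm_cons_erase hs
    obtain ⟨c, -, hc⟩ := word_perm (F := F) (m := m) hp
    have hw' := hp.nodup_iff.mp hw
    rw [List.nodup_cons] at hw'
    have he : Even (w.erase s).length := by
      have := hp.length_eq
      rw [List.length_cons] at this
      rw [this] at ho
      exact Nat.not_odd_iff_even.mp fun h => by
        rw [Nat.odd_add_one] at ho; exact ho h
    rw [hc, mul_smul_comm, dt_smul, word_cons, ← sc_left_comm,
      ← cf_eq_dt (pd_inr_sc_word hw'.1 f)]
    exact Submodule.smul_mem _ _ (hδ.cf_mem_killed h2 hm hn ht hf i hw'.2 he hw'.1)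
  · rw [dt, pd_inr_sc_word hs, vf_zero, smul_zero, sub_zero, pd_inl_sc_mul, pd_inl_word, mul_zero,
      add_zero]
    exact Submodule.smul_mem _ _ (hδ.vf_word_mem_killed h2 hm hn ht
      (SpecialSuper.DividedPow.truncated_partialDeriv F p t i hf) _ hw ho hs)

/-- A small cocycle vanishes on `𝒮`. -/
theorem IsSmall.eq_zero (hδ : IsSmall p t δ) (h2 : (2 : F) ≠ 0) (hm : 2 < m)
    (hn : 2 < n) (ht : ∀ i, 0 < t i) {X : Module.End F (SAlg F m n)} (hX : X ∈ spec F p n t) :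
    δ X = 0 := by
  suffices h : spec F p n t ≤ killed p t δ from (h hX).2
  refine Submodule.span_le.mpr ?_
  rintro _ ⟨r, s, f, hf, hq, rfl⟩
  have hf' := mem_span_word h2 hf hq
  clear hf hq
  induction hf' using Submodule.span_induction with
  | zero =>
    have h := dt_smul (F := F) (m := m) (n := n) r s 0 0
    rw [zero_smul, zero_smul] at h
    rw [h]; exact zero_mem _
  | add x y _ _ hx hy => rw [dt_add]; exact add_mem hx hy
  | smul c x _ hx => rw [dt_smul]; exact Submodule.smul_mem _ _ hx
  | mem x hx =>
    obtain ⟨a, l, ha, hl, he, rfl⟩ := hx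
    rcases r with i | k <;> rcases s with j | k'
    · exact hδ.dt_inl_inl_mem_killed h2 hm hn ht ha i j hl (by simpa [tau] using he)
    · refine hδ.dt_inl_inr_mem_killed h2 hm hn ht ha i k' hl ?_
      exact Nat.not_even_iff_odd.mp (by simpa [tau, Nat.even_add_one] using he)
    · rw [dt_swap]
      refine Submodule.smul_mem _ _ (hδ.dt_inl_inr_mem_killed h2 hm hn ht ha j k hl ?_)
      exact Nat.not_even_iff_odd.mp (by simpa [tau, Nat.even_add_one] using he)
    · refine hδ.dt_inr_inr_mem_killed h2 hm hn ht ha k k' hl ?_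
      simpa [tau, Nat.even_add] using he

/-- Every cocycle is the restriction of `ad (U + ∑ c_js D_j^(p^(s+1)))`. -/
theorem IsCocycle.exists_eq_lie (hδ : IsCocycle p t δ) (h2 : (2 : F) ≠ 0) (h3 : (3 : F) ≠ 0)
    (hm : 2 < m) (hn : 2 < n) (ht : ∀ i, 0 < t i) :
    ∃ U ∈ evenField F m n, ∃ c, ∀ X ∈ spec F p n t, δ X = ⁅U + frob p t n c, X⁆ := by
  obtain ⟨u, hu, h1⟩ := hδ.exists_isGraded h2 hm hn ht
  obtain ⟨b, c, h5⟩ := h1.exists_isReduced h2 h3 hm hn ht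
  obtain ⟨b', h6⟩ := h5.exists_isSmall h2 h3 hm hn ht
  refine ⟨-(u + thetaTorus m b + thetaTorus m b'), neg_mem (add_mem (add_mem hu (thetaTorus_mem b))
    (thetaTorus_mem b')), -c, fun X hX => ?_⟩
  have h := h6.eq_zero h2 hm hn ht hX
  have hc : frob p t n (-c) = -frob p t n c := by
    simp only [frob, Pi.neg_apply, neg_smul, Finset.sum_neg_distrib]
  simp only [LinearMap.add_apply, adl_apply] at h
  rw [hc]
  simp only [add_lie, neg_lie]
  rw [← sub_eq_zero, ← h]
  abel

end Vanishing

/-! ### Even fields that normalize `𝒮`. -/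

section Normalizer

variable {F : Type*} [Field F] {m n : ℕ} {p : ℕ} {t : Fin m → ℕ}

theorem num_inr_mem_trunc [Fact p.Prime] [CharP F p] (k : Fin n) {f : SAlg F m n}
    (hf : f ∈ trunc F p n t) : num (Sum.inr k) f ∈ trunc F p n t := by
  rw [num_apply]
  exact trunc_mul (tm_mem_trunc (fun _ => pow_pos (Fact.out : p.Prime).pos _) _) (trunc_pd _ hf)

/-- The degree in a single odd variable grades the generators, so `θ_k D_k` normalizes `𝒮` although
its divergence is not zero. -/
theorem lie_num_inr_dt (h2 : (2 : F) ≠ 0) (k : Fin n) (r s : Fin m ⊕ Fin n) (f : SAlg F m n) :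
    ⁅(num (Sum.inr k) : Module.End F (SAlg F m n)), dt r s f⁆ = dt r s (num (Sum.inr k) f) -
      ((if Sum.inr k = r then 1 else 0) + (if Sum.inr k = s then 1 else 0) : F) • dt r s f := by
  have h : ∀ r, num (Sum.inr k) (pd r f) =
      pd r (num (Sum.inr k) f) - (if Sum.inr k = r then (1 : F) else 0) • pd r f := by
    rintro (i | l)
    · rw [pd_inl_num_inr, if_neg (by simp), zero_smul, sub_zero]
    · by_cases hl : k = l
      · subst hl
        rw [num_apply, pd_inr_pd_inr, mul_zero, pd_inr_num_self, if_pos rfl, one_smul, sub_self]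
      · rw [pd_inr_num_ne (Ne.symm hl), if_neg (by simpa using hl), zero_smul, sub_zero]
  have e : ∀ P : Prop, [Decidable P] → ∀ x : Module.End F (SAlg F m n),
      (if P then x else 0) = (if P then (1 : F) else 0) • x := fun P _ x => by split_ifs <;> simp
  rw [dt, lie_sub, commutator_smul, commutator_smul, lie_num_vf h2, lie_num_vf h2, h, h, e, e, dt]
  simp only [vf_sub, vf_smul]
  module

theorem lie_num_inr_mem_spec [Fact p.Prime] [CharP F p] (h2 : (2 : F) ≠ 0) (k : Fin n)
    {X : Module.End F (SAlg F m n)} (hX : X ∈ spec F p n t) :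
    ⁅(num (Sum.inr k) : Module.End F (SAlg F m n)), X⁆ ∈ spec F p n t := by
  induction hX using Submodule.span_induction with
  | zero => rw [lie_zero]; exact zero_mem _
  | add x y _ _ hx hy => rw [lie_add]; exact add_mem hx hy
  | smul c x _ hx => rw [commutator_smul]; exact Submodule.smul_mem _ _ hx
  | mem x hx =>
    obtain ⟨r, s, f, hf, hq, rfl⟩ := hx
    rw [lie_num_inr_dt h2]
    refine sub_mem (dt_mem_spec (num_inr_mem_trunc k hf) ?_)
      (Submodule.smul_mem _ _ (dt_mem_spec hf hq))
    rw [evenField.parity_apply (num_mem _), hq, map_smul]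

theorem dv_num_inr (k : Fin n) : dv (num (Sum.inr k) : Module.End F (SAlg F m n)) = -1 := by
  have h : (num (Sum.inr k) : Module.End F (SAlg F m n)) = vf (gen F (Sum.inr k)) (Sum.inr k) :=
    LinearMap.ext fun φ => by rw [num_apply, vf_apply]
  rw [h, dv_vf, pd_gen_self]
  simp [tau]

variable [Fact p.Prime] [CharP F p]

/-- A field normalizing `𝒮` has constant divergence. -/
theorem exists_dv_eq (h2 : (2 : F) ≠ 0) (hm : 2 < m) (hn : 2 < n) (ht : ∀ i, 0 < t i)
    {U : Module.End F (SAlg F m n)}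
    (hU : U ∈ evenField F m n) (hL : ∀ X ∈ spec F p n t, ⁅U, X⁆ ∈ spec F p n t) :
    ∃ c : F, dv U = c • 1 := by
  -- Both `X` and `[U, X]` are divergence free, so the divergence of the bracket reduces to `-X (div
  -- U)`. The translations and the toral elements then force `div U` to be constant.
  have h : ∀ X ∈ spec F p n t, X (dv U) = 0 := by
    intro X hX
    have h1 := dv_lie h2 hU (spec_le hX)
    rw [dv_spec (hL X hX), dv_spec hX, map_zero, zero_sub, eq_comm, neg_eq_zero] at h1
    exact h1
  have hx : ∀ j, pd (Sum.inl j) (dv U) = 0 := fun j => h _ (pd_inl_mem_spec hn j)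
  refine eq_smul_one ?_
  rintro (j | k)
  · exact hx j
  · have h1 := h _ (torus_mem_spec ht (⟨0, by omega⟩ : Fin m) k)
    rw [LinearMap.add_apply, num_apply (Sum.inl _), hx, mul_zero, zero_add] at h1
    rw [← pd_inr_num_self, h1, map_zero]

omit [Fact p.Prime] [CharP F p] in
theorem num_inr_tm_one (k : Fin n) (ω : Ext F n) : num (Sum.inr k) (tm 1 ω : SAlg F m n) =
    tm 1 (ExteriorAlgebra.ι F (Pi.single k 1) * ctr k ω) := by
  rw [num_apply, pd_inr_tm, gen, tm_mul, one_mul]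

omit [Fact p.Prime] [CharP F p] in
theorem coeff_num_inr (β : Fin m → ℕ) (k : Fin n) (f : SAlg F m n) :
    coeff β (num (Sum.inr k) f) = ExteriorAlgebra.ι F (Pi.single k 1) * ctr k (coeff β f) := by
  rw [num_apply, coeff_theta_mul, coeff_pd_inr]

omit [Fact p.Prime] [CharP F p] in
theorem tm_one_injective {ω : Ext F n} (h : (tm 1 ω : SAlg F m n) = 0) : ω = 0 := by
  have h1 := congrArg (coeff 0) h
  rwa [one_eq_monomial, coeff_tm_monomial, if_pos rfl, map_zero] at h1

/-- The coefficients of a field normalizing `𝒮` are truncated. -/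
theorem apply_gen_mem_trunc (h2 : (2 : F) ≠ 0) (hm : 2 < m) (hn : 2 < n) (ht : ∀ i, 0 < t i)
    {U : Module.End F (SAlg F m n)} (hU : U ∈ evenField F m n)
    (hL : ∀ X ∈ spec F p n t, ⁅U, X⁆ ∈ spec F p n t) (r : Fin m ⊕ Fin n) :
    U (gen F r) ∈ trunc F p n t := by
  -- The argument for the centralizer is repeated modulo truncated coefficients.
  have hL' : ∀ X ∈ spec F p n t, ∀ r, X (U (gen F r)) - U (X (gen F r)) ∈ trunc F p n t := by
    intro X hX r
    have h := neg_mem (spec_apply_gen_mem (hL X hX) r)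
    rwa [lie_apply_op, neg_sub] at h
  have hx : ∀ j r, pd (Sum.inl j) (U (gen F r)) ∈ trunc F p n t := by
    intro j r
    have h := neg_mem (spec_apply_gen_mem (hL _ (pd_inl_mem_spec hn j)) r)
    rwa [← LinearMap.neg_apply, lie_skew, lie_pd_inl_gen hU] at h
  have hgx : ∀ a, gen F (Sum.inl a) ∈ trunc F p n t := fun a => trunc_gen ht _
  have hgt : ∀ k : Fin n, gen F (Sum.inr k) ∈ trunc F p n t := fun k => trunc_gen ht _
  rcases r with a | k
  · obtain ⟨b, hb, -⟩ := Fin.exists_ne_and_ne_of_two_lt a a hm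
    have h := hL' _ (lower_mem_spec hn ht hb.symm) (Sum.inl b)
    rw [vf_apply, vf_gen_self] at h
    exact (Submodule.sub_mem_iff_right _ (trunc_mul (hgx a) (hx b _))).mp h
  let j : Fin m := ⟨0, by omega⟩
  have hN : ∀ a k : Fin n, num (Sum.inr a) (U (gen F (Sum.inr k))) -
      (if a = k then U (gen F (Sum.inr k)) else 0) ∈ trunc F p n t := by
    intro a k
    have h := hL' _ (torus_mem_spec ht j a) (Sum.inr k)
    rw [LinearMap.add_apply, LinearMap.add_apply, num_apply (Sum.inl j), num_gen, num_gen,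
      if_neg (show ¬(Sum.inl j : Fin m ⊕ Fin n) = Sum.inr k from Sum.inl_ne_inr), zero_add,
      add_sub_assoc] at h
    have h' := (Submodule.add_mem_iff_right _ (trunc_mul (hgx j) (hx j _))).mp h
    by_cases ha : a = k
    · subst ha; simpa using h'
    · simpa [ha] using h'
  have hP : ∀ k l : Fin n, U (gen F (Sum.inr k)) * gen F (Sum.inr l) +
      gen F (Sum.inr k) * U (gen F (Sum.inr l)) ∈ trunc F p n t := by
    intro k l
    have h := hL' _ (pair_mem_spec hn k l j) (Sum.inl j)
    rw [vf_apply, vf_gen_self, evenField.leibniz h2 hU] at h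
    exact (Submodule.sub_mem_iff_right _
      (trunc_mul (trunc_mul (hgt k) (hgt l)) (hx j _))).mp h
  rw [mem_trunc_iff]
  intro β hβ
  -- For an exponent outside the box the truncated errors have zero coefficient, so the coefficients
  -- of the odd components satisfy the exact relations of `theta_family_eq_zero`.
  by_contra hbox
  have hz : ∀ f ∈ trunc F p n t, coeff β f = 0 := fun f hf => by
    by_contra h0
    exact hbox (mem_trunc_iff.mp hf β h0)
  have hN' : ∀ a k : Fin n, num (Sum.inr a) (tm 1 (coeff β (U (gen F (Sum.inr k)))) : SAlg F m n) =
      if a = k then tm 1 (coeff β (U (gen F (Sum.inr k)))) else 0 := by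
    intro a k
    have h := hz _ (hN a k)
    rw [map_sub, sub_eq_zero, coeff_num_inr] at h
    rw [num_inr_tm_one, h]
    split_ifs <;> simp
  refine hβ (tm_one_injective (m := m) (theta_family_eq_zero h2 hn
    (z := fun k => tm 1 (coeff β (U (gen F (Sum.inr k))))) (fun i k => ?_) (fun k => ?_)
    (fun a k hak => ?_) (fun k l _ => ?_) k))
  · rw [pd_inl_tm, partialDeriv_one, map_zero, LinearMap.zero_apply]
  · rw [hN', if_pos rfl]
  · rw [hN', if_neg hak]
  · have h := hz _ (hP k l)
    rw [comm_theta, map_add, coeff_theta_mul, coeff_theta_mul, coeff_par] at h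
    change tm 1 _ * gen F (Sum.inr l) + gen F (Sum.inr k) * tm 1 _ = 0
    have hθ : ∀ (k : Fin n) (ω : Ext F n), (gen F (Sum.inr k) : SAlg F m n) * tm 1 ω =
        tm 1 (ExteriorAlgebra.ι F (Pi.single k 1) * ω) := by
      intro k ω
      rw [gen, tm_mul, one_mul]
    rw [comm_theta, par_tm, hθ, hθ, ← map_add, h, map_zero]

end Normalizer

/-! ### Partial integration within the truncated algebra. -/

section PartialIntegration

variable {F : Type*} [Field F] {m n : ℕ} {p : ℕ} {t : Fin m → ℕ}

/-- Integration on the truncated algebra; its failure to invert `D_r` is measured by the top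
degree in the variable `r`. -/
noncomputable def part (p : ℕ) (t : Fin m → ℕ) : Fin m ⊕ Fin n → Module.End F (SAlg F m n)
  | Sum.inl i => up (fun a => a + 1 ≠ p ^ t i) i
  | Sum.inr k => LinearMap.mulLeft F (gen F (Sum.inr k))

theorem part_inl (i : Fin m) (f : SAlg F m n) :
    part p t (Sum.inl i) f = up (fun a => a + 1 ≠ p ^ t i) i f := rfl

theorem part_inr (k : Fin n) (f : SAlg F m n) :
    part p t (Sum.inr k) f = gen F (Sum.inr k) * f := rfl

theorem par_part (r : Fin m ⊕ Fin n) (f : SAlg F m n) :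
    par (part p t r f) = (-1 : F) ^ tau r • part p t r (par f) := by
  rcases r with i | k
  · rw [part_inl, part_inl, par_up]; simp [tau]
  · rw [part_inr, part_inr, map_mul, par_gen_inr]; simp [tau]

theorem pd_part_ne {a r : Fin m ⊕ Fin n} (h : a ≠ r) (f : SAlg F m n) :
    pd a (part p t r f) = (-1 : F) ^ (tau a * tau r) • part p t r (pd a f) := by
  rcases a with i | k <;> rcases r with j | l
  · rw [part_inl, part_inl, pd_inl_up_ne _ (by simpa using h)]; simp [tau]
  · rw [part_inr, part_inr, pd_inl_theta_mul]; simp [tau]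
  · rw [part_inl, part_inl, pd_inr_up]; simp [tau]
  · rw [part_inr, part_inr, pd_inr_theta_mul_ne (by simpa using h)]; simp [tau]

theorem up_theta_mul (P : ℕ → Prop) [DecidablePred P] (i : Fin m) (k : Fin n) (f : SAlg F m n) :
    up P i (gen F (Sum.inr k) * f) = gen F (Sum.inr k) * up P i f := by
  induction f using tm_induction with
  | ha x y hx hy => simp only [mul_add, map_add, hx, hy]
  | ht a ω => rw [gen, tm_mul, up_tm, up_tm, tm_mul, one_mul, one_mul]

theorem up_up_comm (P Q : ℕ → Prop) [DecidablePred P] [DecidablePred Q] {i j : Fin m}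
    (h : i ≠ j) (f : SAlg F m n) : up P i (up Q j f) = up Q j (up P i f) := by
  induction f using tm_monomial_induction with
  | h0 => simp
  | ha x y hx hy => simp only [map_add, hx, hy]
  | ht α ω =>
    rw [up_tm_monomial, up_tm_monomial]
    have h1 : (α + e j) i = α i := by simp [SpecialSuper.DividedPow.e_ne h]
    have h2 : (α + e i) j = α j := by simp [SpecialSuper.DividedPow.e_ne h.symm]
    by_cases hP : P (α i) <;> by_cases hQ : Q (α j) <;>
      simp [hP, hQ, up_tm_monomial, h1, h2, add_right_comm]

theorem part_comm {r s : Fin m ⊕ Fin n} (h : r ≠ s) (f : SAlg F m n) :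
    part p t r (part p t s f) = (-1 : F) ^ (tau r * tau s) • part p t s (part p t r f) := by
  rcases r with i | k <;> rcases s with j | l
  · rw [part_inl, part_inl, part_inl, part_inl, up_up_comm _ _ (by simpa using h)]; simp [tau]
  · rw [part_inr, part_inr, part_inl, part_inl, up_theta_mul]; simp [tau]
  · rw [part_inr, part_inr, part_inl, part_inl, up_theta_mul]; simp [tau]
  · rw [part_inr, part_inr, part_inr, part_inr, ← mul_assoc, theta_mul_theta, neg_mul, mul_assoc]
    simp [tau]

/-- Differentiation after partial integration in the variable `r` is a projection: it discards the
monomials with exponent `p^(t_r) - 1` in an even variable, or containing an odd one. Projections for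
different variables commute. -/
theorem pd_part_comm {r s : Fin m ⊕ Fin n} (h : r ≠ s) (f : SAlg F m n) :
    pd r (part p t r (pd s (part p t s f))) = pd s (part p t s (pd r (part p t r f))) := by
  have e1 : part p t r (pd s (part p t s f)) =
      (-1 : F) ^ (tau s * tau r) • pd s (part p t r (part p t s f)) := by
    rw [pd_part_ne h.symm, smul_smul, ← mul_pow]; simp
  have e2 : part p t s (pd r (part p t r f)) =
      (-1 : F) ^ (tau r * tau s) • pd r (part p t s (part p t r f)) := by
    rw [pd_part_ne h, smul_smul, ← mul_pow]; simp
  rw [e1, e2, map_smul, map_smul, pd_comm s r, part_comm h, map_smul, map_smul]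
  simp only [smul_smul, mul_comm (tau s), ← mul_pow]

theorem pd_pd_part {r s : Fin m ⊕ Fin n} (h : r ≠ s) (f : SAlg F m n) :
    pd r (pd s (part p t s f)) = pd s (part p t s (pd r f)) := by
  rw [pd_comm, pd_part_ne h, map_smul, smul_smul, ← mul_pow]
  simp

theorem part_mem_trunc [Fact p.Prime] [CharP F p] (r : Fin m ⊕ Fin n) {f : SAlg F m n}
    (hf : f ∈ trunc F p n t) : part p t r f ∈ trunc F p n t := by
  rcases r with i | k
  · rw [trunc_eq_span] at hf
    induction hf using Submodule.span_induction with
    | zero => rw [map_zero]; exact zero_mem _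
    | add x y _ _ hx hy => rw [map_add]; exact add_mem hx hy
    | smul c x _ hx => rw [map_smul]; exact Submodule.smul_mem _ _ hx
    | mem x hx =>
      obtain ⟨α, ω, hα, rfl⟩ := hx
      rw [part_inl, up_tm_monomial]
      split_ifs with h
      · refine tm_mem_trunc (fun j => ?_) _
        have := hα j
        by_cases hj : j = i
        · subst hj
          rw [Pi.add_apply, SpecialSuper.DividedPow.e_same]
          omega
        · rwa [Pi.add_apply, SpecialSuper.DividedPow.e_ne hj, add_zero]
      · exact zero_mem _
  · exact trunc_mul (tm_mem_trunc (fun _ => pow_pos (Fact.out : p.Prime).pos _) _) hf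

/-- A derivative of a truncated element has no term of top degree in the variable concerned, so the
projection fixes it. -/
theorem pd_part_pd (r : Fin m ⊕ Fin n) {f : SAlg F m n} (hf : f ∈ trunc F p n t) :
    pd r (part p t r (pd r f)) = pd r f := by
  rcases r with i | k
  · rw [trunc_eq_span] at hf
    induction hf using Submodule.span_induction with
    | zero => simp
    | add x y _ _ hx hy => simp only [map_add, hx, hy]
    | smul c x _ hx => simp only [map_smul, hx]
    | mem x hx =>
      obtain ⟨α, ω, hα, rfl⟩ := hx
      rw [part_inl, pd_inl_tm_monomial]
      split_ifs with h
      · simp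
      · rw [up_tm_monomial, if_pos, pd_inl_tm_monomial_add]
        have := hα i
        rw [Pi.sub_apply, SpecialSuper.DividedPow.e_same]
        omega
  · rw [part_inr, ← num_apply, pd_inr_num_self]

end PartialIntegration

/-! ### Divergence free truncated fields modulo `𝒮`. -/

section TopFields

variable {F : Type*} [Field F] {m n : ℕ} {p : ℕ} {t : Fin m → ℕ}

/-- The largest truncated exponent not involving `x_i`. -/
def maxExp (p : ℕ) (t : Fin m → ℕ) (i : Fin m) : Fin m → ℕ :=
  fun j => if j = i then 0 else p ^ t j - 1

/-- The coefficient of the field `topField`. -/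
noncomputable def topCoeff (p : ℕ) (n : ℕ) (t : Fin m → ℕ) (i : Fin m) : SAlg F m n :=
  sc (monomial F (maxExp p t i)) * top F m n

/-- The divergence free field with coefficient of top degree in all variables other than
`x_i`. -/
noncomputable def topField (p : ℕ) (n : ℕ) (t : Fin m → ℕ) (i : Fin m) :
    Module.End F (SAlg F m n) :=
  vf (topCoeff p n t i) (Sum.inl i)

theorem par_topCoeff (hn : Even n) (i : Fin m) :
    par (topCoeff p n t i : SAlg F m n) = topCoeff p n t i := by
  rw [topCoeff, map_mul, par_sc, par_top, hn.neg_one_pow, one_smul]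

theorem pd_topCoeff (i : Fin m) : pd (Sum.inl i) (topCoeff p n t i : SAlg F m n) = 0 := by
  rw [topCoeff, pd_inl_sc_mul, pd_inl_top, mul_zero, add_zero,
    SpecialSuper.DividedPow.partialDeriv_monomial, if_pos (by simp [maxExp]), sc_zero, zero_mul]

theorem topField_mem_evenField (hn : Even n) (i : Fin m) :
    topField p n t i ∈ evenField F m n :=
  vf_inl_mem_evenField (par_topCoeff hn i)

theorem maxExp_lt [Fact p.Prime] (i j : Fin m) : maxExp p t i j < p ^ t j := by
  have := pow_pos (Fact.out : p.Prime).pos (t j)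
  rw [maxExp]
  split_ifs <;> omega

theorem topCoeff_mem_trunc [Fact p.Prime] [CharP F p] (i : Fin m) :
    (topCoeff p n t i : SAlg F m n) ∈ trunc F p n t :=
  trunc_mul (trunc_sc (monomial_mem_truncated (maxExp_lt i))) (trunc_word _)

/-- Coefficient families of divergence free truncated even fields. -/
structure DivFree (p : ℕ) (t : Fin m → ℕ) (h : Fin m ⊕ Fin n → SAlg F m n) : Prop where
  mem : ∀ r, h r ∈ trunc F p n t
  parity : ∀ r, par (h r) = (-1 : F) ^ tau r • h r
  div : ∑ r, (-1 : F) ^ tau r • pd r (h r) = 0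

variable [Fact p.Prime] [CharP F p]

omit [Fact p.Prime] [CharP F p] in
theorem par_part_of {r s : Fin m ⊕ Fin n} {f : SAlg F m n} (hf : par f = (-1 : F) ^ tau r • f) :
    par (part p t s f) = (-1 : F) ^ (tau r + tau s) • part p t s f := by
  rw [par_part, hf, map_smul, smul_smul, pow_add, mul_comm]

omit [Fact p.Prime] [CharP F p] in
theorem par_pd_part {r s : Fin m ⊕ Fin n} {f : SAlg F m n} (hf : par f = (-1 : F) ^ tau r • f) :
    par (pd s (part p t s f)) = (-1 : F) ^ tau r • pd s (part p t s f) := by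
  rw [par_pd, par_part, hf, map_smul, map_smul, map_smul, smul_smul, smul_smul, ← mul_pow]
  simp

/-- The coefficient absorbing the other components of a field in the direction `s`. -/
noncomputable def absorbed (p : ℕ) (t : Fin m → ℕ) (h : Fin m ⊕ Fin n → SAlg F m n)
    (s : Fin m ⊕ Fin n) : SAlg F m n :=
  h s + ∑ r ∈ Finset.univ.erase s,
    (-1 : F) ^ (tau r + tau s + tau r * tau s) • pd r (part p t s (h r))

/-- The components that remain after absorption in the direction `s`. -/
noncomputable def remaining (p : ℕ) (t : Fin m → ℕ) (h : Fin m ⊕ Fin n → SAlg F m n)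
    (s r : Fin m ⊕ Fin n) : SAlg F m n :=
  if r = s then 0 else h r - pd s (part p t s (h r))

omit [CharP F p] [Fact p.Prime] in
theorem DivFree.sum_erase {h : Fin m ⊕ Fin n → SAlg F m n} (hh : DivFree p t h)
    (s : Fin m ⊕ Fin n) :
    ∑ r ∈ Finset.univ.erase s, (-1 : F) ^ tau r • pd r (h r) = -((-1 : F) ^ tau s • pd s (h s)) :=
  eq_neg_of_add_eq_zero_right ((Finset.add_sum_erase _ _ (Finset.mem_univ s)).trans hh.div)

omit [CharP F p] [Fact p.Prime] in
-- The projection in direction `s` is applied to the divergence equation. It commutes with `D_r` for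
-- `r ≠ s` and fixes `D_s (h_s)`.
theorem DivFree.sum_pd_pd_part {h : Fin m ⊕ Fin n → SAlg F m n} (hh : DivFree p t h)
    (s : Fin m ⊕ Fin n) :
    ∑ r ∈ Finset.univ.erase s, (-1 : F) ^ tau r • pd r (pd s (part p t s (h r))) =
      -((-1 : F) ^ tau s • pd s (h s)) := by
  have h1 := congrArg (fun f => pd s (part p t s f)) (hh.sum_erase s)
  simp only [map_sum, map_smul, map_neg, pd_part_pd s (hh.mem s)] at h1
  rw [← h1]
  exact Finset.sum_congr rfl fun r hr => by rw [pd_pd_part (Finset.ne_of_mem_erase hr)]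

theorem DivFree.remainder {h : Fin m ⊕ Fin n → SAlg F m n} (hh : DivFree p t h)
    (s : Fin m ⊕ Fin n) : DivFree p t (remaining p t h s) where
  mem r := by
    rw [remaining]
    split_ifs
    · exact zero_mem _
    · exact sub_mem (hh.mem r) (trunc_pd _ (part_mem_trunc _ (hh.mem r)))
  parity r := by
    rw [remaining]
    split_ifs
    · rw [map_zero, smul_zero]
    · rw [map_sub, hh.parity, par_pd_part (hh.parity r), smul_sub]
  div := by
    rw [← Finset.add_sum_erase _ _ (Finset.mem_univ s), remaining, if_pos rfl, map_zero,
      smul_zero, zero_add]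
    have h1 : ∀ r ∈ Finset.univ.erase s, (-1 : F) ^ tau r • pd r (remaining p t h s r) =
        (-1 : F) ^ tau r • pd r (h r) - (-1 : F) ^ tau r • pd r (pd s (part p t s (h r))) := by
      intro r hr
      rw [remaining, if_neg (Finset.ne_of_mem_erase hr), map_sub, smul_sub]
    rw [Finset.sum_congr rfl h1, Finset.sum_sub_distrib, hh.sum_erase, hh.sum_pd_pd_part, sub_self]

theorem DivFree.absorbed_mem {h : Fin m ⊕ Fin n → SAlg F m n} (hh : DivFree p t h)
    (s : Fin m ⊕ Fin n) : absorbed p t h s ∈ trunc F p n t :=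
  add_mem (hh.mem s) (Submodule.sum_mem _ fun r _ =>
    Submodule.smul_mem _ _ (trunc_pd _ (part_mem_trunc _ (hh.mem r))))

omit [Fact p.Prime] [CharP F p] in
theorem DivFree.par_absorbed {h : Fin m ⊕ Fin n → SAlg F m n} (hh : DivFree p t h)
    (s : Fin m ⊕ Fin n) : par (absorbed p t h s) = (-1 : F) ^ tau s • absorbed p t h s := by
  rw [absorbed, map_add, hh.parity, smul_add, map_sum, Finset.smul_sum]
  congr 1
  refine Finset.sum_congr rfl fun r _ => ?_
  rw [map_smul, par_pd, par_part, hh.parity, map_smul, map_smul, map_smul]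
  simp only [smul_smul]
  congr 1
  rcases tau_cases r with hr | hr <;> rcases tau_cases s with hs | hs <;> norm_num [hr, hs]

omit [CharP F p] [Fact p.Prime] in
-- The absorbed component must be divergence free by itself: its correction terms sum, by the
-- projected divergence equation, to exactly `-D_s (h_s)` after differentiation.
theorem DivFree.pd_absorbed {h : Fin m ⊕ Fin n → SAlg F m n} (hh : DivFree p t h)
    (s : Fin m ⊕ Fin n) : pd s (absorbed p t h s) = 0 := by
  have h1 : ∀ r ∈ Finset.univ.erase s,
      pd s ((-1 : F) ^ (tau r + tau s + tau r * tau s) • pd r (part p t s (h r))) =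
        (-1 : F) ^ tau s • (-1 : F) ^ tau r • pd r (pd s (part p t s (h r))) := by
    intro r _
    rw [map_smul, pd_comm, smul_smul, smul_smul]
    congr 1
    rcases tau_cases r with hr | hr <;> rcases tau_cases s with hs | hs <;> norm_num [hr, hs]
  rw [absorbed, map_add, map_sum, Finset.sum_congr rfl h1, ← Finset.smul_sum,
    hh.sum_pd_pd_part, smul_neg, smul_smul, ← mul_pow]
  simp

omit [CharP F p] [Fact p.Prime] in
theorem vf_pd_eq_dt (r s : Fin m ⊕ Fin n) (f : SAlg F m n) : vf (pd s f) r =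
    (-1 : F) ^ (tau r + tau s + tau r * tau s) • vf (pd r f) s -
      (-1 : F) ^ (tau r + tau s) • dt r s f := by
  rw [dt, smul_sub, smul_smul, smul_smul, ← mul_pow, ← pow_add]
  simp

/-- Modulo the generators `D_rs(g)` one has `D_s(g) D_r ≡ ± D_r(g) D_s`. With `g` the partial
integral of `h_r`, everything except the top degree part of `h_r` moves into the component along
`D_s`. -/
theorem DivFree.sum_sub_mem_spec {h : Fin m ⊕ Fin n → SAlg F m n} (hh : DivFree p t h)
    (s : Fin m ⊕ Fin n) :
    ∑ r, vf (h r) r - ∑ r, vf (remaining p t h s r) r - vf (absorbed p t h s) s ∈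
      spec F p n t := by
  have h1 : ∀ r ∈ Finset.univ.erase s, vf (h r) r = vf (remaining p t h s r) r +
      (vf ((-1 : F) ^ (tau r + tau s + tau r * tau s) • pd r (part p t s (h r))) s -
        (-1 : F) ^ (tau r + tau s) • dt r s (part p t s (h r))) := by
    intro r hr
    rw [vf_smul, ← vf_pd_eq_dt, remaining, if_neg (Finset.ne_of_mem_erase hr), ← vf_add,
      sub_add_cancel]
  have h2 : vf (absorbed p t h s) s = vf (h s) s + ∑ r ∈ Finset.univ.erase s,
      vf ((-1 : F) ^ (tau r + tau s + tau r * tau s) • pd r (part p t s (h r))) s := by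
    rw [absorbed, vf_add]
    congr 1
    exact map_sum (⟨⟨fun g => vf g s, vf_zero s⟩, fun f g => vf_add f g s⟩ :
      SAlg F m n →+ Module.End F (SAlg F m n)) _ _
  rw [← Finset.add_sum_erase _ _ (Finset.mem_univ s),
    ← Finset.add_sum_erase _ (fun r => vf (remaining p t h s r) r) (Finset.mem_univ s),
    Finset.sum_congr rfl h1, h2, Finset.sum_add_distrib, Finset.sum_sub_distrib,
    remaining, if_pos rfl, vf_zero]
  rw [show ∀ a b c d : Module.End F (SAlg F m n), a + (b + (c - d)) - (0 + b) - (a + c) = -d from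
    fun a b c d => by abel]
  exact neg_mem (Submodule.sum_mem _ fun r _ => Submodule.smul_mem _ _
    (dt_mem_spec (part_mem_trunc _ (hh.mem r)) (par_part_of (hh.parity r))))

/-- A divergence free field is, modulo `𝒮`, a sum of fields with one component. -/
theorem DivFree.sum_mem {N : Submodule F (Module.End F (SAlg F m n))} (hN : spec F p n t ≤ N)
    (hv : ∀ s, ∀ v ∈ trunc F p n t, par v = (-1 : F) ^ tau s • v → pd s v = 0 → vf v s ∈ N)
    (S : Finset (Fin m ⊕ Fin n)) : ∀ {h : Fin m ⊕ Fin n → SAlg F m n} (_ : DivFree p t h)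
    (_ : ∀ r, r ∉ S → h r = 0), ∑ r, vf (h r) r ∈ N := by
  induction S using Finset.induction_on with
  | empty =>
    intro h _ h0
    rw [Finset.sum_eq_zero fun r _ => by rw [h0 r (Finset.notMem_empty r), vf_zero]]
    exact zero_mem _
  | insert s S _ ih =>
    intro h hh h0
    -- Absorption empties the component at `s` and creates no new components, so the support
    -- shrinks.
    have h1 := ih (hh.remainder s) fun r hr => by
      rw [remaining]
      split_ifs with hs
      · rfl
      · rw [h0 r (by simp [hs, hr]), map_zero, map_zero, sub_zero]
    have h2 := hv s _ (hh.absorbed_mem s) (hh.par_absorbed s) (hh.pd_absorbed s)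
    have h3 := add_mem (add_mem (hN (hh.sum_sub_mem_spec s)) h2) h1
    rwa [sub_add_cancel, sub_add_cancel] at h3

/-- A field with one component can be normalized modulo `𝒮`. -/
theorem exists_normalized (i : Fin m) (S : Finset (Fin m ⊕ Fin n)) (hS : Sum.inl i ∉ S)
    {v : SAlg F m n} (hv : v ∈ trunc F p n t) (hp : par v = v) (hi : pd (Sum.inl i) v = 0) :
    ∃ w ∈ trunc F p n t, par w = w ∧ pd (Sum.inl i) w = 0 ∧
      (∀ r ∈ S, pd r (part p t r w) = 0) ∧ vf v (Sum.inl i) - vf w (Sum.inl i) ∈ spec F p n t := by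
  induction S using Finset.induction_on with
  | empty => exact ⟨v, hv, hp, hi, by simp, by rw [sub_self]; exact zero_mem _⟩
  | insert s S hs ih =>
    obtain ⟨w, hw, hwp, hwi, hwS, hvw⟩ := ih fun h => hS (Finset.mem_insert_of_mem h)
    have hsi : (Sum.inl i : Fin m ⊕ Fin n) ≠ s := fun h => hS (h ▸ Finset.mem_insert_self _ _)
    have hwp' : par w = (-1 : F) ^ tau (Sum.inl i : Fin m ⊕ Fin n) • w := by simp [tau, hwp]
    -- Independence of `x_i` leaves only one term in the generator `D_is` of the partial integral,
    -- so the part of the coefficient that is not of top degree in `s` already belongs to `𝒮`.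
    have hz : pd (Sum.inl i) (part p t s w) = 0 := by
      rw [pd_part_ne hsi, hwi, map_zero, smul_zero]
    have hd := dt_mem_spec (part_mem_trunc s hw) (par_part_of (s := s) hwp')
    rw [dt, hz, vf_zero, smul_zero, zero_sub, ← smul_neg] at hd
    refine ⟨w - pd s (part p t s w), sub_mem hw (trunc_pd _ (part_mem_trunc _ hw)), ?_, ?_, ?_, ?_⟩
    · rw [map_sub, par_pd_part hwp', hwp]; simp [tau]
    · rw [map_sub, pd_pd_part hsi, hwi, map_zero, map_zero, sub_zero]
    · intro r hr
      rw [map_sub, map_sub]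
      rcases Finset.mem_insert.mp hr with rfl | hr
      · rw [pd_part_pd _ (part_mem_trunc _ hw), sub_self]
      · have hrs : r ≠ s := fun h => hs (h ▸ hr)
        rw [hwS r hr, pd_part_comm hrs, hwS r hr, map_zero, map_zero, sub_zero]
    · have h1 : vf (pd s (part p t s w)) (Sum.inl i) ∈ spec F p n t := by
        have := neg_mem ((Submodule.smul_mem_iff _ (pow_ne_zero _ (by simp))).mp hd)
        rwa [neg_neg] at this
      rw [vf_sub, ← sub_add]
      exact add_mem hvw h1

omit [Fact p.Prime] [CharP F p] in
theorem coeff_pd_up (P : ℕ → Prop) [DecidablePred P] (j : Fin m) (β : Fin m → ℕ) (f : SAlg F m n) :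
    coeff β (pd (Sum.inl j) (up P j f)) = if P (β j) then coeff β f else 0 := by
  induction f using tm_monomial_induction with
  | h0 => simp
  | ha x y hx hy => simp only [map_add, hx, hy]; split_ifs <;> simp
  | ht α ω =>
    rw [up_tm_monomial, coeff_tm_monomial]
    by_cases hP : P (α j)
    · rw [if_pos hP, pd_inl_tm_monomial_add, coeff_tm_monomial]
      split_ifs with h1 h3 <;> simp_all
    · rw [if_neg hP, map_zero, map_zero]
      split_ifs with h1 h3 <;> simp_all

omit [CharP F p] [Fact p.Prime] in
/-- Normalized coefficients are multiples of the top one. -/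
theorem eq_smul_topCoeff (i : Fin m) {w : SAlg F m n} (hi : pd (Sum.inl i) w = 0)
    (hw : ∀ r ∈ Finset.univ.erase (Sum.inl i), pd r (part p t r w) = 0) :
    ∃ c : F, w = c • topCoeff p n t i := by
  have hβ : ∀ β, coeff β w ≠ 0 → β = maxExp p t i := by
    intro β h
    funext j
    rw [maxExp]
    split_ifs with hj
    · subst hj
      by_contra h0
      rw [← add_sub_e h0, ← coeff_pd_inl, hi, map_zero] at h
      exact h rfl
    · have h1 := congrArg (coeff β) (hw (Sum.inl j) (by simpa using hj))
      rw [part_inl, coeff_pd_up, map_zero] at h1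
      -- The projection annihilates the coefficient, so only the maximal exponent can occur in
      -- `x_j`.
      have h2 : ¬ (β j + 1 ≠ p ^ t j) := fun h3 => h (by rwa [if_pos h3] at h1)
      omega
  have hk : ∀ k : Fin n, num (Sum.inr k) w = w := by
    intro k
    have h1 := hw (Sum.inr k) (by simp)
    rw [part_inr, pd_inr_theta_mul_self, sub_eq_zero] at h1
    rw [num_apply, ← h1]
  obtain ⟨a, ha, hd⟩ := eq_top_mul_sc (m := m) (v := tm 1 (coeff (maxExp p t i) w)) fun k => by
    rw [num_inr_tm_one, ← coeff_num_inr, hk]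
  obtain ⟨c, rfl⟩ := eq_smul_one_of_partialDeriv fun j => hd j (by rw [pd_inl_tm, partialDeriv_one, map_zero, LinearMap.zero_apply])
  refine ⟨c, ?_⟩
  have h2 : w = sc (monomial F (maxExp p t i)) * tm 1 (coeff (maxExp p t i) w) := by
    refine coeff_ext fun β => ?_
    rw [sc_mul_tm, mul_one, coeff_tm_monomial]
    split_ifs with h
    · rw [h]
    · by_contra h0
      exact h (hβ β h0).symm
  rw [h2, ha, sc_smul, sc_one, mul_smul_comm, mul_one, mul_smul_comm, topCoeff]

/-- Divergence free fields with truncated coefficients lie in `𝒮` up to the top fields, which are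
even only if `n` is. -/
theorem mem_sup_span_topField (h2 : (2 : F) ≠ 0) {W : Module.End F (SAlg F m n)}
    (hW : W ∈ evenField F m n) (hT : ∀ r, W (gen F r) ∈ trunc F p n t) (hD : dv W = 0) :
    W ∈ spec F p n t ⊔ Submodule.span F
      (Set.range fun i : {_i : Fin m // Even n} => topField p n t i.1) := by
  rw [evenField.eq_sum hW]
  refine DivFree.sum_mem le_sup_left ?_ Finset.univ
    (h := fun r => W (gen F r)) ⟨hT, evenField.par_gen hW, by rwa [dv_apply] at hD⟩
    (fun r hr => absurd (Finset.mem_univ r) hr)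
  rintro (i | k) v hv hp hd
  · replace hp : par v = v := by simpa [tau] using hp
    obtain ⟨w, -, hwp, hwi, hwr, hvw⟩ := exists_normalized i _ (Finset.notMem_erase _ _) hv hp hd
    obtain ⟨c, rfl⟩ := eq_smul_topCoeff i hwi hwr
    rw [← sub_add_cancel (vf v _) (vf (c • topCoeff p n t i) (Sum.inl i))]
    refine add_mem (Submodule.mem_sup_left hvw) ?_
    rcases Nat.even_or_odd n with he | ho
    · rw [vf_smul]
      exact Submodule.mem_sup_right (Submodule.smul_mem _ _ (Submodule.subset_span ⟨⟨i, he⟩, rfl⟩))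
    -- For odd `n` the top coefficient is odd; being also even, the normalized coefficient is zero.
    · have h0 : par (c • topCoeff p n t i : SAlg F m n) = -(c • topCoeff p n t i) := by
        rw [map_smul, topCoeff, map_mul, par_sc, par_top, ho.neg_one_pow, neg_one_smul, mul_neg,
          smul_neg]
      rw [hwp, eq_neg_iff_add_eq_zero, ← two_smul F, smul_eq_zero_iff_right h2] at h0
      rw [h0, vf_zero]
      exact zero_mem _
  · exact Submodule.mem_sup_left (vf_inr_mem_spec h2 hv (by simpa [tau] using hp) hd)

end TopFields

/-! ### A Berezin type integral separating the top fields from `𝒮`. -/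

section Integral

variable {F : Type*} [Field F] {m n : ℕ} {p : ℕ} {t : Fin m → ℕ}

/-- The iterated odd derivative along a list of odd indices. -/
noncomputable def iterPd : List (Fin n) → Module.End F (SAlg F m n)
  | [] => LinearMap.id
  | k :: l => iterPd l ∘ₗ pd (Sum.inr k)

theorem iterPd_cons (k : Fin n) (l : List (Fin n)) (f : SAlg F m n) :
    iterPd (k :: l) f = iterPd l (pd (Sum.inr k) f) := rfl

theorem iterPd_word : ∀ {l : List (Fin n)} (_ : l.Nodup), iterPd l (word l : SAlg F m n) = 1
  | [], _ => rfl
  | k :: l, h => by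
    rw [iterPd_cons, pd_inr_word_cons (List.nodup_cons.mp h).1,
      iterPd_word (List.nodup_cons.mp h).2]

theorem iterPd_pd_inr {k : Fin n} : ∀ {l : List (Fin n)} (_ : k ∈ l) (f : SAlg F m n),
    iterPd l (pd (Sum.inr k) f) = 0
  | a :: l, h, f => by
    rw [iterPd_cons]
    by_cases hk : a = k
    · rw [hk, pd_inr_pd_inr, map_zero]
    · have hl : k ∈ l := (List.mem_cons.mp h).resolve_left (Ne.symm hk)
      rw [pd_inr_comm, map_neg, iterPd_pd_inr hl, neg_zero]

theorem iterPd_pd_inl (i : Fin m) : ∀ (l : List (Fin n)) (f : SAlg F m n),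
    iterPd l (pd (Sum.inl i) f) = pd (Sum.inl i) (iterPd l f)
  | [], _ => rfl
  | k :: l, f => by rw [iterPd_cons, iterPd_cons, ← pd_inl_comm, iterPd_pd_inl i l]

theorem iterPd_sc_mul (a : DividedPow F m) : ∀ (l : List (Fin n)) (f : SAlg F m n),
    iterPd l (sc a * f) = sc a * iterPd l f
  | [], _ => rfl
  | k :: l, f => by rw [iterPd_cons, iterPd_cons, pd_inr_sc_mul, iterPd_sc_mul a l]

theorem iterPd_mem_trunc : ∀ (l : List (Fin n)) {f : SAlg F m n} (_ : f ∈ trunc F p n t),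
    iterPd l f ∈ trunc F p n t
  | [], _, h => h
  | _ :: l, _, h => iterPd_mem_trunc l (trunc_pd _ h)

/-- The Berezin type integral: the coefficient of the top element of the truncated algebra. -/
noncomputable def integral (p : ℕ) (t : Fin m → ℕ) : SAlg F m n →ₗ[F] F :=
  ExteriorAlgebra.algebraMapInv.toLinearMap ∘ₗ coeff (fun i => p ^ t i - 1) ∘ₗ
    iterPd (List.finRange n)

theorem integral_apply (f : SAlg F m n) : integral p t f =
    ExteriorAlgebra.algebraMapInv (coeff (fun i => p ^ t i - 1) (iterPd (List.finRange n) f)) := rfl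

/-- Integrating a derivative reads a coefficient that cannot occur: exponent `p^(t_i)` in an even
variable, or a repeated odd derivative. -/
theorem integral_pd (r : Fin m ⊕ Fin n) {f : SAlg F m n} (hf : f ∈ trunc F p n t) :
    integral p t (pd r f) = 0 := by
  rcases r with i | k
  · rw [integral_apply, iterPd_pd_inl, coeff_pd_inl]
    by_contra h
    have h1 := mem_trunc_iff.mp (iterPd_mem_trunc (List.finRange n) hf) _
      (fun h0 => h (by rw [h0, map_zero])) i
    rw [Pi.add_apply, SpecialSuper.DividedPow.e_same] at h1
    omega
  · rw [integral_apply, iterPd_pd_inr (List.mem_finRange k), map_zero, map_zero]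

theorem integral_sc_mul_top :
    integral p t (sc (monomial F (fun i => p ^ t i - 1)) * top F m n) = 1 := by
  rw [integral_apply, iterPd_sc_mul, top, iterPd_word (List.nodup_finRange n), mul_one, sc,
    coeff_tm_monomial, if_pos rfl, map_one]

variable [Fact p.Prime] [CharP F p]

omit [CharP F p] [Fact p.Prime] in
-- The value of a generator is a sum of two total derivatives. Only the products `f · D_r g` and `f
-- · D_s g` need to be truncated, not `g` itself; this allows the test element `x_i^(p^(t_i))`.
theorem integral_dt (r s : Fin m ⊕ Fin n) {f g : SAlg F m n}
    (hp : par f = (-1 : F) ^ (tau r + tau s) • f)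
    (hr : f * pd r g ∈ trunc F p n t) (hs : f * pd s g ∈ trunc F p n t) :
    integral p t (dt r s f g) = 0 := by
  have h : dt r s f g = (-1 : F) ^ (tau r * tau s) • pd r (f * pd s g) -
      (-1 : F) ^ (tau r + tau s) • pd s (f * pd r g) := by
    rw [pd_mul, pd_mul, par_pow_of_eq hp, par_pow_of_eq hp, dt, pd_comm s r, LinearMap.sub_apply,
      LinearMap.smul_apply, LinearMap.smul_apply, vf_apply, vf_apply]
    simp only [smul_add, smul_mul_assoc, mul_smul_comm, smul_smul]
    rcases tau_cases r with hr | hr <;> rcases tau_cases s with hs | hs <;>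
      norm_num [hr, hs]
  rw [h, map_sub, map_smul, map_smul, integral_pd r hs, integral_pd s hr, smul_zero, smul_zero,
    sub_zero]

theorem integral_spec {X : Module.End F (SAlg F m n)} (hX : X ∈ spec F p n t)
    {f : SAlg F m n} (hf : f ∈ trunc F p n t) : integral p t (X f) = 0 := by
  induction hX using Submodule.span_induction with
  | zero => simp
  | add x y _ _ hx hy => rw [LinearMap.add_apply, map_add, hx, hy, add_zero]
  | smul c x _ hx => rw [LinearMap.smul_apply, map_smul, hx, smul_zero]
  | mem x hx =>
    obtain ⟨r, s, g, hg, hq, rfl⟩ := hx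
    exact integral_dt r s hq (trunc_mul hg (trunc_pd _ hf)) (trunc_mul hg (trunc_pd _ hf))

theorem integral_topField (i : Fin m) {f : SAlg F m n} (hf : f ∈ trunc F p n t) :
    integral p t (topField p n t i f) = 0 := by
  have h : topField p n t i f = pd (Sum.inl i) (topCoeff p n t i * f) := by
    rw [pd_inl_mul, pd_topCoeff, zero_mul, zero_add, topField, vf_apply]
  rw [h, integral_pd _ (trunc_mul (topCoeff_mem_trunc i) hf)]

/-- The element `x_i ^ (p ^ t_i)`, just outside of the truncated algebra. -/
noncomputable def excess (F : Type*) [Field F] {m : ℕ} (p n : ℕ) (t : Fin m → ℕ) (i : Fin m) :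
    SAlg F m n :=
  sc (monomial F (Pi.single i (p ^ t i)))

omit [Fact p.Prime] [CharP F p] in
theorem pd_excess_ne {i : Fin m} {r : Fin m ⊕ Fin n} (h : r ≠ Sum.inl i) :
    pd r (excess F p n t i) = 0 := by
  rcases r with j | k
  · rw [excess, pd_inl_sc, SpecialSuper.DividedPow.partialDeriv_monomial, if_pos, sc_zero]
    exact Pi.single_eq_of_ne (fun h1 => h (by rw [h1])) _
  · rw [excess, pd_inr_sc]

omit [CharP F p] in
theorem pd_excess_self (i : Fin m) : pd (Sum.inl i) (excess F p n t i) =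
    sc (monomial F (Pi.single i (p ^ t i - 1))) := by
  have := pow_pos (Fact.out : p.Prime).pos (t i)
  rw [excess, pd_inl_sc, SpecialSuper.DividedPow.partialDeriv_monomial,
    if_neg (by rw [Pi.single_eq_same]; omega)]
  congr 2
  funext j
  by_cases hj : j = i
  · subst hj; simp [e]
  · simp [e, hj]

omit [CharP F p] in
theorem pd_excess_mem_trunc (i : Fin m) (r : Fin m ⊕ Fin n) :
    pd r (excess F p n t i) ∈ trunc F p n t := by
  by_cases h : r = Sum.inl i
  · subst h
    rw [pd_excess_self]
    refine trunc_sc (monomial_mem_truncated fun j => ?_)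
    have := pow_pos (Fact.out : p.Prime).pos (t j)
    by_cases hj : j = i
    · subst hj; rw [Pi.single_eq_same]; omega
    · rwa [Pi.single_eq_of_ne hj]
  · rw [pd_excess_ne h]; exact zero_mem _

/-- The derivatives of `x_i^(p^(t_i))` are truncated although the element is not. The resulting
functional vanishes on `𝒮` but equals `1` on the top field along `D_i`. -/
theorem integral_spec_excess {X : Module.End F (SAlg F m n)}
    (hX : X ∈ spec F p n t) (i : Fin m) : integral p t (X (excess F p n t i)) = 0 := by
  induction hX using Submodule.span_induction with
  | zero => simp
  | add x y _ _ hx hy => rw [LinearMap.add_apply, map_add, hx, hy, add_zero]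
  | smul c x _ hx => rw [LinearMap.smul_apply, map_smul, hx, smul_zero]
  | mem x hx =>
    obtain ⟨r, s, g, hg, hq, rfl⟩ := hx
    exact integral_dt r s hq (trunc_mul hg (pd_excess_mem_trunc i _))
      (trunc_mul hg (pd_excess_mem_trunc i _))

omit [CharP F p] in
theorem integral_topField_excess (i j : Fin m) :
    integral p t (topField p n t j (excess F p n t i)) = if i = j then 1 else 0 := by
  rw [topField, vf_apply]
  split_ifs with h
  · subst h
    rw [pd_excess_self, ← integral_sc_mul_top (F := F) (n := n) (p := p) (t := t), topCoeff,
      mul_assoc, ← sc_comm, ← mul_assoc, ← sc_mul, SpecialSuper.DividedPow.monomial_mul]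
    have h1 : maxExp p t i + Pi.single i (p ^ t i - 1) = fun j => p ^ t j - 1 := by
      funext j
      by_cases hj : j = i
      · subst hj; simp [maxExp]
      · simp [maxExp, hj]
    have h2 : ∏ a, (maxExp p t i a + (Pi.single i (p ^ t i - 1) : Fin m → ℕ) a).choose
        (maxExp p t i a) = 1 := by
      refine Finset.prod_eq_one fun a _ => ?_
      by_cases ha : a = i
      · subst ha; simp [maxExp]
      · simp [ha]
    rw [h1, h2, Nat.cast_one, one_smul]
  · rw [pd_excess_ne (fun h1 => h (Sum.inl_injective h1).symm), mul_zero, map_zero]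

theorem topField_apply_gen_mem (i : Fin m) (r : Fin m ⊕ Fin n) :
    (topField p n t i : Module.End F (SAlg F m n)) (gen F r) ∈ trunc F p n t := by
  rw [topField, vf_gen]
  split_ifs
  · exact topCoeff_mem_trunc i
  · exact zero_mem _

omit [Fact p.Prime] [CharP F p] in
theorem dv_topField (i : Fin m) : dv (topField p n t i : Module.End F (SAlg F m n)) = 0 := by
  rw [topField, dv_vf, pd_topCoeff, smul_zero]

theorem evenField_apply_mem_trunc {X : Module.End F (SAlg F m n)} (hX : X ∈ evenField F m n)
    (hT : ∀ r, X (gen F r) ∈ trunc F p n t) {f : SAlg F m n}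
    (hf : ∀ r, pd r f ∈ trunc F p n t) : X f ∈ trunc F p n t := by
  rw [evenField.apply_eq_sum hX]
  exact Submodule.sum_mem _ fun r _ => trunc_mul (hT r) (hf r)

omit [CharP F p] [Fact p.Prime] in
theorem exists_mem_spec_of_mem_sup {W : Module.End F (SAlg F m n)}
    (hW : W ∈ spec F p n t ⊔ Submodule.span F
      (Set.range fun i : {_i : Fin m // Even n} => topField p n t i.1)) :
    ∃ d : {_i : Fin m // Even n} → F, W - ∑ i, d i • topField p n t i.1 ∈ spec F p n t := by
  obtain ⟨X, hX, Y, hY, rfl⟩ := Submodule.mem_sup.mp hW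
  obtain ⟨d, rfl⟩ := (Submodule.mem_span_range_iff_exists_fun F).mp hY
  exact ⟨d, by rwa [add_sub_cancel_right]⟩

omit [CharP F p] in
theorem integral_sum_topField (d : {_i : Fin m // Even n} → F) (i : {_i : Fin m // Even n}) :
    integral p t ((∑ j, d j • topField p n t j.1 : Module.End F (SAlg F m n))
      (excess F p n t i.1)) = d i := by
  rw [LinearMap.sum_apply, map_sum, Finset.sum_eq_single i]
  · rw [LinearMap.smul_apply, map_smul, integral_topField_excess, if_pos rfl, smul_eq_mul, mul_one]
  · intro j _ hj
    rw [LinearMap.smul_apply, map_smul, integral_topField_excess,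
      if_neg (fun h => hj (Subtype.ext h.symm)), smul_zero]
  · simp

/-- The bracket is truncated and divergence free, so it lies in `𝒮` up to top fields. Their
coefficients are read off by the integral and vanish, since both operators send the test element
into the truncated algebra, on which their integrals are zero. -/
theorem lie_topField_mem_spec (h2 : (2 : F) ≠ 0) (hn : Even n) (i : Fin m)
    {X : Module.End F (SAlg F m n)} (hX : X ∈ spec F p n t) :
    ⁅(topField p n t i : Module.End F (SAlg F m n)), X⁆ ∈ spec F p n t := by
  have hE := topField_mem_evenField (F := F) (p := p) (t := t) hn i
  have hXt := spec_apply_gen_mem hX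
  have hUt := topField_apply_gen_mem (F := F) (m := m) (n := n) (p := p) (t := t) i
  obtain ⟨d, hd⟩ := exists_mem_spec_of_mem_sup (F := F) (mem_sup_span_topField (p := p) (t := t) h2
    (evenField.lie_mem h2 hE (spec_le hX)) (fun r => by
      rw [lie_apply_op]
      exact sub_mem (evenField_apply_mem_trunc hE hUt fun s => trunc_pd _ (hXt r))
        (evenField_apply_mem_trunc (spec_le hX) hXt fun s => trunc_pd _ (hUt r)))
    (by rw [dv_lie h2 hE (spec_le hX), dv_spec hX, dv_topField, map_zero, map_zero, sub_zero]))
  have hz : d = 0 := by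
    funext j
    have h1 := integral_spec_excess (F := F) hd j.1
    rw [LinearMap.sub_apply, map_sub, integral_sum_topField, lie_apply_op, map_sub,
      integral_topField i (evenField_apply_mem_trunc (spec_le hX) hXt (pd_excess_mem_trunc j.1)),
      integral_spec hX (evenField_apply_mem_trunc hE hUt (pd_excess_mem_trunc j.1)),
      sub_zero, zero_sub, neg_eq_zero] at h1
    exact h1
  rw [hz] at hd
  simpa using hd

end Integral

/-! ### Brackets and independence of the outer fields. -/

section OuterFields

variable {F : Type*} [Field F] {m n : ℕ} {p : ℕ} {t : Fin m → ℕ}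

theorem top_mul_top (hn : 0 < n) : top F m n * top F m n = 0 := by
  have h : top F m n = gen F (Sum.inr ⟨0, hn⟩) * pd (Sum.inr ⟨0, hn⟩) (top F m n) := by
    rw [← num_apply, num_inr_top]
  nth_rewrite 1 [h]
  rw [theta_comm, mul_assoc, theta_mul_top, mul_zero]

/-- Even derivatives do not touch the odd part, and the square of the full odd product is zero. -/
theorem topCoeff_mul_pd (hn : 0 < n) (i j a : Fin m) :
    topCoeff p n t i * pd (Sum.inl a) (topCoeff p n t j) = (0 : SAlg F m n) := by
  rw [topCoeff, topCoeff, pd_inl_sc_mul, pd_inl_top, mul_zero, add_zero, mul_assoc,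
    ← mul_assoc (top F m n), ← sc_comm, mul_assoc (sc _), top_mul_top hn, mul_zero, mul_zero]

theorem lie_topField_topField (h2 : (2 : F) ≠ 0) (hn : 0 < n) (he : Even n) (i j : Fin m) :
    ⁅(topField p n t i : Module.End F (SAlg F m n)), (topField p n t j : Module.End F (SAlg F m n))⁆ = 0 := by
  rw [topField, topField, lie_inl_vf h2 (par_topCoeff he i), topCoeff_mul_pd hn,
    topCoeff_mul_pd hn, vf_zero, vf_zero, sub_zero]

theorem lie_num_topField (h2 : (2 : F) ≠ 0) (k : Fin n) (i : Fin m) :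
    ⁅(num (Sum.inr k) : Module.End F (SAlg F m n)), (topField p n t i : Module.End F (SAlg F m n))⁆ =
      topField p n t i := by
  rw [topField, lie_num_vf h2, if_neg (by simp), sub_zero, topCoeff, num_inr_sc_mul, num_inr_top]

variable [Fact p.Prime] [CharP F p]

theorem lie_frob_num (k : Fin n) (c : (Σ j, Fin (t j - 1)) → F) :
    ⁅frob p t n c, (num (Sum.inr k) : Module.End F (SAlg F m n))⁆ = 0 :=
  lie_frob_eq_zero c fun j => by rw [lie_pd_inl_num, if_neg (by simp), lie_zero]

/-- Already the first bracket of a top field with `D_j` is in `𝒮`, and the remaining ones stay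
there. -/
theorem lie_frob_topField_mem (h2 : (2 : F) ≠ 0) (hn : 2 < n) (he : Even n)
    (c : (Σ j, Fin (t j - 1)) → F) (i : Fin m) :
    ⁅(frob p t n c : Module.End F (SAlg F m n)), topField p n t i⁆ ∈ spec F p n t := by
  rw [lie_frob]
  refine Submodule.sum_mem _ fun x _ => Submodule.smul_mem _ _ ?_
  obtain ⟨k, hk⟩ := Nat.exists_eq_succ_of_ne_zero
    (pow_pos (Fact.out : p.Prime).pos (x.2.1 + 1)).ne'
  rw [hk, pow_succ, Module.End.mul_apply, adl_apply]
  refine adl_pd_pow_mem x.1 (fun X hX => spec_lie h2 (pd_inl_mem_spec hn x.1) hX) k ?_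
  rw [← lie_skew]
  exact neg_mem (lie_topField_mem_spec h2 he i (pd_inl_mem_spec hn x.1))

omit [Fact p.Prime] [CharP F p] in
theorem lie_frob_frob (c c' : (Σ j, Fin (t j - 1)) → F) :
    ⁅(frob p t n c : Module.End F (SAlg F m n)), frob p t n c'⁆ = 0 := by
  have h : ∀ i j : Fin m, Commute (pd (Sum.inl i) : Module.End F (SAlg F m n)) (pd (Sum.inl j)) :=
    fun i j => LinearMap.ext fun f => pd_inl_comm i (Sum.inl j) f
  rw [Ring.lie_def, sub_eq_zero, frob, frob]
  exact Commute.sum_left _ _ _ fun x _ => Commute.sum_right _ _ _ fun y _ =>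
    (((h x.1 y.1).pow_pow _ _).smul_right _).smul_left _

/-- A field normalizing `𝒮` is a combination of a degree operator, top fields, and an element of
`𝒮`. -/
theorem exists_eq_of_normalizes (h2 : (2 : F) ≠ 0) (hm : 2 < m) (hn : 2 < n)
    (ht : ∀ i, 0 < t i) (k : Fin n) {U : Module.End F (SAlg F m n)} (hU : U ∈ evenField F m n)
    (hL : ∀ X ∈ spec F p n t, ⁅U, X⁆ ∈ spec F p n t) :
    ∃ (c : F) (d : {_i : Fin m // Even n} → F),
      U - (c • num (Sum.inr k) + ∑ i, d i • topField p n t i.1) ∈ spec F p n t := by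
  obtain ⟨c, hc⟩ := exists_dv_eq h2 hm hn ht hU hL
  -- Since `θ_k D_k` has divergence `-1`, its coefficient is minus the constant divergence of the
  -- field.
  obtain ⟨d, hd⟩ := exists_mem_spec_of_mem_sup (mem_sup_span_topField (p := p) (t := t) h2
    (W := U - (-c) • num (Sum.inr k)) (sub_mem hU (Submodule.smul_mem _ _ (num_mem _)))
    (fun r => by
      rw [LinearMap.sub_apply, LinearMap.smul_apply, num_gen]
      refine sub_mem (apply_gen_mem_trunc h2 hm hn ht hU hL r) (Submodule.smul_mem _ _ ?_)
      split_ifs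
      · exact trunc_gen ht _
      · exact zero_mem _)
    (by rw [map_sub, map_smul, hc, dv_num_inr]; module))
  exact ⟨-c, d, by rwa [sub_add_eq_sub_sub]⟩

/-- The outer fields are linearly independent as outer derivations. -/
theorem outer_independent (h2 : (2 : F) ≠ 0) (hm : 2 < m) (hn : 2 < n)
    (ht : ∀ i, 0 < t i) (k : Fin n) (c : F) (b : (Σ j, Fin (t j - 1)) → F)
    (d : {_i : Fin m // Even n} → F) {X : Module.End F (SAlg F m n)} (hX : X ∈ spec F p n t)
    (h : ∀ Y ∈ spec F p n t,
      ⁅c • num (Sum.inr k) + frob p t n b + ∑ i, d i • topField p n t i.1 + X, Y⁆ = 0) :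
    c = 0 ∧ b = 0 ∧ d = 0 := by
  obtain ⟨z, hz⟩ : ∃ z, z = c • num (Sum.inr k) + ∑ i, d i • topField p n t i.1 + X := ⟨_, rfl⟩
  have hE : z ∈ evenField F m n := by
    rw [hz]
    exact add_mem (add_mem (Submodule.smul_mem _ _ (num_mem _)) (Submodule.sum_mem _ fun i _ =>
      Submodule.smul_mem _ _ (topField_mem_evenField i.2 i.1))) (spec_le hX)
  have h' : ∀ Y ∈ spec F p n t, ⁅z, Y⁆ + ⁅frob p t n b, Y⁆ = 0 := by
    intro Y hY
    rw [← h Y hY, ← add_lie, hz]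
    congr 1
    abel
  -- On elements with vanishing second brackets by the translations the Frobenius part is invisible,
  -- so there the vector field part `z` commutes by itself. Enough such elements exist to conclude
  -- `z = 0`.
  have hc : ∀ Y ∈ spec F p n t, (∀ j, ⁅(pd (Sum.inl j) : Module.End F (SAlg F m n)),
      ⁅(pd (Sum.inl j) : Module.End F (SAlg F m n)), Y⁆⁆ = 0) → ⁅Y, z⁆ = 0 := by
    intro Y hY hj
    have h1 := h' Y hY
    rwa [lie_frob_eq_zero b hj, add_zero, ← lie_skew, neg_eq_zero] at h1
  have z0 : z = 0 := by
    refine eq_zero_of_commute h2 hm hn hE (fun j => ?_) (fun a b hab => ?_) (fun i s => ?_)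
      (fun k l i _ => ?_)
    · exact hc _ (pd_inl_mem_spec hn j) fun i => by rw [lie_pd_inl_pd_inl, lie_zero]
    · refine hc _ (lower_mem_spec hn ht hab) fun j => ?_
      rw [lie_pd_inl_vf, lie_pd_inl_vf, pd_gen]
      split_ifs <;> simp
    · refine hc _ (torus_mem_spec ht i s) fun j => ?_
      rw [lie_pd_inl_torus, SpecialSuper.commutator_smul, lie_pd_inl_pd_inl, smul_zero]
    · refine hc _ (pair_mem_spec hn k l i) fun j => ?_
      rw [lie_pd_inl_vf, lie_pd_inl_vf, pd_inl_theta_mul, pd_gen_ne (by simp), mul_zero, map_zero,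
        vf_zero]
  -- Once `z = 0`, the Frobenius part must annihilate all of `𝒮`; the root elements with coefficient
  -- `x_j^(p^(s+1))` detect its coefficients.
  have hb : b = 0 := by
    funext x
    have hkl : (⟨0, by omega⟩ : Fin n) ≠ ⟨1, by omega⟩ := by simp
    have hx : x.2.1 + 1 < t x.1 := by have := x.2.2; omega
    have h1 := h' _ (root_mem h2 hkl (f := monomial F (Pi.single x.1 (p ^ (x.2.1 + 1))))
      (monomial_mem_truncated (p := p) (t := t) fun j => by
        by_cases hj : j = x.1
        · subst hj
          rw [Pi.single_eq_same]
          exact Nat.pow_lt_pow_right (Fact.out : p.Prime).one_lt hx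
        · rw [Pi.single_eq_of_ne hj]
          exact pow_pos (Fact.out : p.Prime).pos _))
    rw [z0, zero_lie, zero_add, lie_frob_root, ← root_zero] at h1
    have h3 := coord_zero_frobDeriv (p := p) (t := t) b x
    rw [root_injective h1, map_zero] at h3
    exact h3.symm
  have hs : c • num (Sum.inr k) + ∑ i, d i • topField p n t i.1 + X = 0 := by rw [← hz, z0]
  -- The divergence detects the degree operator; the integral then detects the top fields.
  have hc0 : c = 0 := by
    have h1 := congrArg dv hs
    simp only [map_add, map_smul, map_sum, dv_num_inr, dv_topField, dv_spec hX, smul_zero,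
      Finset.sum_const_zero, add_zero, map_zero, smul_neg, neg_eq_zero] at h1
    have h3 := congrArg aug h1
    rw [map_smul, ← sc_one, aug_sc, map_zero] at h3
    rw [← coord_zero_smul_one (m := m) c, h3, map_zero]
  refine ⟨hc0, hb, funext fun i => ?_⟩
  rw [hc0, zero_smul, zero_add] at hs
  have h1 := congrArg (fun W : Module.End F (SAlg F m n) =>
    integral p t (W (excess F p n t i.1))) hs
  simp only [LinearMap.add_apply, map_add, integral_sum_topField, integral_spec_excess hX,
    LinearMap.zero_apply, map_zero, add_zero] at h1
  exact h1

end OuterFields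

/-! ### Outer derivations from the normalizer in an ambient Lie algebra. -/

section OuterDerivations

variable {F A : Type*} [Field F] [LieRing A] [LieAlgebra F A] (L : LieSubalgebra F A)

/-- The derivation of `L` given by an element of its normalizer. -/
def normalizerDer : L.normalizer →ₗ[F] LieDerivation F L L where
  toFun U :=
    { toFun := fun X => ⟨⁅(U : A), (X : A)⁆, (L.mem_normalizer_iff U).mp U.2 X X.2⟩
      map_add' := fun X Y => Subtype.ext (lie_add _ _ _)
      map_smul' := fun c X => Subtype.ext (lie_smul _ _ _)
      leibniz' := fun X Y => Subtype.ext <| by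
        change ⁅(U : A), ⁅(X : A), (Y : A)⁆⁆ = ⁅(X : A), ⁅(U : A), (Y : A)⁆⁆ - ⁅(Y : A), ⁅(U : A), (X : A)⁆⁆
        rw [leibniz_lie, ← lie_skew (Y : A)]
        abel }
  map_add' U V := LieDerivation.ext fun X => Subtype.ext (add_lie _ _ _)
  map_smul' c U := LieDerivation.ext fun X => Subtype.ext (smul_lie _ _ _)

theorem normalizerDer_apply (U : L.normalizer) (X : L) :
    ((normalizerDer L U X : L) : A) = ⁅(U : A), (X : A)⁆ := rfl

/-- The outer derivation of `L` given by an element of its normalizer. -/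
def outer : L.normalizer →ₗ⁅F⁆ DerOut F L where
  toFun U := LieSubmodule.Quotient.mk (normalizerDer L U)
  map_add' U V := by rw [map_add]; rfl
  map_smul' c U := by rw [map_smul]; rfl
  map_lie' {U V} := by
    rw [← LieSubmodule.Quotient.mk_bracket]
    congr 1
    refine LieDerivation.ext fun X => Subtype.ext ?_
    rw [LieDerivation.commutator_apply]
    exact lie_lie (U : A) (V : A) (X : A)

/-- An element of the normalizer acts as an inner derivation exactly when some translate of it by
`L` centralizes `L`. -/
theorem outer_eq_zero_iff (U : L.normalizer) :
    outer L U = 0 ↔ ∃ X ∈ L, ∀ Y ∈ L, ⁅(U : A) + X, Y⁆ = 0 := by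
  change LieSubmodule.Quotient.mk (normalizerDer L U) = 0 ↔ _
  rw [LieSubmodule.Quotient.mk_eq_zero', LieDerivation.mem_ad_idealRange_iff]
  constructor
  · rintro ⟨X, hX⟩
    refine ⟨-X, neg_mem X.2, fun Y hY => ?_⟩
    have h := congrArg (fun D : LieDerivation F L L => ((D ⟨Y, hY⟩ : L) : A)) hX
    simp only [normalizerDer_apply, LieDerivation.ad_apply_apply, LieSubalgebra.coe_bracket] at h
    rw [add_lie, neg_lie, ← h, add_neg_cancel]
  · rintro ⟨X, hX, h⟩
    refine ⟨-⟨X, hX⟩, LieDerivation.ext fun Y => Subtype.ext ?_⟩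
    have := h Y Y.2
    rw [add_lie, add_eq_zero_iff_eq_neg] at this
    rw [normalizerDer_apply, this, LieDerivation.ad_apply_apply, LieSubalgebra.coe_bracket,
      NegMemClass.coe_neg, neg_lie]

theorem outer_eq_zero_of_mem {U : L.normalizer} (h : (U : A) ∈ L) : outer L U = 0 :=
  (outer_eq_zero_iff L U).mpr ⟨-U, neg_mem h, fun Y _ => by rw [add_neg_cancel, zero_lie]⟩

/-- A family in the normalizer that induces a basis of the outer derivations. -/
noncomputable def outerBasis {ι : Type*} [Fintype ι] (g : ι → L.normalizer)
    (hi : ∀ (a : ι → F), ∀ X ∈ L, (∀ Y ∈ L, ⁅∑ i, a i • (g i : A) + X, Y⁆ = 0) → a = 0)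
    (hs : ∀ D : LieDerivation F L L, ∃ a : ι → F, ∃ X ∈ L, ∀ Y : L,
      ((D Y : L) : A) = ⁅∑ i, a i • (g i : A) + X, (Y : A)⁆) :
    Module.Basis ι F (DerOut F L) :=
  Module.Basis.mk (v := fun i => outer L (g i))
    (by
      rw [Fintype.linearIndependent_iff]
      intro a ha i
      have h : outer L (∑ i, a i • g i) = 0 := by simpa using ha
      obtain ⟨X, hX, hY⟩ := (outer_eq_zero_iff L _).mp h
      exact congrFun (hi a X hX (by simpa using hY)) i)
    (by
      rintro D -
      obtain ⟨D, rfl⟩ := LieSubmodule.Quotient.surjective_mk' _ D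
      obtain ⟨a, X, hX, h⟩ := hs D
      have h1 : D = normalizerDer L (∑ i, a i • g i + ⟨X, L.le_normalizer hX⟩) :=
        LieDerivation.ext fun Y => Subtype.ext (by rw [h, normalizerDer_apply]; simp)
      have h2 : LieSubmodule.Quotient.mk' (LieDerivation.ad F L).idealRange D =
          ∑ i, a i • outer L (g i) := by
        rw [h1]
        change outer L _ = _
        rw [map_add, outer_eq_zero_of_mem L (U := ⟨X, _⟩) hX, add_zero]
        simp
      rw [h2]
      exact Submodule.sum_mem _ fun i _ =>
        Submodule.smul_mem _ _ (Submodule.subset_span ⟨i, rfl⟩))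

theorem outerBasis_apply {ι : Type*} [Fintype ι] (g : ι → L.normalizer) (hi) (hs) (i : ι) :
    outerBasis L g hi hs i = outer L (g i) :=
  Module.Basis.mk_apply _ _ i

end OuterDerivations

/-! ### Lie algebras determined by a dilation multiplication table. -/

section DilationBasis

variable {F G G' I J : Type*} [Field F] [LieRing G] [LieAlgebra F G] [LieRing G'] [LieAlgebra F G']

/-- The first basis vector acts as `0` on the second part and as `1` on the third part of the
basis, and the latter two span an abelian subalgebra. -/
structure IsDilation (b : Module.Basis (Unit ⊕ I ⊕ J) F G) : Prop where
  lie_left : ∀ i, ⁅b (Sum.inl ()), b (Sum.inr (Sum.inl i))⁆ = 0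
  lie_right : ∀ j, ⁅b (Sum.inl ()), b (Sum.inr (Sum.inr j))⁆ = b (Sum.inr (Sum.inr j))
  lie_inr : ∀ x y, ⁅b (Sum.inr x), b (Sum.inr y)⁆ = 0

theorem isDilation_outerBasis {A : Type*} [LieRing A] [LieAlgebra F A] (L : LieSubalgebra F A)
    [Fintype I] [Fintype J] (g : Unit ⊕ I ⊕ J → L.normalizer) (hi) (hs)
    (h0 : ∀ i, ⁅(g (Sum.inl ()) : A), (g (Sum.inr (Sum.inl i)) : A)⁆ ∈ L)
    (h1 : ∀ j, ⁅(g (Sum.inl ()) : A), (g (Sum.inr (Sum.inr j)) : A)⁆ = g (Sum.inr (Sum.inr j)))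
    (h : ∀ x y, ⁅(g (Sum.inr x) : A), (g (Sum.inr y) : A)⁆ ∈ L) :
    IsDilation (outerBasis L g hi hs) where
  lie_left i := by
    rw [outerBasis_apply, outerBasis_apply, ← LieHom.map_lie]
    exact outer_eq_zero_of_mem L (h0 i)
  lie_right j := by
    rw [outerBasis_apply, outerBasis_apply, ← LieHom.map_lie]
    congr 1
    exact Subtype.ext (h1 j)
  lie_inr x y := by
    rw [outerBasis_apply, outerBasis_apply, ← LieHom.map_lie]
    exact outer_eq_zero_of_mem L (h x y)

/-- The projection to the third part of the basis. -/
noncomputable def dilationProj (b : Module.Basis (Unit ⊕ I ⊕ J) F G) : G →ₗ[F] G :=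
  b.constr F (Sum.elim (fun _ => (0 : G)) (Sum.elim (fun _ => 0) fun j => b (Sum.inr (Sum.inr j))))

/-- Both sides are bilinear and agree on basis vectors. The bracket thus depends only on the first
coordinate and the projection `P` to the third part, from which abelianness, metabelianness and the
isomorphism type follow. -/
theorem IsDilation.lie_eq {b : Module.Basis (Unit ⊕ I ⊕ J) F G} (hb : IsDilation b) (x y : G) :
    ⁅x, y⁆ = b.coord (Sum.inl ()) x • dilationProj b y -
      b.coord (Sum.inl ()) y • dilationProj b x := by
  have hp : ∀ i, dilationProj b (b i) =
      Sum.elim (fun _ => (0 : G)) (Sum.elim (fun _ => 0) fun j => b (Sum.inr (Sum.inr j))) i := fun i => b.constr_basis F _ i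
  have h : LinearMap.mk₂ F (fun x y : G => ⁅x, y⁆) add_lie smul_lie lie_add
      (fun c x y => lie_smul c x y) =
      LinearMap.mk₂ F (fun x y => b.coord (Sum.inl ()) x • dilationProj b y -
        b.coord (Sum.inl ()) y • dilationProj b x)
        (fun x y z => by simp only [map_add]; module) (fun c x y => by simp only [map_smul, smul_eq_mul]; module)
        (fun x y z => by simp only [map_add]; module) (fun c x y => by simp only [map_smul, smul_eq_mul]; module) := by
    refine b.ext fun i => b.ext fun j => ?_
    simp only [LinearMap.mk₂_apply, hp, Module.Basis.coord_apply, Module.Basis.repr_self]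
    rcases i with ⟨⟩ | i | i <;> rcases j with ⟨⟩ | j | j
    · simp
    · simp [hb.lie_left]
    · simp [hb.lie_right]
    · rw [← lie_skew, hb.lie_left]; simp
    · simp [hb.lie_inr]
    · simp [hb.lie_inr]
    · rw [← lie_skew, hb.lie_right]; simp
    · simp [hb.lie_inr]
    · simp [hb.lie_inr]
  exact congrFun (congrArg DFunLike.coe (congrFun (congrArg DFunLike.coe h) x)) y

theorem coord_dilationProj (b : Module.Basis (Unit ⊕ I ⊕ J) F G) (x : G) :
    b.coord (Sum.inl ()) (dilationProj b x) = 0 := by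
  have h : b.coord (Sum.inl ()) ∘ₗ dilationProj b = 0 := by
    refine b.ext fun i => ?_
    rw [LinearMap.comp_apply, dilationProj, Module.Basis.constr_basis]
    rcases i with ⟨⟩ | i | i <;> simp
  exact congrFun (congrArg DFunLike.coe h) x

theorem IsDilation.isLieAbelian {b : Module.Basis (Unit ⊕ I ⊕ J) F G} (hb : IsDilation b)
    [IsEmpty J] : IsLieAbelian G where
  trivial x y := by
    have h : dilationProj b = 0 := by
      refine b.ext fun i => ?_
      rw [dilationProj, Module.Basis.constr_basis]
      rcases i with ⟨⟩ | i | i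
      · rfl
      · rfl
      · exact isEmptyElim i
    rw [hb.lie_eq, h]
    simp

/-- Brackets lie in the image of the projection, where the first coordinate vanishes; among such
elements the bracket is zero. -/
theorem IsDilation.derivedSeries_two {b : Module.Basis (Unit ⊕ I ⊕ J) F G} (hb : IsDilation b) :
    LieAlgebra.derivedSeries F G 2 = ⊥ := by
  have h1 : ∀ x ∈ LieAlgebra.derivedSeries F G 1, b.coord (Sum.inl ()) x = 0 := by
    intro x hx
    replace hx : x ∈ (LieAlgebra.derivedSeries F G 1).toLieSubalgebra.toSubmodule := hx
    rw [LieAlgebra.coe_derivedSeries_one_eq] at hx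
    induction hx using Submodule.span_induction with
    | zero => exact map_zero _
    | add x y _ _ hx hy => rw [map_add, hx, hy, add_zero]
    | smul c x _ hx => rw [map_smul, hx, smul_zero]
    | mem x hx =>
      obtain ⟨y, z, rfl⟩ := hx
      rw [hb.lie_eq, map_sub, map_smul, map_smul, coord_dilationProj, coord_dilationProj]
      simp
  rw [LieAlgebra.derivedSeries_def, LieAlgebra.derivedSeriesOfIdeal_succ, eq_bot_iff,
    LieSubmodule.lie_le_iff]
  intro x hx y hy
  rw [hb.lie_eq, h1 x hx, h1 y hy]
  simp

/-- Lie algebras with dilation bases over the same index sets are isomorphic. -/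
theorem IsDilation.nonempty_equiv {b : Module.Basis (Unit ⊕ I ⊕ J) F G} (hb : IsDilation b)
    {b' : Module.Basis (Unit ⊕ I ⊕ J) F G'} (hb' : IsDilation b') : Nonempty (G ≃ₗ⁅F⁆ G') := by
  let f := b.equiv b' (Equiv.refl _)
  have hf : ∀ i, f (b i) = b' i := fun i => b.equiv_apply i b' (Equiv.refl _)
  have hc : b.coord (Sum.inl ()) = b'.coord (Sum.inl ()) ∘ₗ f.toLinearMap :=
    b.ext fun i => by
      rw [LinearMap.comp_apply, LinearEquiv.coe_coe, hf, Module.Basis.coord_apply,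
        Module.Basis.coord_apply, Module.Basis.repr_self, Module.Basis.repr_self]
  have hp : f.toLinearMap ∘ₗ dilationProj b = dilationProj b' ∘ₗ f.toLinearMap :=
    b.ext fun i => by
      rw [LinearMap.comp_apply, LinearMap.comp_apply, LinearEquiv.coe_coe, hf, dilationProj,
        dilationProj, Module.Basis.constr_basis, Module.Basis.constr_basis]
      rcases i with ⟨⟩ | i | i
      · exact map_zero f
      · exact map_zero f
      · exact hf _
  have hp' : ∀ x, f (dilationProj b x) = dilationProj b' (f x) := fun x =>
    congrFun (congrArg DFunLike.coe hp) x
  exact ⟨{ f with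
    map_lie' := fun {x y} => by
      change f ⁅x, y⁆ = ⁅f x, f y⁆
      rw [hb.lie_eq, hb'.lie_eq, map_sub, map_smul, map_smul, hp', hp', hc]
      rfl }⟩

end DilationBasis

/-! ### The model `F·A ⋉ V`. -/

section LineSemidirect

variable {F V : Type*} [Field F] [LieRing V] [LieAlgebra F V] [IsLieAbelian V]

/-- The semidirect product by a projection operator has a dilation basis. -/
theorem exists_isDilation {I J : Type*} [Fintype I] [Fintype J] {A : Module.End F V}
    [FiniteDimensional F V] (hA : A ≠ 0)
    (h0 : Module.finrank F (A.eigenspace 0) = Fintype.card I)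
    (h1 : Module.finrank F (A.eigenspace 1) = Fintype.card J)
    (hV : Module.finrank F V = Fintype.card I + Fintype.card J) :
    ∃ b : Module.Basis (Unit ⊕ I ⊕ J) F (lineSemidirect A), IsDilation b := by
  have hd : Disjoint (A.eigenspace 0) (A.eigenspace 1) := by
    rw [Submodule.disjoint_def]
    intro x hx hy
    rw [Module.End.mem_eigenspace_iff] at hx hy
    rw [hx] at hy
    simpa using hy.symm
  -- The eigenspaces for `0` and `1` are disjoint and their dimensions add up to that of `V`, so
  -- bases of them combine to a basis of `V`.
  have hc : IsCompl (A.eigenspace 0) (A.eigenspace 1) :=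
    IsCompl.of_eq (disjoint_iff.mp hd) (Submodule.eq_top_of_disjoint _ _ (by rw [h0, h1, hV]) hd)
  let v0 : Module.Basis I F (A.eigenspace 0) :=
    (Module.finBasisOfFinrankEq F _ h0).reindex (Fintype.equivFin I).symm
  let v1 : Module.Basis J F (A.eigenspace 1) :=
    (Module.finBasisOfFinrankEq F _ h1).reindex (Fintype.equivFin J).symm
  let v : Module.Basis (I ⊕ J) F V := (v0.prod v1).map (Submodule.prodEquivOfIsCompl _ _ hc)
  have hv0 : ∀ i, A (v (Sum.inl i)) = 0 := fun i => by
    have h : v (Sum.inl i) = v0 i := by simp [v]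
    rw [h, Module.End.mem_eigenspace_iff.mp (v0 i).2, zero_smul]
  have hv1 : ∀ j, A (v (Sum.inr j)) = v (Sum.inr j) := fun j => by
    have h : v (Sum.inr j) = v1 j := by simp [v]
    rw [h, Module.End.mem_eigenspace_iff.mp (v1 j).2, one_smul]
  let a : Module.Basis Unit F (lineAlg A) :=
    (Module.Basis.singleton Unit F).map (LinearEquiv.toSpanNonzeroSingleton F (Module.End F V) A hA)
  have ha : ((a () : lineAlg A) : Module.End F V) = A := by
    change ((LinearEquiv.toSpanNonzeroSingleton F (Module.End F V) A hA
      (Module.Basis.singleton Unit F ())) : Module.End F V) = A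
    simp
  let b : Module.Basis (Unit ⊕ I ⊕ J) F (lineSemidirect A) := (a.prod v).map
    ((LinearEquiv.prodComm F _ _).trans (LieAlgebra.SemiDirectSum.toProdl (lineAction A)).symm)
  have hb0 : b (Sum.inl ()) = ⟨0, a ()⟩ := by
    simp only [b, Module.Basis.map_apply, LinearEquiv.trans_apply, Module.Basis.prod_apply]
    rfl
  have hb1 : ∀ i, b (Sum.inr i) = ⟨v i, 0⟩ := by
    intro i
    simp only [b, Module.Basis.map_apply, LinearEquiv.trans_apply, Module.Basis.prod_apply]
    rfl
  have hl : ∀ i, ⁅b (Sum.inl ()), b (Sum.inr i)⁆ = ⟨A (v i), 0⟩ := by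
    intro i
    have h : lineAction A (a ()) (v i) = A (v i) := by
      change ((a () : lineAlg A) : Module.End F V) (v i) = _
      rw [ha]
    rw [hb0, hb1, LieAlgebra.SemiDirectSum.lie_eq_mk]
    simp [h]
  refine ⟨b, ⟨fun i => ?_, fun j => ?_, fun x y => ?_⟩⟩
  · rw [hl, hv0]; rfl
  · rw [hl, hv1, hb1]
  · rw [hb1, hb1, LieAlgebra.SemiDirectSum.lie_eq_mk]
    simp [LieModule.IsTrivial.trivial]

end LineSemidirect

/-! ### A dilation basis of the outer derivations of `𝒮`. -/

section Classification

variable {F : Type*} [Field F] {m n : ℕ} {p : ℕ} {t : Fin m → ℕ}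

/-- Operators on `SuperAlg`, seen as operators on the synonym `SAlg`. -/
def endEquiv : Module.End F (SuperAlg F m n) ≃ₗ⁅F⁆ Module.End F (SAlg F m n) where
  toFun X := X
  invFun X := X
  map_add' _ _ := rfl
  map_smul' _ _ := rfl
  map_lie' := rfl
  left_inv _ := rfl
  right_inv _ := rfl

/-- Index set of the outer derivations: the degree operator, the Frobenius powers of the
derivations `D_j`, and the top fields if `n` is even. -/
abbrev OuterIndex (n : ℕ) (t : Fin m → ℕ) : Type :=
  Unit ⊕ (Σ j, Fin (t j - 1)) ⊕ {_i : Fin m // Even n}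

/-- Representatives of the outer derivations. -/
noncomputable def outerField (p : ℕ) (t : Fin m → ℕ) (k : Fin n) :
    OuterIndex n t → Module.End F (SAlg F m n) :=
  Sum.elim (fun _ => num (Sum.inr k)) (Sum.elim (fun x => frob p t n (Pi.single x 1))
    fun i => topField p n t i.1)

theorem sum_frob_single (c : (Σ j, Fin (t j - 1)) → F) :
    ∑ x, c x • frob p t n (Pi.single x 1) = (frob p t n c : Module.End F (SAlg F m n)) := by
  refine Finset.sum_congr rfl fun x _ => ?_
  rw [frob, Finset.sum_eq_single x, Pi.single_eq_same, one_smul]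
  · intro y _ hy
    rw [Pi.single_eq_of_ne hy, zero_smul]
  · simp

theorem sum_outerField (k : Fin n) (a : OuterIndex n t → F) :
    ∑ i, a i • outerField p t k i =
      (a (Sum.inl ()) • num (Sum.inr k) + frob p t n (fun x => a (Sum.inr (Sum.inl x))) +
        ∑ i, a (Sum.inr (Sum.inr i)) • topField p n t i.1 : Module.End F (SAlg F m n)) := by
  rw [Fintype.sum_sum_type, Fintype.sum_sum_type, ← sum_frob_single, ← add_assoc]
  simp [outerField]

theorem card_frobIndex (ht : ∀ i, 0 < t i) :
    Fintype.card (Σ j, Fin (t j - 1)) + m = ∑ i, t i := by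
  have h : ∑ i, t i = ∑ i, ((t i - 1) + 1) := Finset.sum_congr rfl fun i _ => by
    have := ht i; omega
  rw [h, Finset.sum_add_distrib]
  simp

variable [Fact p.Prime] [CharP F p]

theorem lie_outerField_mem_spec (h2 : (2 : F) ≠ 0) (hn : 2 < n) (k : Fin n) (i : OuterIndex n t)
    {X : Module.End F (SAlg F m n)} (hX : X ∈ spec F p n t) :
    ⁅(outerField p t k i : Module.End F (SAlg F m n)), X⁆ ∈ spec F p n t := by
  rcases i with ⟨⟩ | x | i
  · exact lie_num_inr_mem_spec h2 k hX
  · exact lie_frob_mem_spec h2 hn _ hX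
  · exact lie_topField_mem_spec h2 i.2 i.1 hX

theorem mem_evenSpecial_iff (hp : 3 < p) (X : Module.End F (SuperAlg F m n)) :
    X ∈ evenSpecial F p hp n t ↔ endEquiv X ∈ spec F p n t := by
  have h : (evenSpecial F p hp n t).toSubmodule =
      Submodule.span F (SpecialSuper.evenGen F p n t) :=
    le_antisymm (SpecialSuper.le_span_evenGen (SpecialSuper.two_ne_zero_of_char F p hp))
      SpecialSuper.span_evenGen_le
  rw [← LieSubalgebra.mem_toSubmodule, h, spec_eq]
  rfl

theorem mem_normalizer_iff (hp : 3 < p) (U : Module.End F (SuperAlg F m n)) :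
    U ∈ (evenSpecial F p hp n t).normalizer ↔
      ∀ X ∈ spec F p n t, ⁅endEquiv U, X⁆ ∈ spec F p n t := by
  rw [LieSubalgebra.mem_normalizer_iff]
  constructor
  · intro h X hX
    exact (mem_evenSpecial_iff hp _).mp (h (endEquiv.symm X) ((mem_evenSpecial_iff hp _).mpr hX))
  · intro h X hX
    exact (mem_evenSpecial_iff hp _).mpr (h (endEquiv X) ((mem_evenSpecial_iff hp _).mp hX))

theorem three_ne_zero_of_char (F : Type*) [Field F] (p : ℕ) [CharP F p] (hp : 3 < p) :
    (3 : F) ≠ 0 := by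
  intro h
  have h1 : ((3 : ℕ) : F) = 0 := by exact_mod_cast h
  have := Nat.le_of_dvd (by norm_num) ((CharP.cast_eq_zero_iff F p 3).mp h1)
  omega

/-- A derivation of `𝒮` extends to a linear map on all operators. -/
theorem exists_cocycle (hp : 3 < p)
    (D : LieDerivation F (evenSpecial F p hp n t) (evenSpecial F p hp n t)) :
    ∃ δ : Module.End F (Module.End F (SAlg F m n)), IsCocycle p t δ ∧
      (∀ X ∈ spec F p n t, δ X ∈ spec F p n t) ∧ ∀ Y : evenSpecial F p hp n t,
        δ (endEquiv (Y : Module.End F (SuperAlg F m n))) =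
          endEquiv ((D Y : evenSpecial F p hp n t) : Module.End F (SuperAlg F m n)) := by
  let f : spec F p n t →ₗ[F] Module.End F (SAlg F m n) :=
    { toFun := fun X => endEquiv ((D ⟨endEquiv.symm X.1, (mem_evenSpecial_iff hp _).mpr X.2⟩ :
        evenSpecial F p hp n t) : Module.End F (SuperAlg F m n))
      map_add' := fun X Y => congrArg (fun Z : evenSpecial F p hp n t =>
        endEquiv (Z : Module.End F (SuperAlg F m n))) (map_add D
          ⟨endEquiv.symm X.1, (mem_evenSpecial_iff hp _).mpr X.2⟩
          ⟨endEquiv.symm Y.1, (mem_evenSpecial_iff hp _).mpr Y.2⟩)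
      map_smul' := fun c X => congrArg (fun Z : evenSpecial F p hp n t =>
        endEquiv (Z : Module.End F (SuperAlg F m n))) (map_smul D c
          ⟨endEquiv.symm X.1, (mem_evenSpecial_iff hp _).mpr X.2⟩) }
  -- The choice of extension is immaterial: the cocycle conditions concern only the values on `𝒮`.
  obtain ⟨δ, hδ⟩ := LinearMap.exists_extend f
  have hv : ∀ Y : evenSpecial F p hp n t, δ (endEquiv (Y : Module.End F (SuperAlg F m n))) =
      endEquiv ((D Y : evenSpecial F p hp n t) : Module.End F (SuperAlg F m n)) := fun Y =>
    congrFun (congrArg DFunLike.coe hδ)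
      (⟨endEquiv (Y : Module.End F (SuperAlg F m n)), (mem_evenSpecial_iff hp _).mp Y.2⟩ :
        spec F p n t)
  have hm' : ∀ X ∈ spec F p n t, δ X ∈ spec F p n t := by
    intro X hX
    have h : δ X = _ := hv ⟨endEquiv.symm X, (mem_evenSpecial_iff hp _).mpr hX⟩
    rw [h]
    exact (mem_evenSpecial_iff hp _).mp (D _).2
  refine ⟨δ, ⟨fun {X Y} hX hY => ?_, fun hX => spec_le (hm' _ hX)⟩, hm', hv⟩
  let X' : evenSpecial F p hp n t := ⟨endEquiv.symm X, (mem_evenSpecial_iff hp _).mpr hX⟩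
  let Y' : evenSpecial F p hp n t := ⟨endEquiv.symm Y, (mem_evenSpecial_iff hp _).mpr hY⟩
  have h : δ ⁅X, Y⁆ = _ := hv ⁅X', Y'⁆
  have hx : δ X = _ := hv X'
  have hy : δ Y = _ := hv Y'
  rw [h, hx, hy, LieDerivation.apply_lie_eq_add, add_comm]
  rfl

/-- A derivation of `𝒮` is the bracket with a combination of the outer fields and an element
of `𝒮`. -/
theorem IsCocycle.exists_outerField {δ : Module.End F (Module.End F (SAlg F m n))}
    (hδ : IsCocycle p t δ) (hδ' : ∀ X ∈ spec F p n t, δ X ∈ spec F p n t) (h2 : (2 : F) ≠ 0)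
    (h3 : (3 : F) ≠ 0) (hm : 2 < m) (hn : 2 < n) (ht : ∀ i, 0 < t i) (k : Fin n) :
    ∃ a : OuterIndex n t → F, ∃ X ∈ spec F p n t, ∀ Y ∈ spec F p n t,
      δ Y = ⁅∑ i, a i • outerField p t k i + X, Y⁆ := by
  obtain ⟨U, hU, b, hUb⟩ := hδ.exists_eq_lie h2 h3 hm hn ht
  -- The derivation and the Frobenius part both preserve `𝒮`, hence so does the bracket with the
  -- vector field `U`.
  obtain ⟨c, d, hX⟩ := exists_eq_of_normalizes h2 hm hn ht k hU fun X hX => by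
    have h := hUb X hX
    rw [add_lie, ← sub_eq_iff_eq_add] at h
    rw [← h]
    exact sub_mem (hδ' X hX) (lie_frob_mem_spec h2 hn b hX)
  refine ⟨Sum.elim (fun _ => c) (Sum.elim b d), _, hX, fun Y hY => ?_⟩
  rw [hUb _ hY, sum_outerField]
  congr 1
  simp only [Sum.elim_inl, Sum.elim_inr]
  abel

/-- The outer fields as elements of the normalizer of `𝒮`. -/
noncomputable def outerElement (hp : 3 < p) (hn : 2 < n) (k : Fin n) (i : OuterIndex n t) :
    (evenSpecial F p hp n t).normalizer :=
  ⟨endEquiv.symm (outerField p t k i), (mem_normalizer_iff hp _).mpr fun _ hX =>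
    lie_outerField_mem_spec (SpecialSuper.two_ne_zero_of_char F p hp) hn k i hX⟩

theorem endEquiv_sum_outerElement (hp : 3 < p) (hn : 2 < n) (k : Fin n)
    (a : OuterIndex n t → F) :
    endEquiv (∑ i, a i • (outerElement (F := F) hp hn k i : Module.End F (SuperAlg F m n))) =
      ∑ i, a i • outerField p t k i := by
  rw [← LieEquiv.coe_toLinearEquiv, map_sum]
  simp only [map_smul]
  rfl

theorem lie_outerField_inr_mem (h2 : (2 : F) ≠ 0) (hn : 2 < n) (k : Fin n)
    (x y : (Σ j, Fin (t j - 1)) ⊕ {_i : Fin m // Even n}) :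
    ⁅(outerField p t k (Sum.inr x) : Module.End F (SAlg F m n)),
      (outerField p t k (Sum.inr y) : Module.End F (SAlg F m n))⁆ ∈ spec F p n t := by
  rcases x with x | i <;> rcases y with y | j <;>
    simp only [outerField, Sum.elim_inr, Sum.elim_inl]
  · rw [lie_frob_frob]
    exact zero_mem _
  · exact lie_frob_topField_mem h2 hn j.2 _ j.1
  · rw [← lie_skew]
    exact neg_mem (lie_frob_topField_mem h2 hn i.2 _ i.1)
  · rw [lie_topField_topField h2 (by omega) i.2]
    exact zero_mem _

theorem outerElement_independent (hp : 3 < p) (hm : 2 < m) (hn : 2 < n) (ht : ∀ i, 0 < t i)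
    (k : Fin n) (a : OuterIndex n t → F) (X : Module.End F (SuperAlg F m n))
    (hX : X ∈ evenSpecial F p hp n t) (h : ∀ Y ∈ evenSpecial F p hp n t,
      ⁅∑ i, a i • (outerElement (F := F) hp hn k i : Module.End F (SuperAlg F m n)) + X, Y⁆ = 0) :
    a = 0 := by
  obtain ⟨h1, h3, h4⟩ := outer_independent (SpecialSuper.two_ne_zero_of_char F p hp) hm hn ht k
    (a (Sum.inl ())) (fun x => a (Sum.inr (Sum.inl x))) (fun i => a (Sum.inr (Sum.inr i)))
    ((mem_evenSpecial_iff hp _).mp hX) fun Y hY => by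
      have h := congrArg endEquiv (h (endEquiv.symm Y) ((mem_evenSpecial_iff hp _).mpr hY))
      rwa [LieEquiv.map_lie, map_add, endEquiv_sum_outerElement, sum_outerField,
        LieEquiv.apply_symm_apply, map_zero] at h
  funext i
  rcases i with ⟨⟩ | x | i
  · exact h1
  · exact congrFun h3 x
  · exact congrFun h4 i

theorem outerElement_span (hp : 3 < p) (hm : 2 < m) (hn : 2 < n) (ht : ∀ i, 0 < t i) (k : Fin n)
    (D : LieDerivation F (evenSpecial F p hp n t) (evenSpecial F p hp n t)) :
    ∃ a : OuterIndex n t → F, ∃ X ∈ evenSpecial F p hp n t, ∀ Y : evenSpecial F p hp n t,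
      ((D Y : evenSpecial F p hp n t) : Module.End F (SuperAlg F m n)) =
        ⁅∑ i, a i • (outerElement (F := F) hp hn k i : Module.End F (SuperAlg F m n)) + X,
          (Y : Module.End F (SuperAlg F m n))⁆ := by
  obtain ⟨δ, hδ, hδ', hv⟩ := exists_cocycle hp D
  obtain ⟨a, X, hX, h⟩ := hδ.exists_outerField hδ' (SpecialSuper.two_ne_zero_of_char F p hp)
    (three_ne_zero_of_char F p hp) hm hn ht k
  refine ⟨a, endEquiv.symm X, (mem_evenSpecial_iff hp _).mpr hX, fun Y => ?_⟩
  have h1 := hv Y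
  rw [h _ ((mem_evenSpecial_iff hp _).mp Y.2), ← endEquiv_sum_outerElement hp hn] at h1
  exact h1.symm

theorem endEquiv_outerElement (hp : 3 < p) (hn : 2 < n) (k : Fin n) (i : OuterIndex n t) :
    endEquiv (outerElement (F := F) hp hn k i : Module.End F (SuperAlg F m n)) =
      outerField p t k i := rfl

theorem lie_outerElement_mem (hp : 3 < p) (hn : 2 < n) (k : Fin n) {i j : OuterIndex n t}
    (h : ⁅(outerField p t k i : Module.End F (SAlg F m n)),
      (outerField p t k j : Module.End F (SAlg F m n))⁆ ∈ spec F p n t) :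
    ⁅(outerElement (F := F) hp hn k i : Module.End F (SuperAlg F m n)),
      (outerElement (F := F) hp hn k j : Module.End F (SuperAlg F m n))⁆ ∈
      evenSpecial F p hp n t := by
  rwa [mem_evenSpecial_iff, LieEquiv.map_lie, endEquiv_outerElement, endEquiv_outerElement]

theorem lie_outerElement_topField (hp : 3 < p) (hn : 2 < n) (k : Fin n)
    (i : {_i : Fin m // Even n}) :
    ⁅(outerElement (F := F) (t := t) hp hn k (Sum.inl ()) : Module.End F (SuperAlg F m n)),
      (outerElement (F := F) (t := t) hp hn k (Sum.inr (Sum.inr i)) :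
        Module.End F (SuperAlg F m n))⁆ =
      (outerElement (F := F) (t := t) hp hn k (Sum.inr (Sum.inr i)) :
        Module.End F (SuperAlg F m n)) := by
  refine (endEquiv (F := F) (m := m) (n := n)).injective ?_
  change endEquiv _ = endEquiv _
  rw [LieEquiv.map_lie, endEquiv_outerElement, endEquiv_outerElement]
  exact lie_num_topField (SpecialSuper.two_ne_zero_of_char F p hp) k i.1

theorem lie_outerField_inl_mem (k : Fin n) (x : Σ j, Fin (t j - 1)) :
    ⁅(outerField p t k (Sum.inl ()) : Module.End F (SAlg F m n)),
      (outerField p t k (Sum.inr (Sum.inl x)) : Module.End F (SAlg F m n))⁆ ∈ spec F p n t := by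
  simp only [outerField, Sum.elim_inr, Sum.elim_inl]
  rw [← lie_skew, lie_frob_num, neg_zero]
  exact zero_mem _

/-- The index type handles both parities of `n` at once: its last summand is empty for `n` odd and
is a copy of `Fin m` for `n` even. -/
theorem exists_derOut_basis (hp : 3 < p) (hm : 2 < m) (hn : 2 < n) (ht : ∀ i, 0 < t i) :
    ∃ b : Module.Basis (OuterIndex n t) F (DerOut F (evenSpecial F p hp n t)), IsDilation b :=
  ⟨_, isDilation_outerBasis (evenSpecial F p hp n t) (outerElement hp hn ⟨0, by omega⟩)
    (outerElement_independent hp hm hn ht _) (outerElement_span hp hm hn ht _)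
    (fun x => lie_outerElement_mem hp hn _ (lie_outerField_inl_mem _ x))
    (fun i => lie_outerElement_topField hp hn _ i)
    (fun x y => lie_outerElement_mem hp hn _
      (lie_outerField_inr_mem (SpecialSuper.two_ne_zero_of_char F p hp) hn _ x y))⟩

end Classification

end EvenSpecial
theorem theorem5p2p5 (F : Type*) [Field F] (p : ℕ) [Fact p.Prime] [CharP F p] (hp : 3 < p)
    (m n : ℕ) (hm : 2 < m) (hn : 2 < n) (t : Fin m → ℕ) (ht : ∀ i, 0 < t i) :
    (Odd n →
      IsLieAbelian (SpecialSuper.DerOut F (SpecialSuper.evenSpecial F p hp n t)) ∧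
      Module.finrank F (SpecialSuper.DerOut F (SpecialSuper.evenSpecial F p hp n t)) + m =
        1 + ∑ i, t i) ∧
    (Even n →
      LieAlgebra.derivedSeries F
        (SpecialSuper.DerOut F (SpecialSuper.evenSpecial F p hp n t)) 2 = ⊥ ∧
      Module.finrank F (SpecialSuper.DerOut F (SpecialSuper.evenSpecial F p hp n t)) =
        1 + ∑ i, t i ∧
      ∀ (V : Type*) [LieRing V] [LieAlgebra F V] [IsLieAbelian V] (A : Module.End F V),
        Module.finrank F V = ∑ i, t i →
        A.IsSemisimple →
        Module.finrank F (A.eigenspace 0) + m = ∑ i, t i →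
        Module.finrank F (A.eigenspace 1) = m →
        Nonempty (SpecialSuper.DerOut F (SpecialSuper.evenSpecial F p hp n t) ≃ₗ⁅F⁆
          SpecialSuper.lineSemidirect A)) := by
  have hE := EvenSpecial.exists_derOut_basis (F := F) hp hm hn ht
  refine Exists.elim hE fun b hb => ?_
  have hc := EvenSpecial.card_frobIndex ht
  have hr := Module.finrank_eq_card_basis b
  rw [Fintype.card_sum, Fintype.card_sum, Fintype.card_unit] at hr
  refine ⟨fun ho => ?_, fun he => ?_⟩
  · have : IsEmpty {_i : Fin m // Even n} := ⟨fun i => Nat.not_even_iff_odd.mpr ho i.2⟩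
    refine ⟨hb.isLieAbelian, ?_⟩
    rw [hr, Fintype.card_eq_zero (α := {_i : Fin m // Even n})]
    omega
  · have hj : Fintype.card {_i : Fin m // Even n} = m := by
      rw [Fintype.card_congr (Equiv.subtypeUnivEquiv fun _ => he), Fintype.card_fin]
    refine ⟨hb.derivedSeries_two, by rw [hr, hj]; omega, ?_⟩
    intro V _ _ _ A hV _ h0 h1
    have : FiniteDimensional F V := Module.finite_of_finrank_pos (by omega)
    -- The eigenspace for `1` has positive dimension `m`, which excludes the zero operator and makes
    -- `F·A` one-dimensional.
    have hA : A ≠ 0 := by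
      rintro rfl
      have h : (0 : Module.End F V).eigenspace 1 = ⊥ := by
        rw [eq_bot_iff]
        intro x hx
        rw [Module.End.mem_eigenspace_iff, LinearMap.zero_apply, one_smul] at hx
        exact (Submodule.mem_bot F).mpr hx.symm
      rw [h, finrank_bot] at h1
      omega
    have hE' := EvenSpecial.exists_isDilation (I := Σ j, Fin (t j - 1))
      (J := {_i : Fin m // Even n}) hA (by omega) (h1.trans hj.symm) (by omega)
    exact Exists.elim hE' fun b' hb' => hb.nonempty_equiv hb'
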